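/- Let $n\ge 1$, let $X$ be a smooth $n$-dimensional manifold with boundary (Hausdorff, second countable), let $X^2_0=[X^2;\mathrm{diag}_{\partial X}]$ be the blow-up of $X^2$ along the boundary diagonal, with boundary hypersurfaces $\mathrm{lb}$ (lift of $\partial X\times X$), $\mathrm{ff}$ (front face), $\mathrm{rb}$ (lift of $X\times\partial X$), and let $\mathrm{KD}_0$ be the tensor product of the pull-backs from both factors of the bundle of half-densities with local frame $|\frac{dx}{x}\frac{dy}{x^{n-1}}|^{1/2}$ (local coordinates $x\ge0$, $y\in\mathbb R^{n-1}$). An index set is a set $\mathcal E\subset\mathbb C\times\mathbb N_0$ such that $(z,k)\in\mathcal E$ implies $(z+1,k)\in\mathcal E$ and, for $k\ge1$, $(z,k-1)\in\mathcal E$, and such that $\{(z,k)\in\mathcal E:\mathrm{Re}\,z<C\}$ is finite for all $C$; put $\mathcal E+\mathcal F=\{(z_1+z_2,k_1+k_2):(z_1,k_1)\in\mathcal E,(z_2,k_2)\in\mathcal F\}$, let $\mathcal E+(n-1)=\{(z+n-1,k):(z,k)\in\mathcal E\}$, and write $\mathbb N_0$ for the index set $\{(j,0):j\in\mathbb N_0\}$.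 Let $\mathcal A_{\mathrm{phg}}$ denote polyhomogeneous functions with the listed index sets at the boundary hypersurfaces, and $\mathcal A$ conormal functions with the listed weights in $\mathbb R\cup\{\infty\}$. Define: * $\Psi_0^{-\infty,(\mathcal E_{\mathrm{lb}},\mathcal E_{\mathrm{ff}},\mathcal E_{\mathrm{rb}})}(X)=\mathcal A_{\mathrm{phg}}^{(\mathcal E_{\mathrm{lb}},\mathcal E_{\mathrm{ff}},\mathcal E_{\mathrm{rb}})}(X^2_0;\mathrm{KD}_0)$ and $\Psi_0^{-\infty,(\alpha_{\mathrm{lb}},\alpha_{\mathrm{rb}})}(X)=\mathcal A^{(\alpha_{\mathrm{lb}},\alpha_{\mathrm{rb}})}_{\{\mathrm{lb},\mathrm{rb}\}}(X^2_0;\mathrm{KD}_0)$, the Schwartz kernels on $X^2_0$ which remain in $\rho_{\mathrm{lb}}^{\alpha_{\mathrm{lb}}}\rho_{\mathrm{rb}}^{\alpha_{\mathrm{rb}}}L^\infty_{\mathrm{loc}}$ under repeated application of smooth vector fields tangent to $\mathrm{lb}$ and $\mathrm{rb}$ (so they are smooth down to $\mathrm{ff}$); * $\Psi^{-\infty,(\mathcal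 E_0,\mathcal E_1)}([0,\infty])$, resp. $\Psi^{-\infty,(\alpha_0,\alpha_1)}([0,\infty])$: the kernels $n(t,t')\,|\frac{dt}{t}\frac{dt'}{t'}|^{1/2}$ with $n\in\mathcal A_{\mathrm{phg}}^{(\mathcal E_0,\mathcal E_1,\emptyset)}$, resp. $n\in\mathcal A^{(\alpha_0,\alpha_1,\infty)}$, on the closed quarter disc $\overline{[0,\infty)^2}$ (radial compactification), with the orders referring to $t=0$, $t'=0$ and the boundary at infinity, in this order. Fix a boundary coordinate chart $(x,y)$ with domain $U\subset X$, and let $W\subset\mathbb R^{n-1}$ be the open set of coordinates $y$ of points of $U\cap\partial X$. Write the Schwartz kernel of $P$ over $U\times U$ as $K_P^0(s,\Upsilon,x',y')\,|\frac{dx}{x}\frac{dy}{x^{n-1}}\frac{dx'}{x'}\frac{dy'}{x'^{n-1}}|^{1/2}$ with $s=x/x'$, $\Upsilon=(y-y')/x'$. The reduced normal operator $N(P,y_0,\hat\eta)$, $y_0\in W$, $\hat\eta\in\mathbb S^{n-2}$, has Schwartz kernel $\widehat{K_P^0}(\tfrac{t}{t'},t'\hat\eta,0,y_0)\,|\frac{dt}{t}\frac{dt'}{t'}|^{1/2}$,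 where $\widehat{\ }$ is the restriction to $\eta\ne0$ of the (distributional) Fourier transform $\int e^{-i\Upsilon\cdot\eta}(\cdot)\,d\Upsilon$. **Proposition.** (1) Let $\mathcal E_0,\mathcal E_1$ be index sets with $\mathrm{Re}\,z>-(n-1)$ for all $(z,k)\in\mathcal E_0+\mathcal E_1$. (a) If $N\in C^\infty(\mathbb S^{n-2};\Psi^{-\infty,(\mathcal E_0,\mathcal E_1)}([0,\infty]))$ and $y_0\in W$, then there is $P\in\Psi_0^{-\infty,(\mathcal E_0,\mathbb N_0,\mathcal E_1+(n-1))}(X)$ with $N(P,y_0,\hat\eta)=N(\hat\eta)$ for all $\hat\eta\in\mathbb S^{n-2}$. (b) If $N=N(y,\hat\eta)\in C^\infty(W\times\mathbb S^{n-2};\Psi^{-\infty,(\mathcal E_0,\mathcal E_1)}([0,\infty]))$, and if $K\subset W$ is such that the set of points of $\partial X$ with coordinates $(0,y)$, $y\in K$, is closed in $X$, then there is a single $P\in\Psi_0^{-\infty,(\mathcal E_0,\mathbb N_0,\mathcal E_1+(n-1))}(X)$ with $N(P,y,\hat\eta)=N(y,\hat\eta)$ for all $y\in K$, $\hat\eta\in\mathbb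 S^{n-2}$. (In particular, for $X=[0,\infty)\times\mathbb R^{n-1}$ with its standard coordinates one can take $K=W=\mathbb R^{n-1}$.) (2) Let $\alpha_0,\alpha_1\in\mathbb R\cup\{\infty\}$ with $\alpha_0+\alpha_1>-(n-1)$. Then (a) and (b) hold with $\Psi^{-\infty,(\alpha_0,\alpha_1)}([0,\infty])$ in place of $\Psi^{-\infty,(\mathcal E_0,\mathcal E_1)}([0,\infty])$ and with $P\in\Psi_0^{-\infty,(\alpha_0,\alpha_1+(n-1))}(X)$. -/

import Mathlib

open Set Filter Topology MeasureTheory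
open scoped Manifold ContDiff

noncomputable section

namespace ZeroCalculus

/-! ### Index sets -/

/-- An index set: `(z, k)` stands for the term `x ^ z * (log x) ^ k`. -/
@[ext] structure IndexSet where
  carrier : Set (ℂ × ℕ)
  add_one_mem : ∀ z k, (z, k) ∈ carrier → (z + 1, k) ∈ carrier
  log_pred_mem : ∀ z k, (z, k + 1) ∈ carrier → (z, k) ∈ carrier
  finite_lt : ∀ C : ℝ, {p ∈ carrier | p.1.re < C}.Finite

namespace IndexSet

theorem finite_le (E : IndexSet) (N : ℝ) : {p ∈ E.carrier | p.1.re ≤ N}.Finite :=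
  (E.finite_lt (N + 1)).subset fun _ hp => ⟨hp.1, lt_of_le_of_lt hp.2 (lt_add_one N)⟩

/-- The finitely many elements `(z, k)` of `E` with `Re z ≤ N`. -/
def upTo (E : IndexSet) (N : ℝ) : Finset (ℂ × ℕ) := (E.finite_le N).toFinset

/-- The trivial index set `∅` (vanishing to infinite order). -/
def empty : IndexSet where
  carrier := ∅
  add_one_mem := by simp
  log_pred_mem := by simp
  finite_lt := by simp

/-- The index set `ℕ₀ = {(j, 0) : j = 0, 1, 2, …}` (smoothness up to the hypersurface). -/
def nat : IndexSet where
  carrier := {p | ∃ j : ℕ, p = ((j : ℂ), 0)}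
  add_one_mem := by
    rintro z k ⟨j, hj⟩
    refine ⟨j + 1, ?_⟩
    simp only [Prod.mk.injEq] at hj ⊢
    exact ⟨by rw [hj.1]; push_cast; ring, hj.2⟩
  log_pred_mem := by
    rintro z k ⟨j, hj⟩
    simp at hj
  finite_lt := by
    intro C
    refine ((Finset.range (⌈C⌉₊ + 1)).finite_toSet.image
      (fun j : ℕ => (((j : ℂ), 0) : ℂ × ℕ))).subset ?_
    rintro p ⟨⟨j, rfl⟩, hj⟩
    refine ⟨j, ?_, rfl⟩
    have h1 : (j : ℝ) < C := by simpa using hj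
    have h2 : (j : ℝ) < ⌈C⌉₊ := lt_of_lt_of_le h1 (Nat.le_ceil C)
    have h3 : j < ⌈C⌉₊ := by exact_mod_cast h2
    simp only [Finset.coe_range, Set.mem_Iio]
    omega

/-- The shifted index set `E + j = {(z + j, k) : (z, k) ∈ E}`. (Since `E` is closed under
`z ↦ z + 1`, this is also `{(z + j', k) : (z, k) ∈ E, j' ≥ j}`.) -/
def shift (E : IndexSet) (j : ℕ) : IndexSet where
  carrier := {p | (p.1 - j, p.2) ∈ E.carrier}
  add_one_mem := by
    intro z k h
    have := E.add_one_mem _ _ h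
    simp only [Set.mem_ofPred_eq] at this ⊢
    convert this using 2
    ring
  log_pred_mem := fun _ _ h => E.log_pred_mem _ _ h
  finite_lt := by
    intro C
    refine ((E.finite_lt (C - j)).image (fun p : ℂ × ℕ => (p.1 + j, p.2))).subset ?_
    rintro ⟨z, k⟩ ⟨hp, hC⟩
    refine ⟨(z - j, k), ⟨hp, ?_⟩, by simp⟩
    simpa using hC

/-- The sum `E + F = {(z₁ + z₂, k₁ + k₂)}` of two index sets, as a set. -/
def sum (E F : IndexSet) : Set (ℂ × ℕ) :=
  {p | ∃ e ∈ E.carrier, ∃ f ∈ F.carrier, p = (e.1 + f.1, e.2 + f.2)}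

end IndexSet

/-! ### Conormal and polyhomogeneous functions on `[0,∞)^k × F`

Functions are only evaluated in the interior `x i > 0`; membership is a local property near
points of the closed orthant, so it is stated at a point `(x₀, y₀)`, `x₀ i ≥ 0`. -/

section Local

variable {F : Type*} [NormedAddCommGroup F] [NormedSpace ℝ F]

/-- Neighbourhoods of `(x₀, y₀)` within the set `{x i > 0 for all i, y ∈ D}`. -/
def interiorNhds {k : ℕ} (D : Set F) (x₀ : Fin k → ℝ) (y₀ : F) : Filter ((Fin k → ℝ) × F) :=
  𝓝[{q | (∀ i, 0 < q.1 i) ∧ q.2 ∈ D}] (x₀, y₀)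

/-- The conormal space with weight `α i` at `x i = 0`: near `(x₀, y₀)`, the function `u` is smooth
in the interior, and all derivatives along products of `x i ∂_{x i}` and `∂_y` are bounded by
`∏ x i ^ α i` (for the weight `⊤`: by every power of `x i`). The vector fields `x i ∂_{x i}` are
the coordinate vector fields in the logarithmic coordinates `log (x i)`. The set `D` is the open
set in which the parameters `y` live; if `y₀` is in the closure of `D`, then the derivatives along
`∂_y` are bounded up to `y₀`. -/
def IsConormalAt {k : ℕ} (α : Fin k → WithTop ℝ) (D : Set F) (u : (Fin k → ℝ) → F → ℂ)
    (x₀ : Fin k → ℝ) (y₀ : F) : Prop :=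
  (∀ᶠ q in interiorNhds D x₀ y₀, ContDiffAt ℝ ∞ (fun p : (Fin k → ℝ) × F => u p.1 p.2) q) ∧
  ∀ (m : ℕ) (β : Fin k → ℝ), (∀ i, (β i : WithTop ℝ) ≤ α i) →
    ∃ C : ℝ, ∀ᶠ q in interiorNhds D x₀ y₀,
      ‖iteratedFDeriv ℝ m (fun p : (Fin k → ℝ) × F => u (fun i => Real.exp (p.1 i)) p.2)
          (fun i => Real.log (q.1 i), q.2)‖
        ≤ C * ∏ i, q.1 i ^ β i

/-- Polyhomogeneity near `(x₀, y₀)` with index set `E i` at `x i = 0`, by induction on the number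
of boundary hypersurfaces: at every hypersurface `x i = 0` through the point, `u` is
an asymptotic sum of terms `x i ^ z * (log (x i)) ^ l * a z l`, `(z, l) ∈ E i`, where the `a z l` are
polyhomogeneous in the remaining variables. The remainder after the terms with `Re z ≤ N` is
conormal, of order `N` at `x i = 0`, and of any order `< Re (E j)` at the
other hypersurfaces `x j = 0`. -/
def IsPhgAt : (k : ℕ) → (Fin k → IndexSet) → ((Fin k → ℝ) → F → ℂ) → (Fin k → ℝ) → F → Prop
  | 0, _, u, x₀, y₀ => IsConormalAt (fun _ => 0) univ u x₀ y₀
  | k + 1, E, u, x₀, y₀ =>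
      (∀ α : Fin (k + 1) → ℝ, (∀ i, ∀ p ∈ (E i).carrier, α i < p.1.re) →
        IsConormalAt (fun i => (α i : WithTop ℝ)) univ u x₀ y₀) ∧
      ∀ i : Fin (k + 1), x₀ i = 0 →
        ∃ a : ℂ → ℕ → (Fin k → ℝ) → F → ℂ,
          (∀ z l, (z, l) ∈ (E i).carrier →
            IsPhgAt k (i.removeNth E) (a z l) (i.removeNth x₀) y₀) ∧
          ∀ (N : ℝ) (α : Fin (k + 1) → ℝ), α i = N →
            (∀ j, j ≠ i → ∀ p ∈ (E j).carrier, α j < p.1.re) →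
            IsConormalAt (fun j => (α j : WithTop ℝ)) univ
              (fun x y => u x y - ∑ p ∈ (E i).upTo N,
                (x i : ℂ) ^ p.1 * (Real.log (x i) : ℂ) ^ p.2 * a p.1 p.2 (i.removeNth x) y)
              x₀ y₀

end Local

/-! ### Fully residual operators on `[0,∞]`

An operator on b-half-densities is given by the coefficient `n t t'` (`t, t' > 0`) of its Schwartz
kernel relative to `|dt/t dt'/t'|^{1/2}`. The closed quarter disc (the closure of the
quadrant `[0,∞)²` in the radial compactification of `ℝ²`) is
described by homogeneous coordinates `(T, a, b) ∈ [0,∞)³ \ 0`, `t = a / T`, `t' = b / T`, in which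
its boundary hypersurfaces are `T = 0` (infinity), `a = 0` (`t = 0`) and `b = 0` (`t' = 0`).
Functions on the quarter disc are conormal/polyhomogeneous iff their pull-backs under the
submersion `(T, a, b) ↦ (a / T, b / T)` are; setting one of
`T, a, b` equal to `1` gives the usual projective coordinates. -/

section Model

variable {G : Type*} [NormedAddCommGroup G] [NormedSpace ℝ G]

/-- The pull-back to homogeneous coordinates of a family of kernels with parameters in `G`. -/
def homogPullback (ν : G → ℝ → ℝ → ℂ) : (Fin 3 → ℝ) → G → ℂ :=
  fun x g => ν g (x 1 / x 0) (x 2 / x 0)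

/-- Near the parameter `g`, the family `ν` depends smoothly on the parameter with values in
`Ψ^{-∞,(E₀,E₁)}([0,∞]) = A_phg^{(E₀,E₁,∅)}` (quarter disc). -/
def IsFullyResidualPhgAt (E₀ E₁ : IndexSet) (ν : G → ℝ → ℝ → ℂ) (g : G) : Prop :=
  ∀ x : Fin 3 → ℝ, (∀ i, 0 ≤ x i) → x ≠ 0 →
    IsPhgAt 3 ![IndexSet.empty, E₀, E₁] (homogPullback ν) x g

/-- Near the parameter `g`, the family `ν` depends smoothly on the parameter with values in
`Ψ^{-∞,(α₀,α₁)}([0,∞]) = A^{(α₀,α₁,∞)}` (quarter disc). -/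
def IsFullyResidualConormalAt (α₀ α₁ : WithTop ℝ) (ν : G → ℝ → ℝ → ℂ) (g : G) : Prop :=
  ∀ x : Fin 3 → ℝ, (∀ i, 0 ≤ x i) → x ≠ 0 →
    IsConormalAt ![⊤, α₀, α₁] univ (homogPullback ν) x g

end Model

/-- The Euclidean space of tangential variables, `ℝ^d` with `d = n - 1`. -/
abbrev Tan (d : ℕ) := EuclideanSpace ℝ (Fin d)

/-- A family on the unit sphere of `ℝ^d`, extended to `η ≠ 0` by homogeneity of degree `0`; smooth
dependence of `n` on `η̂` in the sphere is smooth dependence of the extension on `η ≠ 0`. -/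
def sphereExtend {d : ℕ} (n : Tan d → ℝ → ℝ → ℂ) : Tan d → ℝ → ℝ → ℂ :=
  fun η => n (‖η‖⁻¹ • η)

/-- `n ∈ C^∞(S^{d-1}; Ψ^{-∞,(E₀,E₁)}([0,∞]))`. Only the values `n η̂ t t'` with `|η̂| = 1` and
`t, t' > 0` matter. -/
def IsPhgSphereFamily {d : ℕ} (E₀ E₁ : IndexSet) (n : Tan d → ℝ → ℝ → ℂ) : Prop :=
  ∀ η : Tan d, η ≠ 0 → IsFullyResidualPhgAt E₀ E₁ (sphereExtend n) η

/-- `n ∈ C^∞(S^{d-1}; Ψ^{-∞,(α₀,α₁)}([0,∞]))`. -/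
def IsConormalSphereFamily {d : ℕ} (α₀ α₁ : WithTop ℝ) (n : Tan d → ℝ → ℝ → ℂ) : Prop :=
  ∀ η : Tan d, η ≠ 0 → IsFullyResidualConormalAt α₀ α₁ (sphereExtend n) η

/-- `n ∈ C^∞(W × S^{d-1}; Ψ^{-∞,(E₀,E₁)}([0,∞]))` for an open set `W ⊆ ℝ^d` of parameters `y`. -/
def IsPhgSphereFamilyOn {d : ℕ} (E₀ E₁ : IndexSet) (W : Set (Tan d))
    (n : Tan d → Tan d → ℝ → ℝ → ℂ) : Prop :=
  ∀ y ∈ W, ∀ η : Tan d, η ≠ 0 →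
    IsFullyResidualPhgAt E₀ E₁ (fun g : Tan d × Tan d => sphereExtend (n g.1) g.2) (y, η)

/-- `n ∈ C^∞(W × S^{d-1}; Ψ^{-∞,(α₀,α₁)}([0,∞]))` for an open set `W ⊆ ℝ^d` of parameters `y`. -/
def IsConormalSphereFamilyOn {d : ℕ} (α₀ α₁ : WithTop ℝ) (W : Set (Tan d))
    (n : Tan d → Tan d → ℝ → ℝ → ℂ) : Prop :=
  ∀ y ∈ W, ∀ η : Tan d, η ≠ 0 →
    IsFullyResidualConormalAt α₀ α₁ (fun g : Tan d × Tan d => sphereExtend (n g.1) g.2) (y, η)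

/-! ### Schwartz kernels on `X × X` and the 0-double space -/

/-- The point with coordinates `(x, y)` in `ℝ × ℝ^d = ℝ^{d+1}`; the half space is `x ≥ 0`. -/
def hpoint {d : ℕ} (x : ℝ) (y : Tan d) : EuclideanSpace ℝ (Fin (d + 1)) :=
  WithLp.toLp 2 (Fin.cons x y)

section Manifold

variable {d : ℕ} {X : Type*} [TopologicalSpace X] [ChartedSpace (EuclideanHalfSpace (d + 1)) X]

/-- The factor relating coefficients of half-densities at the point with coordinates `(x, y)` in
the chart `φ`: for the half-density `c |vol|^{1/2}` on the tangent space
`T_pX = ℝ^{d+1}` (`vol` the Lebesgue measure), one has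
`c |vol|^{1/2} = c * zeroFactor φ x y * |dx/x dy/x^d|^{1/2}`. -/
def zeroFactor (φ : OpenPartialHomeomorph X (EuclideanHalfSpace (d + 1))) (x : ℝ) (y : Tan d) :
    ℝ :=
  let J : EuclideanSpace ℝ (Fin (d + 1)) →L[ℝ] EuclideanSpace ℝ (Fin (d + 1)) :=
    mfderiv 𝓘(ℝ, EuclideanSpace ℝ (Fin (d + 1))) (𝓡∂ (d + 1))
      (φ.extend (𝓡∂ (d + 1))).symm (hpoint x y)
  Real.sqrt (|J.det| * x ^ (d + 1))

/-- A Schwartz kernel, that is, a half-density on `X° × X°`, is a function `κ : X → X → ℂ`: its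
value at `(p, q)` is `κ p q` times the Lebesgue half-density of `T_pX × T_qX`.
`kernelCoeff φ ψ κ` is its coefficient `K(x, y, x', y')` relative to
`|dx/x dy/x^d dx'/x' dy'/x'^d|^{1/2}`, with `(x, y)` the coordinates of the chart `φ`
on the left factor and `(x', y')` those of the chart `ψ` on the right factor. -/
def kernelCoeff (φ ψ : OpenPartialHomeomorph X (EuclideanHalfSpace (d + 1))) (κ : X → X → ℂ)
    (x : ℝ) (y : Tan d) (x' : ℝ) (y' : Tan d) : ℂ :=
  κ ((φ.extend (𝓡∂ (d + 1))).symm (hpoint x y)) ((ψ.extend (𝓡∂ (d + 1))).symm (hpoint x' y')) *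
    (zeroFactor φ x y : ℂ) * (zeroFactor ψ x' y' : ℂ)

/-- `(x, y)` lies in the coordinate range of the chart `φ` (in particular, `x ≥ 0`). -/
def InRange (φ : OpenPartialHomeomorph X (EuclideanHalfSpace (d + 1))) (x : ℝ) (y : Tan d) :
    Prop :=
  hpoint x y ∈ (φ.extend (𝓡∂ (d + 1))).target

/-- A property `A` of functions on blow-ups `[U × U; diag_{∂U}]` of charts and a property `B` of
functions on products `U × V` of disjoint charts, required on sets of this form which cover the
0-double space `X²₀ = [X²; diag_{∂X}]`. -/
def LocallyOnDoubleSpace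
    (A : OpenPartialHomeomorph X (EuclideanHalfSpace (d + 1)) → Prop)
    (B : OpenPartialHomeomorph X (EuclideanHalfSpace (d + 1)) →
      OpenPartialHomeomorph X (EuclideanHalfSpace (d + 1)) → Prop) : Prop :=
  ∀ p q : X,
    (∃ φ ∈ IsManifold.maximalAtlas (𝓡∂ (d + 1)) ∞ X, p ∈ φ.source ∧ q ∈ φ.source ∧ A φ) ∨
    (∃ φ ∈ IsManifold.maximalAtlas (𝓡∂ (d + 1)) ∞ X,
      ∃ ψ ∈ IsManifold.maximalAtlas (𝓡∂ (d + 1)) ∞ X,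
        p ∈ φ.source ∧ q ∈ ψ.source ∧ Disjoint φ.source ψ.source ∧ B φ ψ)

/-- Homogeneous coordinates on the blow-up of the boundary diagonal `x = x' = 0, y = y'`:
the map `(R, a, b, w, y') ↦ (x, y, x', y') = (R a, y' + R w, R b, y')` with `R, a, b ≥ 0` and
`(a, b, w) ≠ 0` lifts to a surjective submersion onto the blow-up, and a
function on the blow-up is conormal/polyhomogeneous iff its pull-back is. The front face `ff` is
`R = 0`, `lb` (the lift of `x = 0`) is `a = 0`, and `rb` (the lift of `x' = 0`) is `b = 0`.
Normalizing one of `a`, `b`, `±w_j` to `1` gives the projective coordinates; `b = 1`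
gives `s = x / x'`, `Υ = (y - y') / x'`, `x'`, `y'`. -/
def IsBlowupPoint (φ : OpenPartialHomeomorph X (EuclideanHalfSpace (d + 1)))
    (R a b : ℝ) (w y' : Tan d) : Prop :=
  0 ≤ R ∧ 0 ≤ a ∧ 0 ≤ b ∧ ¬ (a = 0 ∧ b = 0 ∧ w = 0) ∧
    InRange φ (R * a) (y' + R • w) ∧ InRange φ (R * b) y'

/-- `κ` is the Schwartz kernel of an element of
`Ψ₀^{-∞,(E_lb,E_ff,E_rb)}(X) = A_phg^{(E_lb,E_ff,E_rb)}(X²₀, KD₀)`. -/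
def IsResidualPhg (Elb Eff Erb : IndexSet) (κ : X → X → ℂ) : Prop :=
  LocallyOnDoubleSpace (d := d) (X := X)
    (fun φ => ∀ (R a b : ℝ) (w y' : Tan d), IsBlowupPoint φ R a b w y' →
      IsPhgAt 3 ![Eff, Elb, Erb]
        (fun x (g : Tan d × Tan d) =>
          kernelCoeff φ φ κ (x 0 * x 1) (g.2 + x 0 • g.1) (x 0 * x 2) g.2)
        ![R, a, b] (w, y'))
    (fun φ ψ => ∀ (x : ℝ) (y : Tan d) (x' : ℝ) (y' : Tan d), InRange φ x y → InRange ψ x' y' →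
      IsPhgAt 2 ![Elb, Erb]
        (fun v (g : Tan d × Tan d) => kernelCoeff φ ψ κ (v 0) g.1 (v 1) g.2)
        ![x, x'] (y, y'))

/-- `κ` is the Schwartz kernel of an element of
`Ψ₀^{-∞,(α_lb,α_rb)}(X) = A_{lb,rb}^{(α_lb,α_rb)}(X²₀, KD₀)`: conormal at `lb` and `rb`, and smooth
down to `ff` (differentiation along vector fields which need to be tangent to `lb` and `rb` only;
thus `R > 0` is an ordinary variable, and derivatives along `∂_R` are bounded down to `R = 0`). -/
def IsResidualConormal (αlb αrb : WithTop ℝ) (κ : X → X → ℂ) : Prop :=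
  LocallyOnDoubleSpace (d := d) (X := X)
    (fun φ => ∀ (R a b : ℝ) (w y' : Tan d), IsBlowupPoint φ R a b w y' →
      IsConormalAt ![αlb, αrb] {g : ℝ × Tan d × Tan d | 0 < g.1}
        (fun x (g : ℝ × Tan d × Tan d) =>
          kernelCoeff φ φ κ (g.1 * x 0) (g.2.2 + g.1 • g.2.1) (g.1 * x 1) g.2.2)
        ![a, b] (R, w, y'))
    (fun φ ψ => ∀ (x : ℝ) (y : Tan d) (x' : ℝ) (y' : Tan d), InRange φ x y → InRange ψ x' y' →
      IsConormalAt ![αlb, αrb] univ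
        (fun v (g : Tan d × Tan d) => kernelCoeff φ ψ κ (v 0) g.1 (v 1) g.2)
        ![x, x'] (y, y'))

/-! ### The reduced normal operator -/

/-- The (distributional) Fourier transform `∫ e^{-i Y·η} f(Y) dY` of `f` is, on the set `η ≠ 0`,
the function `g`. -/
def HasFourierTransformOffZero (f g : Tan d → ℂ) : Prop :=
  ∀ χ : Tan d → ℂ, ContDiff ℝ ∞ χ → HasCompactSupport χ → (0 : Tan d) ∉ tsupport χ →
    Integrable (fun Y => f Y * ∫ η, Complex.exp (-(Complex.I * (inner ℝ Y η : ℝ))) * χ η) ∧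
    Integrable (fun η => g η * χ η) ∧
    ∫ Y, f Y * ∫ η, Complex.exp (-(Complex.I * (inner ℝ Y η : ℝ))) * χ η = ∫ η, g η * χ η

/-- In the chart `φ`, the reduced normal operator `N(P, y₀, η̂)` at the boundary point with
coordinates `(0, y₀)` of the operator `P` with Schwartz kernel `κ` has Schwartz kernel
`n η̂ t t' |dt/t dt'/t'|^{1/2}` for all `|η̂| = 1`. Here `K₀ s Υ` is the restriction to
the front face of the coefficient
`K_P^0(s, Υ, x', y')` of `κ` in the coordinates `s = x/x'`, `Υ = (y-y')/x'`, `x'`, `y'`, and `n` is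
defined by `n η̂ t t' = (Fourier transform of K₀ in Υ)(t/t', t' η̂)`; thus
`n (η/|η|) (s|η|) |η|` is the Fourier transform of `K₀ s` at `η ≠ 0`. -/
def HasReducedNormalOperator (φ : OpenPartialHomeomorph X (EuclideanHalfSpace (d + 1)))
    (κ : X → X → ℂ) (y₀ : Tan d) (n : Tan d → ℝ → ℝ → ℂ) : Prop :=
  ∃ K₀ : ℝ → Tan d → ℂ,
    (∀ s : ℝ, 0 < s → ∀ Υ : Tan d,
      Tendsto (fun x' : ℝ => kernelCoeff φ φ κ (s * x') (y₀ + x' • Υ) x' y₀)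
        (𝓝[>] 0) (𝓝 (K₀ s Υ))) ∧
    ∀ s : ℝ, 0 < s →
      HasFourierTransformOffZero (K₀ s) (fun η => n (‖η‖⁻¹ • η) (s * ‖η‖) ‖η‖)

/-- The set of all `y` such that `(0, y)` are the coordinates of a boundary point in the domain of
the chart `φ`. -/
def boundaryRange (φ : OpenPartialHomeomorph X (EuclideanHalfSpace (d + 1))) : Set (Tan d) :=
  {y | InRange φ 0 y}

/-- The set of boundary points of `X` whose coordinates in the chart `φ` are `(0, y)`, `y ∈ K`. -/
def boundaryPoints (φ : OpenPartialHomeomorph X (EuclideanHalfSpace (d + 1))) (K : Set (Tan d)) :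
    Set X :=
  (fun y => (φ.extend (𝓡∂ (d + 1))).symm (hpoint 0 y)) '' K

end Manifold

end ZeroCalculus

end

noncomputable section

namespace ZeroCalculus

section

/-! ### Functions all of whose derivatives satisfy the same exponential bound along a filter -/

section Symbol

variable {E E' : Type*} [NormedAddCommGroup E] [NormedSpace ℝ E] [NormedAddCommGroup E']
  [NormedSpace ℝ E'] {G : Type*} [NormedAddCommGroup G] [NormedSpace ℝ G]

/-! The operator is written down explicitly. Put `d = n - 1`. Fourier inversion in `Υ` suggests as
kernel on the front face the function `(2π)^{-d} ∫ exp(i Υ·ξ) n(y', ξ/|ξ|, s|ξ|, |ξ|) dξ`. In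
homogeneous coordinates `(a, b, w)` with `s = a/b`, `Υ = w/b` it becomes `(2π)^{-d} b^d ∫ exp(i w·ξ)
n(y', ξ/|ξ|, a|ξ|, b|ξ|) dξ`, which is invariant under dilations of `(a, b, w)`
(`zeroKernel_dilation`). Hence it can be evaluated at `(x, x', y - y')`: in the coordinates of the
blow-up the result does not depend on `R`, so it is smooth down to `ff`, and only a cutoff to the
chart remains to be multiplied in. The factor `b^d` is the shift by `n - 1` at `rb`.

Convergence and size. Near `ξ = 0` the integrand is `O(|ξ|^{β₀ + β₁})` for weights `β₀`, `β₁` of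
`n`, which is integrable exactly because weights with `β₀ + β₁ > -d` are available. For large `ξ`
and `a + b > 0` the decay of `n` at infinity suffices. At `a = b = 0` one has `w ≠ 0` on the
blow-up, and integration by parts in `ξ` gains a power of `|ξ|⁻¹` at each step, since `n(ξ/|ξ|,
a|ξ|, b|ξ|)` is homogeneous in `(a⁻¹, b⁻¹, ξ)`. This gives `HomSymbol.symbolBound_oscIntegral`, with
conormal bounds `a^{β₀} b^{β₁}` for the integral, and settles the conormal case.

Polyhomogeneity. All estimates are made in logarithmic coordinates, where `x ∂_x` is a coordinate
derivative and a weight is an exponential (`SymbolBound`). The operator `a ∂_a` passes under the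
integral and becomes `t ∂_t` acting on `n`, and similarly for `b` and `t'` (`shiftDerivs_kernelOf`).
Therefore products of operators `a ∂_a - z` over the exponents of `𝓔₀`, which remove the expansion
of `n` at `t = 0`, improve the order of the kernel at `a = 0` arbitrarily. That such improvements
imply an expansion is the content of `TestPhg.isPhgAt`: solving the ordinary differential equations
`(x ∂_x - z) V = f` produces the terms of the expansion (`exists_expansion`), uniqueness makes the
coefficients independent of the truncation (`eq_zero_of_expSum`), and interpolation between bounds
at two faces shows that the coefficients satisfy the same tests (`TestPhg.coeff`). The class is
stable under multiplication by smooth functions (`TestPhg.smooth_mul`), hence by the cutoff.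

On the manifold the cutoff equals `1` over `K`, with support in a set which is closed in `X` and
inside the chart (`exists_boundary_cutoff`); elsewhere the kernel is zero. The normal operator is
then read off by Fourier inversion (`FamilySymbol.hasFourierTransformOffZero`). For `n = 1` the
sphere is empty and the zero kernel works. -/

theorem exists_isOpen_contDiffOn {f : E → G} {x : E} {n : ℕ} (hf : ContDiffAt ℝ n f x) :
    ∃ s, IsOpen s ∧ x ∈ s ∧ ContDiffOn ℝ n f s := by
  obtain ⟨u, hu, hfu⟩ := hf.contDiffOn le_rfl (by simp)
  replace hu : u ∈ 𝓝 x := by simpa using hu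
  obtain ⟨s, hsu, hs, hx⟩ := mem_nhds_iff.1 hu
  exact ⟨s, hs, hx, hfu.mono (by simpa using hsu)⟩

theorem iteratedFDeriv_congr_of_eventuallyEq {f g : E → ℂ} {x : E} (h : f =ᶠ[𝓝 x] g) (n : ℕ) :
    iteratedFDeriv ℝ n f x = iteratedFDeriv ℝ n g x :=
  (h.iteratedFDeriv ℝ n).eq_of_nhds

theorem norm_iteratedFDeriv_mul_le_of_contDiffAt {f g : E → ℂ} {x : E} {n : ℕ}
    (hf : ContDiffAt ℝ n f x) (hg : ContDiffAt ℝ n g x) :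
    ‖iteratedFDeriv ℝ n (fun y => f y * g y) x‖ ≤ ∑ i ∈ Finset.range (n + 1),
      (n.choose i : ℝ) * ‖iteratedFDeriv ℝ i f x‖ * ‖iteratedFDeriv ℝ (n - i) g x‖ := by
  obtain ⟨s, hs, hxs, hfs⟩ := exists_isOpen_contDiffOn hf
  obtain ⟨t, ht, hxt, hgt⟩ := exists_isOpen_contDiffOn hg
  have ho := hs.inter ht
  have hx : x ∈ s ∩ t := ⟨hxs, hxt⟩
  have key := norm_iteratedFDerivWithin_mul_le (𝕜 := ℝ) (hfs.mono inter_subset_left)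
    (hgt.mono inter_subset_right) ho.uniqueDiffOn hx (n := n) le_rfl
  simpa only [iteratedFDerivWithin_of_isOpen _ ho hx] using key

theorem iteratedFDeriv_comp_affine {f : E → G} (A : E' →L[ℝ] E) (c : E) {x : E'} {n : ℕ}
    (hf : ContDiffAt ℝ n f (A x + c)) :
    iteratedFDeriv ℝ n (fun y => f (A y + c)) x =
      (iteratedFDeriv ℝ n f (A x + c)).compContinuousLinearMap fun _ => A := by
  have h1 : ContDiffAt ℝ n (fun y => f (y + c)) (A x) :=
    ContDiffAt.comp (A x) hf (contDiffAt_id.add contDiffAt_const)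
  obtain ⟨s, hs, hxs, hfs⟩ := exists_isOpen_contDiffOn h1
  have hs' : IsOpen (A ⁻¹' s) := hs.preimage A.continuous
  have key := A.iteratedFDerivWithin_comp_right hfs hs.uniqueDiffOn hs'.uniqueDiffOn hxs
    (i := n) le_rfl
  rw [iteratedFDerivWithin_of_isOpen _ hs' hxs, iteratedFDerivWithin_of_isOpen _ hs hxs,
    iteratedFDeriv_comp_add_right] at key
  exact key

theorem norm_iteratedFDeriv_comp_affine_le {f : E → G} (A : E' →L[ℝ] E) (c : E) {x : E'} {n : ℕ}
    (hf : ContDiffAt ℝ n f (A x + c)) :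
    ‖iteratedFDeriv ℝ n (fun y => f (A y + c)) x‖ ≤
      ‖iteratedFDeriv ℝ n f (A x + c)‖ * ‖A‖ ^ n := by
  rw [iteratedFDeriv_comp_affine A c hf]
  refine (ContinuousMultilinearMap.norm_compContinuousLinearMap_le _ _).trans ?_
  simp

theorem contDiffAt_lineDeriv {f : E → ℂ} {x : E} (v : E) (hf : ContDiffAt ℝ ∞ f x) :
    ContDiffAt ℝ ∞ (fun y => fderiv ℝ f y v) x :=
  (hf.fderiv_right (m := ∞) (by simp)).clm_apply contDiffAt_const

theorem lineDeriv_eventuallyEq {f : E → ℂ} {x : E} (v : E) (hf : ContDiffAt ℝ ∞ f x) :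
    (fun y => lineDeriv ℝ f y v) =ᶠ[𝓝 x] fun y => fderiv ℝ f y v := by
  have h1 : ContDiffAt ℝ 1 f x := hf.of_le (by simp)
  filter_upwards [h1.eventually (by simp)] with y hy
  exact (hy.differentiableAt (by simp)).lineDeriv_eq_fderiv

theorem norm_iteratedFDeriv_lineDeriv_le {f : E → ℂ} {x : E} (v : E) (n : ℕ)
    (hf : ContDiffAt ℝ ∞ f x) :
    ‖iteratedFDeriv ℝ n (fun y => lineDeriv ℝ f y v) x‖ ≤
      ‖v‖ * ‖iteratedFDeriv ℝ (n + 1) f x‖ := by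
  rw [iteratedFDeriv_congr_of_eventuallyEq (lineDeriv_eventuallyEq v hf) n]
  refine (norm_iteratedFDeriv_clm_apply_const (N := ∞)
    (hf.fderiv_right (m := ∞) (by simp)) (by exact_mod_cast le_top)).trans ?_
  rw [norm_iteratedFDeriv_fderiv]

/-- A filter generated by open sets: what holds eventually holds near eventually every point. -/
def IsOpenFilter (l : Filter E) : Prop :=
  ∀ P : E → Prop, (∀ᶠ q in l, P q) → ∀ᶠ q in l, ∀ᶠ q' in 𝓝 q, P q'

/-- `U` is smooth, with all derivatives `O(exp μ)`, along the filter `l`. -/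
structure SymbolBound (l : Filter E) (μ : E → ℝ) (U : E → ℂ) : Prop where
  smooth : ∀ᶠ q in l, ContDiffAt ℝ ∞ U q
  bound : ∀ m : ℕ, ∃ C : ℝ, ∀ᶠ q in l, ‖iteratedFDeriv ℝ m U q‖ ≤ C * Real.exp (μ q)

namespace SymbolBound

variable {l : Filter E} {μ ν : E → ℝ} {U V : E → ℂ}

theorem exists_pos_bound (h : SymbolBound l μ U) (m : ℕ) :
    ∃ C : ℝ, 0 < C ∧ ∀ᶠ q in l, ‖iteratedFDeriv ℝ m U q‖ ≤ C * Real.exp (μ q) := by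
  obtain ⟨C, hC⟩ := h.bound m
  refine ⟨max C 1, by positivity, hC.mono fun q hq => hq.trans ?_⟩
  gcongr
  exact le_max_left _ _

/-- An additive constant in the exponent is a multiplicative constant in the bound. All comparisons
of weights on sets where the logarithmic coordinates are bounded above go through this. -/
theorem mono (h : SymbolBound l μ U) (c : ℝ) (hc : ∀ᶠ q in l, μ q ≤ ν q + c) :
    SymbolBound l ν U := by
  refine ⟨h.smooth, fun m => ?_⟩
  obtain ⟨C, hC, hb⟩ := h.exists_pos_bound m
  refine ⟨C * Real.exp c, ?_⟩
  filter_upwards [hb, hc] with q h1 h2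
  refine h1.trans ?_
  rw [mul_assoc, ← Real.exp_add, add_comm c]
  gcongr

theorem congr (hl : IsOpenFilter l) (h : SymbolBound l μ U) (he : ∀ᶠ q in l, U q = V q) :
    SymbolBound l μ V := by
  have he' := hl _ he
  refine ⟨?_, fun m => ?_⟩
  · filter_upwards [h.smooth, he'] with q h1 h2
    exact h1.congr_of_eventuallyEq (h2.mono fun _ h => h.symm)
  · obtain ⟨C, hC⟩ := h.bound m
    refine ⟨C, ?_⟩
    filter_upwards [hC, he'] with q h1 h2
    rwa [← iteratedFDeriv_congr_of_eventuallyEq h2 m]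

theorem add (hU : SymbolBound l μ U) (hV : SymbolBound l μ V) :
    SymbolBound l μ (fun q => U q + V q) := by
  refine ⟨?_, fun m => ?_⟩
  · filter_upwards [hU.smooth, hV.smooth] with q h1 h2 using h1.add h2
  · obtain ⟨C, hC⟩ := hU.bound m
    obtain ⟨D, hD⟩ := hV.bound m
    refine ⟨C + D, ?_⟩
    filter_upwards [hC, hD, hU.smooth, hV.smooth] with q h1 h2 h3 h4
    have h3' : ContDiffAt ℝ m U q := h3.of_le (by exact_mod_cast le_top)
    have h4' : ContDiffAt ℝ m V q := h4.of_le (by exact_mod_cast le_top)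
    have := iteratedFDeriv_add_apply h3' h4'
    change iteratedFDeriv ℝ m (fun q => U q + V q) q = _ at this
    rw [this, add_mul]
    exact (norm_add_le _ _).trans (add_le_add h1 h2)

theorem zero : SymbolBound l μ (fun _ => 0) :=
  ⟨Eventually.of_forall fun _ => contDiffAt_const, fun m => ⟨0, Eventually.of_forall fun q => by
    change ‖iteratedFDeriv ℝ m (0 : E → ℂ) q‖ ≤ _
    simp⟩⟩

theorem const (c : ℂ) : SymbolBound l (fun _ => 0) (fun _ => c) := by
  refine ⟨Eventually.of_forall fun _ => contDiffAt_const, fun m => ⟨‖c‖, ?_⟩⟩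
  refine Eventually.of_forall fun q => ?_
  rcases m with _ | m
  · simp
  · rw [iteratedFDeriv_succ_const]
    simp

theorem mul (hU : SymbolBound l μ U) (hV : SymbolBound l ν V) :
    SymbolBound l (fun q => μ q + ν q) (fun q => U q * V q) := by
  refine ⟨?_, fun m => ?_⟩
  · filter_upwards [hU.smooth, hV.smooth] with q h1 h2 using h1.mul h2
  · choose C hC hCb using hU.exists_pos_bound
    choose D hD hDb using hV.exists_pos_bound
    refine ⟨∑ i ∈ Finset.range (m + 1), (m.choose i : ℝ) * C i * D (m - i), ?_⟩
    have h1 : ∀ᶠ q in l, ∀ i ∈ Finset.range (m + 1),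
        ‖iteratedFDeriv ℝ i U q‖ ≤ C i * Real.exp (μ q) :=
      (Finset.eventually_all _).2 fun i _ => hCb i
    have h2 : ∀ᶠ q in l, ∀ i ∈ Finset.range (m + 1),
        ‖iteratedFDeriv ℝ (m - i) V q‖ ≤ D (m - i) * Real.exp (ν q) :=
      (Finset.eventually_all _).2 fun i _ => hDb _
    filter_upwards [h1, h2, hU.smooth, hV.smooth] with q h1 h2 h3 h4
    refine (norm_iteratedFDeriv_mul_le_of_contDiffAt (h3.of_le (by exact_mod_cast le_top))
      (h4.of_le (by exact_mod_cast le_top))).trans ?_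
    rw [Finset.sum_mul]
    refine Finset.sum_le_sum fun i hi => ?_
    rw [Real.exp_add]
    calc _ ≤ (m.choose i : ℝ) * (C i * Real.exp (μ q)) * (D (m - i) * Real.exp (ν q)) := by
          have := (hC i).le
          gcongr
          · exact h1 i hi
          · exact h2 i hi
      _ = _ := by ring

theorem const_mul (c : ℂ) (hU : SymbolBound l μ U) : SymbolBound l μ (fun q => c * U q) :=
  ((const (l := l) c).mul hU).mono 0 (Eventually.of_forall fun q => by simp)

theorem sub (hU : SymbolBound l μ U) (hV : SymbolBound l μ V) :
    SymbolBound l μ (fun q => U q - V q) := by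
  simpa [sub_eq_add_neg] using hU.add (hV.const_mul (-1))

theorem sum {ι : Type*} (s : Finset ι) {W : ι → E → ℂ} (h : ∀ i ∈ s, SymbolBound l μ (W i)) :
    SymbolBound l μ (fun q => ∑ i ∈ s, W i q) := by
  classical
  induction s using Finset.induction_on with
  | empty => simpa using zero
  | insert i s hi ih =>
    simp only [Finset.sum_insert hi]
    exact (h i (by simp)).add (ih fun j hj => h j (by simp [hj]))

theorem lineDeriv (hU : SymbolBound l μ U) (v : E) :
    SymbolBound l μ (fun q => lineDeriv ℝ U q v) := by
  refine ⟨?_, fun m => ?_⟩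
  · filter_upwards [hU.smooth] with q hq
    exact (contDiffAt_lineDeriv v hq).congr_of_eventuallyEq (lineDeriv_eventuallyEq v hq)
  · obtain ⟨C, hC⟩ := hU.bound (m + 1)
    refine ⟨‖v‖ * C, ?_⟩
    filter_upwards [hC, hU.smooth] with q h1 h2
    refine (norm_iteratedFDeriv_lineDeriv_le v m h2).trans ?_
    rw [mul_assoc]
    gcongr

theorem comp_affine (hU : SymbolBound l μ U) {l' : Filter E'} (A : E' →L[ℝ] E) (c : E)
    (hA : Tendsto (fun q => A q + c) l' l) :
    SymbolBound l' (fun q => μ (A q + c)) (fun q => U (A q + c)) := by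
  refine ⟨?_, fun m => ?_⟩
  · filter_upwards [hA.eventually hU.smooth] with q hq
    exact ContDiffAt.comp q hq (A.contDiff.contDiffAt.add contDiffAt_const)
  · obtain ⟨C, hC⟩ := hU.bound m
    refine ⟨C * ‖A‖ ^ m, ?_⟩
    filter_upwards [hA.eventually hU.smooth, hA.eventually hC] with q h1 h2
    refine (norm_iteratedFDeriv_comp_affine_le A c (h1.of_le (by exact_mod_cast le_top))).trans ?_
    rw [mul_right_comm]
    gcongr

theorem comp_linear (hU : SymbolBound l μ U) {l' : Filter E'} (A : E' →L[ℝ] E)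
    (hA : Tendsto A l' l) : SymbolBound l' (fun q => μ (A q)) (fun q => U (A q)) := by
  simpa using hU.comp_affine A 0 (by simpa using hA)

/-- The smaller of the two exponents is available at every point, and it lies below every convex
combination. In `TestPhg.coeff` this combines bounds that are good at different hypersurfaces. -/
theorem interpolate (hU : SymbolBound l μ U) (hV : SymbolBound l ν U) {θ : ℝ} (h0 : 0 ≤ θ)
    (h1 : θ ≤ 1) : SymbolBound l (fun q => θ * μ q + (1 - θ) * ν q) U := by
  refine ⟨hU.smooth, fun m => ?_⟩
  obtain ⟨C, hC, hCb⟩ := hU.exists_pos_bound m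
  obtain ⟨D, hD, hDb⟩ := hV.exists_pos_bound m
  refine ⟨max C D, ?_⟩
  filter_upwards [hCb, hDb] with q h2 h3
  rcases le_total (μ q) (ν q) with h | h
  · refine h2.trans ?_
    gcongr
    · exact le_max_left _ _
    · nlinarith
  · refine h3.trans ?_
    gcongr
    · exact le_max_right _ _
    · nlinarith

theorem norm_le (hU : SymbolBound l μ U) : ∃ C, 0 < C ∧ ∀ᶠ q in l, ‖U q‖ ≤ C * Real.exp (μ q) := by
  obtain ⟨C, h, hC⟩ := hU.exists_pos_bound 0
  exact ⟨C, h, by simpa using hC⟩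

end SymbolBound

theorem norm_iteratedFDeriv_cexp_le (z : ℂ) (L : E →L[ℝ] ℝ) (m : ℕ) (q : E) :
    ‖iteratedFDeriv ℝ m (fun q => Complex.exp (z * (L q : ℂ))) q‖ ≤
      ‖z‖ ^ m * ‖L‖ ^ m * Real.exp (z.re * L q) := by
  have hd : ∀ m : ℕ, iteratedDeriv m (fun t : ℝ => Complex.exp (z * (t : ℂ))) =
      fun t : ℝ => z ^ m * Complex.exp (z * (t : ℂ)) := by
    intro m
    induction m with
    | zero => simp
    | succ m ih =>
      rw [iteratedDeriv_succ, ih]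
      ext t
      have h1 : HasDerivAt (fun t : ℝ => z * (t : ℂ)) z t := by
        simpa using (Complex.ofRealCLM.hasDerivAt (x := t)).const_mul z
      rw [(h1.cexp.const_mul (z ^ m)).deriv]
      ring
  have hs : ContDiff ℝ ∞ (fun t : ℝ => Complex.exp (z * (t : ℂ))) :=
    (contDiff_const.mul Complex.ofRealCLM.contDiff).cexp
  have := norm_iteratedFDeriv_comp_affine_le (f := fun t : ℝ => Complex.exp (z * (t : ℂ))) L 0
    (x := q) (n := m) (hs.contDiffAt.of_le (by exact_mod_cast le_top))
  simp only [add_zero] at this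
  refine this.trans (le_of_eq ?_)
  rw [norm_iteratedFDeriv_eq_norm_iteratedDeriv, hd]
  simp only [norm_mul, norm_pow, Complex.norm_exp]
  simp
  ring

/-- In logarithmic coordinates this is the factor `x ^ z`, with its exact weight `Re z`. -/
theorem SymbolBound.cexp (l : Filter E) (z : ℂ) (L : E →L[ℝ] ℝ) :
    SymbolBound l (fun q => z.re * L q) (fun q => Complex.exp (z * (L q : ℂ))) := by
  refine ⟨Eventually.of_forall fun q => ?_, fun m => ⟨‖z‖ ^ m * ‖L‖ ^ m,
    Eventually.of_forall fun q => norm_iteratedFDeriv_cexp_le z L m q⟩⟩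
  exact (contDiffAt_const.mul (Complex.ofRealCLM.contDiff.comp L.contDiff).contDiffAt).cexp

/-- A linear functional that is bounded above grows slower than any exponential. -/
theorem SymbolBound.linear (l : Filter E) (L : E →L[ℝ] ℝ) {M ε : ℝ} (hε : 0 < ε)
    (hL : ∀ᶠ q in l, L q ≤ M) : SymbolBound l (fun q => -ε * L q) (fun q => (L q : ℂ)) := by
  set T : E →L[ℝ] ℂ := Complex.ofRealCLM.comp L
  have hT : (fun q => (L q : ℂ)) = T := rfl
  refine ⟨Eventually.of_forall fun q => hT ▸ T.contDiff.contDiffAt, fun m => ?_⟩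
  have hexp : ∀ q, L q ≤ M → Real.exp (-ε * M) ≤ Real.exp (-ε * L q) := fun q hq => by
    apply Real.exp_le_exp.2; nlinarith
  rcases m with _ | _ | m
  -- The first summand bounds `-L q`, by `u ≤ exp u` for `u = -ε L q`; the second bounds `L q ≤
  -- |M|`, since the exponential is at least `exp (-ε M)`.
  · refine ⟨1 / ε + |M| / Real.exp (-ε * M), ?_⟩
    filter_upwards [hL] with q hq
    simp only [norm_iteratedFDeriv_zero, Complex.norm_real, Real.norm_eq_abs]
    have h1 := Real.add_one_le_exp (-ε * L q)
    have h2 := hexp q hq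
    have h3 : |M| ≤ |M| / Real.exp (-ε * M) * Real.exp (-ε * L q) := by
      rw [div_mul_eq_mul_div, le_div_iff₀ (Real.exp_pos _)]
      gcongr
    have h4 : -L q ≤ 1 / ε * Real.exp (-ε * L q) := by
      rw [div_mul_eq_mul_div, le_div_iff₀ hε]
      linarith
    have h5 : 0 < 1 / ε * Real.exp (-ε * L q) := by positivity
    have h6 := le_abs_self M
    have h7 := abs_nonneg M
    rw [add_mul, abs_le]
    constructor <;> linarith
  · refine ⟨‖T‖ / Real.exp (-ε * M), ?_⟩
    filter_upwards [hL] with q hq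
    have h1 : ‖iteratedFDeriv ℝ (0 + 1) (fun q => (L q : ℂ)) q‖ = ‖T‖ := by
      rw [zero_add, norm_iteratedFDeriv_one, hT, T.fderiv]
    rw [h1, div_mul_eq_mul_div, le_div_iff₀ (Real.exp_pos _)]
    exact mul_le_mul_of_nonneg_left (hexp q hq) (norm_nonneg _)
  · refine ⟨0, Eventually.of_forall fun q => ?_⟩
    rw [hT, ← norm_iteratedFDeriv_fderiv]
    have : fderiv ℝ T = fun _ => T := by ext1 q; exact T.fderiv
    rw [this, iteratedFDeriv_succ_const]
    simp

end Symbol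

end

section

/-! ### Smoothness of integrals depending on a parameter -/

section ParametricIntegral

variable {E : Type*} [NormedAddCommGroup E] [NormedSpace ℝ E] {A : Type*} [MeasurableSpace A]
  {μ : Measure A}

theorem exists_hasFDerivAt_integral {N : Type*} [NormedAddCommGroup N] [NormedSpace ℝ N]
    [CompleteSpace N] {s : Set E} {x : E} (hs : s ∈ 𝓝 x) {f : E → A → N} {f' : E → A → E →L[ℝ] N}
    {b : A → ℝ} (hm : ∀ y ∈ s, AEStronglyMeasurable (f y) μ) (hi : Integrable (f x) μ)
    (hm' : AEStronglyMeasurable (f' x) μ) (hb : ∀ᵐ a ∂μ, ∀ y ∈ s, ‖f' y a‖ ≤ b a)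
    (hbi : Integrable b μ) (hf : ∀ᵐ a ∂μ, ∀ y ∈ s, HasFDerivAt (f · a) (f' y a) y) :
    ∃ L : E →L[ℝ] N, HasFDerivAt (fun x => ∫ a, f x a ∂μ) L x ∧ ∀ v, L v = ∫ a, f' x a v ∂μ := by
  refine ⟨_, hasFDerivAt_integral_of_dominated_of_fderiv_le (𝕜 := ℝ) hs
    (eventually_of_mem hs hm) hi hm' hb hbi hf, fun v => ?_⟩
  exact ContinuousLinearMap.integral_apply
    (hbi.mono' hm' (hb.mono fun a ha => ha x (mem_of_mem_nhds hs))) v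

/-- The integrals of the derivatives are checked directly to form a Taylor series: the dominating
function of order `m + 1` justifies differentiating the integral of order `m`, and the one of order
`m` gives its continuity. -/
theorem hasFTaylorSeriesUpToOn_integral {s : Set E} (hs : IsOpen s) {n : ℕ} {f : E → A → ℂ}
    {b : ℕ → A → ℝ} (hf : ∀ᵐ a ∂μ, ContDiffOn ℝ n (fun x => f x a) s)
    (hm : ∀ m ≤ n, ∀ x ∈ s, AEStronglyMeasurable (fun a => iteratedFDeriv ℝ m (fun x => f x a) x) μ)
    (hb : ∀ m ≤ n, ∀ᵐ a ∂μ, ∀ x ∈ s, ‖iteratedFDeriv ℝ m (fun x => f x a) x‖ ≤ b m a)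
    (hbi : ∀ m ≤ n, Integrable (b m) μ) :
    HasFTaylorSeriesUpToOn n (fun x => ∫ a, f x a ∂μ)
      (fun x m => ∫ a, iteratedFDeriv ℝ m (fun x => f x a) x ∂μ) s := by
  have hint : ∀ m ≤ n, ∀ x ∈ s,
      Integrable (fun a => iteratedFDeriv ℝ m (fun x => f x a) x) μ := fun m hmn x hx =>
    (hbi m hmn).mono' (hm m hmn x hx) ((hb m hmn).mono fun a ha => ha x hx)
  have hder : ∀ m < n, ∀ᵐ a ∂μ, ∀ x ∈ s, HasFDerivAt (iteratedFDeriv ℝ m (fun x => f x a))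
      (fderiv ℝ (iteratedFDeriv ℝ m (fun x => f x a)) x) x := by
    intro m hmn
    filter_upwards [hf] with a ha x hx
    have h1 : ContDiffAt ℝ n (fun x => f x a) x := ha.contDiffAt (hs.mem_nhds hx)
    exact (h1.differentiableAt_iteratedFDeriv (by exact_mod_cast hmn)).hasFDerivAt
  have hmeas : ∀ m < n, ∀ x ∈ s, AEStronglyMeasurable
      (fun a => fderiv ℝ (iteratedFDeriv ℝ m (fun x => f x a)) x) μ := by
    intro m hmn x hx
    have := (continuousMultilinearCurryLeftEquiv ℝ (fun _ : Fin (m + 1) => E)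
      ℂ).continuous.comp_aestronglyMeasurable (hm (m + 1) hmn x hx)
    exact this.congr (Eventually.of_forall fun a => by simp only [fderiv_iteratedFDeriv]; rfl)
  constructor
  · intro x hx
    have h0 := hint 0 (Nat.zero_le _) x hx
    have key := (continuousMultilinearCurryFin0 ℝ E ℂ).toContinuousLinearEquiv.integral_comp_comm
      (μ := μ) (fun a => iteratedFDeriv ℝ 0 (fun x => f x a) x)
    refine Eq.trans ?_ (key.symm.trans ?_)
    · rfl
    · congr 1
  · intro m hmn x hx
    have hmn' : m < n := by exact_mod_cast hmn
    obtain ⟨L, hL, hLv⟩ := exists_hasFDerivAt_integral (hs.mem_nhds hx)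
      (fun y hy => hm m hmn'.le y hy) (hint m hmn'.le x hx) (hmeas m hmn' x hx)
      (by
        filter_upwards [hb (m + 1) hmn'] with a ha y hy
        rw [norm_fderiv_iteratedFDeriv]
        exact ha y hy) (hbi (m + 1) hmn') (hder m hmn')
    have hi := hint (m + 1) hmn' x hx
    refine HasFDerivAt.hasFDerivWithinAt ?_
    -- Both sides are compared on vectors, where currying and evaluation commute with the integral.
    have hc : (∫ a, iteratedFDeriv ℝ (m + 1) (fun x => f x a) x ∂μ).curryLeft = L := by
      ext v w
      have hiv : Integrable (fun a => fderiv ℝ (iteratedFDeriv ℝ m (fun x => f x a)) x v) μ := by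
        refine Integrable.mono' (hi.norm.mul_const ‖v‖)
          ((hmeas m hmn' x hx).apply_continuousLinearMap v) (Eventually.of_forall fun a => ?_)
        rw [← norm_fderiv_iteratedFDeriv]
        exact ContinuousLinearMap.le_opNorm _ _
      rw [hLv, ContinuousMultilinearMap.integral_apply hiv,
        ContinuousMultilinearMap.curryLeft_apply, ContinuousMultilinearMap.integral_apply hi]
      rfl
    rw [← hc] at hL
    exact hL
  · intro m hmn x hx
    have hmn' : m ≤ n := by exact_mod_cast hmn
    refine ContinuousAt.continuousWithinAt ?_
    refine continuousAt_of_dominated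
      (eventually_of_mem (hs.mem_nhds hx) fun y hy => hm m hmn' y hy)
      (bound := b m) (eventually_of_mem (hs.mem_nhds hx) fun y hy =>
        (hb m hmn').mono fun a ha => ha y hy) (hbi m hmn') ?_
    filter_upwards [hf] with a ha
    exact (ha.contDiffAt (hs.mem_nhds hx)).continuousAt_iteratedFDeriv (by exact_mod_cast hmn')

theorem iteratedFDeriv_integral {s : Set E} (hs : IsOpen s) {n : ℕ} {f : E → A → ℂ}
    {b : ℕ → A → ℝ} (hf : ∀ᵐ a ∂μ, ContDiffOn ℝ n (fun x => f x a) s)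
    (hm : ∀ m ≤ n, ∀ x ∈ s, AEStronglyMeasurable (fun a => iteratedFDeriv ℝ m (fun x => f x a) x) μ)
    (hb : ∀ m ≤ n, ∀ᵐ a ∂μ, ∀ x ∈ s, ‖iteratedFDeriv ℝ m (fun x => f x a) x‖ ≤ b m a)
    (hbi : ∀ m ≤ n, Integrable (b m) μ) :
    ContDiffOn ℝ n (fun x => ∫ a, f x a ∂μ) s ∧ ∀ m ≤ n, ∀ x ∈ s,
      iteratedFDeriv ℝ m (fun x => ∫ a, f x a ∂μ) x =
        ∫ a, iteratedFDeriv ℝ m (fun x => f x a) x ∂μ := by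
  have h := hasFTaylorSeriesUpToOn_integral hs hf hm hb hbi
  refine ⟨h.contDiffOn, fun m hmn x hx => ?_⟩
  rw [← iteratedFDerivWithin_of_isOpen m hs hx]
  exact (h.eq_iteratedFDerivWithin_of_uniqueDiffOn (by exact_mod_cast hmn) hs.uniqueDiffOn hx).symm

/-- Provides measurability in the integration variable of the derivatives in the parameter: the
slice derivative is the full derivative restricted to the first factor. -/
theorem continuousAt_iteratedFDeriv_slice {B : Type*} [NormedAddCommGroup B] [NormedSpace ℝ B]
    {F : E × B → ℂ} {x : E} {a : B} {n : ℕ} (hF : ContDiffAt ℝ n F (x, a)) :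
    ContinuousAt (fun a => iteratedFDeriv ℝ n (fun x => F (x, a)) x) a := by
  have hev : (fun a => iteratedFDeriv ℝ n (fun x => F (x, a)) x) =ᶠ[𝓝 a] fun a =>
      ContinuousMultilinearMap.compContinuousLinearMapL (𝕜 := ℝ) (F := ℂ)
        (fun _ : Fin n => ContinuousLinearMap.inl ℝ E B) (iteratedFDeriv ℝ n F (x, a)) := by
    have h1 : ∀ᶠ a' in 𝓝 a, ContDiffAt ℝ n F (x, a') :=
      (Continuous.prodMk_right x).continuousAt.eventually (hF.eventually (by simp))
    filter_upwards [h1] with a' ha'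
    have := iteratedFDeriv_comp_affine (f := F) (ContinuousLinearMap.inl ℝ E B) ((0 : E), a')
      (x := x) (n := n) (by simpa using ha')
    simpa using this
  refine ContinuousAt.congr_of_eventuallyEq ?_ hev
  have h2 : ContinuousAt (iteratedFDeriv ℝ n F) (x, a) := hF.continuousAt_iteratedFDeriv le_rfl
  exact (ContinuousLinearMap.continuous _).continuousAt.comp
    (ContinuousAt.comp (f := fun a => (x, a)) h2 (Continuous.prodMk_right x).continuousAt)

end ParametricIntegral

end

section

/-! ### Products of first order constant coefficient operators along a fixed direction -/

section ShiftDeriv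

variable {E E' : Type*} [NormedAddCommGroup E] [NormedSpace ℝ E] [NormedAddCommGroup E']
  [NormedSpace ℝ E']

/-- The operator `∂_v - z`. -/
def shiftDeriv (v : E) (z : ℂ) (U : E → ℂ) : E → ℂ := fun q => lineDeriv ℝ U q v - z * U q

/-- The product of the operators `∂_v - z` for `z` in a list. -/
def shiftDerivs (v : E) : List ℂ → (E → ℂ) → E → ℂ
  | [], U => U
  | z :: L, U => shiftDeriv v z (shiftDerivs v L U)

theorem shiftDerivs_append (v : E) (L L' : List ℂ) (U : E → ℂ) :
    shiftDerivs v (L ++ L') U = shiftDerivs v L (shiftDerivs v L' U) := by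
  induction L with
  | nil => rfl
  | cons z L ih => simp [shiftDerivs, ih]

theorem shiftDeriv_comp_affine (A : E' →L[ℝ] E) (c : E) (v : E') (z : ℂ) (U : E → ℂ) :
    shiftDeriv v z (fun q => U (A q + c)) = fun q => shiftDeriv (A v) z U (A q + c) := by
  ext q
  simp only [shiftDeriv, lineDeriv]
  congr 3
  ext t
  congr 1
  simp
  abel

theorem shiftDerivs_comp_affine (A : E' →L[ℝ] E) (c : E) (v : E') (L : List ℂ) (U : E → ℂ) :
    shiftDerivs v L (fun q => U (A q + c)) = fun q => shiftDerivs (A v) L U (A q + c) := by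
  induction L with
  | nil => rfl
  | cons z L ih => simp only [shiftDerivs, ih]; exact shiftDeriv_comp_affine A c v z _

theorem shiftDerivs_comp_linear (A : E' →L[ℝ] E) (v : E') (L : List ℂ) (U : E → ℂ) :
    shiftDerivs v L (fun q => U (A q)) = fun q => shiftDerivs (A v) L U (A q) := by
  simpa using shiftDerivs_comp_affine A 0 v L U

variable {l : Filter E} {μ : E → ℝ} {U V : E → ℂ}

theorem SymbolBound.shiftDeriv (hU : SymbolBound l μ U) (v : E) (z : ℂ) :
    SymbolBound l μ (shiftDeriv v z U) :=
  (hU.lineDeriv v).sub (hU.const_mul z)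

theorem SymbolBound.shiftDerivs (hU : SymbolBound l μ U) (v : E) (L : List ℂ) :
    SymbolBound l μ (shiftDerivs v L U) := by
  induction L with
  | nil => exact hU
  | cons z L ih => exact ih.shiftDeriv v z

theorem contDiffAt_shiftDeriv {q : E} (v : E) (z : ℂ) (hU : ContDiffAt ℝ ∞ U q) :
    ContDiffAt ℝ ∞ (shiftDeriv v z U) q :=
  ((contDiffAt_lineDeriv v hU).congr_of_eventuallyEq (lineDeriv_eventuallyEq v hU)).sub
    (contDiffAt_const.mul hU)

theorem contDiffAt_shiftDerivs {q : E} (v : E) (L : List ℂ) (hU : ContDiffAt ℝ ∞ U q) :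
    ContDiffAt ℝ ∞ (shiftDerivs v L U) q := by
  induction L with
  | nil => exact hU
  | cons z L ih => exact contDiffAt_shiftDeriv v z ih

theorem shiftDeriv_congr {q : E} (v : E) (z : ℂ) (h : U =ᶠ[𝓝 q] V) :
    shiftDeriv v z U =ᶠ[𝓝 q] shiftDeriv v z V := by
  filter_upwards [h.eventuallyEq_nhds] with y hy
  simp only [shiftDeriv, hy.lineDeriv_eq, hy.eq_of_nhds]

theorem shiftDerivs_congr {q : E} (v : E) (L : List ℂ) (h : U =ᶠ[𝓝 q] V) :
    shiftDerivs v L U =ᶠ[𝓝 q] shiftDerivs v L V := by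
  induction L with
  | nil => exact h
  | cons z L ih => exact shiftDeriv_congr v z ih

theorem eventually_shiftDerivs_congr (hl : IsOpenFilter l) (v : E) (L : List ℂ)
    (h : ∀ᶠ q in l, U q = V q) : ∀ᶠ q in l, shiftDerivs v L U q = shiftDerivs v L V q := by
  filter_upwards [hl _ h] with q hq
  exact (shiftDerivs_congr v L hq).eq_of_nhds

theorem shiftDeriv_add {q : E} (v : E) (z : ℂ) (hU : ContDiffAt ℝ ∞ U q)
    (hV : ContDiffAt ℝ ∞ V q) : shiftDeriv v z (fun q => U q + V q) =ᶠ[𝓝 q]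
      fun q => shiftDeriv v z U q + shiftDeriv v z V q := by
  filter_upwards [lineDeriv_eventuallyEq v hU, lineDeriv_eventuallyEq v hV,
    lineDeriv_eventuallyEq v (hU.add hV),
    (hU.of_le (m := 1) (by simp)).eventually (by simp),
    (hV.of_le (m := 1) (by simp)).eventually (by simp)] with y h1 h2 h3 h4 h5
  have h6 := fderiv_add (h4.differentiableAt (by simp)) (h5.differentiableAt (by simp))
  change fderiv ℝ (fun q => U q + V q) y = _ at h6
  simp only [shiftDeriv]
  rw [h3, h6, h1, h2]
  simp
  ring

theorem shiftDerivs_add {q : E} (v : E) (L : List ℂ) (hU : ContDiffAt ℝ ∞ U q)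
    (hV : ContDiffAt ℝ ∞ V q) : shiftDerivs v L (fun q => U q + V q) =ᶠ[𝓝 q]
      fun q => shiftDerivs v L U q + shiftDerivs v L V q := by
  induction L with
  | nil => rfl
  | cons z L ih =>
    exact (shiftDeriv_congr v z ih).trans
      (shiftDeriv_add v z (contDiffAt_shiftDerivs v L hU) (contDiffAt_shiftDerivs v L hV))

theorem shiftDerivs_zero (v : E) (L : List ℂ) : shiftDerivs v L (fun _ => 0) = fun _ => 0 := by
  induction L with
  | nil => rfl
  | cons z L ih =>
    simp only [shiftDerivs, ih]
    ext q
    simp [shiftDeriv, lineDeriv]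

theorem shiftDerivs_sum {ι : Type*} (s : Finset ι) {W : ι → E → ℂ} {q : E} (v : E) (L : List ℂ)
    (hW : ∀ i ∈ s, ContDiffAt ℝ ∞ (W i) q) : shiftDerivs v L (fun q => ∑ i ∈ s, W i q) =ᶠ[𝓝 q]
      fun q => ∑ i ∈ s, shiftDerivs v L (W i) q := by
  classical
  induction s using Finset.induction_on with
  | empty => simp only [Finset.sum_empty, shiftDerivs_zero]; rfl
  | insert i s hi ih =>
    simp only [Finset.sum_insert hi]
    have h1 := hW i (by simp)
    have h2 : ∀ j ∈ s, ContDiffAt ℝ ∞ (W j) q := fun j hj => hW j (by simp [hj])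
    refine (shiftDerivs_add v L h1 (ContDiffAt.sum h2)).trans ?_
    filter_upwards [ih h2] with y hy
    rw [hy]

/-- Symmetry of the second derivative. It is stated near `q` rather than at `q`, so that it can be
differentiated again. -/
theorem shiftDeriv_comm {q : E} (v w : E) (z z' : ℂ) (hU : ContDiffAt ℝ ∞ U q) :
    shiftDeriv v z (shiftDeriv w z' U) =ᶠ[𝓝 q] shiftDeriv w z' (shiftDeriv v z U) := by
  have key : ∀ (v w : E) (z z' : ℂ), ∀ y, ContDiffAt ℝ 2 U y →
      shiftDeriv v z (shiftDeriv w z' U) y = fderiv ℝ (fderiv ℝ U) y v w - z' * fderiv ℝ U y v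
        - z * (fderiv ℝ U y w - z' * U y) := by
    intro v w z z' y hy
    have hy1 : ContDiffAt ℝ 1 U y := hy.of_le (by norm_num)
    have e1 : shiftDeriv w z' U =ᶠ[𝓝 y] fun y => fderiv ℝ U y w - z' * U y := by
      filter_upwards [hy1.eventually (by simp)] with x hx
      simp only [shiftDeriv, (hx.differentiableAt (by simp)).lineDeriv_eq_fderiv]
    have d1 : DifferentiableAt ℝ (fderiv ℝ U) y :=
      (hy.fderiv_right (m := 1) (by norm_num)).differentiableAt (by simp)
    have d2 : DifferentiableAt ℝ U y := hy1.differentiableAt (by simp)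
    have h3 : HasFDerivAt (fun y => fderiv ℝ U y w - z' * U y)
        ((fderiv ℝ (fderiv ℝ U) y).flip w - z' • fderiv ℝ U y) y := by
      refine HasFDerivAt.sub ?_ (d2.hasFDerivAt.const_mul z')
      simpa using d1.hasFDerivAt.clm_apply (hasFDerivAt_const w y)
    rw [shiftDeriv, e1.lineDeriv_eq, e1.eq_of_nhds, (h3.hasLineDerivAt v).lineDeriv]
    simp
  have h2 : ContDiffAt ℝ 2 U q := hU.of_le (by norm_cast)
  filter_upwards [h2.eventually (by simp)] with y hy
  rw [key v w z z' y hy, key w v z' z y hy]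
  have := (hy.isSymmSndFDerivAt (by simp)).eq v w
  rw [this]
  ring

theorem shiftDeriv_shiftDerivs_comm {q : E} (v w : E) (z : ℂ) (L : List ℂ)
    (hU : ContDiffAt ℝ ∞ U q) :
    shiftDeriv v z (shiftDerivs w L U) =ᶠ[𝓝 q] shiftDerivs w L (shiftDeriv v z U) := by
  induction L with
  | nil => rfl
  | cons z' L ih =>
    exact (shiftDeriv_comm v w z z' (contDiffAt_shiftDerivs w L hU)).trans
      (shiftDeriv_congr w z' ih)

theorem shiftDerivs_comm {q : E} (v w : E) (L L' : List ℂ) (hU : ContDiffAt ℝ ∞ U q) :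
    shiftDerivs v L (shiftDerivs w L' U) =ᶠ[𝓝 q] shiftDerivs w L' (shiftDerivs v L U) := by
  induction L with
  | nil => rfl
  | cons z L ih =>
    exact (shiftDeriv_congr v z ih).trans
      (shiftDeriv_shiftDerivs_comm v w z L' (contDiffAt_shiftDerivs v L hU))

theorem shiftDerivs_perm {q : E} (v : E) {L L' : List ℂ} (h : L.Perm L')
    (hU : ContDiffAt ℝ ∞ U q) : shiftDerivs v L U =ᶠ[𝓝 q] shiftDerivs v L' U := by
  induction h with
  | nil => rfl
  | cons z _ ih => exact shiftDeriv_congr v z ih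
  | swap z z' L => exact shiftDeriv_comm v v z' z (contDiffAt_shiftDerivs v L hU)
  | trans _ _ ih1 ih2 => exact ih1.trans ih2

/-- Bounds for `∏ (∂_v - z) U` over a list persist if further factors are included. -/
theorem SymbolBound.shiftDerivs_of_subperm (hl : IsOpenFilter l) {ν : E → ℝ} {v : E}
    {L L' : List ℂ} (h : L.Subperm L') (hU : ∀ᶠ q in l, ContDiffAt ℝ ∞ U q)
    (hL : SymbolBound l ν (ZeroCalculus.shiftDerivs v L U)) :
    SymbolBound l ν (ZeroCalculus.shiftDerivs v L' U) := by
  obtain ⟨M, hM⟩ : ∃ M : List ℂ, (M ++ L).Perm L' := by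
    classical
    exact ⟨L'.diff L, (List.perm_append_comm).trans (List.subperm_append_diff_self_of_count_le
      (List.subperm_ext_iff.1 h))⟩
  refine (hL.shiftDerivs v M).congr hl ?_
  filter_upwards [hU] with q hq
  rw [← shiftDerivs_append]
  exact (shiftDerivs_perm v hM hq).eq_of_nhds

end ShiftDeriv

end

section

/-! ### Conormality in logarithmic coordinates -/

section Logarithmic

variable {F : Type*} [NormedAddCommGroup F] [NormedSpace ℝ F] {k : ℕ}

/-- The exponential in the coordinates normal to the boundary. -/
def expMap (p : (Fin k → ℝ) × F) : (Fin k → ℝ) × F := (fun i => Real.exp (p.1 i), p.2)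

theorem continuous_expMap : Continuous (expMap : (Fin k → ℝ) × F → (Fin k → ℝ) × F) := by
  unfold expMap
  fun_prop

theorem contDiff_expMap : ContDiff ℝ ∞ (expMap : (Fin k → ℝ) × F → (Fin k → ℝ) × F) :=
  ContDiff.prodMk (contDiff_pi.2 fun i => Real.contDiff_exp.comp
    ((contDiff_apply ℝ ℝ i).comp contDiff_fst)) contDiff_snd

/-- The preimage of `interiorNhds` in logarithmic coordinates. -/
def logNhds (D : Set F) (x₀ : Fin k → ℝ) (y₀ : F) : Filter ((Fin k → ℝ) × F) :=
  comap expMap (interiorNhds D x₀ y₀)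

theorem map_expMap_logNhds (D : Set F) (x₀ : Fin k → ℝ) (y₀ : F) :
    map expMap (logNhds D x₀ y₀) = interiorNhds D x₀ y₀ := by
  refine map_comap_of_mem (mem_of_superset self_mem_nhdsWithin ?_)
  rintro ⟨x, y⟩ ⟨hx, -⟩
  exact ⟨(fun i => Real.log (x i), y), by simp [expMap, Real.exp_log (hx _)]⟩

theorem eventually_interiorNhds_iff {D : Set F} {x₀ : Fin k → ℝ} {y₀ : F}
    {P : (Fin k → ℝ) × F → Prop} :
    (∀ᶠ q in interiorNhds D x₀ y₀, P q) ↔ ∀ᶠ p in logNhds D x₀ y₀, P (expMap p) := by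
  rw [← map_expMap_logNhds, eventually_map]

theorem eventually_logNhds_of_nhds {D : Set F} {x₀ : Fin k → ℝ} {y₀ : F}
    {P : (Fin k → ℝ) × F → Prop} (h : ∀ᶠ q in 𝓝 (x₀, y₀), P q) :
    ∀ᶠ p in logNhds D x₀ y₀, P (expMap p) :=
  eventually_interiorNhds_iff.1 (h.filter_mono nhdsWithin_le_nhds)

theorem isOpenFilter_logNhds {D : Set F} (hD : IsOpen D) (x₀ : Fin k → ℝ) (y₀ : F) :
    IsOpenFilter (logNhds D x₀ y₀) := by
  intro P hP
  obtain ⟨t, ht, htP⟩ := mem_comap.1 hP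
  obtain ⟨o, ho, hxo, hot⟩ := mem_nhdsWithin.1 ht
  have hS : IsOpen {q : (Fin k → ℝ) × F | (∀ i, 0 < q.1 i) ∧ q.2 ∈ D} := by
    have he : {q : (Fin k → ℝ) × F | (∀ i, 0 < q.1 i) ∧ q.2 ∈ D} =
        (⋂ i, {q : (Fin k → ℝ) × F | 0 < q.1 i}) ∩ Prod.snd ⁻¹' D := by
      ext
      simp
    rw [he]
    exact (isOpen_iInter_of_finite fun i => isOpen_lt continuous_const
      (by fun_prop)).inter (hD.preimage continuous_snd)
  refine mem_comap.2 ⟨_, inter_mem_nhdsWithin _ (ho.mem_nhds hxo), fun p hp => ?_⟩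
  have := ((hS.inter ho).preimage continuous_expMap).mem_nhds hp
  exact mem_of_superset this fun p' hp' => htP (hot ⟨hp'.2, hp'.1⟩)

theorem eventually_logNhds_univ_iff {x₀ : Fin k → ℝ} {y₀ : F} {P : (Fin k → ℝ) × F → Prop} :
    (∀ᶠ p in logNhds univ x₀ y₀, P p) ↔ ∃ ε > 0, ∀ p : (Fin k → ℝ) × F,
      (∀ i, |Real.exp (p.1 i) - x₀ i| < ε) → ‖p.2 - y₀‖ < ε → P p := by
  constructor
  · intro h
    obtain ⟨t, ht, htP⟩ := mem_comap.1 h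
    obtain ⟨o, ho, hxo, hot⟩ := mem_nhdsWithin.1 ht
    obtain ⟨ε, hε, hb⟩ := Metric.isOpen_iff.1 ho _ hxo
    refine ⟨ε, hε, fun p h1 h2 => htP (hot ⟨hb ?_, fun i => Real.exp_pos _, mem_univ _⟩)⟩
    rw [Metric.mem_ball, Prod.dist_eq, max_lt_iff, dist_pi_lt_iff hε]
    exact ⟨h1, by simpa [dist_eq_norm, expMap] using h2⟩
  · rintro ⟨ε, hε, h⟩
    have : ∀ᶠ q in 𝓝 (x₀, y₀), (∀ i, |q.1 i - x₀ i| < ε) ∧ ‖q.2 - y₀‖ < ε := by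
      filter_upwards [Metric.ball_mem_nhds (x₀, y₀) hε] with q hq
      rw [Metric.mem_ball, Prod.dist_eq, max_lt_iff, dist_pi_lt_iff hε] at hq
      exact ⟨hq.1, by simpa [dist_eq_norm] using hq.2⟩
    filter_upwards [eventually_logNhds_of_nhds (D := univ) this] with p hp
    exact h p hp.1 (by simpa [expMap] using hp.2)

theorem eventually_logNhds_le (D : Set F) (x₀ : Fin k → ℝ) (y₀ : F) (i : Fin k) :
    ∀ᶠ p in logNhds D x₀ y₀, p.1 i ≤ |x₀ i| := by
  have : ∀ᶠ q in 𝓝 (x₀, y₀), q.1 i < |x₀ i| + 1 := by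
    have hc : ContinuousAt (fun q : (Fin k → ℝ) × F => q.1 i) (x₀, y₀) := by fun_prop
    exact hc.eventually (gt_mem_nhds (by dsimp; linarith [le_abs_self (x₀ i)]))
  filter_upwards [eventually_logNhds_of_nhds (D := D) this] with p hp
  have h1 := Real.add_one_le_exp (p.1 i)
  simp only [expMap] at hp
  linarith

theorem eventually_logNhds_ge (D : Set F) (x₀ : Fin k → ℝ) (y₀ : F) {i : Fin k} (hi : 0 < x₀ i) :
    ∀ᶠ p in logNhds D x₀ y₀, Real.log (x₀ i / 2) ≤ p.1 i := by
  have : ∀ᶠ q in 𝓝 (x₀, y₀), x₀ i / 2 < q.1 i := by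
    have hc : ContinuousAt (fun q : (Fin k → ℝ) × F => q.1 i) (x₀, y₀) := by fun_prop
    exact hc.eventually (lt_mem_nhds (by dsimp; linarith))
  filter_upwards [eventually_logNhds_of_nhds (D := D) this] with p hp
  rw [Real.log_le_iff_le_exp (by positivity)]
  exact hp.le

/-- The logarithm of the weight `∏ x i ^ β i`. -/
def weight (β : Fin k → ℝ) : (Fin k → ℝ) × F → ℝ := fun p => ∑ i, β i * p.1 i

/-- Near a point of `x i = 0` the coordinate `log (x i)` is bounded above only, so the weight there
can only be lowered. If `x₀ i > 0`, it is bounded on both sides and the weight is irrelevant. -/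
theorem exists_weight_le (D : Set F) {x₀ : Fin k → ℝ} (y₀ : F) (hx₀ : ∀ i, 0 ≤ x₀ i)
    {α β : Fin k → ℝ} (h : ∀ i, x₀ i = 0 → β i ≤ α i) :
    ∃ c, ∀ᶠ p in logNhds D x₀ y₀, weight α p ≤ weight β p + c := by
  have : ∀ i, ∃ c, ∀ᶠ p in logNhds D x₀ y₀, (α i - β i) * p.1 i ≤ c := by
    intro i
    rcases (hx₀ i).eq_or_lt with h0 | h0
    · refine ⟨(α i - β i) * |x₀ i|, (eventually_logNhds_le D x₀ y₀ i).mono fun p hp => ?_⟩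
      have := h i h0.symm
      exact mul_le_mul_of_nonneg_left hp (by linarith)
    · refine ⟨|α i - β i| * (|x₀ i| + |Real.log (x₀ i / 2)|), ?_⟩
      filter_upwards [eventually_logNhds_le D x₀ y₀ i, eventually_logNhds_ge D x₀ y₀ h0]
        with p h1 h2
      have h3 : |p.1 i| ≤ |x₀ i| + |Real.log (x₀ i / 2)| := by
        rw [abs_le]
        constructor
        · linarith [abs_nonneg (x₀ i), neg_abs_le (Real.log (x₀ i / 2))]
        · linarith [abs_nonneg (Real.log (x₀ i / 2))]
      calc _ ≤ |(α i - β i) * p.1 i| := le_abs_self _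
        _ ≤ _ := by rw [abs_mul]; gcongr
  choose c hc using this
  refine ⟨∑ i, c i, (eventually_all.2 hc).mono fun p hp => ?_⟩
  simp only [weight]
  rw [← sub_le_iff_le_add', ← Finset.sum_sub_distrib]
  refine Finset.sum_le_sum fun i _ => ?_
  linarith [hp i]

/-- The function `u` in logarithmic coordinates. -/
def logPullback (u : (Fin k → ℝ) → F → ℂ) : (Fin k → ℝ) × F → ℂ :=
  fun p => u (fun i => Real.exp (p.1 i)) p.2

theorem contDiffAt_logPullback_iff {u : (Fin k → ℝ) → F → ℂ} {p : (Fin k → ℝ) × F} :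
    ContDiffAt ℝ ∞ (logPullback u) p ↔
      ContDiffAt ℝ ∞ (fun q : (Fin k → ℝ) × F => u q.1 q.2) (expMap p) := by
  constructor
  · intro h
    have hlog : ContDiffAt ℝ ∞ (fun q : (Fin k → ℝ) × F => ((fun i => Real.log (q.1 i), q.2) :
        (Fin k → ℝ) × F)) (expMap p) := by
      refine ContDiffAt.prodMk (contDiffAt_pi.2 fun i => ?_) contDiffAt_snd
      refine ContDiffAt.log ?_ (Real.exp_pos (p.1 i)).ne'
      exact (contDiff_apply ℝ ℝ i).contDiffAt.comp _ contDiffAt_fst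
    have h' : ContDiffAt ℝ ∞ (logPullback u)
        ((fun i => Real.log ((expMap p).1 i), (expMap p).2) : (Fin k → ℝ) × F) := by
      simpa [expMap] using h
    refine (ContDiffAt.comp (expMap p) (f := fun q : (Fin k → ℝ) × F =>
      ((fun i => Real.log (q.1 i), q.2) : (Fin k → ℝ) × F)) h' hlog).congr_of_eventuallyEq ?_
    have hpos : ∀ᶠ q in 𝓝 (expMap p), ∀ i, 0 < q.1 i := by
      refine eventually_all.2 fun i => ?_
      have hc : ContinuousAt (fun q : (Fin k → ℝ) × F => q.1 i) (expMap p) := by fun_prop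
      exact hc.eventually (lt_mem_nhds (Real.exp_pos _))
    filter_upwards [hpos] with q hq
    simp [logPullback, Real.exp_log (hq _)]
  · intro h
    exact ContDiffAt.comp p (f := expMap) h contDiff_expMap.contDiffAt

/-- Smoothness and weights are transported by the logarithm, which is a diffeomorphism of the
interior. From here on estimates are made in logarithmic coordinates. -/
theorem isConormalAt_iff {α : Fin k → WithTop ℝ} {D : Set F} {u : (Fin k → ℝ) → F → ℂ}
    {x₀ : Fin k → ℝ} {y₀ : F} : IsConormalAt α D u x₀ y₀ ↔
      ∀ β : Fin k → ℝ, (∀ i, (β i : WithTop ℝ) ≤ α i) →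
        SymbolBound (logNhds D x₀ y₀) (weight β) (logPullback u) := by
  have hw : ∀ (β : Fin k → ℝ) (p : (Fin k → ℝ) × F),
      ∏ i, (expMap p).1 i ^ β i = Real.exp (weight β p) := by
    intro β p
    rw [weight, Real.exp_sum]
    refine Finset.prod_congr rfl fun i _ => ?_
    rw [expMap, ← Real.exp_mul, mul_comm]
  have hsm : (∀ᶠ q in interiorNhds D x₀ y₀,
      ContDiffAt ℝ ∞ (fun p : (Fin k → ℝ) × F => u p.1 p.2) q) ↔
      ∀ᶠ p in logNhds D x₀ y₀, ContDiffAt ℝ ∞ (logPullback u) p := by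
    rw [eventually_interiorNhds_iff]
    simp only [contDiffAt_logPullback_iff]
  have hlog : ∀ p : (Fin k → ℝ) × F, ((fun i => Real.log ((expMap p).1 i), (expMap p).2) :
      (Fin k → ℝ) × F) = p := fun p => by simp [expMap]
  unfold IsConormalAt
  rw [hsm]
  constructor
  · rintro ⟨h1, h2⟩ β hβ
    refine ⟨h1, fun m => ?_⟩
    obtain ⟨C, hC⟩ := h2 m β hβ
    refine ⟨C, ?_⟩
    rw [eventually_interiorNhds_iff] at hC
    filter_upwards [hC] with p hp
    rw [hw, hlog] at hp
    exact hp
  · intro h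
    -- Smoothness is read off from the bound for one admissible real weight, so one must exist; for
    -- an infinite weight any value, here `0`, will do.
    have hex : ∃ β : Fin k → ℝ, ∀ i, (β i : WithTop ℝ) ≤ α i := by
      refine ⟨fun i => (α i).untopD 0, fun i => ?_⟩
      dsimp only
      induction α i using WithTop.recTopCoe <;> simp
    obtain ⟨β₀, hβ₀⟩ := hex
    refine ⟨(h β₀ hβ₀).smooth, fun m β hβ => ?_⟩
    obtain ⟨C, hC⟩ := (h β hβ).bound m
    refine ⟨C, ?_⟩
    rw [eventually_interiorNhds_iff]
    filter_upwards [hC] with p hp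
    rw [hw, hlog]
    exact hp

theorem SymbolBound.mono_weight {D : Set F} {x₀ : Fin k → ℝ} {y₀ : F} (hx₀ : ∀ i, 0 ≤ x₀ i)
    {α β : Fin k → ℝ} (h : ∀ i, x₀ i = 0 → β i ≤ α i) {U : (Fin k → ℝ) × F → ℂ}
    (hU : SymbolBound (logNhds D x₀ y₀) (weight α) U) :
    SymbolBound (logNhds D x₀ y₀) (weight β) U := by
  obtain ⟨c, hc⟩ := exists_weight_le D y₀ hx₀ h
  exact hU.mono c hc

theorem isConormalAt_coe_iff {α : Fin k → ℝ} {D : Set F} {u : (Fin k → ℝ) → F → ℂ}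
    {x₀ : Fin k → ℝ} (hx₀ : ∀ i, 0 ≤ x₀ i) {y₀ : F} :
    IsConormalAt (fun i => (α i : WithTop ℝ)) D u x₀ y₀ ↔
      SymbolBound (logNhds D x₀ y₀) (weight α) (logPullback u) := by
  rw [isConormalAt_iff]
  refine ⟨fun h => h α fun i => le_rfl, fun h β hβ => h.mono_weight hx₀ fun i _ => ?_⟩
  exact_mod_cast hβ i

/-- The `i`-th normal coordinate. -/
def coordL (i : Fin k) : (Fin k → ℝ) × F →L[ℝ] ℝ :=
  (ContinuousLinearMap.proj (R := ℝ) (φ := fun _ : Fin k => ℝ) i).comp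
    (ContinuousLinearMap.fst ℝ (Fin k → ℝ) F)

@[simp] theorem coordL_apply (i : Fin k) (p : (Fin k → ℝ) × F) : coordL i p = p.1 i := rfl

/-- The inclusion of the `i`-th normal coordinate axis. -/
def axisL (i : Fin k) : ℝ →L[ℝ] (Fin k → ℝ) × F :=
  (ContinuousLinearMap.inl ℝ (Fin k → ℝ) F).comp
    (ContinuousLinearMap.single ℝ (fun _ : Fin k => ℝ) i)

@[simp] theorem axisL_apply (i : Fin k) (t : ℝ) :
    (axisL i t : (Fin k → ℝ) × F) = (Pi.single i t, 0) := rfl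

theorem norm_coordL_le (i : Fin k) : ‖(coordL i : (Fin k → ℝ) × F →L[ℝ] ℝ)‖ ≤ 1 :=
  ContinuousLinearMap.opNorm_le_bound _ zero_le_one fun q => by
    rw [one_mul]
    exact (norm_le_pi_norm q.1 i).trans (norm_fst_le q)

theorem norm_axisL_le (i : Fin k) : ‖(axisL i : ℝ →L[ℝ] (Fin k → ℝ) × F)‖ ≤ 1 :=
  ContinuousLinearMap.opNorm_le_bound _ zero_le_one fun t => by
    rw [axisL_apply, Prod.norm_def]
    simp [Pi.norm_single]

/-- Every derivative of the exponential is the exponential, and this is bounded where the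
logarithmic coordinates are bounded above. It is the input for the chain rule estimate in
`SymbolBound.of_contDiffAt`. -/
theorem norm_iteratedFDeriv_expMap_le (m : ℕ) {M : ℝ} {p : (Fin k → ℝ) × F}
    (hp : ∀ i, p.1 i ≤ M) :
    ‖iteratedFDeriv ℝ (m + 1) (expMap : (Fin k → ℝ) × F → (Fin k → ℝ) × F) p‖ ≤
      k * Real.exp M + 1 := by
  let S : (Fin k → ℝ) × F →L[ℝ] (Fin k → ℝ) × F :=
    (ContinuousLinearMap.inr ℝ (Fin k → ℝ) F).comp (ContinuousLinearMap.snd ℝ (Fin k → ℝ) F)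
  have hS : ‖S‖ ≤ 1 := ContinuousLinearMap.opNorm_le_bound _ zero_le_one fun q => by
    rw [one_mul]
    change ‖((0 : Fin k → ℝ), q.2)‖ ≤ ‖q‖
    rw [Prod.norm_def]
    simpa using norm_snd_le q
  have hexp : (expMap : (Fin k → ℝ) × F → (Fin k → ℝ) × F) =
      fun p => (∑ i, (axisL i (Real.exp (coordL i p)) : (Fin k → ℝ) × F)) + S p := by
    ext1 p
    refine Prod.ext ?_ ?_
    · ext j
      simp [expMap, S, Prod.fst_sum, Finset.sum_apply, Pi.single_apply]
    · simp [expMap, S, Prod.snd_sum]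
  have hsm : ∀ i, ContDiff ℝ ∞ (fun p : (Fin k → ℝ) × F => Real.exp (coordL i p)) := fun i =>
    Real.contDiff_exp.comp
      (coordL i : (Fin k → ℝ) × F →L[ℝ] ℝ).contDiff
  have hsm' : ∀ i, ContDiff ℝ ∞ (fun p : (Fin k → ℝ) × F => (axisL i (Real.exp (coordL i p)) : (Fin k → ℝ) × F)) := fun i =>
    (axisL i : ℝ →L[ℝ] (Fin k → ℝ) × F).contDiff.comp (hsm i)
  have hle : ((m + 1 : ℕ) : ℕ∞ω) ≤ ∞ := by exact_mod_cast le_top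
  have h1 : ∀ i, ‖iteratedFDeriv ℝ (m + 1) (fun p : (Fin k → ℝ) × F => (axisL i (Real.exp (coordL i p)) : (Fin k → ℝ) × F)) p‖ ≤
      Real.exp M := by
    intro i
    refine ((axisL i : ℝ →L[ℝ] (Fin k → ℝ) × F).norm_iteratedFDeriv_comp_left (hsm i).contDiffAt hle).trans ?_
    have h2 := norm_iteratedFDeriv_comp_affine_le (f := Real.exp) (coordL i) 0 (x := p) (n := m + 1)
      (Real.contDiff_exp.contDiffAt)
    simp only [add_zero] at h2
    have h3 : ‖iteratedFDeriv ℝ (m + 1) Real.exp (coordL i p)‖ = Real.exp (p.1 i) := by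
      rw [norm_iteratedFDeriv_eq_norm_iteratedDeriv, iteratedDeriv_eq_iterate, Real.iter_deriv_exp,
        Real.norm_eq_abs, abs_of_pos (Real.exp_pos _)]
      rfl
    rw [h3] at h2
    calc _ ≤ 1 * (Real.exp (p.1 i) * 1) := by
          refine mul_le_mul (norm_axisL_le i) (h2.trans ?_) (norm_nonneg _) zero_le_one
          gcongr
          exact pow_le_one₀ (norm_nonneg _) (norm_coordL_le i)
      _ ≤ _ := by simpa using hp i
  have h4 : ‖iteratedFDeriv ℝ (m + 1) S p‖ ≤ 1 := by
    rw [← norm_iteratedFDeriv_fderiv]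
    have : fderiv ℝ S = fun _ => S := by ext1 q; exact S.fderiv
    rw [this]
    rcases m with _ | m
    · simpa using hS
    · rw [iteratedFDeriv_succ_const]; simp
  rw [hexp]
  have h5 := iteratedFDeriv_add_apply (𝕜 := ℝ) (i := m + 1)
    (f := fun p : (Fin k → ℝ) × F => ∑ i, (axisL i (Real.exp (coordL i p)) : (Fin k → ℝ) × F)) (g := S) (x := p)
    ((ContDiff.sum fun i _ => hsm' i).contDiffAt.of_le hle) (S.contDiff.contDiffAt)
  change iteratedFDeriv ℝ (m + 1) (fun p : (Fin k → ℝ) × F => ∑ i, (axisL i (Real.exp (coordL i p)) : (Fin k → ℝ) × F) + S p) p = _ at h5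
  have h6 := iteratedFDeriv_fun_sum_apply (𝕜 := ℝ) (n := m + 1) (u := Finset.univ) (x := p)
    (f := fun i (p : (Fin k → ℝ) × F) =>
      (axisL i (Real.exp (coordL i p)) : (Fin k → ℝ) × F))
    (fun i _ => (hsm' i).contDiffAt.of_le hle)
  rw [h5]
  refine (norm_add_le _ _).trans (add_le_add ?_ h4)
  rw [h6]
  refine (norm_sum_le _ _).trans ((Finset.sum_le_sum fun i _ => h1 i).trans ?_)
  simp

/-- A function that is smooth up to the boundary is conormal of weight `0`. -/
theorem SymbolBound.of_contDiffAt {D : Set F} {x₀ : Fin k → ℝ} {y₀ : F}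
    {G : (Fin k → ℝ) × F → ℂ} (hG : ∀ᶠ q in 𝓝 (x₀, y₀), ContDiffAt ℝ ∞ G q) :
    SymbolBound (logNhds D x₀ y₀) (fun _ => 0) (fun p => G (expMap p)) := by
  refine ⟨?_, fun m => ?_⟩
  · filter_upwards [eventually_logNhds_of_nhds (D := D) hG] with p hp
    exact hp.comp p contDiff_expMap.contDiffAt
  · have hle : ∀ i : ℕ, (i : ℕ∞ω) ≤ ∞ := fun i => by exact_mod_cast le_top
    have hx := hG.self_of_nhds
    have hb : ∀ᶠ q in 𝓝 (x₀, y₀), ∀ i ∈ Finset.range (m + 1),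
        ‖iteratedFDeriv ℝ i G q‖ ≤ ‖iteratedFDeriv ℝ i G (x₀, y₀)‖ + 1 :=
      (Finset.eventually_all _).2 fun i _ =>
        ((hx.continuousAt_iteratedFDeriv (hle i)).norm.eventually
          (gt_mem_nhds (lt_add_one _))).mono fun _ h => h.le
    set B := ∑ i ∈ Finset.range (m + 1), (‖iteratedFDeriv ℝ i G (x₀, y₀)‖ + 1)
    set M := ∑ i, |x₀ i|
    -- The constant of the Faà di Bruno estimate: `B` bounds the derivatives of `G` up to order `m`
    -- near the base point, and the last factor those of `expMap`.
    refine ⟨m.factorial * B * (k * Real.exp M + 1) ^ m, ?_⟩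
    filter_upwards [eventually_logNhds_of_nhds (D := D) hG,
      eventually_logNhds_of_nhds (D := D) hb,
      eventually_all.2 fun i => eventually_logNhds_le D x₀ y₀ i] with p h1 h2 h3
    have hM : ∀ i, p.1 i ≤ M := fun i => (h3 i).trans
      (Finset.single_le_sum (f := fun i => |x₀ i|) (fun j _ => abs_nonneg _) (Finset.mem_univ i))
    obtain ⟨s, hs, hps, hGs⟩ := exists_isOpen_contDiffOn (h1.of_le (hle m))
    have hs' : IsOpen (expMap ⁻¹' s) := hs.preimage continuous_expMap
    have key := norm_iteratedFDerivWithin_comp_le (𝕜 := ℝ) (g := G) (f := expMap) (n := m)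
      (s := expMap ⁻¹' s) (t := s) (x := p) hGs
      (contDiff_expMap.contDiffOn.of_le (hle m)) le_rfl hs.uniqueDiffOn hs'.uniqueDiffOn
      (mapsTo_preimage _ _) hps (C := B) (D := k * Real.exp M + 1)
      (fun i hi => by
        rw [iteratedFDerivWithin_of_isOpen _ hs hps]
        refine (h2 i (Finset.mem_range.2 (by omega))).trans ?_
        exact Finset.single_le_sum (f := fun i => ‖iteratedFDeriv ℝ i G (x₀, y₀)‖ + 1)
          (fun j _ => by positivity) (Finset.mem_range.2 (by omega)))
      (fun i hi _ => by
        obtain ⟨j, rfl⟩ : ∃ j, i = j + 1 := ⟨i - 1, by omega⟩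
        rw [iteratedFDerivWithin_of_isOpen _ hs' hps]
        refine (norm_iteratedFDeriv_expMap_le j hM).trans ?_
        exact le_self_pow₀ (by
          have : 0 ≤ (k : ℝ) * Real.exp M := by positivity
          linarith) (by omega))
    rw [iteratedFDerivWithin_of_isOpen _ hs' hps] at key
    simpa [Function.comp_def] using key

end Logarithmic

end

section

/-! ### Terms of polyhomogeneous expansions and the operators annihilating them -/

section ExpPoly

variable {F : Type*} [NormedAddCommGroup F] [NormedSpace ℝ F] {k : ℕ}

/-- Forgetting the `i`-th normal coordinate. -/
def dropL (i : Fin (k + 1)) : (Fin (k + 1) → ℝ) × F →L[ℝ] (Fin k → ℝ) × F :=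
  ((ContinuousLinearMap.pi fun j => ContinuousLinearMap.proj (R := ℝ)
    (φ := fun _ : Fin (k + 1) => ℝ) (i.succAbove j)).comp
      (ContinuousLinearMap.fst ℝ (Fin (k + 1) → ℝ) F)).prod
    (ContinuousLinearMap.snd ℝ (Fin (k + 1) → ℝ) F)

@[simp] theorem dropL_apply_fst (i : Fin (k + 1)) (p : (Fin (k + 1) → ℝ) × F) (j : Fin k) :
    (dropL i p).1 j = p.1 (i.succAbove j) := rfl

@[simp] theorem dropL_apply_snd (i : Fin (k + 1)) (p : (Fin (k + 1) → ℝ) × F) :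
    (dropL i p).2 = p.2 := rfl

/-- The unit vector in the direction of the `i`-th normal coordinate. -/
def unitVec (i : Fin k) : (Fin k → ℝ) × F := axisL i 1

@[simp] theorem unitVec_fst_self (i : Fin k) : (unitVec i : (Fin k → ℝ) × F).1 i = 1 := by
  simp [unitVec]

theorem dropL_unitVec (i : Fin (k + 1)) : dropL i (unitVec i : (Fin (k + 1) → ℝ) × F) = 0 := by
  refine Prod.ext ?_ ?_
  · ext j
    simp [unitVec]
  · simp [unitVec]

theorem dropL_unitVec_succAbove (i : Fin (k + 1)) (j : Fin k) :
    dropL i (unitVec (i.succAbove j) : (Fin (k + 1) → ℝ) × F) = unitVec j := by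
  refine Prod.ext ?_ ?_
  · ext j'
    simp [unitVec, Pi.single_apply]
  · simp [unitVec]

/-- The function `x i ^ z * q (log (x i)) * c` in logarithmic coordinates. -/
def expPoly (i : Fin (k + 1)) (z : ℂ) (q : Polynomial ℂ) (c : (Fin k → ℝ) × F → ℂ) :
    (Fin (k + 1) → ℝ) × F → ℂ :=
  fun p => Complex.exp (z * (p.1 i : ℂ)) * q.eval (p.1 i : ℂ) * c (dropL i p)

theorem hasLineDerivAt_expPoly (i : Fin (k + 1)) (z : ℂ) (q : Polynomial ℂ)
    (c : (Fin k → ℝ) × F → ℂ) (p : (Fin (k + 1) → ℝ) × F) :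
    HasLineDerivAt ℝ (expPoly i z q c)
      (expPoly i z (Polynomial.C z * q + q.derivative) c p) p (unitVec i) := by
  have h1 : HasDerivAt (fun w : ℂ => Complex.exp (z * w) * q.eval w * c (dropL i p))
      (expPoly i z (Polynomial.C z * q + q.derivative) c p) ((p.1 i : ℝ) : ℂ) := by
    have h2 : HasDerivAt (fun w : ℂ => Complex.exp (z * w)) (Complex.exp (z * (p.1 i : ℂ)) * z)
        ((p.1 i : ℝ) : ℂ) := by
      have := ((hasDerivAt_id ((p.1 i : ℝ) : ℂ)).const_mul z).cexp
      rwa [mul_one] at this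
    refine ((h2.mul (q.hasDerivAt _)).mul_const (c (dropL i p))).congr_deriv ?_
    simp only [expPoly, Polynomial.eval_add, Polynomial.eval_mul, Polynomial.eval_C]
    ring
  have h3 : HasDerivAt (fun t : ℝ => p.1 i + t) 1 0 := by
    exact (hasDerivAt_id (0 : ℝ)).const_add (p.1 i)
  have h4 : HasDerivAt (fun t : ℝ => (fun w : ℂ => Complex.exp (z * w) * q.eval w *
      c (dropL i p)) ((p.1 i + t : ℝ) : ℂ)) ((1 : ℝ) •
        expPoly i z (Polynomial.C z * q + q.derivative) c p) 0 := by
    refine HasDerivAt.scomp (h := fun t : ℝ => p.1 i + t) (g₁ := fun r : ℝ =>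
      Complex.exp (z * (r : ℂ)) * q.eval (r : ℂ) * c (dropL i p)) (0 : ℝ) ?_ h3
    rw [add_zero]
    exact h1.comp_ofReal
  rw [one_smul] at h4
  refine h4.congr_of_eventuallyEq (Eventually.of_forall fun t => ?_)
  simp [expPoly, dropL_unitVec]

theorem shiftDeriv_expPoly (i : Fin (k + 1)) (z z' : ℂ) (q : Polynomial ℂ)
    (c : (Fin k → ℝ) × F → ℂ) : shiftDeriv (unitVec i) z' (expPoly i z q c) =
      expPoly i z (Polynomial.C (z - z') * q + q.derivative) c := by
  ext p
  rw [shiftDeriv, (hasLineDerivAt_expPoly i z q c p).lineDeriv]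
  simp [expPoly]
  ring

/-- On `x ^ z * q (log x)` the operator `x ∂_x - z'` acts on `q` as `(z - z') + d/dX`. It lowers the
degree by one if `z' = z` and does not raise it otherwise, so the number of occurrences of `z` in
the list is what counts. -/
theorem exists_shiftDerivs_expPoly (i : Fin (k + 1)) (z : ℂ) (L : List ℂ)
    (q : Polynomial ℂ) (c : (Fin k → ℝ) × F → ℂ) {n : ℕ} (hq : ∀ j, n ≤ j → q.coeff j = 0) :
    ∃ q' : Polynomial ℂ, (∀ j, n - L.count z ≤ j → q'.coeff j = 0) ∧
      shiftDerivs (unitVec i) L (expPoly i z q c) = expPoly i z q' c := by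
  induction L with
  | nil => exact ⟨q, by simpa using hq, rfl⟩
  | cons z' L ih =>
    obtain ⟨q', h1, h2⟩ := ih
    refine ⟨_, fun j hj => ?_, by rw [shiftDerivs, h2, shiftDeriv_expPoly]⟩
    rw [Polynomial.coeff_add, Polynomial.coeff_C_mul, Polynomial.coeff_derivative]
    by_cases hz : z' = z
    · subst hz
      rw [h1 (j + 1) (by simp at hj; omega)]
      simp
    · rw [List.count_cons_of_ne hz] at hj
      rw [h1 j hj, h1 (j + 1) (by omega)]
      simp

theorem shiftDerivs_expPoly_eq_zero (i : Fin (k + 1)) {z : ℂ} {L : List ℂ} {n : ℕ}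
    (h : n < L.count z) (c : (Fin k → ℝ) × F → ℂ) :
    shiftDerivs (unitVec i) L (expPoly i z (Polynomial.X ^ n) c) = fun _ => 0 := by
  obtain ⟨q', h1, h2⟩ := exists_shiftDerivs_expPoly i z L (Polynomial.X ^ n) c (n := n + 1)
    (fun j hj => by rw [Polynomial.coeff_X_pow, if_neg (by omega)])
  have : q' = 0 := Polynomial.ext fun j => by simpa using h1 j (by omega)
  rw [h2, this]
  ext p
  simp [expPoly]

/-- The coefficients `c` need not be smooth: only the direction `unitVec i` is differentiated, in
which the `c` are constant. The sum is kept in the form of exponential polynomials so that the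
operators can be applied termwise. -/
theorem shiftDerivs_sum_expPoly_eq_zero {ι : Type*} (s : Finset ι) (i : Fin (k + 1))
    (z : ι → ℂ) (L : List ℂ) (n : ι → ℕ) (c : ι → (Fin k → ℝ) × F → ℂ)
    (h : ∀ j ∈ s, n j < L.count (z j)) :
    shiftDerivs (unitVec i) L
      (fun p => ∑ j ∈ s, expPoly i (z j) (Polynomial.X ^ n j) (c j) p) = fun _ => 0 := by
  have key : ∀ L : List ℂ, ∃ q : ι → Polynomial ℂ,
      (∀ j, shiftDerivs (unitVec i) L (expPoly i (z j) (Polynomial.X ^ n j) (c j)) =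
        expPoly i (z j) (q j) (c j)) ∧
      shiftDerivs (unitVec i) L
        (fun p => ∑ j ∈ s, expPoly i (z j) (Polynomial.X ^ n j) (c j) p) =
          fun p => ∑ j ∈ s, expPoly i (z j) (q j) (c j) p := by
    intro L
    induction L with
    | nil => exact ⟨_, fun _ => rfl, rfl⟩
    | cons z' L ih =>
      obtain ⟨q, h1, h2⟩ := ih
      refine ⟨_, fun j => by rw [shiftDerivs, h1, shiftDeriv_expPoly], ?_⟩
      rw [shiftDerivs, h2]
      ext p
      have h3 : HasLineDerivAt ℝ (fun p => ∑ j ∈ s, expPoly i (z j) (q j) (c j) p)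
          (∑ j ∈ s, expPoly i (z j) (Polynomial.C (z j) * q j + (q j).derivative) (c j) p) p
          (unitVec i) :=
        HasDerivAt.fun_sum fun j _ => hasLineDerivAt_expPoly i (z j) (q j) (c j) p
      rw [ZeroCalculus.shiftDeriv, h3.lineDeriv, Finset.mul_sum, ← Finset.sum_sub_distrib]
      refine Finset.sum_congr rfl fun j _ => ?_
      simp [expPoly]
      ring
  obtain ⟨q, h1, h2⟩ := key L
  rw [h2]
  ext p
  refine Finset.sum_eq_zero fun j hj => ?_
  rw [← h1, shiftDerivs_expPoly_eq_zero i (h j hj)]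

theorem term_eq_expPoly (i : Fin (k + 1)) (z : ℂ) (n : ℕ) (a : (Fin k → ℝ) → F → ℂ)
    (p : (Fin (k + 1) → ℝ) × F) :
    ((Real.exp (p.1 i) : ℝ) : ℂ) ^ z * (Real.log (Real.exp (p.1 i)) : ℂ) ^ n *
      a (i.removeNth fun j => Real.exp (p.1 j)) p.2 =
    expPoly i z (Polynomial.X ^ n) (logPullback a) p := by
  rw [expPoly, Real.log_exp, Complex.cpow_def_of_ne_zero (by simp [Complex.exp_ne_zero]),
    ← Complex.ofReal_log (Real.exp_pos _).le, Real.log_exp, mul_comm z]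
  simp only [Polynomial.eval_pow, Polynomial.eval_X]
  rfl

end ExpPoly

/-! ### Lists of exponents -/

namespace IndexSet

/-- The list `L` contains any `z` at most as often as there are terms `x ^ z * (log x) ^ l`. -/
def Admissible (E : IndexSet) (L : List ℂ) : Prop :=
  ∀ z l, l < L.count z → (z, l) ∈ E.carrier

theorem mem_of_le (E : IndexSet) {z : ℂ} {l l' : ℕ} (h : (z, l) ∈ E.carrier) (hl : l' ≤ l) :
    (z, l') ∈ E.carrier := by
  induction l with
  | zero => rwa [Nat.le_zero.1 hl]
  | succ l ih =>
    rcases hl.eq_or_lt with rfl | hlt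
    · exact h
    · exact ih (E.log_pred_mem z l h) (Nat.lt_succ_iff.1 hlt)

/-- The exponents of `E` with real part at most `N`, with multiplicities. -/
def exponents (E : IndexSet) (N : ℝ) : List ℂ := (E.upTo N).toList.map Prod.fst

theorem mem_upTo {E : IndexSet} {N : ℝ} {p : ℂ × ℕ} :
    p ∈ E.upTo N ↔ p ∈ E.carrier ∧ p.1.re ≤ N := by
  simp [upTo]

/-- For fixed `z` the admitted powers of the logarithm form an initial segment of `ℕ`, so membership
of `l` is the same as `l` being less than their number, which is the multiplicity of `z` in the
list. -/
theorem lt_count_exponents {E : IndexSet} {N : ℝ} {z : ℂ} {l : ℕ} :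
    l < (E.exponents N).count z ↔ (z, l) ∈ E.upTo N := by
  classical
  have h1 : (E.exponents N).count z = ((E.upTo N).filter fun p => p.1 = z).card := by
    have h0 : ((E.upTo N).toList.map Prod.fst).count z =
        ((E.upTo N).toList.filter fun p => p.1 = z).length := by
      induction (E.upTo N).toList with
      | nil => rfl
      | cons a l ih =>
        by_cases ha : a.1 = z
        · simp [ha, ih]
        · simp [ha, ih]
    rw [exponents, h0, Finset.card_def, Finset.filter_val, ← Multiset.coe_card,
      ← Multiset.filter_coe, Finset.coe_toList]
  set S := ((E.upTo N).filter fun p => p.1 = z).image Prod.snd with hS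
  have h2 : S.card = (E.exponents N).count z := by
    rw [h1]
    refine Finset.card_image_of_injOn ?_
    rintro ⟨a, b⟩ ha ⟨a', b'⟩ ha' (rfl : b = b')
    simp only [Finset.coe_filter, mem_ofPred_eq] at ha ha'
    rw [ha.2, ha'.2]
  have h3 : ∀ l, l ∈ S ↔ (z, l) ∈ E.upTo N := by
    intro l
    simp only [hS, Finset.mem_image, Finset.mem_filter]
    constructor
    · rintro ⟨⟨a, b⟩, ⟨h, rfl⟩, rfl⟩
      exact h
    · intro h
      exact ⟨(z, l), ⟨h, rfl⟩, rfl⟩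
  have h4 : ∀ l ∈ S, ∀ l' ≤ l, l' ∈ S := by
    intro l hl l' hl'
    rw [h3, mem_upTo] at hl ⊢
    exact ⟨E.mem_of_le hl.1 hl', hl.2⟩
  -- A finite set of naturals closed downwards is the initial segment of its cardinality.
  have h5 : S = Finset.range S.card := by
    have hsub : ∀ l ∈ S, l < S.card := by
      intro l hl
      have : Finset.range (l + 1) ⊆ S := fun l' hl' =>
        h4 l hl l' (Nat.lt_succ_iff.1 (Finset.mem_range.1 hl'))
      have := Finset.card_le_card this
      simp at this
      omega
    exact Finset.eq_of_subset_of_card_le (fun l hl => Finset.mem_range.2 (hsub l hl)) (by simp)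
  rw [← h2, ← h3, ← Finset.mem_range, ← h5]

theorem admissible_exponents (E : IndexSet) (N : ℝ) : E.Admissible (E.exponents N) :=
  fun _ _ h => (mem_upTo.1 (lt_count_exponents.1 h)).1

theorem exists_lt (E : IndexSet) : ∃ b : ℝ, ∀ p ∈ E.carrier, b < p.1.re := by
  obtain ⟨b, hb⟩ := ((E.finite_lt 0).image fun p : ℂ × ℕ => p.1.re).bddBelow
  refine ⟨min b 0 - 1, fun p hp => ?_⟩
  rcases lt_or_ge p.1.re 0 with h | h
  · have := hb ⟨p, ⟨hp, h⟩, rfl⟩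
    have := min_le_left b 0
    dsimp only at *
    linarith
  · have := min_le_right b 0
    linarith

/-- The supremum of multisets has as multiplicities the maxima of the multiplicities. Concatenating
the lists would add them up and lose admissibility. -/
theorem Admissible.exists_common {E : IndexSet} {ι : Type*} (s : Finset ι) {L : ι → List ℂ}
    (h : ∀ i ∈ s, E.Admissible (L i)) : ∃ L', E.Admissible L' ∧ ∀ i ∈ s, (L i).Subperm L' := by
  classical
  let M : Multiset ℂ := s.sup fun i => (L i : Multiset ℂ)
  refine ⟨M.toList, fun z l hl => ?_, fun i hi => ?_⟩
  · have hc : M.toList.count z = s.sup fun i => (L i).count z := by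
      rw [← Multiset.coe_count, Multiset.coe_toList]
      simp only [M]
      rw [Multiset.count_finset_sup]
      simp
    rw [hc, Finset.lt_sup_iff] at hl
    obtain ⟨i, hi, hl⟩ := hl
    exact h i hi z l hl
  · rw [← Multiset.coe_le, Multiset.coe_toList]
    exact Finset.le_sup (f := fun i => (L i : Multiset ℂ)) hi

end IndexSet

/-! ### Polyhomogeneous functions are conormal of any order after removing the leading terms -/

section Phg

variable {F : Type*} [NormedAddCommGroup F] [NormedSpace ℝ F] {k : ℕ}

theorem IsPhgAt.symbolBound {E : Fin (k + 1) → IndexSet} {u : (Fin (k + 1) → ℝ) → F → ℂ}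
    {x₀ : Fin (k + 1) → ℝ} {y₀ : F} (h : IsPhgAt (k + 1) E u x₀ y₀) (hx₀ : ∀ i, 0 ≤ x₀ i)
    {α : Fin (k + 1) → ℝ} (hα : ∀ i, ∀ p ∈ (E i).carrier, α i < p.1.re) :
    SymbolBound (logNhds univ x₀ y₀) (weight α) (logPullback u) := by
  rw [← isConormalAt_coe_iff hx₀]
  exact h.1 α hα

/-- The operators for all exponents up to `α i` annihilate the truncated expansion, so only the
remainder contributes. There is no condition on `α i`. -/
theorem IsPhgAt.symbolBound_shiftDerivs {E : Fin (k + 1) → IndexSet}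
    {u : (Fin (k + 1) → ℝ) → F → ℂ} {x₀ : Fin (k + 1) → ℝ} {y₀ : F}
    (h : IsPhgAt (k + 1) E u x₀ y₀) (hx₀ : ∀ i, 0 ≤ x₀ i) {i : Fin (k + 1)} (hi : x₀ i = 0)
    {α : Fin (k + 1) → ℝ} (hα : ∀ j, j ≠ i → ∀ p ∈ (E j).carrier, α j < p.1.re) :
    SymbolBound (logNhds univ x₀ y₀) (weight α)
      (shiftDerivs (unitVec i) ((E i).exponents (α i)) (logPullback u)) := by
  obtain ⟨a, -, ha⟩ := h.2 i hi
  have h1 := (isConormalAt_coe_iff hx₀).1 (ha (α i) α rfl hα)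
  set S : (Fin (k + 1) → ℝ) × F → ℂ := fun p => ∑ q ∈ (E i).upTo (α i),
    expPoly i q.1 (Polynomial.X ^ q.2) (logPullback (a q.1 q.2)) p with hS
  set R := logPullback fun x y => u x y - ∑ p ∈ (E i).upTo (α i),
    (x i : ℂ) ^ p.1 * (Real.log (x i) : ℂ) ^ p.2 * a p.1 p.2 (i.removeNth x) y with hR
  have hUSR : logPullback u = fun p => S p + R p := by
    ext p
    have : ∀ q : ℂ × ℕ, _ := fun q => term_eq_expPoly i q.1 q.2 (a q.1 q.2) p
    simp only [hS, hR, logPullback, ← this]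
    ring
  have hu : ∀ᶠ p in logNhds univ x₀ y₀, ContDiffAt ℝ ∞ (logPullback u) p := by
    choose β hβ using fun j => (E j).exists_lt
    exact (h.symbolBound hx₀ hβ).smooth
  refine (h1.shiftDerivs (unitVec i) ((E i).exponents (α i))).congr
    (isOpenFilter_logNhds isOpen_univ x₀ y₀) ?_
  filter_upwards [hu, h1.smooth] with p hp1 hp2
  -- Smoothness of the partial sum comes from writing it as `u` minus the remainder, both of which
  -- are conormal; this avoids treating the coefficients one by one.
  have hSsm : ContDiffAt ℝ ∞ S p := by
    have : S = fun p => logPullback u p - R p := by rw [hUSR]; ext; simp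
    rw [this]
    exact hp1.sub hp2
  have hS0 : shiftDerivs (unitVec i) ((E i).exponents (α i)) S = fun _ => 0 :=
    shiftDerivs_sum_expPoly_eq_zero _ i _ _ _ _ fun q hq => IndexSet.lt_count_exponents.2 hq
  rw [hUSR, (shiftDerivs_add _ _ hSsm hp2).eq_of_nhds, hS0, zero_add]

end Phg

end

section

/-! ### First order equations along a normal coordinate -/

section Box

variable {F : Type*} [NormedAddCommGroup F] [NormedSpace ℝ F] {k : ℕ}

/-- A box neighbourhood in logarithmic coordinates. -/
def logBox (x₀ : Fin k → ℝ) (y₀ : F) (ε : ℝ) : Set ((Fin k → ℝ) × F) :=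
  {p | (∀ i, |Real.exp (p.1 i) - x₀ i| < ε) ∧ ‖p.2 - y₀‖ < ε}

variable {x₀ : Fin k → ℝ} {y₀ : F} {ε : ℝ}

theorem isOpen_logBox : IsOpen (logBox x₀ y₀ ε) := by
  have he : logBox x₀ y₀ ε = (⋂ i, {p : (Fin k → ℝ) × F | |Real.exp (p.1 i) - x₀ i| < ε}) ∩
      {p : (Fin k → ℝ) × F | ‖p.2 - y₀‖ < ε} := by
    ext
    simp [logBox]
  rw [he]
  refine (isOpen_iInter_of_finite fun i => ?_).inter ?_
  · exact isOpen_lt (by fun_prop) continuous_const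
  · exact isOpen_lt (by fun_prop) continuous_const

theorem isOpenFilter_principal {E : Type*} [TopologicalSpace E] {s : Set E} (hs : IsOpen s) :
    ∀ P : E → Prop, (∀ᶠ q in 𝓟 s, P q) → ∀ᶠ q in 𝓟 s, ∀ᶠ q' in 𝓝 q, P q' := by
  intro P hP
  rw [eventually_principal] at hP ⊢
  exact fun q hq => eventually_of_mem (hs.mem_nhds hq) hP

theorem isOpenFilter_logBox : IsOpenFilter (𝓟 (logBox x₀ y₀ ε)) :=
  isOpenFilter_principal isOpen_logBox

theorem logNhds_le_logBox (hε : 0 < ε) : logNhds univ x₀ y₀ ≤ 𝓟 (logBox x₀ y₀ ε) := by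
  rw [le_principal_iff]
  exact eventually_logNhds_univ_iff.2 ⟨ε, hε, fun p h1 h2 => ⟨h1, h2⟩⟩

theorem SymbolBound.filter_mono {E : Type*} [NormedAddCommGroup E] [NormedSpace ℝ E]
    {l l' : Filter E} {μ : E → ℝ} {U : E → ℂ} (h : SymbolBound l μ U) (hl : l' ≤ l) :
    SymbolBound l' μ U :=
  ⟨h.smooth.filter_mono hl, fun m => (h.bound m).imp fun _ hC => hC.filter_mono hl⟩

theorem unitVec_fst_of_ne {i j : Fin k} (h : j ≠ i) : (unitVec i : (Fin k → ℝ) × F).1 j = 0 := by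
  simp [unitVec, h]

theorem unitVec_snd (i : Fin k) : (unitVec i : (Fin k → ℝ) × F).2 = 0 := by
  simp [unitVec]

theorem add_smul_unitVec_mem_logBox {i : Fin k} (hi : x₀ i = 0) {p : (Fin k → ℝ) × F}
    (hp : p ∈ logBox x₀ y₀ ε) {t : ℝ} (ht : Real.exp (p.1 i + t) < ε) :
    p + t • unitVec i ∈ logBox x₀ y₀ ε := by
  refine ⟨fun j => ?_, by simpa [unitVec_snd] using hp.2⟩
  by_cases hj : j = i
  · subst hj
    simpa [hi, abs_of_pos (Real.exp_pos _)] using ht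
  · simpa [unitVec_fst_of_ne hj] using hp.1 j

theorem exp_lt_of_mem_logBox {i : Fin k} (hi : x₀ i = 0) {p : (Fin k → ℝ) × F}
    (hp : p ∈ logBox x₀ y₀ ε) : Real.exp (p.1 i) < ε := by
  simpa [hi, abs_of_pos (Real.exp_pos _)] using hp.1 i

theorem sub_smul_unitVec_mem_logBox {i : Fin k} (hi : x₀ i = 0) {p : (Fin k → ℝ) × F}
    (hp : p ∈ logBox x₀ y₀ ε) {s : ℝ} (hs : 0 ≤ s) : p - s • unitVec i ∈ logBox x₀ y₀ ε := by
  rw [sub_eq_add_neg, ← neg_smul]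
  refine add_smul_unitVec_mem_logBox hi hp (lt_of_le_of_lt ?_ (exp_lt_of_mem_logBox hi hp))
  exact Real.exp_le_exp.2 (by linarith)

theorem weight_add_smul_unitVec (β : Fin k → ℝ) (p : (Fin k → ℝ) × F) (i : Fin k) (t : ℝ) :
    weight β (p + t • unitVec i) = weight β p + β i * t := by
  simp only [weight, Prod.fst_add, Prod.smul_fst, Pi.add_apply, Pi.smul_apply, smul_eq_mul,
    mul_add, Finset.sum_add_distrib]
  congr 1
  rw [Finset.sum_eq_single i]
  · simp
  · intro j _ hj
    simp [unitVec_fst_of_ne hj]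
  · simp

theorem weight_sub_smul_unitVec (β : Fin k → ℝ) (p : (Fin k → ℝ) × F) (i : Fin k) (t : ℝ) :
    weight β (p - t • unitVec i) = weight β p - β i * t := by
  rw [sub_eq_add_neg, ← neg_smul, weight_add_smul_unitVec]
  ring

/-- On balls of radius one the weight varies by a bounded amount, so one dominating function serves
the whole ball when differentiating under an integral. -/
theorem weight_le_of_norm_sub_le (β : Fin k → ℝ) {p q : (Fin k → ℝ) × F} (h : ‖q - p‖ ≤ 1) :
    weight β q ≤ weight β p + ∑ i, |β i| := by
  rw [weight, weight, ← Finset.sum_add_distrib]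
  refine Finset.sum_le_sum fun i _ => ?_
  have h1 : |q.1 i - p.1 i| ≤ 1 := (norm_le_pi_norm (q - p).1 i).trans ((norm_fst_le _).trans h)
  have h2 : β i * (q.1 i - p.1 i) ≤ |β i| * 1 := (le_abs_self _).trans
    (by rw [abs_mul]; gcongr)
  linarith

/-- The equation `(∂ - z) w = f` can be solved in the space of functions of order `α i > Re z`. -/
theorem exists_shiftDeriv_eq {i : Fin k} (hi : x₀ i = 0) {α : Fin k → ℝ} {z : ℂ}
    (hz : z.re < α i) {f : (Fin k → ℝ) × F → ℂ}
    (hf : SymbolBound (𝓟 (logBox x₀ y₀ ε)) (weight α) f) :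
    ∃ w, SymbolBound (𝓟 (logBox x₀ y₀ ε)) (weight α) w ∧
      ∀ p ∈ logBox x₀ y₀ ε, shiftDeriv (unitVec i) z w p = f p := by
  set B := logBox x₀ y₀ ε with hB
  set e : (Fin k → ℝ) × F := unitVec i with he
  have hsm : ∀ p ∈ B, ContDiffAt ℝ ∞ f p := eventually_principal.1 hf.smooth
  choose C hC hCb using hf.exists_pos_bound
  replace hCb : ∀ m, ∀ p ∈ B, ‖iteratedFDeriv ℝ m f p‖ ≤ C m * Real.exp (weight α p) :=
    fun m => eventually_principal.1 (hCb m)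
  have hlt : z.re - α i < 0 := by linarith
  -- The solution is `w p = ∫₀^∞ exp(z s) f(p - s e) ds`, that is, integration from `x i = 0`. The
  -- integrand decays like `exp((Re z - α i) s)`, which is where `Re z < α i` enters.
  let G : (Fin k → ℝ) × F → ℝ → ℂ := fun p s => Complex.exp (z * (s : ℂ)) * f (p - s • e)
  have hjoint : ∀ p ∈ B, ∀ s : ℝ, 0 ≤ s →
      ContDiffAt ℝ ∞ (fun q : ((Fin k → ℝ) × F) × ℝ => G q.1 q.2) (p, s) := by
    intro p hp s hs
    refine ContDiffAt.mul ?_ ?_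
    · exact (contDiffAt_const.mul (Complex.ofRealCLM.contDiff.contDiffAt.comp _
        contDiffAt_snd)).cexp
    · refine ContDiffAt.comp (p, s) (hsm _ (sub_smul_unitVec_mem_logBox hi hp hs)) ?_
      exact contDiffAt_fst.sub (contDiffAt_snd.smul contDiffAt_const)
  have hslice : ∀ p ∈ B, ∀ s : ℝ, 0 ≤ s → ContDiffAt ℝ ∞ (fun p => G p s) p := fun p hp s hs =>
    (hjoint p hp s hs).comp p (f := fun p => (p, s)) (contDiffAt_id.prodMk contDiffAt_const)
  have hGb : ∀ m : ℕ, ∀ p ∈ B, ∀ s : ℝ, 0 ≤ s → ‖iteratedFDeriv ℝ m (fun p => G p s) p‖ ≤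
      C m * Real.exp (weight α p) * Real.exp ((z.re - α i) * s) := by
    intro m p hp s hs
    have h1 := sub_smul_unitVec_mem_logBox hi hp hs
    have h2 : ContDiffAt ℝ m f (ContinuousLinearMap.id ℝ _ p + -(s • e)) := by
      rw [ContinuousLinearMap.id_apply, ← sub_eq_add_neg]
      exact (hsm _ h1).of_le (by exact_mod_cast le_top)
    have h3 : ContDiffAt ℝ m (fun p => f (p - s • e)) p := by
      refine ContDiffAt.comp p ((hsm _ h1).of_le (by exact_mod_cast le_top)) ?_
      exact contDiffAt_id.sub contDiffAt_const
    have h4 : iteratedFDeriv ℝ m (fun p => G p s) p =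
        Complex.exp (z * (s : ℂ)) • iteratedFDeriv ℝ m (fun p => f (p - s • e)) p :=
      iteratedFDeriv_const_smul_apply' (a := Complex.exp (z * (s : ℂ))) h3
    have h5 := norm_iteratedFDeriv_comp_affine_le (ContinuousLinearMap.id ℝ _) (-(s • e)) h2
    simp only [ContinuousLinearMap.id_apply, ← sub_eq_add_neg] at h5
    have h6 : ‖ContinuousLinearMap.id ℝ ((Fin k → ℝ) × F)‖ ^ m ≤ 1 :=
      pow_le_one₀ (norm_nonneg _) ContinuousLinearMap.norm_id_le
    rw [h4, norm_smul, Complex.norm_exp]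
    have h7 : ‖iteratedFDeriv ℝ m (fun p => f (p - s • e)) p‖ ≤
        C m * Real.exp (weight α p - α i * s) := by
      rw [← weight_sub_smul_unitVec]
      refine h5.trans ((mul_le_of_le_one_right (norm_nonneg _) h6).trans (hCb m _ h1))
    calc _ ≤ Real.exp ((z * (s : ℂ)).re) * (C m * Real.exp (weight α p - α i * s)) := by gcongr
      _ = _ := by
        rw [mul_left_comm, ← Real.exp_add, mul_assoc, ← Real.exp_add]
        congr 2
        simp
        ring
  have hmeas : ∀ m : ℕ, ∀ p ∈ B, AEStronglyMeasurable
      (fun s => iteratedFDeriv ℝ m (fun p => G p s) p) (volume.restrict (Ioi 0)) := by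
    intro m p hp
    refine ContinuousOn.aestronglyMeasurable (fun s hs => ContinuousAt.continuousWithinAt ?_)
      measurableSet_Ioi
    exact continuousAt_iteratedFDeriv_slice
      ((hjoint p hp s (le_of_lt hs)).of_le (by exact_mod_cast le_top))
  have hint : IntegrableOn (fun s => Real.exp ((z.re - α i) * s)) (Ioi 0) :=
    integrableOn_exp_mul_Ioi hlt 0
  have hpos : ∀ᵐ s ∂(volume.restrict (Ioi (0 : ℝ))), 0 < s := ae_restrict_mem measurableSet_Ioi
  let w : (Fin k → ℝ) × F → ℂ := fun p => ∫ s in Ioi (0 : ℝ), G p s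
  have hw : ∀ n : ℕ, ∀ p ∈ B, ContDiffAt ℝ n w p ∧
      iteratedFDeriv ℝ n w p = ∫ s in Ioi (0 : ℝ), iteratedFDeriv ℝ n (fun p => G p s) p := by
    intro n p hp
    have ho : IsOpen (B ∩ Metric.ball p 1) := isOpen_logBox.inter Metric.isOpen_ball
    have hpo : p ∈ B ∩ Metric.ball p 1 := ⟨hp, Metric.mem_ball_self one_pos⟩
    have := iteratedFDeriv_integral (μ := volume.restrict (Ioi (0 : ℝ))) ho (n := n)
      (f := G) (b := fun m s => C m * Real.exp (weight α p + ∑ i, |α i|) *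
        Real.exp ((z.re - α i) * s))
      (hpos.mono fun s hs q hq =>
        ((hslice q hq.1 s hs.le).of_le (by exact_mod_cast le_top)).contDiffWithinAt)
      (fun m _ q hq => hmeas m q hq.1)
      (fun m _ => hpos.mono fun s hs q hq => (hGb m q hq.1 s hs.le).trans (by
        have := hC m
        gcongr
        exact weight_le_of_norm_sub_le α (mem_ball_iff_norm.1 hq.2).le))
      (fun m _ => hint.const_mul _)
    exact ⟨this.1.contDiffAt (ho.mem_nhds hpo), this.2 n le_rfl p hpo⟩
  refine ⟨w, ⟨?_, fun m => ⟨C m * ∫ s in Ioi (0 : ℝ), Real.exp ((z.re - α i) * s), ?_⟩⟩, ?_⟩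
  · exact eventually_principal.2 fun p hp => contDiffAt_infty.2 fun n => (hw n p hp).1
  · refine eventually_principal.2 fun p hp => ?_
    rw [(hw m p hp).2]
    refine (norm_integral_le_of_norm_le (hint.const_mul (C m * Real.exp (weight α p)))
      (hpos.mono fun s hs => hGb m p hp s hs.le)).trans_eq ?_
    rw [integral_const_mul]
    ring
  · intro p hp
    have hd : ∀ s : ℝ, 0 ≤ s → HasFDerivAt f (fderiv ℝ f (p - s • e)) (p - s • e) := fun s hs =>
      ((hsm _ (sub_smul_unitVec_mem_logBox hi hp hs)).differentiableAt (by simp)).hasFDerivAt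
    have h0 : Integrable (fun s => G p s) (volume.restrict (Ioi 0)) := by
      have h1 : AEStronglyMeasurable (fun s => G p s) (volume.restrict (Ioi 0)) :=
        ContinuousOn.aestronglyMeasurable (fun s hs => ((hjoint p hp s (le_of_lt hs)).continuousAt.comp
          (Continuous.prodMk_right p).continuousAt).continuousWithinAt) measurableSet_Ioi
      refine (hint.const_mul (C 0 * Real.exp (weight α p))).mono' h1
        (hpos.mono fun s hs => ?_)
      simpa using hGb 0 p hp s hs.le
    have h1int : Integrable (fun s => iteratedFDeriv ℝ 1 (fun p => G p s) p)
        (volume.restrict (Ioi 0)) :=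
      (hint.const_mul (C 1 * Real.exp (weight α p))).mono' (hmeas 1 p hp)
        (hpos.mono fun s hs => hGb 1 p hp s hs.le)
    have hap : ∀ s : ℝ, 0 ≤ s → iteratedFDeriv ℝ 1 (fun p => G p s) p (fun _ => e) =
        Complex.exp (z * (s : ℂ)) * fderiv ℝ f (p - s • e) e := by
      intro s hs
      rw [iteratedFDeriv_one_apply]
      have h2 : HasFDerivAt (fun p => G p s)
          (Complex.exp (z * (s : ℂ)) • fderiv ℝ f (p - s • e)) p := by
        have h3 := (hd s hs).comp p ((hasFDerivAt_id p).sub_const (s • e))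
        rw [ContinuousLinearMap.comp_id] at h3
        exact HasFDerivAt.const_mul (a := fun p => f (p - s • e)) h3 _
      rw [h2.fderiv]
      simp
    let ev := ContinuousMultilinearMap.apply ℝ (fun _ : Fin 1 => (Fin k → ℝ) × F) ℂ (fun _ => e)
    have hI : Integrable (fun s : ℝ => Complex.exp (z * (s : ℂ)) * fderiv ℝ f (p - s • e) e)
        (volume.restrict (Ioi 0)) :=
      (ev.integrable_comp h1int).congr (hpos.mono fun s hs => hap s hs.le)
    have hder : lineDeriv ℝ w p e =
        ∫ s in Ioi (0 : ℝ), Complex.exp (z * (s : ℂ)) * fderiv ℝ f (p - s • e) e := by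
      rw [((hw 1 p hp).1.differentiableAt (by simp)).lineDeriv_eq_fderiv]
      have h2 : fderiv ℝ w p e = iteratedFDeriv ℝ 1 w p (fun _ => e) := by
        rw [iteratedFDeriv_one_apply]
      rw [h2, (hw 1 p hp).2]
      refine (ev.integral_comp_comm h1int).symm.trans ?_
      exact integral_congr_ae (hpos.mono fun s hs => hap s hs.le)
    -- The derivative of the integrand in `s` is `z` times the integrand minus the integrand of `∂_e
    -- w`. Integrating over `(0, ∞)` gives `z w - ∂_e w = -f`.
    have hs1 : ∀ s ∈ Ici (0 : ℝ), HasDerivAt (fun s => G p s)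
        (z * G p s - Complex.exp (z * (s : ℂ)) * fderiv ℝ f (p - s • e) e) s := by
      intro s hs
      have h2 : HasDerivAt (fun s : ℝ => Complex.exp (z * (s : ℂ)))
          (Complex.exp (z * (s : ℂ)) * (z * 1)) s :=
        ((hasDerivAt_id (s : ℂ)).const_mul z).cexp.comp_ofReal
      have h3 : HasDerivAt (fun s : ℝ => p - s • e) (-((1 : ℝ) • e)) s := by
        simpa using ((hasDerivAt_id s).smul_const e).const_sub p
      refine (h2.mul ((hd s hs).comp_hasDerivAt s h3)).congr_deriv ?_
      simp [G]
      ring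
    have hlim : Tendsto (fun s => G p s) atTop (𝓝 0) := by
      have h2 : Tendsto (fun s => C 0 * Real.exp (weight α p) * Real.exp ((z.re - α i) * s))
          atTop (𝓝 (C 0 * Real.exp (weight α p) * 0)) :=
        (Real.tendsto_exp_atBot.comp (tendsto_id.const_mul_atTop_of_neg hlt)).const_mul _
      rw [mul_zero] at h2
      refine squeeze_zero_norm' ((eventually_ge_atTop 0).mono fun s hs => ?_) h2
      simpa using hGb 0 p hp s hs
    have hfin := integral_Ioi_of_hasDerivAt_of_tendsto' hs1 ((h0.const_mul z).sub hI) hlim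
    rw [integral_sub (h0.const_mul z) hI, integral_const_mul, ← hder] at hfin
    have hG0 : G p 0 = f p := by simp [G]
    rw [hG0] at hfin
    rw [shiftDeriv]
    change lineDeriv ℝ w p e - z * w p = f p
    have : z * w p - lineDeriv ℝ w p e = 0 - f p := hfin
    linear_combination -this

end Box

end

/-! ### Propagation of bounds along a normal coordinate and homogeneous solutions -/

section

theorem natCast_le_infty (n : ℕ) : (n : ℕ∞ω) ≤ ∞ := by exact_mod_cast le_top

section Commute

variable {E G : Type*} [NormedAddCommGroup E] [NormedSpace ℝ E] [NormedAddCommGroup G]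
  [NormedSpace ℝ G]

/-- By symmetry of second derivatives. Order `m + 2` is assumed so that the derivative of order `m`
is itself twice differentiable. It turns the equation for `V` into the same equation for the tensor
of its derivatives of order `m`. -/
theorem iteratedFDeriv_fderiv_apply {V : E → G} {p : E} (v : E) (m : ℕ)
    (hV : ContDiffAt ℝ ((m + 2 : ℕ) : ℕ∞ω) V p) :
    iteratedFDeriv ℝ m (fun q => fderiv ℝ V q v) p = fderiv ℝ (iteratedFDeriv ℝ m V) p v := by
  induction m generalizing p with
  | zero =>
    have h1 : iteratedFDeriv ℝ 0 V = (continuousMultilinearCurryFin0 ℝ E G).symm ∘ V := by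
      ext; simp
    ext w
    rw [h1, LinearIsometryEquiv.comp_fderiv]
    simp
  | succ m ih =>
    have hev : (iteratedFDeriv ℝ m fun q => fderiv ℝ V q v) =ᶠ[𝓝 p]
        fun q => fderiv ℝ (iteratedFDeriv ℝ m V) q v := by
      filter_upwards [hV.eventually (by generalize m + 1 + 2 = n; simp)] with q hq
      exact ih (hq.of_le (by exact_mod_cast Nat.le_succ _))
    have h2 : ContDiffAt ℝ 2 (iteratedFDeriv ℝ m V) p :=
      hV.iteratedFDeriv_right (m := 2) (i := m) (by norm_cast; omega)
    have h3 : DifferentiableAt ℝ (fderiv ℝ (iteratedFDeriv ℝ m V)) p :=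
      (h2.fderiv_right (m := 1) (by norm_num)).differentiableAt (by simp)
    have h4 : fderiv ℝ (iteratedFDeriv ℝ m fun q => fderiv ℝ V q v) p =
        fderiv ℝ (fderiv ℝ (iteratedFDeriv ℝ m V)) p v := by
      rw [hev.fderiv_eq]
      ext1 w
      rw [fderiv_clm_apply h3 (differentiableAt_const v)]
      simpa using h2.isSymmSndFDerivAt (by simp) w v
    have h5 : DifferentiableAt ℝ (iteratedFDeriv ℝ (m + 1) V) p :=
      hV.differentiableAt_iteratedFDeriv (by exact_mod_cast (by omega : m + 1 < m + 1 + 2))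
    ext w
    rw [iteratedFDeriv_succ_apply_left, h4]
    have h6 := ((ContinuousMultilinearMap.apply ℝ (fun _ : Fin (m + 1) => E) G
      w).hasFDerivAt.comp p h5.hasFDerivAt).fderiv
    have h7 := ((ContinuousMultilinearMap.apply ℝ (fun _ : Fin m => E) G
      (Fin.tail w)).hasFDerivAt.comp p (h3.hasFDerivAt.clm_apply (hasFDerivAt_const (w 0) p))).fderiv
    have h8 := congrArg (fun T => T v) (h6.symm.trans h7)
    simpa using h8.symm

end Commute

section Box

variable {F : Type*} [NormedAddCommGroup F] [NormedSpace ℝ F] {k : ℕ}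
  {x₀ : Fin k → ℝ} {y₀ : F} {ε : ℝ}

theorem weight_eq_add_mul (i : Fin k) {α β : Fin k → ℝ} (h : ∀ j, j ≠ i → β j = α j)
    (p : (Fin k → ℝ) × F) : weight β p = weight α p + (β i - α i) * p.1 i := by
  rw [weight, weight, ← sub_eq_iff_eq_add', ← Finset.sum_sub_distrib, Finset.sum_eq_single i]
  · ring
  · intro j _ hj
    rw [h j hj]; ring
  · simp

/-- Lowering the weight at a hypersurface through the centre of the box. -/
theorem SymbolBound.mono_logBox {i : Fin k} (hi : x₀ i = 0) (hε : 0 < ε) {α β : Fin k → ℝ}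
    (h : ∀ j, j ≠ i → β j = α j) (hle : β i ≤ α i) {V : (Fin k → ℝ) × F → ℂ}
    (hV : SymbolBound (𝓟 (logBox x₀ y₀ ε)) (weight α) V) :
    SymbolBound (𝓟 (logBox x₀ y₀ ε)) (weight β) V := by
  refine hV.mono ((α i - β i) * Real.log ε) (eventually_principal.2 fun p hp => ?_)
  have h1 : p.1 i ≤ Real.log ε := by
    rw [Real.le_log_iff_exp_le hε]
    exact (exp_lt_of_mem_logBox hi hp).le
  rw [weight_eq_add_mul i (fun j hj => (h j hj).symm)]
  gcongr

/-- If `(∂ - z) V` is of order `α i < Re z`, then so is `V`. -/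
theorem SymbolBound.of_shiftDeriv {i : Fin k} (hi : x₀ i = 0) (hε : 0 < ε) {α β : Fin k → ℝ}
    (hαβ : ∀ j, j ≠ i → β j = α j) {z : ℂ} (hz : α i < z.re) {V : (Fin k → ℝ) × F → ℂ}
    (hV : SymbolBound (𝓟 (logBox x₀ y₀ ε)) (weight β) V)
    (hf : SymbolBound (𝓟 (logBox x₀ y₀ ε)) (weight α) (ZeroCalculus.shiftDeriv (unitVec i) z V)) :
    SymbolBound (𝓟 (logBox x₀ y₀ ε)) (weight α) V := by
  refine ⟨hV.smooth, fun m => ?_⟩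
  set e : (Fin k → ℝ) × F := unitVec i
  set B := logBox x₀ y₀ ε
  have hsm : ∀ p ∈ B, ContDiffAt ℝ ∞ V p := eventually_principal.1 hV.smooth
  obtain ⟨C, hC, hCb⟩ := hV.exists_pos_bound m
  obtain ⟨D, hD, hDb⟩ := hf.exists_pos_bound m
  rw [eventually_principal] at hCb hDb
  set a := z.re - α i with ha
  have ha0 : 0 < a := by linarith
  -- A fixed height inside the box, from which the equation is integrated towards `x i = 0`.
  set τ := Real.log (ε / 2) with hτ
  have heτ : Real.exp τ = ε / 2 := Real.exp_log (by linarith)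
  have hT : ∀ p ∈ B, iteratedFDeriv ℝ m (ZeroCalculus.shiftDeriv e z V) p =
      fderiv ℝ (iteratedFDeriv ℝ m V) p e - z • iteratedFDeriv ℝ m V p := by
    intro p hp
    have h1 : ZeroCalculus.shiftDeriv e z V =ᶠ[𝓝 p] fun q => fderiv ℝ V q e - z • V q := by
      filter_upwards [lineDeriv_eventuallyEq e (hsm p hp)] with q hq
      simp [ZeroCalculus.shiftDeriv, hq]
    have hle : (m : ℕ∞ω) ≤ ∞ := by exact_mod_cast le_top
    have h2 : ContDiffAt ℝ m (fun q => fderiv ℝ V q e) p :=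
      (contDiffAt_lineDeriv e (hsm p hp)).of_le hle
    have h3 : ContDiffAt ℝ m V p := (hsm p hp).of_le hle
    have h4 : ContDiffAt ℝ m (fun q => z • V q) p := h3.const_smul z
    rw [iteratedFDeriv_congr_of_eventuallyEq h1]
    refine (iteratedFDeriv_sub_apply h2 h4).trans ?_
    rw [iteratedFDeriv_fderiv_apply e m ((hsm p hp).of_le (natCast_le_infty _)),
      iteratedFDeriv_const_smul_apply' (a := z) h3]
  refine ⟨max (C * Real.exp (|β i - α i| * (|τ| + |Real.log ε|)))
    (C * Real.exp ((β i - α i) * τ) + D / a), eventually_principal.2 fun p hp => ?_⟩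
  have hpi : p.1 i ≤ Real.log ε := by
    rw [Real.le_log_iff_exp_le hε]
    exact (exp_lt_of_mem_logBox hi hp).le
  -- Above height `τ` the coordinate `p.1 i` is bounded on both sides, so the weights `α` and `β`
  -- are comparable there.
  rcases le_or_gt τ (p.1 i) with hle | hlt
  · have h1 : |p.1 i| ≤ |τ| + |Real.log ε| := by
      rw [abs_le]
      constructor
      · linarith [neg_abs_le τ, abs_nonneg (Real.log ε)]
      · linarith [le_abs_self (Real.log ε), abs_nonneg τ]
    have h2 : (β i - α i) * p.1 i ≤ |β i - α i| * (|τ| + |Real.log ε|) :=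
      (le_abs_self _).trans (by rw [abs_mul]; gcongr)
    calc _ ≤ C * Real.exp (weight β p) := hCb p hp
      _ ≤ C * Real.exp (|β i - α i| * (|τ| + |Real.log ε|)) * Real.exp (weight α p) := by
        rw [mul_assoc, ← Real.exp_add, weight_eq_add_mul i hαβ, add_comm (weight α p)]
        gcongr
      _ ≤ _ := by gcongr; exact le_max_left _ _
  · set T := τ - p.1 i with hTdef
    have hT0 : 0 < T := by linarith
    have hmem : ∀ t, t ≤ T → p + t • e ∈ B := fun t ht =>
      add_smul_unitVec_mem_logBox hi hp (lt_of_le_of_lt (b := Real.exp τ)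
        (Real.exp_le_exp.2 (by linarith)) (by rw [heτ]; linarith))
    have hder : ∀ t, t ≤ T → HasDerivAt
        (fun t : ℝ => Complex.exp (-z * (t : ℂ)) • iteratedFDeriv ℝ m V (p + t • e))
        (Complex.exp (-z * (t : ℂ)) •
          iteratedFDeriv ℝ m (ZeroCalculus.shiftDeriv e z V) (p + t • e)) t := by
      intro t ht
      have h1 : HasDerivAt (fun t : ℝ => Complex.exp (-z * (t : ℂ)))
          (Complex.exp (-z * (t : ℂ)) * (-z * 1)) t :=
        ((hasDerivAt_id (t : ℂ)).const_mul (-z)).cexp.comp_ofReal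
      have h2 : HasDerivAt (fun t : ℝ => p + t • e) ((1 : ℝ) • e) t :=
        ((hasDerivAt_id t).smul_const e).const_add p
      have h3 : HasFDerivAt (iteratedFDeriv ℝ m V)
          (fderiv ℝ (iteratedFDeriv ℝ m V) (p + t • e)) (p + t • e) :=
        (((hsm _ (hmem t ht)).of_le (m := ((m + 1 : ℕ) : ℕ∞ω))
          (by exact_mod_cast le_top)).differentiableAt_iteratedFDeriv
            (by exact_mod_cast Nat.lt_succ_self m)).hasFDerivAt
      refine (h1.smul (h3.comp_hasDerivAt t h2)).congr_deriv ?_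
      rw [hT _ (hmem t ht), one_smul, smul_sub, smul_smul]
      simp only [mul_one, mul_neg, neg_smul, Function.comp_apply]
      abel
    have hnorm : ∀ t : ℝ, ‖Complex.exp (-z * (t : ℂ))‖ = Real.exp (-z.re * t) := by
      intro t
      rw [Complex.norm_exp]
      simp
    -- The ray from `p` up to height `τ` is traversed downwards, so that `f 0` sits at height `τ`,
    -- where the old bound is as good as the new one, and `f T` is the derivative at `p`. The speed
    -- is at most a constant times `exp(-a (T - s))` with `a = Re z - α i > 0`, whose integral is
    -- bounded independently of `T`.
    set f : ℝ → _ := fun s : ℝ =>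
      Complex.exp (-z * ((T - s : ℝ) : ℂ)) • iteratedFDeriv ℝ m V (p + (T - s) • e) with hf
    have hfd : ∀ s ∈ Icc 0 T, HasDerivAt f (-(Complex.exp (-z * ((T - s : ℝ) : ℂ)) •
        iteratedFDeriv ℝ m (ZeroCalculus.shiftDeriv e z V) (p + (T - s) • e))) s := by
      intro s hs
      have h1 : HasDerivAt (fun s : ℝ => T - s) (-1) s := (hasDerivAt_id s).const_sub T
      have := (hder (T - s) (by linarith [hs.1])).scomp s h1
      rw [neg_one_smul] at this
      exact this
    have hBd : ∀ s : ℝ, HasDerivAt (fun s => ‖f 0‖ + D * Real.exp (weight α p) / a *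
        Real.exp (-a * (T - s))) (D * Real.exp (weight α p) * Real.exp (-a * (T - s))) s := by
      intro s
      have h1 : HasDerivAt (fun s : ℝ => -a * (T - s)) (-a * (-1)) s :=
        ((hasDerivAt_id s).const_sub T).const_mul (-a)
      refine ((h1.exp.const_mul _).const_add _).congr_deriv ?_
      field_simp
    have key := image_norm_le_of_norm_deriv_right_le_deriv_boundary (f := f) (a := 0) (b := T)
      (fun s hs => (hfd s hs).continuousAt.continuousWithinAt)
      (fun s hs => (hfd s ⟨hs.1, hs.2.le⟩).hasDerivWithinAt)
      (by
        have : 0 ≤ D * Real.exp (weight α p) / a * Real.exp (-a * (T - 0)) := by positivity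
        linarith) hBd
      (by
        intro s hs
        rw [norm_neg, norm_smul, hnorm]
        refine (mul_le_mul_of_nonneg_left (hDb _ (hmem _ (by linarith [hs.1])))
          (Real.exp_pos _).le).trans_eq ?_
        rw [weight_add_smul_unitVec, mul_left_comm, ← Real.exp_add, mul_assoc, ← Real.exp_add]
        congr 2
        rw [ha]
        ring) (right_mem_Icc.2 hT0.le)
    have hfT : f T = iteratedFDeriv ℝ m V p := by simp [hf]
    have hf0 : ‖f 0‖ ≤ C * Real.exp ((β i - α i) * τ) * Real.exp (weight α p) := by
      rw [hf]
      simp only [sub_zero]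
      rw [norm_smul, hnorm]
      refine (mul_le_mul_of_nonneg_left (hCb _ (hmem T le_rfl)) (Real.exp_pos _).le).trans ?_
      rw [mul_left_comm, ← Real.exp_add, mul_assoc, ← Real.exp_add, weight_add_smul_unitVec,
        weight_eq_add_mul i hαβ]
      refine mul_le_mul_of_nonneg_left (Real.exp_le_exp.2 ?_) hC.le
      nlinarith
    rw [hfT] at key
    simp only [sub_self, mul_zero, Real.exp_zero, mul_one] at key
    refine key.trans ?_
    calc _ ≤ C * Real.exp ((β i - α i) * τ) * Real.exp (weight α p) +
          D * Real.exp (weight α p) / a := by gcongr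
      _ = (C * Real.exp ((β i - α i) * τ) + D / a) * Real.exp (weight α p) := by ring
      _ ≤ _ := by gcongr; exact le_max_right _ _

end Box

section Slice

variable {F : Type*} [NormedAddCommGroup F] [NormedSpace ℝ F] {k : ℕ}

/-- Inserting `0` as the `i`-th normal coordinate. -/
def insL (i : Fin (k + 1)) : (Fin k → ℝ) × F →L[ℝ] (Fin (k + 1) → ℝ) × F where
  toFun p := (i.insertNth 0 p.1, p.2)
  map_add' p q := Prod.ext (funext (i.forall_iff_succAbove.2 (by simp))) rfl
  map_smul' t p := Prod.ext (funext (i.forall_iff_succAbove.2 (by simp))) rfl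
  cont := by
    refine Continuous.prodMk (Continuous.finInsertNth i continuous_const continuous_fst)
      continuous_snd

@[simp] theorem insL_fst_self (i : Fin (k + 1)) (p : (Fin k → ℝ) × F) : (insL i p).1 i = 0 := by
  simp [insL]

@[simp] theorem insL_fst_succAbove (i : Fin (k + 1)) (p : (Fin k → ℝ) × F) (j : Fin k) :
    (insL i p).1 (i.succAbove j) = p.1 j := by
  simp [insL]

@[simp] theorem insL_snd (i : Fin (k + 1)) (p : (Fin k → ℝ) × F) : (insL i p).2 = p.2 := rfl

@[simp] theorem unitVec_fst_succAbove (i : Fin (k + 1)) (j : Fin k) :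
    (unitVec i : (Fin (k + 1) → ℝ) × F).1 (i.succAbove j) = 0 :=
  unitVec_fst_of_ne (Fin.succAbove_ne i j)

theorem insL_dropL_add (i : Fin (k + 1)) (p : (Fin (k + 1) → ℝ) × F) (t : ℝ) :
    insL i (dropL i p) + t • unitVec i = p + (t - p.1 i) • unitVec i := by
  refine Prod.ext (funext (i.forall_iff_succAbove.2 ⟨by simp, fun j => by simp⟩)) ?_
  simp [unitVec_snd]

theorem dropL_insL_add (i : Fin (k + 1)) (p : (Fin k → ℝ) × F) (t : ℝ) :
    dropL i (insL i p + t • unitVec i) = p := by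
  refine Prod.ext (funext fun j => by simp) ?_
  simp [unitVec_snd]

theorem weight_insL_add (i : Fin (k + 1)) (β : Fin (k + 1) → ℝ) (p : (Fin k → ℝ) × F) (t : ℝ) :
    weight β (insL i p + t • unitVec i) = weight (i.removeNth β) p + β i * t := by
  rw [weight_add_smul_unitVec]
  congr 1
  rw [weight, weight, Fin.sum_univ_succAbove _ i]
  simp [Fin.removeNth]

theorem weight_eq_dropL (i : Fin (k + 1)) (β : Fin (k + 1) → ℝ) (p : (Fin (k + 1) → ℝ) × F) :
    weight β p = weight (i.removeNth β) (dropL i p) + β i * p.1 i := by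
  rw [weight, weight, Fin.sum_univ_succAbove _ i]
  simp [Fin.removeNth]
  ring

variable {x₀ : Fin (k + 1) → ℝ} {y₀ : F} {ε : ℝ} {i : Fin (k + 1)}

theorem dropL_mem_logBox {p : (Fin (k + 1) → ℝ) × F} (hp : p ∈ logBox x₀ y₀ ε) :
    dropL i p ∈ logBox (i.removeNth x₀) y₀ ε :=
  ⟨fun j => hp.1 (i.succAbove j), hp.2⟩

theorem insL_add_mem_logBox (hi : x₀ i = 0) {p : (Fin k → ℝ) × F}
    (hp : p ∈ logBox (i.removeNth x₀) y₀ ε) {t : ℝ} (ht : Real.exp t < ε) :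
    insL i p + t • unitVec i ∈ logBox x₀ y₀ ε := by
  refine ⟨i.forall_iff_succAbove.2 ⟨?_, fun j => ?_⟩, by simpa [unitVec_snd] using hp.2⟩
  · simpa [hi, abs_of_pos (Real.exp_pos _)] using ht
  · simpa [Fin.removeNth] using hp.1 j

/-- A solution of the homogeneous equation `(∂ - z) W = 0` is a multiple of `x i ^ z`. -/
theorem exists_eq_expPoly_of_shiftDeriv_eq_zero (hi : x₀ i = 0) (hε : 0 < ε)
    {γ : Fin (k + 1) → ℝ} {z : ℂ} {W : (Fin (k + 1) → ℝ) × F → ℂ}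
    (hW : SymbolBound (𝓟 (logBox x₀ y₀ ε)) (weight γ) W)
    (h0 : ∀ p ∈ logBox x₀ y₀ ε, shiftDeriv (unitVec i) z W p = 0) :
    ∃ c, SymbolBound (𝓟 (logBox (i.removeNth x₀) y₀ ε)) (weight (i.removeNth γ)) c ∧
      ∀ p ∈ logBox x₀ y₀ ε, W p = expPoly i z (Polynomial.X ^ 0) c p := by
  set e : (Fin (k + 1) → ℝ) × F := unitVec i
  set τ := Real.log (ε / 2) with hτ
  have heτ : Real.exp τ < ε := by rw [hτ, Real.exp_log (by linarith)]; linarith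
  have hsm := eventually_principal.1 hW.smooth
  -- The coefficient is determined by the value of `W` at the fixed height `τ` of the box.
  refine ⟨fun p => Complex.exp (-z * (τ : ℂ)) * W (insL i p + τ • e), ?_, fun p hp => ?_⟩
  · refine SymbolBound.const_mul _ ((hW.comp_affine (insL i) (τ • e)
      (tendsto_principal_principal.2 fun p hp => insL_add_mem_logBox hi hp heτ)).mono (γ i * τ) ?_)
    exact Eventually.of_forall fun p => (weight_insL_add i γ p τ).le
  · have hmem : ∀ t ∈ {t : ℝ | Real.exp (p.1 i + t) < ε}, p + t • e ∈ logBox x₀ y₀ ε :=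
      fun t ht => add_smul_unitVec_mem_logBox hi hp ht
    have hset : {t : ℝ | Real.exp (p.1 i + t) < ε} = Iio (Real.log ε - p.1 i) := by
      ext t
      simp only [mem_ofPred_eq, mem_Iio, ← Real.lt_log_iff_exp_lt hε]
      constructor <;> intro h <;> linarith
    rw [hset] at hmem
    -- `exp(-z t) W(p + t e)` is constant on the part of the line in the box, which is a half line
    -- and hence connected; it is compared at `t = 0` and at height `τ`.
    have hder : ∀ t ∈ Iio (Real.log ε - p.1 i),
        HasDerivAt (fun t : ℝ => Complex.exp (-z * (t : ℂ)) * W (p + t • e)) 0 t := by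
      intro t ht
      have h1 : HasDerivAt (fun t : ℝ => Complex.exp (-z * (t : ℂ)))
          (Complex.exp (-z * (t : ℂ)) * (-z * 1)) t :=
        ((hasDerivAt_id (t : ℂ)).const_mul (-z)).cexp.comp_ofReal
      have h2 : HasDerivAt (fun t : ℝ => p + t • e) ((1 : ℝ) • e) t :=
        ((hasDerivAt_id t).smul_const e).const_add p
      have h3 := (hsm _ (hmem t ht)).differentiableAt (by simp)
      have h4 := h0 _ (hmem t ht)
      rw [shiftDeriv, h3.lineDeriv_eq_fderiv] at h4
      refine (h1.mul (h3.hasFDerivAt.comp_hasDerivAt t h2)).congr_deriv ?_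
      rw [one_smul]
      simp only [Function.comp_apply]
      linear_combination Complex.exp (-z * (t : ℂ)) * h4
    have hc := IsOpen.is_const_of_deriv_eq_zero isOpen_Iio isPreconnected_Iio
      (fun t ht => (hder t ht).differentiableAt.differentiableWithinAt)
      (fun t ht => (hder t ht).deriv)
      (x := 0) (y := τ - p.1 i) (by
        have := (Real.lt_log_iff_exp_lt hε).2 (exp_lt_of_mem_logBox hi hp)
        simpa using this) (by
        have := (Real.lt_log_iff_exp_lt hε).2 heτ
        simpa using this)
    simp only [Complex.ofReal_zero, mul_zero, Complex.exp_zero, one_mul, zero_smul, add_zero] at hc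
    rw [hc, expPoly]
    change _ = _ * (Complex.exp (-z * (τ : ℂ)) * W (insL i (dropL i p) + τ • e))
    rw [insL_dropL_add, pow_zero, Polynomial.eval_one, mul_one, ← mul_assoc, ← Complex.exp_add]
    congr 2
    push_cast
    ring

end Slice

end

section

/-! ### Finite expansions -/

section ExpSum

variable {F : Type*} [NormedAddCommGroup F] [NormedSpace ℝ F] {k : ℕ}

/-- A finite sum of terms `x i ^ z * (log (x i)) ^ l * c z l`, `(z, l) ∈ S`. -/
def expSum (i : Fin (k + 1)) (S : Finset (ℂ × ℕ)) (c : ℂ × ℕ → (Fin k → ℝ) × F → ℂ) :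
    (Fin (k + 1) → ℝ) × F → ℂ :=
  fun p => ∑ s ∈ S, expPoly i s.1 (Polynomial.X ^ s.2) (c s) p

/-- `V` is a finite sum of terms `x i ^ z * (log (x i)) ^ l * c`, `(z, l) ∈ S`. -/
def IsExpSum (i : Fin (k + 1)) (l : Filter ((Fin k → ℝ) × F)) (μ : (Fin k → ℝ) × F → ℝ)
    (S : Finset (ℂ × ℕ)) (V : (Fin (k + 1) → ℝ) × F → ℂ) : Prop :=
  ∃ c : ℂ × ℕ → (Fin k → ℝ) × F → ℂ, (∀ s, SymbolBound l μ (c s)) ∧ V = expSum i S c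

variable {i : Fin (k + 1)} {l : Filter ((Fin k → ℝ) × F)} {μ : (Fin k → ℝ) × F → ℝ}
  {S T : Finset (ℂ × ℕ)} {V W : (Fin (k + 1) → ℝ) × F → ℂ}

theorem IsExpSum.zero : IsExpSum i l μ S (fun _ => 0) :=
  ⟨fun _ _ => 0, fun _ => SymbolBound.zero, by ext p; simp [expSum, expPoly]⟩

theorem IsExpSum.add (hV : IsExpSum i l μ S V) (hW : IsExpSum i l μ S W) :
    IsExpSum i l μ S (fun p => V p + W p) := by
  obtain ⟨c, hc, rfl⟩ := hV
  obtain ⟨c', hc', rfl⟩ := hW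
  refine ⟨fun s p => c s p + c' s p, fun s => (hc s).add (hc' s), ?_⟩
  ext p
  simp only [expSum, expPoly, mul_add, Finset.sum_add_distrib]

theorem IsExpSum.sum {ι : Type*} (s : Finset ι) {V : ι → (Fin (k + 1) → ℝ) × F → ℂ}
    (h : ∀ j ∈ s, IsExpSum i l μ S (V j)) : IsExpSum i l μ S (fun p => ∑ j ∈ s, V j p) := by
  classical
  induction s using Finset.induction_on with
  | empty => simpa using IsExpSum.zero
  | insert j s hj ih =>
    simp only [Finset.sum_insert hj]
    exact (h j (by simp)).add (ih fun j hj => h j (by simp [hj]))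

theorem IsExpSum.of_expPoly {z : ℂ} {q : Polynomial ℂ} {c : (Fin k → ℝ) × F → ℂ}
    (hc : SymbolBound l μ c) (hq : ∀ n, q.coeff n ≠ 0 → (z, n) ∈ S) :
    IsExpSum i l μ S (expPoly i z q c) := by
  classical
  refine ⟨fun s p => (if s.1 = z then q.coeff s.2 else 0) * c p,
    fun s => hc.const_mul _, ?_⟩
  ext p
  have h1 : q.support.image (fun n => (z, n)) ⊆ S := by
    intro s hs
    obtain ⟨n, hn, rfl⟩ := Finset.mem_image.1 hs
    exact hq n (Polynomial.mem_support_iff.1 hn)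
  rw [expSum, ← Finset.sum_subset h1, Finset.sum_image (by simp)]
  · rw [expPoly, Polynomial.eval_eq_sum, Polynomial.sum_def, Finset.mul_sum, Finset.sum_mul]
    refine Finset.sum_congr rfl fun n _ => ?_
    simp [expPoly]
    ring
  · rintro ⟨z', n⟩ - hs
    simp only [Finset.mem_image, Polynomial.mem_support_iff, not_exists, not_and] at hs
    by_cases hz : z' = z
    · subst hz
      have : q.coeff n = 0 := by
        by_contra hne
        exact hs n hne rfl
      simp [expPoly, this]
    · simp [expPoly, hz]

/-- For `a ≠ 0` the operator `a + d/dX` is invertible on polynomials of degree at most `n`; for `a =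
0` one has to integrate, and the degree grows by one. This resonance produces an additional
logarithm. -/
theorem exists_polynomial_eq (a : ℂ) (n : ℕ) : ∃ Q : Polynomial ℂ,
    Polynomial.C a * Q + Q.derivative = Polynomial.X ^ n ∧
      ∀ j, n + (if a = 0 then 1 else 0) < j → Q.coeff j = 0 := by
  by_cases ha : a = 0
  · refine ⟨Polynomial.C ((n + 1 : ℂ)⁻¹) * Polynomial.X ^ (n + 1), ?_, fun j hj => ?_⟩
    · have : (n + 1 : ℂ) ≠ 0 := by exact_mod_cast Nat.succ_ne_zero n
      rw [ha, Polynomial.derivative_C_mul_X_pow]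
      simp [this]
    · rw [Polynomial.coeff_C_mul_X_pow, if_neg]
      simp only [ha, if_true] at hj
      omega
  · simp only [ha, if_false, add_zero]
    induction n with
    | zero =>
      refine ⟨Polynomial.C a⁻¹, by rw [← Polynomial.C_mul]; simp [ha], fun j hj => ?_⟩
      rw [Polynomial.coeff_C, if_neg (by omega)]
    | succ n ih =>
      obtain ⟨Q, h1, h2⟩ := ih
      -- With `Q` the solution for `X ^ n`, the trial solution `a⁻¹ X ^ (n + 1)` leaves the error
      -- `a⁻¹ (n + 1) X ^ n`, which is removed by a multiple of `Q`.
      refine ⟨Polynomial.C a⁻¹ * (Polynomial.X ^ (n + 1) - Polynomial.C ((n : ℂ) + 1) * Q), ?_,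
        fun j hj => ?_⟩
      · have h3 : Polynomial.C a * Polynomial.C a⁻¹ = (1 : Polynomial ℂ) := by
          rw [← Polynomial.C_mul]; simp [ha]
        simp only [Polynomial.derivative_mul, Polynomial.derivative_C, Polynomial.derivative_sub,
          Polynomial.derivative_X_pow, zero_mul, zero_add]
        simp only [Nat.add_sub_cancel, Polynomial.C_add, Polynomial.C_1, Nat.cast_add, Nat.cast_one,
          Polynomial.derivative_add, Polynomial.derivative_C, Polynomial.derivative_one]
        linear_combination (Polynomial.X ^ (n + 1) - (Polynomial.C (n : ℂ) + 1) * Q) * h3 -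
          Polynomial.C a⁻¹ * (Polynomial.C (n : ℂ) + 1) * h1 +
          (Polynomial.C (n : ℂ) + 1) * Q * h3
      · rw [Polynomial.coeff_C_mul, Polynomial.coeff_sub, Polynomial.coeff_C_mul,
          Polynomial.coeff_X_pow, if_neg (by omega), h2 j (by omega)]
        simp

/-- The terms for the exponents in a list with real part less than `N`. -/
def termsBelow (L : List ℂ) (N : ℝ) : Finset (ℂ × ℕ) :=
  (L.toFinset ×ˢ Finset.range L.length).filter fun s => s.2 < L.count s.1 ∧ s.1.re < N

theorem mem_termsBelow {L : List ℂ} {N : ℝ} {s : ℂ × ℕ} :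
    s ∈ termsBelow L N ↔ s.2 < L.count s.1 ∧ s.1.re < N := by
  simp only [termsBelow, Finset.mem_filter, Finset.mem_product, List.mem_toFinset,
    Finset.mem_range, and_iff_right_iff_imp]
  rintro ⟨h, -⟩
  exact ⟨List.count_pos_iff.1 (by omega), h.trans_le List.count_le_length⟩

/-- Particular solutions of `(∂ - z) Q = V` for finite expansions. -/
theorem IsExpSum.exists_shiftDeriv_eq {L : List ℂ} {N : ℝ} (z : ℂ)
    (hV : IsExpSum i l μ (termsBelow L N) V) :
    ∃ Q, IsExpSum i l μ (termsBelow (z :: L) N) Q ∧ shiftDeriv (unitVec i) z Q = V := by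
  obtain ⟨c, hc, rfl⟩ := hV
  choose q hq1 hq2 using fun s : ℂ × ℕ => exists_polynomial_eq (s.1 - z) s.2
  refine ⟨fun p => ∑ s ∈ termsBelow L N, expPoly i s.1 (q s) (c s) p, ?_, ?_⟩
  · refine IsExpSum.sum _ fun s hs => IsExpSum.of_expPoly (hc s) fun n hn => ?_
    rw [mem_termsBelow] at hs ⊢
    refine ⟨?_, hs.2⟩
    have h1 : n ≤ s.2 + (if s.1 - z = 0 then 1 else 0) := by
      by_contra h
      exact hn (hq2 s n (by omega))
    by_cases h : s.1 = z
    · subst h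
      simp only [sub_self, if_true] at h1
      simp only [List.count_cons_self]
      omega
    · rw [if_neg (sub_ne_zero.2 h)] at h1
      rw [List.count_cons_of_ne (Ne.symm h)]
      exact lt_of_le_of_lt h1 hs.1
  · ext p
    have h3 : HasLineDerivAt ℝ (fun p => ∑ s ∈ termsBelow L N, expPoly i s.1 (q s) (c s) p)
        (∑ s ∈ termsBelow L N,
          expPoly i s.1 (Polynomial.C s.1 * q s + (q s).derivative) (c s) p) p (unitVec i) :=
      HasDerivAt.fun_sum fun s _ => hasLineDerivAt_expPoly i s.1 (q s) (c s) p
    rw [shiftDeriv, h3.lineDeriv, Finset.mul_sum, ← Finset.sum_sub_distrib, expSum]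
    refine Finset.sum_congr rfl fun s _ => ?_
    rw [← hq1 s]
    simp [expPoly]
    ring

variable {x₀ : Fin (k + 1) → ℝ} {y₀ : F} {ε : ℝ}

/-- A power of the logarithm costs an arbitrarily small exponent, here the gap `Re z - γ i`; hence
the strict inequality. -/
theorem SymbolBound.expPoly (hi : x₀ i = 0) (hε : 0 < ε) {γ : Fin (k + 1) → ℝ} {z : ℂ} {n : ℕ}
    {c : (Fin k → ℝ) × F → ℂ} (hz : γ i < z.re)
    (hc : SymbolBound (𝓟 (logBox (i.removeNth x₀) y₀ ε)) (weight (i.removeNth γ)) c) :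
    SymbolBound (𝓟 (logBox x₀ y₀ ε)) (weight γ) (expPoly i z (Polynomial.X ^ n) c) := by
  have h1 := SymbolBound.cexp (𝓟 (logBox x₀ y₀ ε)) z (coordL i)
  have h2 := hc.comp_linear (dropL i) (l' := 𝓟 (logBox x₀ y₀ ε))
    (tendsto_principal_principal.2 fun p hp => dropL_mem_logBox hp)
  have hup : ∀ᶠ p in 𝓟 (logBox x₀ y₀ ε), coordL i p ≤ Real.log ε :=
    eventually_principal.2 fun p hp =>
      (Real.le_log_iff_exp_le hε).2 (exp_lt_of_mem_logBox hi hp).le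
  have h3 : ∀ n : ℕ, ∀ δ > 0, SymbolBound (𝓟 (logBox x₀ y₀ ε)) (fun p => -δ * coordL i p)
      (fun p => (coordL i p : ℂ) ^ n) := by
    intro n
    induction n with
    | zero =>
      intro δ hδ
      simp only [pow_zero]
      refine (SymbolBound.const 1).mono (δ * Real.log ε) (hup.mono fun p hp => ?_)
      nlinarith
    | succ n ih =>
      intro δ hδ
      simp only [pow_succ]
      refine ((ih (δ / 2) (by linarith)).mul (SymbolBound.linear (𝓟 (logBox x₀ y₀ ε)) (coordL i)
        (show 0 < δ / 2 by linarith) hup)).mono 0 (Eventually.of_forall fun p => ?_)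
      apply le_of_eq; ring
  refine SymbolBound.congr isOpenFilter_logBox (U := fun p =>
    Complex.exp (z * (coordL i p : ℂ)) * (coordL i p : ℂ) ^ n * c (dropL i p)) ?_
    (Eventually.of_forall fun p => by simp [ZeroCalculus.expPoly])
  refine ((h1.mul (h3 n (z.re - γ i) (by linarith))).mul h2).mono 0
    (Eventually.of_forall fun p => le_of_eq ?_)
  rw [weight_eq_dropL i γ p, coordL_apply]
  ring

theorem SymbolBound.expSum (hi : x₀ i = 0) (hε : 0 < ε) {γ : Fin (k + 1) → ℝ}
    {c : ℂ × ℕ → (Fin k → ℝ) × F → ℂ} (hS : ∀ s ∈ S, γ i < s.1.re)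
    (hc : ∀ s ∈ S, SymbolBound (𝓟 (logBox (i.removeNth x₀) y₀ ε)) (weight (i.removeNth γ)) (c s)) :
    SymbolBound (𝓟 (logBox x₀ y₀ ε)) (weight γ) (expSum i S c) :=
  SymbolBound.sum S fun s hs => SymbolBound.expPoly hi hε (hS s hs) (hc s hs)

/-- If `∏ (∂ - z) V`, `z ∈ L`, is of order `α i` at `x i = 0`, then so is `V` up to
a finite expansion. -/
theorem exists_expansion (hi : x₀ i = 0) (hε : 0 < ε) {α β : Fin (k + 1) → ℝ}
    (hαβ : ∀ j, j ≠ i → β j = α j) {L : List ℂ} (hL : ∀ z ∈ L, z.re ≠ α i)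
    (hV : SymbolBound (𝓟 (logBox x₀ y₀ ε)) (weight β) V)
    (h : SymbolBound (𝓟 (logBox x₀ y₀ ε)) (weight α) (shiftDerivs (unitVec i) L V)) :
    ∃ W, IsExpSum i (𝓟 (logBox (i.removeNth x₀) y₀ ε)) (weight (i.removeNth α))
      (termsBelow L (α i)) W ∧
      SymbolBound (𝓟 (logBox x₀ y₀ ε)) (weight α) (fun p => V p - W p) := by
  induction L generalizing V with
  | nil => exact ⟨fun _ => 0, IsExpSum.zero, by simpa [shiftDerivs] using h⟩
  | cons z L ih =>
    have hsm := eventually_principal.1 hV.smooth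
    -- The induction hypothesis is applied to `(∂ - z) V`, after moving the factor for `z` to the
    -- innermost place. It remains to invert `∂ - z` on the expansion `W` and on the remainder.
    obtain ⟨W, hW, hVW⟩ := ih (fun z' hz' => hL z' (by simp [hz'])) (hV.shiftDeriv (unitVec i) z)
      (h.congr isOpenFilter_logBox (eventually_principal.2 fun p hp =>
        (shiftDeriv_shiftDerivs_comm _ _ z L (hsm p hp)).eq_of_nhds))
    obtain ⟨Q, hQ, hQW⟩ := hW.exists_shiftDeriv_eq z
    obtain ⟨b, hb⟩ : ∃ b : ℝ, ∀ s ∈ termsBelow (z :: L) (α i), b < s.1.re := by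
      obtain ⟨b, hb⟩ := ((termsBelow (z :: L) (α i)).image fun s => s.1.re).bddBelow
      exact ⟨b - 1, fun s hs => lt_of_lt_of_le (by linarith)
        (hb (Finset.mem_coe.2 (Finset.mem_image_of_mem _ hs)))⟩
    -- A weight at `x i = 0` so low that `V`, the particular solution `Q` and the correction `w` all
    -- satisfy it. It only serves to have some bound before the sharp ones.
    let γ : Fin (k + 1) → ℝ := Function.update α i (min b (min (α i) (β i)))
    have hγi : γ i = min b (min (α i) (β i)) := by simp [γ]
    have hγα : ∀ j, j ≠ i → γ j = α j := fun j hj => by simp [γ, hj]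
    have hγβ : ∀ j, j ≠ i → γ j = β j := fun j hj => by rw [hγα j hj, hαβ j hj]
    have hrem : i.removeNth γ = i.removeNth α :=
      funext fun j => hγα _ (Fin.succAbove_ne i j)
    have hQb : SymbolBound (𝓟 (logBox x₀ y₀ ε)) (weight γ) Q := by
      obtain ⟨c, hc, rfl⟩ := hQ
      refine SymbolBound.expSum hi hε (fun s hs => ?_) fun s _ => by rw [hrem]; exact hc s
      rw [hγi]
      exact lt_of_le_of_lt (min_le_left _ _) (hb s hs)
    have hVQ : SymbolBound (𝓟 (logBox x₀ y₀ ε)) (weight γ) (fun p => V p - Q p) :=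
      (hV.mono_logBox hi hε hγβ
        (by rw [hγi]; exact (min_le_right _ _).trans (min_le_right _ _))).sub hQb
    have hQsm := eventually_principal.1 hQb.smooth
    have hsub : ∀ {A B : (Fin (k + 1) → ℝ) × F → ℂ} {p : (Fin (k + 1) → ℝ) × F},
        ContDiffAt ℝ ∞ A p → ContDiffAt ℝ ∞ B p →
        shiftDeriv (unitVec i) z (fun p => A p - B p) p =
          shiftDeriv (unitVec i) z A p - shiftDeriv (unitVec i) z B p := by
      intro A B p hA hB
      have hd := hA.differentiableAt (by simp)
      have hd' := hB.differentiableAt (by simp)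
      have h1 : lineDeriv ℝ (fun p => A p - B p) p (unitVec i) =
          lineDeriv ℝ A p (unitVec i) - lineDeriv ℝ B p (unitVec i) :=
        (hd.lineDifferentiableAt.hasLineDerivAt.fun_sub
          hd'.lineDifferentiableAt.hasLineDerivAt).deriv
      simp only [shiftDeriv, h1]
      ring
    have hTVQ : SymbolBound (𝓟 (logBox x₀ y₀ ε)) (weight α)
        (shiftDeriv (unitVec i) z fun p => V p - Q p) := by
      refine hVW.congr isOpenFilter_logBox (eventually_principal.2 fun p hp => ?_)
      rw [hsub (hsm p hp) (hQsm p hp), hQW]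
    -- If `Re z < α i`, the remainder equation is solved by integration from the boundary, and the
    -- difference is a homogeneous solution `c x ^ z`, a new term of the expansion. If `Re z > α i`,
    -- the bound propagates and no new term appears.
    rcases lt_or_gt_of_ne (hL z (by simp)) with hlt | hgt
    · obtain ⟨w, hw, hzw⟩ := exists_shiftDeriv_eq hi hlt hTVQ
      have hwsm := eventually_principal.1 hw.smooth
      have hwγ := hw.mono_logBox hi hε hγα
        (by rw [hγi]; exact (min_le_right _ _).trans (min_le_left _ _))
      obtain ⟨c, hc, hcW⟩ := exists_eq_expPoly_of_shiftDeriv_eq_zero hi hε (hVQ.sub hwγ) (z := z)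
        (fun p hp => by rw [hsub ((hsm p hp).sub (hQsm p hp)) (hwsm p hp), hzw p hp, sub_self])
      rw [hrem] at hc
      refine ⟨_, hQ.add (IsExpSum.of_expPoly (q := Polynomial.X ^ 0) (z := z) hc
        fun n hn => ?_), hw.congr isOpenFilter_logBox (eventually_principal.2 fun p hp => ?_)⟩
      · have : n = 0 := by
          by_contra hne
          rw [Polynomial.coeff_X_pow, if_neg hne] at hn
          exact hn rfl
        rw [mem_termsBelow, this]
        exact ⟨by simp, hlt⟩
      · linear_combination -(hcW p hp)
    · exact ⟨Q, hQ, hVQ.of_shiftDeriv hi hε hγα hgt hTVQ⟩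

end ExpSum

/-! ### Uniqueness of expansions -/

section Unique

/-- Induction on the sum of the bounds `d z` for the numbers of coefficients. An operator `∂ - z₀`
lowers it while respecting the bound `O(exp (N τ))`; in the end only a multiple of `exp (z₀ τ)` is
left, which is too large as `τ → -∞` unless it vanishes. -/
theorem eq_zero_of_symbolBound {Z : Finset ℂ} {N τ₀ : ℝ} (hZ : ∀ z ∈ Z, z.re < N)
    {q : ℂ → Polynomial ℂ} (h : SymbolBound (𝓟 (Iio τ₀)) (fun τ => N * τ)
      (fun τ : ℝ => ∑ z ∈ Z, Complex.exp (z * (τ : ℂ)) * (q z).eval (τ : ℂ))) :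
    ∀ z ∈ Z, q z = 0 := by
  obtain ⟨d, hd⟩ : ∃ d : ℂ → ℕ, ∀ z ∈ Z, ∀ n, d z ≤ n → (q z).coeff n = 0 :=
    ⟨fun z => (q z).natDegree + 1, fun z _ n hn => Polynomial.coeff_eq_zero_of_natDegree_lt hn⟩
  generalize hM : ∑ z ∈ Z, d z = M
  induction M generalizing d q with
  | zero =>
    intro z hz
    refine Polynomial.ext fun n => ?_
    rw [hd z hz n (by rw [Finset.sum_eq_zero_iff.1 hM z hz]; exact Nat.zero_le n)]
    simp
  | succ M ih =>
    classical
    obtain ⟨z₀, hz₀, hdz⟩ : ∃ z ∈ Z, d z ≠ 0 := by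
      by_contra hne
      push Not at hne
      rw [Finset.sum_eq_zero hne] at hM
      omega
    have hder : shiftDeriv (1 : ℝ) z₀
        (fun τ : ℝ => ∑ z ∈ Z, Complex.exp (z * (τ : ℂ)) * (q z).eval (τ : ℂ)) =
        fun τ : ℝ => ∑ z ∈ Z, Complex.exp (z * (τ : ℂ)) *
          (Polynomial.C (z - z₀) * q z + (q z).derivative).eval (τ : ℂ) := by
      ext τ
      have h1 : HasDerivAt
          (fun τ : ℝ => ∑ z ∈ Z, Complex.exp (z * (τ : ℂ)) * (q z).eval (τ : ℂ))
          (∑ z ∈ Z, (Complex.exp (z * (τ : ℂ)) * (z * 1) * (q z).eval (τ : ℂ) +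
            Complex.exp (z * (τ : ℂ)) * (q z).derivative.eval (τ : ℂ))) τ :=
        HasDerivAt.fun_sum fun z _ => (((hasDerivAt_id (τ : ℂ)).const_mul z).cexp.mul
          ((q z).hasDerivAt _)).comp_ofReal
      rw [shiftDeriv, h1.differentiableAt.lineDeriv_eq_fderiv, fderiv_apply_one_eq_deriv, h1.deriv,
        Finset.mul_sum, ← Finset.sum_sub_distrib]
      refine Finset.sum_congr rfl fun z _ => ?_
      simp
      ring
    have key := ih (d := Function.update d z₀ (d z₀ - 1)) (by
        have := h.shiftDeriv (1 : ℝ) z₀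
        rwa [hder] at this)
      (fun z hz n hn => by
        rw [Polynomial.coeff_add, Polynomial.coeff_C_mul, Polynomial.coeff_derivative]
        by_cases hzz : z = z₀
        · subst hzz
          rw [Function.update_self] at hn
          rw [hd z hz (n + 1) (by omega)]
          simp
        · rw [Function.update_of_ne hzz] at hn
          rw [hd z hz n hn, hd z hz (n + 1) (by omega)]
          simp)
      (by
        have h1 := Finset.add_sum_erase Z d hz₀
        have h2 : ∑ z ∈ Z.erase z₀, Function.update d z₀ (d z₀ - 1) z = ∑ z ∈ Z.erase z₀, d z :=
          Finset.sum_congr rfl fun z hz => by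
            rw [Function.update_of_ne (Finset.ne_of_mem_erase hz)]
        rw [← Finset.add_sum_erase Z _ hz₀, Function.update_self, h2]
        omega)
    -- If `(z - z₀) q + q' = 0` with `z ≠ z₀`, the leading coefficient of `q` vanishes.
    have hne : ∀ z ∈ Z, z ≠ z₀ → q z = 0 := by
      intro z hz hzz
      by_contra hq
      have h1 := congrArg (fun r : Polynomial ℂ => r.coeff (q z).natDegree) (key z hz)
      simp only [Polynomial.coeff_add, Polynomial.coeff_C_mul, Polynomial.coeff_derivative,
        Polynomial.coeff_zero] at h1
      rw [Polynomial.coeff_eq_zero_of_natDegree_lt (Nat.lt_succ_self _), zero_mul, add_zero] at h1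
      rcases mul_eq_zero.1 h1 with h2 | h2
      · exact hzz (sub_eq_zero.1 h2)
      · exact hq (Polynomial.leadingCoeff_eq_zero.1 h2)
    intro z hz
    by_cases hzz : z = z₀
    · subst hzz
      have h1 := key z hz
      rw [sub_self, Polynomial.C_0, zero_mul, zero_add] at h1
      have h2 := Polynomial.eq_C_of_derivative_eq_zero h1
      obtain ⟨C, hC, hb⟩ := h.norm_le
      rw [eventually_principal] at hb
      have h3 : ∀ τ : ℝ, ∑ z ∈ Z, Complex.exp (z * (τ : ℂ)) * (q z).eval (τ : ℂ) =
          Complex.exp (z * (τ : ℂ)) * (q z).coeff 0 := by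
        intro τ
        rw [Finset.sum_eq_single z]
        · conv_lhs => rw [h2, Polynomial.eval_C]
        · intro z' hz' hne'
          rw [hne z' hz' hne']
          simp
        · exact fun h => absurd hz h
      -- By the preceding steps only the constant of the exponent `z` is left, and its bound tends
      -- to `0` as `τ → -∞` because `Re z < N`.
      have h4 : ∀ τ < τ₀, ‖(q z).coeff 0‖ ≤ C * Real.exp ((N - z.re) * τ) := by
        intro τ hτ
        have h5 := hb τ hτ
        rw [h3, norm_mul, Complex.norm_exp] at h5
        have h6 : (z * (τ : ℂ)).re = z.re * τ := by simp
        rw [h6] at h5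
        have h7 : Real.exp (N * τ) = Real.exp (z.re * τ) * Real.exp ((N - z.re) * τ) := by
          rw [← Real.exp_add]; ring_nf
        rw [h7, mul_left_comm] at h5
        exact le_of_mul_le_mul_left h5 (Real.exp_pos _)
      have h5 : Tendsto (fun τ => C * Real.exp ((N - z.re) * τ)) atBot (𝓝 (C * 0)) :=
        (Real.tendsto_exp_atBot.comp (tendsto_id.const_mul_atBot
          (by have := hZ z hz; linarith))).const_mul C
      rw [mul_zero] at h5
      have h6 : ‖(q z).coeff 0‖ ≤ 0 := ge_of_tendsto h5 ((eventually_lt_atBot τ₀).mono h4)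
      rw [h2, norm_le_zero_iff.1 h6, Polynomial.C_0]
    · exact hne z hz hzz

variable {F : Type*} [NormedAddCommGroup F] [NormedSpace ℝ F] {k : ℕ}
  {x₀ : Fin (k + 1) → ℝ} {y₀ : F} {ε : ℝ} {i : Fin (k + 1)}

/-- The coefficients of an expansion vanish if the expansion vanishes to the order `γ i`. -/
theorem eq_zero_of_expSum (hi : x₀ i = 0) (hε : 0 < ε) {γ : Fin (k + 1) → ℝ}
    {S : Finset (ℂ × ℕ)} (hS : ∀ s ∈ S, s.1.re < γ i) {c : ℂ × ℕ → (Fin k → ℝ) × F → ℂ}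
    (h : SymbolBound (𝓟 (logBox x₀ y₀ ε)) (weight γ) (expSum i S c)) :
    ∀ s ∈ S, ∀ p ∈ logBox (i.removeNth x₀) y₀ ε, c s p = 0 := by
  classical
  intro s hs p hp
  -- For a fixed point `p` of the face, the bound is restricted to the line over `p`, where the
  -- expansion is an exponential polynomial in one variable.
  have h1 := h.comp_affine (l' := 𝓟 (Iio (Real.log ε)))
    (ContinuousLinearMap.toSpanSingleton ℝ (unitVec i)) (insL i p)
    (tendsto_principal_principal.2 fun t ht => by
      rw [ContinuousLinearMap.toSpanSingleton_apply, add_comm (t • unitVec i)]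
      exact insL_add_mem_logBox hi hp ((Real.lt_log_iff_exp_lt hε).1 ht))
  simp only [ContinuousLinearMap.toSpanSingleton_apply, add_comm _ (insL i p), weight_insL_add]
    at h1
  have h2 := h1.mono (ν := fun τ => γ i * τ) (weight (i.removeNth γ) p)
    (Eventually.of_forall fun τ => le_of_eq (by ring))
  let q : ℂ → Polynomial ℂ := fun z =>
    ∑ s ∈ S with s.1 = z, Polynomial.C (c s p) * Polynomial.X ^ s.2
  have h3 : ∀ τ : ℝ, expSum i S c (insL i p + τ • unitVec i) =
      ∑ z ∈ S.image Prod.fst, Complex.exp (z * (τ : ℂ)) * (q z).eval (τ : ℂ) := by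
    intro τ
    rw [expSum, ← Finset.sum_fiberwise_of_maps_to (g := Prod.fst) (t := S.image Prod.fst)
      (fun s hs => Finset.mem_image_of_mem _ hs)]
    refine Finset.sum_congr rfl fun z _ => ?_
    simp only [q]
    rw [Polynomial.eval_finset_sum, Finset.mul_sum]
    refine Finset.sum_congr rfl fun s hs => ?_
    rw [Finset.mem_filter] at hs
    rw [expPoly, dropL_insL_add, hs.2]
    simp
    ring
  simp only [h3] at h2
  have h4 := eq_zero_of_symbolBound (fun z hz => by
    obtain ⟨s, hs, rfl⟩ := Finset.mem_image.1 hz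
    exact hS s hs) h2 s.1 (Finset.mem_image_of_mem _ hs)
  have h5 : (q s.1).coeff s.2 = c s p := by
    simp only [q, Polynomial.finset_sum_coeff, Polynomial.coeff_C_mul_X_pow]
    rw [Finset.sum_eq_single s]
    · simp
    · rintro s' hs' hne
      have hs1 := (Finset.mem_filter.1 hs').2
      rw [if_neg]
      exact fun h => hne (Prod.ext hs1 h.symm)
    · intro h
      refine absurd ?_ h
      exact Finset.mem_filter.2 ⟨hs, rfl⟩
  rw [← h5, h4, Polynomial.coeff_zero]

end Unique

end

section

/-! ### Characterization of polyhomogeneity by products of first order operators -/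

/-- Only finitely many real parts lie in `(N, M]`. A slightly larger order without exponents in
between is needed because `exists_expansion` excludes exponents whose real part equals the order. -/
theorem IndexSet.exists_gap (E : IndexSet) {N M : ℝ} (h : N < M) :
    ∃ N', N < N' ∧ N' ≤ M ∧ ∀ p ∈ E.carrier, p.1.re ≤ N' → p.1.re ≤ N := by
  classical
  let S := ((E.upTo M).image fun p => p.1.re).filter fun r => N < r
  rcases S.eq_empty_or_nonempty with hS | hS
  · refine ⟨M, h, le_rfl, fun p hp hM => ?_⟩
    by_contra hN
    have : p.1.re ∈ S := Finset.mem_filter.2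
      ⟨Finset.mem_image_of_mem (fun p : ℂ × ℕ => p.1.re) (mem_upTo.2 ⟨hp, hM⟩), not_le.1 hN⟩
    rw [hS] at this
    exact absurd this (Finset.notMem_empty _)
  · have h1 : N < S.min' hS := (Finset.mem_filter.1 (S.min'_mem hS)).2
    have h2 : S.min' hS ≤ M := by
      obtain ⟨p, hp, hpe⟩ := Finset.mem_image.1 (Finset.mem_filter.1 (S.min'_mem hS)).1
      rw [← hpe]
      exact (mem_upTo.1 hp).2
    refine ⟨(N + S.min' hS) / 2, by linarith, by linarith, fun p hp hM => ?_⟩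
    by_contra hN
    have : p.1.re ∈ S := Finset.mem_filter.2
      ⟨Finset.mem_image_of_mem (fun p : ℂ × ℕ => p.1.re) (mem_upTo.2 ⟨hp, by linarith⟩),
        not_le.1 hN⟩
    have := S.min'_le _ this
    linarith

theorem IndexSet.Admissible.mem {E : IndexSet} {L : List ℂ} (h : E.Admissible L) {z : ℂ}
    (hz : z ∈ L) : (z, 0) ∈ E.carrier :=
  h z 0 (List.count_pos_iff.2 hz)

section Box

variable {F : Type*} [NormedAddCommGroup F] [NormedSpace ℝ F]

theorem SymbolBound.mono_weight_logBox {k : ℕ} {x₀ : Fin k → ℝ} {y₀ : F} {ε : ℝ} (hε : 0 < ε)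
    {α β : Fin k → ℝ} (h : ∀ j, β j ≤ α j) {V : (Fin k → ℝ) × F → ℂ}
    (hV : SymbolBound (𝓟 (logBox x₀ y₀ ε)) (weight α) V) :
    SymbolBound (𝓟 (logBox x₀ y₀ ε)) (weight β) V := by
  refine hV.mono (∑ j, (α j - β j) * Real.log (|x₀ j| + ε)) (eventually_principal.2 fun p hp => ?_)
  rw [weight, weight, ← Finset.sum_add_distrib]
  refine Finset.sum_le_sum fun j _ => ?_
  have h1 : p.1 j ≤ Real.log (|x₀ j| + ε) := by
    rw [Real.le_log_iff_exp_le (by positivity)]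
    have := abs_lt.1 (hp.1 j)
    linarith [le_abs_self (x₀ j)]
  have := mul_le_mul_of_nonneg_left h1 (sub_nonneg.2 (h j))
  linarith

variable {k : ℕ} {x₀ : Fin (k + 1) → ℝ} {y₀ : F} {ε : ℝ} {i : Fin (k + 1)}
  {U : (Fin (k + 1) → ℝ) × F → ℂ}

theorem expSum_eq_of_subset {S T : Finset (ℂ × ℕ)} (h : S ⊆ T) (c : ℂ × ℕ → (Fin k → ℝ) × F → ℂ)
    [DecidablePred (· ∈ S)] :
    expSum i S c = expSum i T (fun s p => if s ∈ S then c s p else 0) := by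
  ext p
  rw [expSum, expSum, ← Finset.sum_subset h]
  · refine Finset.sum_congr rfl fun s hs => ?_
    simp [expPoly, hs]
  · intro s _ hs
    simp [expPoly, hs]

theorem expSum_sub (S : Finset (ℂ × ℕ)) (c c' : ℂ × ℕ → (Fin k → ℝ) × F → ℂ) :
    expSum i S (fun s p => c s p - c' s p) = fun p => expSum i S c p - expSum i S c' p := by
  ext p
  simp only [expSum, expPoly, mul_sub, Finset.sum_sub_distrib]

theorem shiftDerivs_expPoly_succAbove (j : Fin k) (z : ℂ) (q : Polynomial ℂ) (L : List ℂ)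
    (c : (Fin k → ℝ) × F → ℂ) :
    shiftDerivs (unitVec (i.succAbove j)) L (expPoly i z q c) =
      expPoly i z q (shiftDerivs (unitVec j) L c) := by
  induction L with
  | nil => rfl
  | cons z' L ih =>
    rw [shiftDerivs, ih]
    ext p
    set g := shiftDerivs (unitVec j) L c
    have h1 : lineDeriv ℝ (expPoly i z q g) p (unitVec (i.succAbove j)) =
        Complex.exp (z * (p.1 i : ℂ)) * q.eval (p.1 i : ℂ) *
          lineDeriv ℝ g (dropL i p) (unitVec j) := by
      rw [lineDeriv, lineDeriv, ← deriv_const_mul_field]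
      congr 1
      ext t
      have h2 : (unitVec (i.succAbove j) : (Fin (k + 1) → ℝ) × F).1 i = 0 :=
        unitVec_fst_of_ne (Fin.succAbove_ne i j).symm
      simp [expPoly, h2, dropL_unitVec_succAbove]
    rw [shiftDeriv, h1]
    simp only [expPoly, shiftDerivs, shiftDeriv]
    ring

theorem shiftDerivs_expSum_succAbove {j : Fin k} {S : Finset (ℂ × ℕ)} {L : List ℂ}
    {c : ℂ × ℕ → (Fin k → ℝ) × F → ℂ} {p : (Fin (k + 1) → ℝ) × F}
    (h : ∀ s ∈ S, ContDiffAt ℝ ∞ (c s) (dropL i p)) :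
    shiftDerivs (unitVec (i.succAbove j)) L (expSum i S c) p =
      expSum i S (fun s => shiftDerivs (unitVec j) L (c s)) p := by
  have hs : ∀ s ∈ S, ContDiffAt ℝ ∞ (expPoly i s.1 (Polynomial.X ^ s.2) (c s)) p := by
    intro s hs
    have hdrop : ContDiffAt ℝ ∞ (dropL i : (Fin (k + 1) → ℝ) × F →L[ℝ] (Fin k → ℝ) × F) p :=
      (dropL i : (Fin (k + 1) → ℝ) × F →L[ℝ] (Fin k → ℝ) × F).contDiff.contDiffAt
    have hcoord : ContDiffAt ℝ ∞ (coordL i : (Fin (k + 1) → ℝ) × F →L[ℝ] ℝ) p :=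
      (coordL i : (Fin (k + 1) → ℝ) × F →L[ℝ] ℝ).contDiff.contDiffAt
    refine ContDiffAt.mul (ContDiffAt.mul ?_ ?_) (ContDiffAt.comp p (h s hs) hdrop)
    · exact (contDiffAt_const.mul (Complex.ofRealCLM.contDiff.contDiffAt.comp _ hcoord)).cexp
    · simp only [Polynomial.eval_pow, Polynomial.eval_X]
      exact (Complex.ofRealCLM.contDiff.contDiffAt.comp _ hcoord).pow _
  have h2 := (shiftDerivs_sum S (unitVec (i.succAbove j)) L hs).eq_of_nhds
  refine h2.trans (Finset.sum_congr rfl fun s _ => ?_)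
  rw [shiftDerivs_expPoly_succAbove]

/-- An expansion of `U` at `x i = 0` up to an error of order larger than `α i`. -/
def Expands (E : IndexSet) (x₀ : Fin (k + 1) → ℝ) (y₀ : F) (ε : ℝ) (i : Fin (k + 1))
    (α : Fin (k + 1) → ℝ) (U : (Fin (k + 1) → ℝ) × F → ℂ) (c : ℂ × ℕ → (Fin k → ℝ) × F → ℂ) :
    Prop :=
  (∀ s, SymbolBound (𝓟 (logBox (i.removeNth x₀) y₀ ε)) (weight (i.removeNth α)) (c s)) ∧
  ∃ N' > α i, SymbolBound (𝓟 (logBox x₀ y₀ ε)) (weight (Function.update α i N'))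
    (fun p => U p - expSum i (E.upTo (α i)) c p)

/-- The order `M` lies above `α i`, does not exceed the orders of the two remainders, and has no
exponents between it and `α i`. The additional terms of the longer expansion are then of order `M`
as well, so the difference of the two expansions up to `α i` vanishes to order `M`, and uniqueness
applies. -/
theorem Expands.eq {E : IndexSet} (hi : x₀ i = 0) (hε : 0 < ε) {α α' : Fin (k + 1) → ℝ}
    {c c' : ℂ × ℕ → (Fin k → ℝ) × F → ℂ} (h : Expands E x₀ y₀ ε i α U c)
    (h' : Expands E x₀ y₀ ε i α' U c') (hle : α i ≤ α' i) :
    ∀ s ∈ E.upTo (α i), ∀ p ∈ logBox (i.removeNth x₀) y₀ ε, c s p = c' s p := by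
  classical
  obtain ⟨hc, N, hN, hb⟩ := h
  obtain ⟨hc', N', hN', hb'⟩ := h'
  obtain ⟨M, hM1, hM2, hM3⟩ := E.exists_gap (lt_min hN (hle.trans_lt hN'))
  let γ : Fin (k + 1) → ℝ := Function.update (fun j => min (α j) (α' j)) i M
  have hγi : γ i = M := by simp [γ]
  have hγ : ∀ j, j ≠ i → γ j = min (α j) (α' j) := fun j hj => by simp [γ, hj]
  have hrem : ∀ j, i.removeNth γ j = min (i.removeNth α j) (i.removeNth α' j) := fun j =>
    hγ _ (Fin.succAbove_ne i j)
  have h1 := hb.mono_weight_logBox hε (β := γ) (fun j => by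
    by_cases hj : j = i
    · subst hj
      simpa [hγi] using hM2.trans (min_le_left _ _)
    · simp [hγ j hj, hj])
  have h1' := hb'.mono_weight_logBox hε (β := γ) (fun j => by
    by_cases hj : j = i
    · subst hj
      simpa [hγi] using hM2.trans (min_le_right _ _)
    · simp [hγ j hj, hj])
  have hsub : E.upTo (α i) ⊆ E.upTo (α' i) := fun s hs =>
    IndexSet.mem_upTo.2 ⟨(IndexSet.mem_upTo.1 hs).1, (IndexSet.mem_upTo.1 hs).2.trans hle⟩
  have h2 : SymbolBound (𝓟 (logBox x₀ y₀ ε)) (weight γ)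
      (expSum i (E.upTo (α' i) \ E.upTo (α i)) c') := by
    refine SymbolBound.expSum hi hε (fun s hs => ?_) (fun s _ => (hc' s).mono_weight_logBox hε
      fun j => by rw [hrem]; exact min_le_right _ _)
    rw [Finset.mem_sdiff, IndexSet.mem_upTo, IndexSet.mem_upTo] at hs
    rw [hγi]
    by_contra hlt
    exact hs.2 ⟨hs.1.1, hM3 s hs.1.1 (not_lt.1 hlt)⟩
  have h3 : SymbolBound (𝓟 (logBox x₀ y₀ ε)) (weight γ)
      (expSum i (E.upTo (α i)) fun s p => c s p - c' s p) := by
    refine ((h1'.sub h1).add h2).congr isOpenFilter_logBox (Eventually.of_forall fun p => ?_)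
    have h4 : expSum i (E.upTo (α' i)) c' p = expSum i (E.upTo (α' i) \ E.upTo (α i)) c' p +
        expSum i (E.upTo (α i)) c' p := (Finset.sum_sdiff hsub).symm
    rw [expSum_sub, h4]
    ring
  intro s hs p hp
  refine sub_eq_zero.1 (eq_zero_of_expSum hi hε (fun s hs => ?_) h3 s hs p hp)
  rw [hγi]
  exact (IndexSet.mem_upTo.1 hs).2.trans_lt hM1

end Box

/-- The symbolic version of polyhomogeneity: products of operators `x i ∂_{x i} - z` improve the
order of vanishing at `x i = 0`. -/
structure TestPhg {F : Type*} [NormedAddCommGroup F] [NormedSpace ℝ F] {k : ℕ}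
    (E : Fin k → IndexSet) (x₀ : Fin k → ℝ) (y₀ : F) (ε : ℝ) (U : (Fin k → ℝ) × F → ℂ) : Prop where
  conormal : ∀ α : Fin k → ℝ, (∀ i, ∀ p ∈ (E i).carrier, α i < p.1.re) →
    SymbolBound (𝓟 (logBox x₀ y₀ ε)) (weight α) U
  tests : ∀ i, x₀ i = 0 → ∀ α : Fin k → ℝ, (∀ j, j ≠ i → ∀ p ∈ (E j).carrier, α j < p.1.re) →
    ∃ L, (E i).Admissible L ∧
      SymbolBound (𝓟 (logBox x₀ y₀ ε)) (weight α) (shiftDerivs (unitVec i) L U)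

namespace TestPhg

variable {F : Type*} [NormedAddCommGroup F] [NormedSpace ℝ F]

section Succ

variable {k : ℕ} {E : Fin (k + 1) → IndexSet} {x₀ : Fin (k + 1) → ℝ} {y₀ : F} {ε : ℝ}
  {i : Fin (k + 1)} {U : (Fin (k + 1) → ℝ) × F → ℂ}

theorem smooth (h : TestPhg E x₀ y₀ ε U) : ∀ p ∈ logBox x₀ y₀ ε, ContDiffAt ℝ ∞ U p := by
  choose β hβ using fun j => (E j).exists_lt
  exact eventually_principal.1 (h.conormal β hβ).smooth

/-- The test is carried out at an order slightly above `α i`, chosen by `IndexSet.exists_gap`, so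
that no exponent is resonant and all terms produced have real part at most `α i`. -/
theorem exists_expands (h : TestPhg E x₀ y₀ ε U) (hi : x₀ i = 0) (hε : 0 < ε)
    {α : Fin (k + 1) → ℝ} (hα : ∀ j, j ≠ i → ∀ p ∈ (E j).carrier, α j < p.1.re) :
    ∃ c, Expands (E i) x₀ y₀ ε i α U c := by
  classical
  obtain ⟨N, hN, -, hgap⟩ := (E i).exists_gap (lt_add_one (α i))
  obtain ⟨b, hb⟩ := (E i).exists_lt
  have hoff : ∀ r : ℝ, ∀ j, j ≠ i → Function.update α i r j = α j := fun r j hj => by simp [hj]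
  obtain ⟨L, hL, hLb⟩ := h.tests i hi (Function.update α i N) fun j hj p hp => by
    rw [hoff N j hj]; exact hα j hj p hp
  have hV := h.conormal (Function.update α i b) fun j p hp => by
    by_cases hj : j = i
    · subst hj
      simpa using hb p hp
    · rw [hoff b j hj]; exact hα j hj p hp
  obtain ⟨W, ⟨c, hc, rfl⟩, hW⟩ := exists_expansion hi hε
    (fun j hj => by rw [hoff b j hj, hoff N j hj])
    (fun z hz => by
      rw [Function.update_self]
      intro he
      have := hgap _ (hL.mem hz) he.le
      simp only at this
      linarith) hV hLb
  have hrem : i.removeNth (Function.update α i N) = i.removeNth α :=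
    funext fun j => hoff N _ (Fin.succAbove_ne i j)
  rw [hrem] at hc
  rw [Function.update_self] at hW
  have hsub : termsBelow L N ⊆ (E i).upTo (α i) := fun s hs => by
    rw [mem_termsBelow] at hs
    have := hL s.1 s.2 hs.1
    exact IndexSet.mem_upTo.2 ⟨this, hgap s this hs.2.le⟩
  rw [expSum_eq_of_subset hsub] at hW
  refine ⟨_, fun s => ?_, N, hN, hW⟩
  by_cases hs : s ∈ termsBelow L N
  · simpa [hs] using hc s
  · simpa [hs] using SymbolBound.zero

/-- The coefficient of `s` is taken from the expansion truncated at `Re s`. By uniqueness it agrees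
with the coefficient in every longer expansion and for every choice of weights at the other
hypersurfaces, so it inherits all their bounds. -/
theorem exists_coeff (h : TestPhg E x₀ y₀ ε U) (hi : x₀ i = 0) (hε : 0 < ε) :
    ∃ c : ℂ × ℕ → (Fin k → ℝ) × F → ℂ, ∀ α : Fin (k + 1) → ℝ,
      (∀ j, j ≠ i → ∀ p ∈ (E j).carrier, α j < p.1.re) →
      (∀ s ∈ (E i).upTo (α i),
        SymbolBound (𝓟 (logBox (i.removeNth x₀) y₀ ε)) (weight (i.removeNth α)) (c s)) ∧
      ∃ N' > α i, SymbolBound (𝓟 (logBox x₀ y₀ ε)) (weight (Function.update α i N'))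
        (fun p => U p - expSum i ((E i).upTo (α i)) c p) := by
  choose β hβ using fun j => (E j).exists_lt
  have hoff : ∀ r : ℝ, ∀ j, j ≠ i → Function.update β i r j = β j := fun r j hj => by simp [hj]
  choose d hd using fun r : ℝ => h.exists_expands hi hε (α := Function.update β i r)
    fun j hj p hp => by rw [hoff r j hj]; exact hβ j p hp
  refine ⟨fun s => d s.1.re s, fun α hα => ?_⟩
  obtain ⟨c, hc⟩ := h.exists_expands hi hε hα
  have heq : ∀ s ∈ (E i).upTo (α i), ∀ p ∈ logBox (i.removeNth x₀) y₀ ε,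
      d s.1.re s p = c s p := by
    intro s hs
    rw [IndexSet.mem_upTo] at hs
    refine (hd s.1.re).eq hi hε hc (by simpa using hs.2) s ?_
    rw [IndexSet.mem_upTo]
    exact ⟨hs.1, by simp⟩
  obtain ⟨hcb, N, hN, hb⟩ := hc
  refine ⟨fun s hs => (hcb s).congr isOpenFilter_logBox
    (eventually_principal.2 fun p hp => (heq s hs p hp).symm), N, hN,
    hb.congr isOpenFilter_logBox (eventually_principal.2 fun p hp => ?_)⟩
  rw [expSum, expSum]
  congr 1
  refine Finset.sum_congr rfl fun s hs => ?_
  rw [expPoly, expPoly, heq s hs _ (dropL_mem_logBox hp)]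

/-- To test the coefficient at a second hypersurface `J`, apply the operators for `J` to `U` and
expand at `i`. This requires high order at `i` and at `J` simultaneously, whereas each test gives it
at one of them only, with a poor but fixed order at the other. Applying both products of operators
and interpolating the two bounds gives both. -/
theorem coeff (h : TestPhg E x₀ y₀ ε U) (hi : x₀ i = 0) (hε : 0 < ε)
    {c : ℂ × ℕ → (Fin k → ℝ) × F → ℂ} (hc : ∀ α : Fin (k + 1) → ℝ,
      (∀ j, j ≠ i → ∀ p ∈ (E j).carrier, α j < p.1.re) →
      (∀ s ∈ (E i).upTo (α i),
        SymbolBound (𝓟 (logBox (i.removeNth x₀) y₀ ε)) (weight (i.removeNth α)) (c s)) ∧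
      ∃ N' > α i, SymbolBound (𝓟 (logBox x₀ y₀ ε)) (weight (Function.update α i N'))
        (fun p => U p - expSum i ((E i).upTo (α i)) c p))
    {s : ℂ × ℕ} (hs : s ∈ (E i).carrier) :
    TestPhg (i.removeNth E) (i.removeNth x₀) y₀ ε (c s) := by
  classical
  refine ⟨fun α hα => ?_, fun j hj α hα => ?_⟩
  · have h1 := (hc (i.insertNth s.1.re α) (fun j hj p hp => by
      obtain ⟨j', rfl⟩ := Fin.exists_succAbove_eq hj
      simpa using hα j' p hp)).1 s (by
        rw [IndexSet.mem_upTo]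
        exact ⟨hs, by simp⟩)
    simpa using h1
  choose β hβ using fun j => (E j).exists_lt
  set M := α j with hM
  set J := i.succAbove j with hJ
  have hJi : J ≠ i := Fin.succAbove_ne i j
  set A := β i
  set B := β J
  -- So small that mixing the poor order `B` at `J` with weight `θ` into `M + 1` loses at most `1`.
  set θ : ℝ := 1 / (1 + |M + 1 - B|) with hθ
  have hθ0 : 0 < θ := by positivity
  have hθ1 : θ ≤ 1 := by
    rw [hθ, div_le_one (by positivity)]
    linarith [abs_nonneg (M + 1 - B)]
  have hθM : M ≤ θ * B + (1 - θ) * (M + 1) := by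
    have h1 : θ * (M + 1 - B) ≤ 1 := by
      rw [hθ, div_mul_eq_mul_div, one_mul, div_le_one (by positivity)]
      linarith [le_abs_self (M + 1 - B)]
    nlinarith
  -- So large that, although `N` enters with the small weight `θ`, the interpolated order at `i` is
  -- `Re s + 1`.
  set N := (s.1.re + 1 - (1 - θ) * A) / θ with hN
  have hθN : θ * N + (1 - θ) * A = s.1.re + 1 := by
    rw [hN]; field_simp; ring
  let α₁ : Fin (k + 1) → ℝ := i.insertNth A (Function.update α j (M + 1))
  let α₂ : Fin (k + 1) → ℝ := i.insertNth N (Function.update α j B)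
  have hα' : ∀ j', j' ≠ j → ∀ p ∈ (E (i.succAbove j')).carrier, α j' < p.1.re :=
    fun j' hj' => hα j' hj'
  obtain ⟨Lj, hLj, hLjb⟩ := h.tests J hj α₁ (i.forall_iff_succAbove.2
    ⟨fun _ p hp => by simpa [α₁] using hβ i p hp, fun j' hj' p hp => by
      have hne : j' ≠ j := fun he => hj' (by rw [he])
      simpa [α₁, hne] using hα' j' hne p hp⟩)
  obtain ⟨Li, hLi, hLib⟩ := h.tests i hi α₂ (i.forall_iff_succAbove.2
    ⟨fun h => absurd rfl h, fun j' _ p hp => by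
      by_cases hne : j' = j
      · subst hne
        simpa [α₂] using hβ _ p hp
      · simpa [α₂, hne] using hα' j' hne p hp⟩)
  obtain ⟨N₁, hN₁, hN₁', hgap⟩ := (E i).exists_gap (lt_add_one s.1.re)
  let γ : Fin (k + 1) → ℝ := i.insertNth N₁ α
  have hsm := h.smooth
  -- Two expansions of `V` at `i` are compared: the one obtained from `hTV`, whose coefficients have
  -- order `α j` at `J`, and the one obtained by applying the operators for `J` to the expansion of
  -- `U`.
  set V := shiftDerivs (unitVec J) Lj U with hV
  have hTV : SymbolBound (𝓟 (logBox x₀ y₀ ε)) (weight γ) (shiftDerivs (unitVec i) Li V) := by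
    have h1 : SymbolBound (𝓟 (logBox x₀ y₀ ε)) (weight α₂) (shiftDerivs (unitVec i) Li V) :=
      (hLib.shiftDerivs (unitVec J) Lj).congr isOpenFilter_logBox
        (eventually_principal.2 fun p hp =>
          (shiftDerivs_comm _ _ _ _ (hsm p hp)).eq_of_nhds)
    have h2 := (h1.interpolate (hLjb.shiftDerivs (unitVec i) Li) hθ0.le hθ1).mono
      (ν := weight fun j => θ * α₂ j + (1 - θ) * α₁ j) 0 (Eventually.of_forall fun p => by
        simp only [weight, Finset.mul_sum, ← Finset.sum_add_distrib, add_zero]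
        exact Finset.sum_le_sum fun j _ => le_of_eq (by ring))
    refine h2.mono_weight_logBox hε (i.forall_iff_succAbove.2 ⟨?_, fun j' => ?_⟩)
    · simpa [γ, α₁, α₂, hθN] using hN₁'
    · by_cases hne : j' = j
      · subst hne
        simpa [γ, α₁, α₂] using hθM
      · simp only [γ, α₁, α₂, Fin.insertNth_apply_succAbove, Function.update_of_ne hne]
        linarith
  have hVβ : SymbolBound (𝓟 (logBox x₀ y₀ ε)) (weight (Function.update γ i A)) V := by
    refine hLjb.mono_weight_logBox hε (i.forall_iff_succAbove.2 ⟨by simp [α₁], fun j' => ?_⟩)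
    by_cases hne : j' = j
    · subst hne
      simp [γ, α₁, Fin.succAbove_ne, hM]
    · simp [γ, α₁, Fin.succAbove_ne, hne]
  have hγi : γ i = N₁ := by simp [γ]
  have hγr : i.removeNth γ = α := by simp [γ]
  obtain ⟨W, ⟨c', hc', rfl⟩, hW⟩ := exists_expansion hi hε (fun j hj => by simp [hj])
    (fun z hz => by
      rw [hγi]
      intro he
      have := hgap _ (hLi.mem hz) he.le
      simp only at this
      linarith) hVβ hTV
  rw [hγr] at hc'
  rw [hγi] at hW
  have hsub : termsBelow Li N₁ ⊆ (E i).upTo s.1.re := fun s' hs' => by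
    rw [mem_termsBelow] at hs'
    have := hLi s'.1 s'.2 hs'.1
    exact IndexSet.mem_upTo.2 ⟨this, hgap s' this hs'.2.le⟩
  rw [expSum_eq_of_subset hsub] at hW
  obtain ⟨hcs, N₂, hN₂, hcN⟩ := hc (Function.update β i s.1.re) fun j hj p hp => by
    simpa [hj] using hβ j p hp
  rw [Function.update_self] at hcs hN₂ hcN
  simp only [Function.update_idem] at hcN
  have hcN' : SymbolBound (𝓟 (logBox x₀ y₀ ε)) (weight (Function.update β i N₂))
      (fun p => V p - expSum i ((E i).upTo s.1.re)
        (fun s => shiftDerivs (unitVec j) Lj (c s)) p) := by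
    refine (hcN.shiftDerivs (unitVec J) Lj).congr isOpenFilter_logBox
      (eventually_principal.2 fun p hp => ?_)
    have hcsm : ∀ s' ∈ (E i).upTo s.1.re, ContDiffAt ℝ ∞ (c s') (dropL i p) := fun s' hs' =>
      eventually_principal.1 (hcs s' hs').smooth _ (dropL_mem_logBox hp)
    have h1 : ContDiffAt ℝ ∞ (fun p => U p - expSum i ((E i).upTo s.1.re) c p) p :=
      eventually_principal.1 hcN.smooth p hp
    have h2 : ContDiffAt ℝ ∞ (expSum i ((E i).upTo s.1.re) c) p := by
      have := (hsm p hp).sub h1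
      simpa using this
    have h3 := (shiftDerivs_add (unitVec J) Lj h1 h2).eq_of_nhds
    simp only [sub_add_cancel] at h3
    rw [hV]
    change _ = shiftDerivs (unitVec J) Lj (fun p => U p) p - _
    rw [h3, ← shiftDerivs_expSum_succAbove hcsm]
    simp [hJ]
  let δ : Fin (k + 1) → ℝ := fun j => min (γ j) (Function.update β i N₂ j)
  -- Subtracting the remainders leaves a finite expansion vanishing to an order above `Re s`, so the
  -- coefficients agree. Terms absent from the first expansion have coefficient `0` there.
  have hδ : SymbolBound (𝓟 (logBox x₀ y₀ ε)) (weight δ)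
      (expSum i ((E i).upTo s.1.re) fun s' p => shiftDerivs (unitVec j) Lj (c s') p -
        if s' ∈ termsBelow Li N₁ then c' s' p else 0) := by
    refine ((hW.mono_weight_logBox hε (β := δ) fun j => min_le_left _ _).sub
      (hcN'.mono_weight_logBox hε (β := δ) fun j => min_le_right _ _)).congr isOpenFilter_logBox
      (Eventually.of_forall fun p => ?_)
    rw [expSum_sub]
    ring
  have hδi : s.1.re < δ i := by
    simp only [δ, hγi, Function.update_self]
    exact lt_min hN₁ hN₂
  have heq := eq_zero_of_expSum hi hε
    (fun s' hs' => (IndexSet.mem_upTo.1 hs').2.trans_lt hδi) hδ s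
    (IndexSet.mem_upTo.2 ⟨hs, le_rfl⟩)
  refine ⟨Lj, hLj, SymbolBound.congr isOpenFilter_logBox
    (U := fun p => if s ∈ termsBelow Li N₁ then c' s p else 0) ?_
    (eventually_principal.2 fun p hp => (sub_eq_zero.1 (heq p hp)).symm)⟩
  by_cases hmem : s ∈ termsBelow Li N₁
  · simpa [hmem] using hc' s
  · simpa [hmem] using SymbolBound.zero

end Succ

/-- Induction on the number of hypersurfaces, since `TestPhg.coeff` puts the coefficients in the
same class with one hypersurface fewer. The strictly better order `N'` of the remainder is lowered
to the required `N`. -/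
theorem isPhgAt {k : ℕ} {E : Fin k → IndexSet} {x₀ : Fin k → ℝ} {y₀ : F} {ε : ℝ}
    {u : (Fin k → ℝ) → F → ℂ} (h : TestPhg E x₀ y₀ ε (logPullback u)) (hε : 0 < ε)
    (hx₀ : ∀ i, 0 ≤ x₀ i) : IsPhgAt k E u x₀ y₀ := by
  induction k with
  | zero =>
    have h1 := (isConormalAt_coe_iff (D := univ) hx₀).2
      ((h.conormal 0 fun i => i.elim0).filter_mono (logNhds_le_logBox hε))
    exact h1
  | succ k ih =>
    refine ⟨fun α hα => (isConormalAt_coe_iff hx₀).2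
      ((h.conormal α hα).filter_mono (logNhds_le_logBox hε)), fun i hi => ?_⟩
    obtain ⟨c, hc⟩ := h.exists_coeff hi hε
    let a : ℂ → ℕ → (Fin k → ℝ) → F → ℂ := fun z l x y => c (z, l) (fun j => Real.log (x j), y)
    have ha : ∀ z l, logPullback (a z l) = c (z, l) := fun z l => by
      ext p
      simp [logPullback, a]
    refine ⟨a, fun z l hz => ih ?_ fun j => hx₀ _, fun N α hαi hα => ?_⟩
    · rw [ha]
      exact h.coeff hi hε hc hz
    · rw [isConormalAt_coe_iff hx₀]
      obtain ⟨-, N', hN', hb⟩ := hc α hα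
      rw [hαi] at hb hN'
      refine ((hb.mono_weight_logBox hε (β := α) fun j => ?_).filter_mono
        (logNhds_le_logBox hε)).congr (isOpenFilter_logNhds isOpen_univ _ _)
        (Eventually.of_forall fun p => ?_)
      · by_cases hj : j = i
        · subst hj
          simpa [hαi] using hN'.le
        · simp [hj]
      · have := fun s : ℂ × ℕ => term_eq_expPoly i s.1 s.2 (a s.1 s.2) p
        simp only [logPullback, expSum]
        congr 1
        refine Finset.sum_congr rfl fun s _ => ?_
        rw [this, ha]

end TestPhg

end

section

/-! ### From points to boxes, and products with smooth functions -/

section Compact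

variable {F : Type*} [NormedAddCommGroup F] [NormedSpace ℝ F] {k : ℕ}
  {x₀ : Fin k → ℝ} {y₀ : F} {ε : ℝ}

/-- The part of a closed box neighbourhood where the normal coordinates are nonnegative. -/
def closedBox (x₀ : Fin k → ℝ) (y₀ : F) (ε : ℝ) : Set ((Fin k → ℝ) × F) :=
  {q | (∀ i, 0 ≤ q.1 i ∧ |q.1 i - x₀ i| ≤ ε) ∧ ‖q.2 - y₀‖ ≤ ε}

theorem expMap_mem_closedBox {p : (Fin k → ℝ) × F} (hp : p ∈ logBox x₀ y₀ ε) :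
    expMap p ∈ closedBox x₀ y₀ ε :=
  ⟨fun i => ⟨(Real.exp_pos _).le, (hp.1 i).le⟩, hp.2.le⟩

theorem isCompact_closedBox [ProperSpace F] : IsCompact (closedBox x₀ y₀ ε) := by
  have h1 : closedBox x₀ y₀ ε =
      (Set.univ.pi fun i => Icc (max 0 (x₀ i - ε)) (x₀ i + ε)) ×ˢ Metric.closedBall y₀ ε := by
    ext q
    simp only [closedBox, mem_ofPred_eq, mem_prod, Set.mem_pi, mem_univ, forall_true_left, mem_Icc,
      max_le_iff, Metric.mem_closedBall, dist_eq_norm, abs_le]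
    refine and_congr_left fun _ => forall_congr' fun i => ?_
    constructor
    · rintro ⟨h1, h2, h3⟩
      exact ⟨⟨h1, by linarith⟩, by linarith⟩
    · rintro ⟨⟨h1, h2⟩, h3⟩
      exact ⟨h1, by linarith, by linarith⟩
  rw [h1]
  exact (isCompact_univ_pi fun i => isCompact_Icc).prod (isCompact_closedBall _ _)

theorem exists_nhds_of_eventually_logNhds {P : (Fin k → ℝ) × F → Prop}
    (h : ∀ᶠ p in logNhds univ x₀ y₀, P p) :
    ∃ t ∈ 𝓝 (x₀, y₀), ∀ p, expMap p ∈ t → P p := by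
  obtain ⟨t, ht, htP⟩ := mem_comap.1 h
  obtain ⟨o, ho, hxo, hot⟩ := mem_nhdsWithin.1 ht
  exact ⟨o, ho.mem_nhds hxo, fun p hp => htP (hot ⟨hp, fun i => Real.exp_pos _, mem_univ _⟩)⟩

/-- A logarithmic box is unbounded, but its image in the original coordinates lies in a compact set,
over which local constants can be made uniform. -/
theorem SymbolBound.logBox_of_forall [ProperSpace F] {μ : (Fin k → ℝ) × F → ℝ}
    {U : (Fin k → ℝ) × F → ℂ}
    (h : ∀ q ∈ closedBox x₀ y₀ ε, SymbolBound (logNhds univ q.1 q.2) μ U) :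
    SymbolBound (𝓟 (logBox x₀ y₀ ε)) μ U := by
  have hK : IsCompact (closedBox x₀ y₀ ε) := isCompact_closedBox
  constructor
  · rw [eventually_principal]
    have := hK.induction_on (p := fun S => ∀ p, expMap p ∈ S → ContDiffAt ℝ ∞ U p)
      (fun p hp => absurd hp (notMem_empty _)) (fun s t hst ht p hp => ht p (hst hp))
      (fun s t hs ht p hp => hp.elim (hs p) (ht p))
      (fun q hq => by
        obtain ⟨t, ht, h1⟩ := exists_nhds_of_eventually_logNhds (h q hq).smooth
        exact ⟨t, mem_nhdsWithin_of_mem_nhds ht, h1⟩)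
    exact fun p hp => this p (expMap_mem_closedBox hp)
  · intro m
    have := hK.induction_on (p := fun S => ∃ C : ℝ, 0 < C ∧
        ∀ p, expMap p ∈ S → ‖iteratedFDeriv ℝ m U p‖ ≤ C * Real.exp (μ p))
      ⟨1, one_pos, fun p hp => absurd hp (notMem_empty _)⟩
      (fun s t hst ⟨C, hC, ht⟩ => ⟨C, hC, fun p hp => ht p (hst hp)⟩)
      (fun s t ⟨C, hC, hs⟩ ⟨D, hD, ht⟩ => ⟨C + D, by positivity, fun p hp => by
        have := Real.exp_pos (μ p)
        rcases hp with hp | hp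
        · exact (hs p hp).trans (by gcongr; linarith)
        · exact (ht p hp).trans (by gcongr; linarith)⟩)
      (fun q hq => by
        obtain ⟨C, hC, hb⟩ := (h q hq).exists_pos_bound m
        obtain ⟨t, ht, h1⟩ := exists_nhds_of_eventually_logNhds hb
        exact ⟨t, mem_nhdsWithin_of_mem_nhds ht, C, hC, h1⟩)
    obtain ⟨C, -, hC⟩ := this
    exact ⟨C, eventually_principal.2 fun p hp => hC p (expMap_mem_closedBox hp)⟩

theorem SymbolBound.logBox_of_contDiffOn [ProperSpace F] {O : Set ((Fin k → ℝ) × F)}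
    (hO : IsOpen O) (hsub : closedBox x₀ y₀ ε ⊆ O) {G : (Fin k → ℝ) × F → ℂ}
    (hG : ContDiffOn ℝ ∞ G O) :
    SymbolBound (𝓟 (logBox x₀ y₀ ε)) (fun _ => 0) (fun p => G (expMap p)) :=
  SymbolBound.logBox_of_forall fun q hq => SymbolBound.of_contDiffAt
    (eventually_of_mem (hO.mem_nhds (hsub hq)) fun _ hq' => hG.contDiffAt (hO.mem_nhds hq'))

end Compact

section Smooth

variable {F : Type*} [NormedAddCommGroup F] [NormedSpace ℝ F] {k : ℕ}

theorem fderiv_expMap_unitVec (i : Fin k) (p : (Fin k → ℝ) × F) :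
    fderiv ℝ (expMap : (Fin k → ℝ) × F → (Fin k → ℝ) × F) p (unitVec i) =
      Real.exp (p.1 i) • unitVec i := by
  have hd : DifferentiableAt ℝ (expMap : (Fin k → ℝ) × F → (Fin k → ℝ) × F) p :=
    (contDiff_expMap (F := F)).differentiable (by simp) p
  rw [← hd.lineDeriv_eq_fderiv]
  suffices h : HasLineDerivAt ℝ (expMap : (Fin k → ℝ) × F → (Fin k → ℝ) × F)
      (Real.exp (p.1 i) • unitVec i) p (unitVec i) from h.lineDeriv
  refine HasDerivAt.prodMk (f₁ := fun t : ℝ => (expMap (p + t • (unitVec i : (Fin k → ℝ) × F))).1)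
    (f₂ := fun t : ℝ => (p + t • (unitVec i : (Fin k → ℝ) × F)).2) ?_ ?_
  · refine hasDerivAt_pi.2 fun j => ?_
    by_cases hj : j = i
    · subst hj
      have h1 : HasDerivAt (fun t : ℝ => p.1 j + t) 1 0 := (hasDerivAt_id (0 : ℝ)).const_add _
      simpa [unitVec, expMap] using h1.exp
    · simpa [unitVec, expMap, hj] using hasDerivAt_const (0 : ℝ) (Real.exp (p.1 j))
  · simpa [unitVec] using hasDerivAt_const (0 : ℝ) p.2

/-- The iterated derivative in the direction of a normal coordinate. -/
def normalDeriv (i : Fin k) : ℕ → ((Fin k → ℝ) × F → ℂ) → (Fin k → ℝ) × F → ℂ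
  | 0, G => G
  | n + 1, G => fun q => fderiv ℝ (normalDeriv i n G) q (unitVec i)

theorem contDiffOn_normalDeriv (i : Fin k) (n : ℕ) {O : Set ((Fin k → ℝ) × F)} (hO : IsOpen O)
    {G : (Fin k → ℝ) × F → ℂ} (hG : ContDiffOn ℝ ∞ G O) :
    ContDiffOn ℝ ∞ (normalDeriv i n G) O := by
  induction n with
  | zero => exact hG
  | succ n ih =>
    intro q hq
    exact (contDiffAt_lineDeriv (unitVec i) (ih.contDiffAt (hO.mem_nhds hq))).contDiffWithinAt

/-- `(δ - (n-1)) ⋯ (δ - 1) δ = x ^ n ∂_x ^ n` for `δ = x ∂_x`. -/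
theorem shiftDerivs_comp_expMap (i : Fin k) (n : ℕ) {O : Set ((Fin k → ℝ) × F)} (hO : IsOpen O)
    {G : (Fin k → ℝ) × F → ℂ} (hG : ContDiffOn ℝ ∞ G O) {p : (Fin k → ℝ) × F}
    (hp : expMap p ∈ O) :
    shiftDerivs (unitVec i) ((List.range n).reverse.map fun j : ℕ => (j : ℂ))
      (fun p => G (expMap p)) p =
        Complex.exp ((n : ℂ) * (p.1 i : ℂ)) * normalDeriv i n G (expMap p) := by
  induction n generalizing p with
  | zero => simp [shiftDerivs, normalDeriv]
  | succ n ih =>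
    rw [List.range_succ, List.reverse_append]
    simp only [List.reverse_cons, List.reverse_nil, List.nil_append, List.cons_append,
      List.map_cons, shiftDerivs]
    have hev : shiftDerivs (unitVec i) ((List.range n).reverse.map fun j : ℕ => (j : ℂ))
        (fun p => G (expMap p)) =ᶠ[𝓝 p]
          fun p => Complex.exp ((n : ℂ) * (p.1 i : ℂ)) * normalDeriv i n G (expMap p) :=
      eventually_of_mem ((hO.preimage continuous_expMap).mem_nhds hp) fun p' hp' => ih hp'
    rw [(shiftDeriv_congr (unitVec i) (n : ℂ) hev).eq_of_nhds]
    have hd : DifferentiableAt ℝ (normalDeriv i n G) (expMap p) :=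
      ((contDiffOn_normalDeriv i n hO hG).contDiffAt (hO.mem_nhds hp)).differentiableAt (by simp)
    have h1 : HasLineDerivAt ℝ (fun p => normalDeriv i n G (expMap p))
        (fderiv ℝ (normalDeriv i n G) (expMap p) (Real.exp (p.1 i) • unitVec i)) p (unitVec i) := by
      have hde : DifferentiableAt ℝ (expMap : (Fin k → ℝ) × F → (Fin k → ℝ) × F) p :=
        contDiff_expMap.differentiable (by simp) p
      rw [← fderiv_expMap_unitVec]
      exact (hd.hasFDerivAt.comp p hde.hasFDerivAt).hasLineDerivAt (unitVec i)
    have h2 : HasDerivAt (fun t : ℝ => Complex.exp ((n : ℂ) * ((p.1 i + t : ℝ) : ℂ)))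
        (Complex.exp ((n : ℂ) * (p.1 i : ℂ)) * (n : ℂ)) 0 := by
      have h3 : HasDerivAt (fun w : ℂ => Complex.exp ((n : ℂ) * ((p.1 i : ℂ) + w)))
          (Complex.exp ((n : ℂ) * ((p.1 i : ℂ) + ((0 : ℝ) : ℂ))) * ((n : ℂ) * 1)) ((0 : ℝ) : ℂ) :=
        (((hasDerivAt_id _).const_add _).const_mul (n : ℂ)).cexp
      have := h3.comp_ofReal
      simpa using this
    have h3 := HasDerivAt.mul h2 h1
    have h4 : lineDeriv ℝ (fun p : (Fin k → ℝ) × F =>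
        Complex.exp ((n : ℂ) * (p.1 i : ℂ)) * normalDeriv i n G (expMap p)) p (unitVec i) =
        Complex.exp ((n : ℂ) * (p.1 i : ℂ)) * (n : ℂ) * normalDeriv i n G (expMap p) +
          Complex.exp ((n : ℂ) * (p.1 i : ℂ)) *
            (Complex.exp (p.1 i : ℂ) * normalDeriv i (n + 1) G (expMap p)) := by
      refine HasLineDerivAt.lineDeriv ?_
      refine (h3.congr_of_eventuallyEq (Eventually.of_forall fun t => ?_)).congr_deriv ?_
      · simp
      · simp [normalDeriv]
    rw [shiftDeriv, h4]
    have h5 : Complex.exp (((n + 1 : ℕ) : ℂ) * (p.1 i : ℂ)) =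
        Complex.exp ((n : ℂ) * (p.1 i : ℂ)) * Complex.exp (p.1 i : ℂ) := by
      rw [← Complex.exp_add]
      congr 1
      push_cast
      ring
    rw [h5]
    ring

end Smooth

section Product

variable {F : Type*} [NormedAddCommGroup F] [NormedSpace ℝ F] {k : ℕ}

/-- Conjugation by `x i ^ a` shifts exponents by `a`; the factor `c` does not depend on `x i`. -/
theorem shiftDerivs_expPoly_mul (i : Fin (k + 1)) (a : ℂ) (c : (Fin k → ℝ) × F → ℂ) (L : List ℂ)
    {U : (Fin (k + 1) → ℝ) × F → ℂ} {p : (Fin (k + 1) → ℝ) × F} (hU : ContDiffAt ℝ ∞ U p) :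
    shiftDerivs (unitVec i) (L.map (· + a)) (fun p => expPoly i a (Polynomial.X ^ 0) c p * U p)
      =ᶠ[𝓝 p] fun p => expPoly i a (Polynomial.X ^ 0) c p * shiftDerivs (unitVec i) L U p := by
  induction L with
  | nil => rfl
  | cons z L ih =>
    refine (shiftDeriv_congr (unitVec i) (z + a) ih).trans ?_
    have h1 : ContDiffAt ℝ 1 (shiftDerivs (unitVec i) L U) p :=
      (contDiffAt_shiftDerivs _ L hU).of_le (by simp)
    filter_upwards [h1.eventually (by simp)] with q hq
    have h2 := (hq.differentiableAt (by simp)).lineDifferentiableAt.hasLineDerivAt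
      (v := (unitVec i : (Fin (k + 1) → ℝ) × F))
    have h3 : lineDeriv ℝ (fun p => expPoly i a (Polynomial.X ^ 0) c p *
        shiftDerivs (unitVec i) L U p) q (unitVec i) = _ :=
      HasDerivAt.deriv (HasDerivAt.mul (hasLineDerivAt_expPoly i a (Polynomial.X ^ 0) c q) h2)
    rw [shiftDeriv, h3]
    simp [expPoly, shiftDerivs, shiftDeriv]
    ring

theorem IndexSet.add_nat_mem (E : IndexSet) {z : ℂ} {l : ℕ} (h : (z, l) ∈ E.carrier) (n : ℕ) :
    (z + n, l) ∈ E.carrier := by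
  induction n with
  | zero => simpa using h
  | succ n ih =>
    have := E.add_one_mem _ _ ih
    push_cast
    rwa [← add_assoc]

theorem IndexSet.Admissible.map_add {E : IndexSet} {L : List ℂ} (h : E.Admissible L) (n : ℕ) :
    E.Admissible (L.map (· + (n : ℂ))) := by
  intro z l hl
  have h1 : (L.map (· + (n : ℂ))).count z = L.count (z - n) := by
    have := List.count_map_of_injective L (· + (n : ℂ)) (add_left_injective (n : ℂ)) (z - n)
    simpa using this
  rw [h1] at hl
  simpa using E.add_nat_mem (h _ _ hl) n

theorem IndexSet.Admissible.nil (E : IndexSet) : E.Admissible [] := fun _ _ h => by simp at h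

variable {E : Fin (k + 1) → IndexSet} {x₀ : Fin (k + 1) → ℝ} {y₀ : F} {ε : ℝ}
  {U : (Fin (k + 1) → ℝ) × F → ℂ}

/-- Expand `G` in powers of `x i`. A term `x i ^ j * c` only shifts exponents by `j`, and the index
set is stable under this; the Taylor remainder times `U` has large order without any operator being
applied. The expansion of `G` itself is obtained from `exists_expansion`, with the exponents `0, …,
n - 1`. -/
theorem TestPhg.smooth_mul [ProperSpace F] (h : TestPhg E x₀ y₀ ε U) (hε : 0 < ε)
    {O : Set ((Fin (k + 1) → ℝ) × F)} (hO : IsOpen O) (hsub : closedBox x₀ y₀ ε ⊆ O)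
    {G : (Fin (k + 1) → ℝ) × F → ℂ} (hG : ContDiffOn ℝ ∞ G O) :
    TestPhg E x₀ y₀ ε (fun p => G (expMap p) * U p) := by
  have hG0 := SymbolBound.logBox_of_contDiffOn hO hsub hG
  refine ⟨fun α hα => (hG0.mul (h.conormal α hα)).mono 0 (Eventually.of_forall fun p => by simp),
    fun i hi α hα => ?_⟩
  obtain ⟨b, hb⟩ := (E i).exists_lt
  obtain ⟨n, hn⟩ := exists_nat_ge (α i - b + 1)
  have hoff : ∀ (β : Fin (k + 1) → ℝ) (r : ℝ), ∀ j, j ≠ i → Function.update β i r j = β j :=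
    fun β r j hj => by simp [hj]
  set L := (List.range n).reverse.map fun j : ℕ => (j : ℂ) with hL
  have hLmem : ∀ z ∈ L, ∃ j : ℕ, j < n ∧ z = j := by
    intro z hz
    obtain ⟨j, hj, rfl⟩ := List.mem_map.1 hz
    exact ⟨j, by simpa using hj, rfl⟩
  -- Half an integer, to avoid resonance with the exponents of `G`. By the choice of `n`, the order
  -- `N + b` of remainder times `U` exceeds `α i`.
  set N : ℝ := n - 1 / 2 with hN
  have hT : SymbolBound (𝓟 (logBox x₀ y₀ ε)) (weight (Function.update 0 i N))
      (shiftDerivs (unitVec i) L fun p => G (expMap p)) := by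
    have h1 := (SymbolBound.cexp (𝓟 (logBox x₀ y₀ ε)) (n : ℂ) (coordL i)).mul
      (SymbolBound.logBox_of_contDiffOn hO hsub (contDiffOn_normalDeriv i n hO hG))
    have h2 : SymbolBound (𝓟 (logBox x₀ y₀ ε)) (weight (Function.update 0 i (n : ℝ)))
        (shiftDerivs (unitVec i) L fun p => G (expMap p)) := by
      refine (h1.mono 0 (Eventually.of_forall fun p => ?_)).congr isOpenFilter_logBox
        (eventually_principal.2 fun p hp => ?_)
      · have := weight_eq_add_mul i (hoff 0 (n : ℝ)) p
        rw [this]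
        simp [weight]
      · rw [hL, shiftDerivs_comp_expMap i n hO hG (hsub (expMap_mem_closedBox hp)), coordL_apply]
    refine h2.mono_logBox hi hε (fun j hj => by simp [hj]) ?_
    simp [hN]
  have hG0' : SymbolBound (𝓟 (logBox x₀ y₀ ε)) (weight (0 : Fin (k + 1) → ℝ))
      fun p => G (expMap p) :=
    hG0.mono 0 (Eventually.of_forall fun p => by simp [weight])
  obtain ⟨W, ⟨c, hc, rfl⟩, hw⟩ := exists_expansion hi hε (fun j hj => by simp [hj])
    (fun z hz => by
      obtain ⟨j, hj, rfl⟩ := hLmem z hz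
      rw [Function.update_self]
      intro he
      have h1 : (2 * j + 1 : ℝ) = 2 * n := by
        have : (j : ℝ) = n - 1 / 2 := by simpa [hN] using he
        linarith
      have h2 : 2 * j + 1 = 2 * n := by exact_mod_cast h1
      omega) hG0' hT
  have hrem : i.removeNth (Function.update (0 : Fin (k + 1) → ℝ) i N) = 0 :=
    funext fun j => hoff 0 N _ (Fin.succAbove_ne i j)
  rw [hrem] at hc
  set S := termsBelow L (Function.update (0 : Fin (k + 1) → ℝ) i N i) with hS
  -- The exponents are distinct, so each has multiplicity one and no logarithms occur.
  have hSmem : ∀ s ∈ S, ∃ j : ℕ, s = ((j : ℂ), 0) := by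
    intro s hs
    rw [hS, mem_termsBelow] at hs
    obtain ⟨j, -, hj⟩ := hLmem s.1 (List.count_pos_iff.1 (by omega))
    have hnd : L.Nodup := by
      rw [hL]
      exact (List.nodup_reverse.2 (List.nodup_range)).map Nat.cast_injective
    have := List.nodup_iff_count_le_one.1 hnd s.1
    exact ⟨j, Prod.ext hj (by simp; omega)⟩
  choose jj hjj using hSmem
  have hsm : ∀ p ∈ logBox x₀ y₀ ε, ContDiffAt ℝ ∞ U p := h.smooth
  have htest : ∀ s : ℂ × ℕ, ∃ L', (E i).Admissible L' ∧ (s ∈ S → SymbolBound (𝓟 (logBox x₀ y₀ ε))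
      (weight α) (shiftDerivs (unitVec i) L'
        fun p => expPoly i s.1 (Polynomial.X ^ s.2) (c s) p * U p)) := by
    intro s
    by_cases hs : s ∈ S
    · obtain ⟨j, hj⟩ : ∃ j : ℕ, s = ((j : ℂ), 0) := ⟨jj s hs, hjj s hs⟩
      -- The factor `x i ^ j` contributes `j` to the order, so `U` is tested at `α i - j` only.
      obtain ⟨L', hL', hb'⟩ := h.tests i hi (Function.update α i (α i - j)) fun j' hj' p hp => by
        rw [hoff α _ j' hj']; exact hα j' hj' p hp
      refine ⟨_, hL'.map_add j, fun _ => ?_⟩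
      have h1 := (SymbolBound.cexp (𝓟 (logBox x₀ y₀ ε)) (j : ℂ) (coordL i)).mul
        ((hc s).comp_linear (dropL i) (l' := 𝓟 (logBox x₀ y₀ ε))
          (tendsto_principal_principal.2 fun p hp => dropL_mem_logBox hp))
      refine ((h1.mul hb').mono 0 (Eventually.of_forall fun p => ?_)).congr isOpenFilter_logBox
        (eventually_principal.2 fun p hp => ?_)
      · have h2 := weight_eq_add_mul i (hoff α (α i - j)) p
        rw [h2]
        simp [weight]
      · rw [hj]
        rw [(shiftDerivs_expPoly_mul i (j : ℂ) (c _) L' (hsm p hp)).eq_of_nhds]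
        simp [expPoly]
    · exact ⟨[], IndexSet.Admissible.nil _, fun h => absurd h hs⟩
  choose L₁ hL₁ hL₁b using htest
  -- Each term comes with its own list; one admissible list containing all of them is applied to the
  -- whole product.
  obtain ⟨L', hL', hsubp⟩ := IndexSet.Admissible.exists_common S fun s _ => hL₁ s
  refine ⟨L', hL', ?_⟩
  have hcsm : ∀ s, ∀ p ∈ logBox x₀ y₀ ε,
      ContDiffAt ℝ ∞ (fun p => expPoly i s.1 (Polynomial.X ^ s.2) (c s) p * U p) p := by
    intro s p hp
    have hs : SymbolBound (𝓟 (logBox x₀ y₀ ε)) (weight (Function.update 0 i (s.1.re - 1)))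
        (expPoly i s.1 (Polynomial.X ^ s.2) (c s)) := by
      refine SymbolBound.expPoly hi hε (by simp) ?_
      have hrem' : i.removeNth (Function.update (0 : Fin (k + 1) → ℝ) i (s.1.re - 1)) = 0 :=
        funext fun j => hoff 0 _ _ (Fin.succAbove_ne i j)
      rw [hrem']
      exact hc s
    exact (eventually_principal.1 hs.smooth p hp).mul (hsm p hp)
  have hrest : SymbolBound (𝓟 (logBox x₀ y₀ ε)) (weight α)
      (fun p => (G (expMap p) - expSum i S c p) * U p) := by
    have h1 := h.conormal (Function.update α i b) fun j p hp => by
      by_cases hj : j = i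
      · subst hj
        simpa using hb p hp
      · rw [hoff α b j hj]; exact hα j hj p hp
    have h2 : SymbolBound (𝓟 (logBox x₀ y₀ ε)) (weight (Function.update α i (N + b)))
        (fun p => (G (expMap p) - expSum i S c p) * U p) := by
      refine (hw.mul h1).mono 0 (Eventually.of_forall fun p => ?_)
      rw [weight_eq_add_mul i (hoff α b) p, weight_eq_add_mul i (hoff α (N + b)) p,
        weight_eq_add_mul i (hoff 0 N) p]
      simp [weight]
      linarith
    refine h2.mono_logBox hi hε (fun j hj => by simp [hj]) ?_
    simp [hN]
    linarith
  refine ((hrest.shiftDerivs (unitVec i) L').add (SymbolBound.sum S fun s hs =>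
    SymbolBound.shiftDerivs_of_subperm isOpenFilter_logBox (hsubp s hs)
      (eventually_principal.2 (hcsm s)) (hL₁b s hs))).congr isOpenFilter_logBox
      (eventually_principal.2 fun p hp => ?_)
  have hA : ContDiffAt ℝ ∞ (fun p => (G (expMap p) - expSum i S c p) * U p) p :=
    eventually_principal.1 hrest.smooth p hp
  have hB : ContDiffAt ℝ ∞
      (fun p => ∑ s ∈ S, expPoly i s.1 (Polynomial.X ^ s.2) (c s) p * U p) p :=
    ContDiffAt.sum fun s _ => hcsm s p hp
  have h1 := (shiftDerivs_add (unitVec i) L' hA hB).eq_of_nhds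
  have h2 := (shiftDerivs_sum S (unitVec i) L' fun s _ => hcsm s p hp).eq_of_nhds
  rw [h2] at h1
  rw [← h1]
  congr 1
  ext p
  rw [expSum, ← Finset.sum_mul]
  ring

end Product

end

section

/-! ### Oscillatory integrals of homogeneous symbols -/

variable {d : ℕ}

/-- Functions `Ψ (p, y, ξ)`, smooth in `ξ ≠ 0`, homogeneous of degree `σ` with respect to the
scaling of `(exp (-p), ξ)`, of order `β` in `exp p` and rapidly decreasing. -/
structure HomSymbol (B : Set (Tan d)) (β : Fin 2 → ℝ) (σ : ℝ)
    (Ψ : ((Fin 2 → ℝ) × Tan d) × Tan d → ℂ) : Prop where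
  smooth : ∀ τ ξ, τ.2 ∈ B → ξ ≠ 0 → ContDiffAt ℝ ∞ Ψ (τ, ξ)
  hom : ∀ r : ℝ, 0 < r → ∀ τ ξ, ξ ≠ 0 →
    Ψ (τ, r • ξ) = ((r ^ σ : ℝ) : ℂ) * Ψ ((fun i => τ.1 i + Real.log r, τ.2), ξ)
  bound : ∀ m N : ℕ, ∃ C > 0, ∀ τ ξ, τ.2 ∈ B → ‖ξ‖ = 1 → ‖iteratedFDeriv ℝ m Ψ (τ, ξ)‖ ≤
    C * Real.exp (weight β τ) / (1 + (Real.exp (τ.1 0) + Real.exp (τ.1 1))) ^ N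

theorem weight_fin_two {F : Type*} (β : Fin 2 → ℝ) (q : (Fin 2 → ℝ) × F) :
    weight β q = β 0 * q.1 0 + β 1 * q.1 1 := by
  simp [weight, Fin.sum_univ_two]

namespace HomSymbol

variable {B : Set (Tan d)} {β : Fin 2 → ℝ} {σ : ℝ} {Ψ : ((Fin 2 → ℝ) × Tan d) × Tan d → ℂ}

/-- With `ξ = r θ`, `|θ| = 1`, homogeneity transfers the bound from the unit sphere: the factor `r ^
σ` and the translation of both logarithmic coordinates by `log r` give the power of `|ξ|`. The
translation does not affect derivatives in `τ`. -/
theorem slice_bound (h : HomSymbol B β σ Ψ) (m N : ℕ) :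
    ∃ C > 0, ∀ τ ξ, τ.2 ∈ B → ξ ≠ 0 → ‖iteratedFDeriv ℝ m (fun τ => Ψ (τ, ξ)) τ‖ ≤
      C * Real.exp (weight β τ) * (‖ξ‖ ^ (σ + β 0 + β 1) /
        (1 + ‖ξ‖ * (Real.exp (τ.1 0) + Real.exp (τ.1 1))) ^ N) := by
  obtain ⟨C, hC, hb⟩ := h.bound m N
  refine ⟨C, hC, fun τ ξ hτ hξ => ?_⟩
  have hr : 0 < ‖ξ‖ := norm_pos_iff.2 hξ
  set r := ‖ξ‖ with hrdef
  set θ := r⁻¹ • ξ with hθ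
  have hθ1 : ‖θ‖ = 1 := by
    rw [hθ, norm_smul, norm_inv, Real.norm_of_nonneg hr.le, inv_mul_cancel₀ hr.ne']
  have hθ0 : θ ≠ 0 := by
    rw [← norm_pos_iff, hθ1]; exact one_pos
  have hξθ : ξ = r • θ := by rw [hθ, smul_smul, mul_inv_cancel₀ hr.ne', one_smul]
  let A : (Fin 2 → ℝ) × Tan d →L[ℝ] ((Fin 2 → ℝ) × Tan d) × Tan d := ContinuousLinearMap.inl ℝ _ _
  let c : ((Fin 2 → ℝ) × Tan d) × Tan d := ((fun _ => Real.log r, 0), θ)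
  have hAc : ∀ τ' : (Fin 2 → ℝ) × Tan d,
      A τ' + c = ((fun i => τ'.1 i + Real.log r, τ'.2), θ) := by
    intro τ'
    refine Prod.ext (Prod.ext ?_ ?_) ?_
    · ext i; simp [A, c]
    · simp [A, c]
    · simp [A, c]
  have hfun : (fun τ => Ψ (τ, ξ)) = fun τ' => ((r ^ σ : ℝ) : ℂ) • Ψ (A τ' + c) := by
    ext τ'
    rw [hAc, hξθ, h.hom r hr _ _ hθ0, smul_eq_mul]
  have hle : (m : ℕ∞ω) ≤ ∞ := natCast_le_infty m
  have hsm : ContDiffAt ℝ m Ψ (A τ + c) := by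
    rw [hAc]; exact (h.smooth (fun i => τ.1 i + Real.log r, τ.2) _ hτ hθ0).of_le hle
  have hsm' : ContDiffAt ℝ m (fun τ' => Ψ (A τ' + c)) τ :=
    hsm.comp τ (A.contDiff.contDiffAt.add contDiffAt_const)
  rw [hfun, iteratedFDeriv_const_smul_apply' (a := ((r ^ σ : ℝ) : ℂ)) hsm', norm_smul]
  have h1 := norm_iteratedFDeriv_comp_affine_le A c hsm
  have hA : ‖A‖ ^ m ≤ 1 := pow_le_one₀ (norm_nonneg _) (ContinuousLinearMap.norm_inl_le_one ℝ _ _)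
  have h2 : ‖iteratedFDeriv ℝ m Ψ (A τ + c)‖ ≤
      C * (Real.exp (weight β τ) * r ^ (β 0 + β 1)) /
        (1 + r * (Real.exp (τ.1 0) + Real.exp (τ.1 1))) ^ N := by
    rw [hAc]
    refine (hb (fun i => τ.1 i + Real.log r, τ.2) θ hτ hθ1).trans_eq ?_
    have e1 : ∀ x : ℝ, Real.exp (x + Real.log r) = r * Real.exp x := fun x => by
      rw [Real.exp_add, Real.exp_log hr, mul_comm]
    have e2 : Real.exp (weight β ((fun i => τ.1 i + Real.log r, τ.2) : (Fin 2 → ℝ) × Tan d)) =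
        Real.exp (weight β τ) * r ^ (β 0 + β 1) := by
      rw [Real.rpow_def_of_pos hr, ← Real.exp_add, weight_fin_two, weight_fin_two]
      congr 1
      ring
    rw [e2]
    simp only [e1]
    rw [mul_add]
  calc _ ≤ r ^ σ * (C * (Real.exp (weight β τ) * r ^ (β 0 + β 1)) /
        (1 + r * (Real.exp (τ.1 0) + Real.exp (τ.1 1))) ^ N) := by
        rw [Complex.norm_real, Real.norm_of_nonneg (Real.rpow_nonneg hr.le σ)]
        gcongr
        exact (h1.trans (mul_le_of_le_one_right (norm_nonneg _) hA)).trans h2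
    _ = _ := by
        have h3 : r ^ (σ + β 0 + β 1) = r ^ σ * r ^ (β 0 + β 1) := by
          rw [add_assoc, Real.rpow_add hr]
        rw [h3]
        ring

/-- Differentiation in the covariable lowers the degree. -/
theorem fderiv_snd (hB : IsOpen B) (h : HomSymbol B β σ Ψ) (v : Tan d) :
    HomSymbol B β (σ - 1) (fun q => lineDeriv ℝ Ψ q (0, v)) := by
  refine ⟨fun τ ξ hτ hξ => ?_, fun r hr τ ξ hξ => ?_, fun m N => ?_⟩
  · exact (contDiffAt_lineDeriv _ (h.smooth τ ξ hτ hξ)).congr_of_eventuallyEq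
      (lineDeriv_eventuallyEq _ (h.smooth τ ξ hτ hξ))
  · have h1 : ∀ᶠ t : ℝ in 𝓝 0, ξ + t • (r⁻¹ • v) ≠ 0 := by
      have : ContinuousAt (fun t : ℝ => ξ + t • (r⁻¹ • v)) 0 := by fun_prop
      exact this.eventually_ne (by simpa using hξ)
    -- Moving `r ξ` by `t v` is moving `ξ` by `t r⁻¹ v` before scaling; the factor `r⁻¹` is the loss
    -- of one degree.
    have h2 : (fun t : ℝ => Ψ ((τ, r • ξ) + t • (0, v))) =ᶠ[𝓝 0] fun t : ℝ =>
        ((r ^ σ : ℝ) : ℂ) * (fun t : ℝ => Ψ (((fun i => τ.1 i + Real.log r, τ.2), ξ) +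
          t • (0, v))) (r⁻¹ * t) := by
      filter_upwards [h1] with t ht
      have h3 := h.hom r hr τ _ ht
      have h4 : (τ, r • ξ) + t • ((0 : (Fin 2 → ℝ) × Tan d), v) =
          (τ, r • (ξ + t • (r⁻¹ • v))) := by
        refine Prod.ext (by simp) ?_
        simp only [Prod.snd_add, Prod.smul_snd, smul_add]
        rw [smul_comm r t, smul_smul r, mul_inv_cancel₀ hr.ne', one_smul]
      rw [h4, h3]
      congr 2
      refine Prod.ext (by simp) ?_
      simp [smul_smul, mul_comm]
    have h5 := deriv_comp_mul_left r⁻¹ (fun t : ℝ => Ψ (((fun i => τ.1 i + Real.log r, τ.2), ξ) +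
      t • (0, v))) 0
    rw [mul_zero] at h5
    rw [lineDeriv, h2.deriv_eq, deriv_const_mul_field, h5, Real.rpow_sub hr,
      Real.rpow_one, lineDeriv, Complex.real_smul]
    push_cast
    ring
  · obtain ⟨C, hC, hb⟩ := h.bound (m + 1) N
    refine ⟨(‖v‖ + 1) * C, by positivity, fun τ ξ hτ hξ => ?_⟩
    have hξ0 : ξ ≠ 0 := by rw [← norm_pos_iff, hξ]; exact one_pos
    refine (norm_iteratedFDeriv_lineDeriv_le _ m (h.smooth τ ξ hτ hξ0)).trans ?_
    have h1 : ‖((0 : (Fin 2 → ℝ) × Tan d), v)‖ ≤ ‖v‖ + 1 := by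
      rw [Prod.norm_def]
      simp
    calc _ ≤ (‖v‖ + 1) * (C * Real.exp (weight β τ) /
          (1 + (Real.exp (τ.1 0) + Real.exp (τ.1 1))) ^ N) := by
          gcongr
          exact hb τ ξ hτ hξ
      _ = _ := by ring

end HomSymbol

/-- The integrand `e ^ {i w ξ} ψ(ξ) Ψ(p, y, ξ)`. -/
def oscIntegrand (ψ : Tan d → ℂ) (Ψ : ((Fin 2 → ℝ) × Tan d) × Tan d → ℂ)
    (q : (Fin 2 → ℝ) × (Tan d × Tan d)) (ξ : Tan d) : ℂ :=
  Complex.exp (Complex.I * (inner ℝ q.2.1 ξ : ℝ)) * (ψ ξ * Ψ ((q.1, q.2.2), ξ))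

/-- The oscillatory integral `∫ e ^ {i w ξ} ψ(ξ) Ψ(p, y, ξ) dξ`. -/
def oscIntegral (ψ : Tan d → ℂ) (Ψ : ((Fin 2 → ℝ) × Tan d) × Tan d → ℂ)
    (q : (Fin 2 → ℝ) × (Tan d × Tan d)) : ℂ :=
  ∫ ξ, oscIntegrand ψ Ψ q ξ

section Osc

variable {B : Set (Tan d)} {β : Fin 2 → ℝ} {σ : ℝ} {Ψ : ((Fin 2 → ℝ) × Tan d) × Tan d → ℂ}
  {ψ : Tan d → ℂ}

theorem contDiffAt_oscIntegrand (h : HomSymbol B β σ Ψ) (hψ : ContDiff ℝ ∞ ψ)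
    {q : (Fin 2 → ℝ) × (Tan d × Tan d)} {ξ : Tan d} (hq : q.2.2 ∈ B) (hξ : ξ ≠ 0) :
    ContDiffAt ℝ ∞ (fun a : ((Fin 2 → ℝ) × (Tan d × Tan d)) × Tan d => oscIntegrand ψ Ψ a.1 a.2)
      (q, ξ) := by
  refine ContDiffAt.mul ?_ (ContDiffAt.mul (hψ.contDiffAt.comp _ contDiffAt_snd) ?_)
  · refine (contDiffAt_const.mul (Complex.ofRealCLM.contDiff.contDiffAt.comp _ ?_)).cexp
    exact ContDiffAt.inner ℝ (contDiffAt_fst.snd.fst) contDiffAt_snd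
  · exact ContDiffAt.comp (g := Ψ) (q, ξ) (h.smooth (q.1, q.2.2) ξ hq hξ)
      ((contDiffAt_fst.fst.prodMk contDiffAt_fst.snd.snd).prodMk contDiffAt_snd)

/-- A derivative in `w` costs a factor `|ξ|`, the others fall on the symbol. The constant does not
depend on the cutoff `ψ`. -/
theorem exists_norm_oscIntegrand_le (h : HomSymbol B β σ Ψ) (m N : ℕ) :
    ∃ C > 0, ∀ (ψ : Tan d → ℂ) (q : (Fin 2 → ℝ) × (Tan d × Tan d)) (ξ : Tan d), q.2.2 ∈ B → ξ ≠ 0 →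
      ‖iteratedFDeriv ℝ m (fun q => oscIntegrand ψ Ψ q ξ) q‖ ≤
        C * Real.exp (weight β q) * (‖ψ ξ‖ * (1 + ‖ξ‖) ^ m * (‖ξ‖ ^ (σ + β 0 + β 1) /
          (1 + ‖ξ‖ * (Real.exp (q.1 0) + Real.exp (q.1 1))) ^ N)) := by
  choose C hC hb using fun j => h.slice_bound j N
  refine ⟨∑ i ∈ Finset.range (m + 1), (m.choose i : ℝ) * C (m - i), ?_, fun ψ q ξ hq hξ => ?_⟩
  · refine Finset.sum_pos (fun i hi => ?_) ⟨0, by simp⟩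
    have := Nat.choose_pos (Nat.lt_succ_iff.1 (Finset.mem_range.1 hi))
    have := hC (m - i)
    positivity
  set s := ‖ξ‖ ^ (σ + β 0 + β 1) / (1 + ‖ξ‖ * (Real.exp (q.1 0) + Real.exp (q.1 1))) ^ N with hs
  have hs0 : 0 ≤ s := by positivity
  let L : (Fin 2 → ℝ) × (Tan d × Tan d) →L[ℝ] ℝ := (innerSL ℝ ξ).comp
    ((ContinuousLinearMap.fst ℝ _ _).comp (ContinuousLinearMap.snd ℝ _ _))
  have hL : ‖L‖ ≤ ‖ξ‖ := by
    refine ContinuousLinearMap.opNorm_le_bound _ (norm_nonneg _) fun a => ?_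
    refine (norm_inner_le_norm ξ a.2.1).trans ?_
    gcongr
    exact (norm_fst_le a.2).trans (norm_snd_le a)
  let π : (Fin 2 → ℝ) × (Tan d × Tan d) →L[ℝ] (Fin 2 → ℝ) × Tan d :=
    (ContinuousLinearMap.fst ℝ _ _).prod
      ((ContinuousLinearMap.snd ℝ _ _).comp (ContinuousLinearMap.snd ℝ _ _))
  have hπ : ‖π‖ ≤ 1 := by
    refine ContinuousLinearMap.opNorm_le_bound _ zero_le_one fun a => ?_
    rw [one_mul, Prod.norm_def]
    exact max_le (norm_fst_le a) ((norm_snd_le a.2).trans (norm_snd_le a))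
  have hle : ∀ j : ℕ, (j : ℕ∞ω) ≤ ∞ := natCast_le_infty
  have hsl : ContDiffAt ℝ ∞ (fun τ => Ψ (τ, ξ)) (π q) :=
    (h.smooth (q.1, q.2.2) ξ hq hξ).comp (π q) (f := fun τ => (τ, ξ))
      (contDiffAt_id.prodMk contDiffAt_const)
  have hsl' : ContDiffAt ℝ ∞ (fun q => ψ ξ • Ψ (π q, ξ)) q :=
    (hsl.comp q π.contDiff.contDiffAt).const_smul (ψ ξ)
  have hexp : ContDiffAt ℝ ∞ (fun q => Complex.exp (Complex.I * (L q : ℂ))) q :=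
    (contDiffAt_const.mul (Complex.ofRealCLM.contDiff.comp L.contDiff).contDiffAt).cexp
  have hfun : (fun q => oscIntegrand ψ Ψ q ξ) =
      fun q => Complex.exp (Complex.I * (L q : ℂ)) * (ψ ξ • Ψ (π q, ξ)) := by
    ext q
    simp only [oscIntegrand, L, π, smul_eq_mul]
    rw [real_inner_comm]
    rfl
  rw [hfun]
  refine (norm_iteratedFDeriv_mul_le_of_contDiffAt (hexp.of_le (hle m))
    (hsl'.of_le (hle m))).trans ?_
  rw [Finset.sum_mul, Finset.sum_mul]
  refine Finset.sum_le_sum fun i hi => ?_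
  have hi' : i ≤ m := Nat.lt_succ_iff.1 (Finset.mem_range.1 hi)
  have h1 : ‖iteratedFDeriv ℝ i (fun q => Complex.exp (Complex.I * (L q : ℂ))) q‖ ≤
      (1 + ‖ξ‖) ^ m := by
    refine (norm_iteratedFDeriv_cexp_le Complex.I L i q).trans ?_
    simp only [Complex.norm_I, one_pow, one_mul, Complex.I_re, zero_mul, Real.exp_zero, mul_one]
    calc ‖L‖ ^ i ≤ (1 + ‖ξ‖) ^ i := by
          gcongr
          linarith [norm_nonneg ξ]
      _ ≤ (1 + ‖ξ‖) ^ m := pow_le_pow_right₀ (by linarith [norm_nonneg ξ]) hi'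
  have h2 : ‖iteratedFDeriv ℝ (m - i) (fun q => ψ ξ • Ψ (π q, ξ)) q‖ ≤
      ‖ψ ξ‖ * (C (m - i) * Real.exp (weight β q) * s) := by
    rw [iteratedFDeriv_const_smul_apply' (a := ψ ξ) (show ContDiffAt ℝ ((m - i : ℕ) : ℕ∞ω)
      (fun q => Ψ (π q, ξ)) q from (hsl.comp q π.contDiff.contDiffAt).of_le (hle _)), norm_smul]
    gcongr
    have h3 : ContDiffAt ℝ ((m - i : ℕ) : ℕ∞ω) (fun τ => Ψ (τ, ξ)) (π q + 0) := by
      rw [add_zero]; exact hsl.of_le (hle _)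
    have h4 := norm_iteratedFDeriv_comp_affine_le π 0 h3
    simp only [add_zero] at h4
    refine h4.trans ((mul_le_of_le_one_right (norm_nonneg _)
      (pow_le_one₀ (norm_nonneg _) hπ)).trans ?_)
    have h5 := hb (m - i) (π q) ξ hq hξ
    rw [weight_fin_two] at h5 ⊢
    exact h5
  have := hC (m - i)
  calc _ ≤ (m.choose i : ℝ) * (1 + ‖ξ‖) ^ m *
        (‖ψ ξ‖ * (C (m - i) * Real.exp (weight β q) * s)) := by gcongr
    _ = _ := by ring

/-- In positive dimension the origin is a null set; the symbols are controlled only for `ξ ≠ 0`. -/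
theorem volume_restrict_compl_zero [Nontrivial (Tan d)] :
    (volume : Measure (Tan d)).restrict {0}ᶜ = volume :=
  restrict_compl_singleton 0

theorem ae_ne_zero [Nontrivial (Tan d)] : ∀ᵐ ξ : Tan d, ξ ≠ 0 := by
  rw [← volume_restrict_compl_zero]
  exact ae_restrict_mem (measurableSet_singleton 0).compl

theorem aestronglyMeasurable_of_continuousAt [Nontrivial (Tan d)] {G : Type*}
    [NormedAddCommGroup G] {f : Tan d → G} (hf : ∀ ξ ≠ 0, ContinuousAt f ξ) :
    AEStronglyMeasurable f volume := by
  rw [← volume_restrict_compl_zero]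
  exact ContinuousOn.aestronglyMeasurable (fun ξ hξ => (hf ξ hξ).continuousWithinAt)
    (measurableSet_singleton 0).compl

/-- The oscillatory integral is `m` times differentiable where `δ < exp p₀ + exp p₁`, with
derivatives given by absolutely convergent integrals and of size `O (exp (β p))`. -/
def OscBound (B : Set (Tan d)) (β : Fin 2 → ℝ) (ψ : Tan d → ℂ)
    (Ψ : ((Fin 2 → ℝ) × Tan d) × Tan d → ℂ) (m : ℕ) (δ : ℝ) : Prop :=
  ∃ C : ℝ, ∀ q : (Fin 2 → ℝ) × (Tan d × Tan d), q.2.2 ∈ B →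
    δ < Real.exp (q.1 0) + Real.exp (q.1 1) →
    ContDiffAt ℝ m (oscIntegral ψ Ψ) q ∧ ∀ j ≤ m,
      Integrable (fun ξ => iteratedFDeriv ℝ j (fun q => oscIntegrand ψ Ψ q ξ) q) ∧
      iteratedFDeriv ℝ j (oscIntegral ψ Ψ) q =
        ∫ ξ, iteratedFDeriv ℝ j (fun q => oscIntegrand ψ Ψ q ξ) q ∧
      ‖iteratedFDeriv ℝ j (oscIntegral ψ Ψ) q‖ ≤ C * Real.exp (weight β q)

/-- The number `δ` is a lower bound for `a + b = exp p₀ + exp p₁`. After the factor `exp (β p)` is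
split off, a single integrable function of `ξ` bounds all the integrands with `a + b > δ`. -/
theorem OscBound.of_dominated [Nontrivial (Tan d)] (hB : IsOpen B) (h : HomSymbol B β σ Ψ)
    (hψ : ContDiff ℝ ∞ ψ) {m N : ℕ} {δ : ℝ} {g : Tan d → ℝ} (hδ : 0 ≤ δ) (hg : Integrable g)
    (hψg : ∀ ξ ≠ 0, ‖ψ ξ‖ * (1 + ‖ξ‖) ^ m * (‖ξ‖ ^ (σ + β 0 + β 1) / (1 + ‖ξ‖ * δ) ^ N) ≤ g ξ) :
    OscBound B β ψ Ψ m δ := by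
  choose C hC hb using fun j => exists_norm_oscIntegrand_le h j N
  set C' := ∑ j ∈ Finset.range (m + 1), C j with hC'
  have hCC' : ∀ j ≤ m, C j ≤ C' := fun j hj => Finset.single_le_sum (f := C)
    (fun j _ => (hC j).le) (Finset.mem_range.2 (Nat.lt_succ_of_le hj))
  have hC'0 : 0 ≤ C' := Finset.sum_nonneg fun j _ => (hC j).le
  have hbb : ∀ j ≤ m, ∀ q : (Fin 2 → ℝ) × (Tan d × Tan d), ∀ ξ : Tan d, q.2.2 ∈ B →
      δ ≤ Real.exp (q.1 0) + Real.exp (q.1 1) → ξ ≠ 0 →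
      ‖iteratedFDeriv ℝ j (fun q => oscIntegrand ψ Ψ q ξ) q‖ ≤
        C' * Real.exp (weight β q) * g ξ := by
    intro j hj q ξ hq hqδ hξ
    refine (hb j ψ q ξ hq hξ).trans ?_
    have h1 : ‖ψ ξ‖ * (1 + ‖ξ‖) ^ j * (‖ξ‖ ^ (σ + β 0 + β 1) /
        (1 + ‖ξ‖ * (Real.exp (q.1 0) + Real.exp (q.1 1))) ^ N) ≤ g ξ := by
      refine le_trans ?_ (hψg ξ hξ)
      have := norm_nonneg ξ
      gcongr
      linarith
    have h2 : 0 ≤ g ξ := le_trans (by positivity) (hψg ξ hξ)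
    have := hCC' j hj
    gcongr
  refine ⟨C' * ∫ ξ, g ξ, fun q hq hqδ => ?_⟩
  set O : Set ((Fin 2 → ℝ) × (Tan d × Tan d)) :=
    {q' | q'.2.2 ∈ B} ∩ {q' | δ < Real.exp (q'.1 0) + Real.exp (q'.1 1)} ∩ Metric.ball q 1 with hO
  have hOo : IsOpen O := by
    refine ((hB.preimage (by fun_prop)).inter ?_).inter Metric.isOpen_ball
    exact isOpen_lt continuous_const (by fun_prop)
  have hqO : q ∈ O := ⟨⟨hq, hqδ⟩, Metric.mem_ball_self one_pos⟩
  have hjoint : ∀ q' ∈ O, ∀ ξ : Tan d, ξ ≠ 0 → ContDiffAt ℝ ∞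
      (fun a : ((Fin 2 → ℝ) × (Tan d × Tan d)) × Tan d => oscIntegrand ψ Ψ a.1 a.2) (q', ξ) :=
    fun q' hq' ξ hξ => contDiffAt_oscIntegrand h hψ hq'.1.1 hξ
  have hmeas : ∀ j : ℕ, ∀ q' ∈ O, AEStronglyMeasurable
      (fun ξ => iteratedFDeriv ℝ j (fun q => oscIntegrand ψ Ψ q ξ) q') volume := fun j q' hq' =>
    aestronglyMeasurable_of_continuousAt fun ξ hξ => continuousAt_iteratedFDeriv_slice
      ((hjoint q' hq' ξ hξ).of_le (natCast_le_infty j))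
  have key := iteratedFDeriv_integral (μ := (volume : Measure (Tan d))) hOo (n := m)
    (f := oscIntegrand ψ Ψ)
    (b := fun _ ξ => C' * Real.exp (weight β q + ∑ i, |β i|) * g ξ)
    (ae_ne_zero.mono fun ξ hξ q' hq' => ((hjoint q' hq' ξ hξ).comp q' (f := fun q => (q, ξ))
      (contDiffAt_id.prodMk contDiffAt_const)).contDiffWithinAt.of_le (natCast_le_infty m))
    (fun j _ q' hq' => hmeas j q' hq')
    (fun j hj => ae_ne_zero.mono fun ξ hξ q' hq' => (hbb j hj q' ξ hq'.1.1 hq'.1.2.le hξ).trans (by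
      have h2 : 0 ≤ g ξ := le_trans (by positivity) (hψg ξ hξ)
      gcongr
      exact weight_le_of_norm_sub_le β (mem_ball_iff_norm.1 hq'.2).le))
    (fun j _ => hg.const_mul _)
  refine ⟨key.1.contDiffAt (hOo.mem_nhds hqO), fun j hj => ⟨?_, key.2 j hj q hqO, ?_⟩⟩
  · exact (hg.const_mul (C' * Real.exp (weight β q))).mono' (hmeas j q hqO)
      (ae_ne_zero.mono fun ξ hξ => hbb j hj q ξ hq hqδ.le hξ)
  · have h1 := key.2 j hj q hqO
    change iteratedFDeriv ℝ j (oscIntegral ψ Ψ) q = _ at h1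
    rw [h1]
    refine (norm_integral_le_of_norm_le (hg.const_mul _)
      (ae_ne_zero.mono fun ξ hξ => hbb j hj q ξ hq hqδ.le hξ)).trans_eq ?_
    rw [integral_const_mul]
    ring

end Osc

end

/-! ### Dominating functions for the oscillatory integrals -/

section

section Dominating

variable {d : ℕ}

/-- Rapid decrease beats every power once `δ > 0`: use `1 + r δ ≥ min 1 δ * (1 + r)` and choose the
decay order as the sum of `m`, of a bound for `|s|` and of the `d + 1` that remain for
integrability. -/
theorem exists_rpow_div_pow_le (s : ℝ) (m : ℕ) {δ : ℝ} (hδ : 0 < δ) :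
    ∃ (N : ℕ) (A : ℝ), ∀ r : ℝ, 1 ≤ r →
      (1 + r) ^ m * (r ^ s / (1 + r * δ) ^ N) ≤ A * (1 + r) ^ (-((d : ℝ) + 1)) := by
  obtain ⟨n, hn⟩ := exists_nat_ge |s|
  set c := min 1 δ
  have hc : 0 < c := lt_min one_pos hδ
  refine ⟨m + n + (d + 1), (c ^ (m + n + (d + 1)))⁻¹, fun r hr => ?_⟩
  have h0 : 0 < 1 + r := by linarith
  have h1 : r ^ s ≤ (1 + r) ^ n := by
    calc r ^ s ≤ r ^ (n : ℝ) := Real.rpow_le_rpow_of_exponent_le hr ((le_abs_self s).trans hn)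
      _ = r ^ n := Real.rpow_natCast r n
      _ ≤ (1 + r) ^ n := by gcongr; linarith
  have h2 : c * (1 + r) ≤ 1 + r * δ := by
    have h3 : c ≤ 1 := min_le_left _ _
    have h4 : c ≤ δ := min_le_right _ _
    nlinarith
  have h5 : (1 + r) ^ (-((d : ℝ) + 1)) = ((1 + r) ^ (d + 1))⁻¹ := by
    rw [Real.rpow_neg h0.le, ← Real.rpow_natCast]
    push_cast
    rfl
  calc (1 + r) ^ m * (r ^ s / (1 + r * δ) ^ (m + n + (d + 1)))
      ≤ (1 + r) ^ m * ((1 + r) ^ n / (c * (1 + r)) ^ (m + n + (d + 1))) := by gcongr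
    _ = _ := by
      rw [h5, mul_pow, pow_add (1 + r) (m + n), pow_add (1 + r) m n]
      field_simp

/-- The case of a symbol of very negative order, where no decay in `a + b` is needed. -/
theorem exists_rpow_mul_pow_le {s : ℝ} {m : ℕ} (hs : s + m ≤ -((d : ℝ) + 1)) :
    ∃ A : ℝ, ∀ r : ℝ, 1 ≤ r → (1 + r) ^ m * r ^ s ≤ A * (1 + r) ^ (-((d : ℝ) + 1)) := by
  refine ⟨2 ^ (-s), fun r hr => ?_⟩
  have h0 : 0 < 1 + r := by linarith
  have hs0 : s ≤ 0 := by
    have : (0 : ℝ) ≤ d := Nat.cast_nonneg d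
    have : (0 : ℝ) ≤ m := Nat.cast_nonneg m
    linarith
  have h1 : r ^ s ≤ 2 ^ (-s) * (1 + r) ^ s := by
    calc r ^ s ≤ ((1 + r) / 2) ^ s :=
          Real.rpow_le_rpow_of_nonpos (by positivity) (by linarith) hs0
      _ = _ := by rw [Real.div_rpow h0.le two_pos.le, Real.rpow_neg two_pos.le]; ring
  calc (1 + r) ^ m * r ^ s ≤ (1 + r) ^ m * (2 ^ (-s) * (1 + r) ^ s) := by gcongr
    _ = 2 ^ (-s) * (1 + r) ^ (s + m) := by
      rw [Real.rpow_add h0, Real.rpow_natCast]; ring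
    _ ≤ _ := by
      gcongr
      linarith

/-- Inside the ball of radius `2` the majorant is a power `|ξ| ^ s'` with `s' > -d`, or a constant
if `ψ` vanishes near the origin; outside it is `(1 + |ξ|) ^ (-(d + 1))`. -/
theorem exists_dominating [Nontrivial (Tan d)] {ψ : Tan d → ℂ} {M : ℝ} (hM : ∀ ξ, ‖ψ ξ‖ ≤ M)
    {s δ : ℝ} (hδ : 0 ≤ δ) {m N : ℕ} (hs : -(d : ℝ) < s ∨ ∀ ξ, ‖ξ‖ < 1 → ψ ξ = 0)
    (hl : ∃ A : ℝ, ∀ ξ : Tan d, 2 ≤ ‖ξ‖ →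
      ‖ψ ξ‖ * (1 + ‖ξ‖) ^ m * (‖ξ‖ ^ s / (1 + ‖ξ‖ * δ) ^ N) ≤ A * (1 + ‖ξ‖) ^ (-((d : ℝ) + 1))) :
    ∃ g : Tan d → ℝ, Integrable g ∧ ∀ ξ : Tan d, ξ ≠ 0 →
      ‖ψ ξ‖ * (1 + ‖ξ‖) ^ m * (‖ξ‖ ^ s / (1 + ‖ξ‖ * δ) ^ N) ≤ g ξ := by
  have hd : 1 ≤ Module.finrank ℝ (Tan d) := Module.finrank_pos
  have hfd : Module.finrank ℝ (Tan d) = d := by simp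
  have hM0 : 0 ≤ M := (norm_nonneg _).trans (hM 0)
  obtain ⟨A, hA⟩ := hl
  have hdiv : ∀ r : ℝ, 0 ≤ r → r ^ s / (1 + r * δ) ^ N ≤ r ^ s := fun r hr =>
    div_le_self (Real.rpow_nonneg hr s) (one_le_pow₀ (by nlinarith))
  obtain ⟨s', c, hs', hc, hsm⟩ : ∃ s' c : ℝ, -(d : ℝ) < s' ∧ 0 ≤ c ∧ ∀ ξ : Tan d, ξ ≠ 0 → ‖ξ‖ < 2 →
      ‖ψ ξ‖ * (1 + ‖ξ‖) ^ m * (‖ξ‖ ^ s / (1 + ‖ξ‖ * δ) ^ N) ≤ c * ‖ξ‖ ^ s' := by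
    rcases hs with hs | hs
    · refine ⟨s, M * 3 ^ m, hs, by positivity, fun ξ _ h2 => ?_⟩
      have := hM ξ
      have := hdiv ‖ξ‖ (norm_nonneg ξ)
      gcongr
      linarith
    · refine ⟨0, M * 3 ^ m * 2 ^ |s|, ?_, by positivity, fun ξ hξ h2 => ?_⟩
      · have : (1 : ℝ) ≤ d := by rw [hfd] at hd; exact_mod_cast hd
        linarith
      rw [Real.rpow_zero, mul_one]
      rcases lt_or_ge ‖ξ‖ 1 with h1 | h1
      · rw [hs ξ h1]
        simp only [norm_zero, zero_mul]
        positivity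
      · have := hM ξ
        have h3 : ‖ξ‖ ^ s / (1 + ‖ξ‖ * δ) ^ N ≤ 2 ^ |s| := by
          refine (hdiv ‖ξ‖ (norm_nonneg ξ)).trans ?_
          calc ‖ξ‖ ^ s ≤ ‖ξ‖ ^ |s| := Real.rpow_le_rpow_of_exponent_le h1 (le_abs_self s)
            _ ≤ 2 ^ |s| := Real.rpow_le_rpow (norm_nonneg ξ) h2.le (abs_nonneg s)
        gcongr
        linarith
  have hi1 : IntegrableOn (fun ξ : Tan d => ‖ξ‖ ^ s') (Metric.ball 0 2) := by
    refine integrableOn_ball_of_norm_le_rpow hd (C := 1) (α := -s') (by rw [hfd]; linarith)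
      (ae_of_all _ fun ξ => ?_) (measurable_norm.pow_const s').aestronglyMeasurable
    rw [neg_neg, one_mul, Real.norm_of_nonneg (Real.rpow_nonneg (norm_nonneg ξ) _)]
  have hi2 : Integrable (fun ξ : Tan d => (1 + ‖ξ‖) ^ (-((d : ℝ) + 1))) :=
    integrable_one_add_norm (by rw [hfd]; linarith)
  refine ⟨fun ξ => c * (Metric.ball 0 2).indicator (fun ξ : Tan d => ‖ξ‖ ^ s') ξ +
    |A| * (1 + ‖ξ‖) ^ (-((d : ℝ) + 1)), ((integrable_indicator_iff
      Metric.isOpen_ball.measurableSet).2 hi1 |>.const_mul c).add (hi2.const_mul _),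
      fun ξ hξ => ?_⟩
  rcases lt_or_ge ‖ξ‖ 2 with h2 | h2
  · have hmem : ξ ∈ Metric.ball (0 : Tan d) 2 := by simpa using h2
    simp only [indicator_of_mem hmem]
    refine (hsm ξ hξ h2).trans (le_add_of_nonneg_right (by positivity))
  · have hmem : ξ ∉ Metric.ball (0 : Tan d) 2 := by simpa using h2
    simp only [indicator_of_notMem hmem, mul_zero, zero_add]
    refine (hA ξ h2).trans ?_
    gcongr
    exact le_abs_self A

end Dominating

section OscBounds

variable {d : ℕ} [Nontrivial (Tan d)] {B : Set (Tan d)} {β : Fin 2 → ℝ} {σ : ℝ}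
  {Ψ : ((Fin 2 → ℝ) × Tan d) × Tan d → ℂ} {ψ : Tan d → ℂ} {M : ℝ}

/-- Convergence at infinity from the decay of the symbol in `(a + b) |ξ|`, uniformly where `a + b >
δ`. -/
theorem HomSymbol.oscBound_of_pos (hB : IsOpen B) (h : HomSymbol B β σ Ψ) (hψ : ContDiff ℝ ∞ ψ)
    (hM : ∀ ξ, ‖ψ ξ‖ ≤ M) (hs : -(d : ℝ) < σ + β 0 + β 1 ∨ ∀ ξ, ‖ξ‖ < 1 → ψ ξ = 0) (m : ℕ) {δ : ℝ}
    (hδ : 0 < δ) : OscBound B β ψ Ψ m δ := by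
  obtain ⟨N, A, hA⟩ := exists_rpow_div_pow_le (d := d) (σ + β 0 + β 1) m hδ
  obtain ⟨g, hg, hψg⟩ := exists_dominating hM hδ.le (m := m) (N := N) hs
    ⟨M * A, fun ξ hξ => by
      have h1 := hA ‖ξ‖ (by linarith)
      have h2 := hM ξ
      have h4 := (norm_nonneg _).trans h2
      have h3 : 0 ≤ A * (1 + ‖ξ‖) ^ (-((d : ℝ) + 1)) := le_trans (by positivity) h1
      rw [mul_assoc, mul_assoc]
      gcongr⟩
  exact .of_dominated hB h hψ hδ.le hg hψg

/-- Convergence up to `a = b = 0` because `ψ` has bounded support. -/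
theorem HomSymbol.oscBound_of_support (hB : IsOpen B) (h : HomSymbol B β σ Ψ)
    (hψ : ContDiff ℝ ∞ ψ) (hM : ∀ ξ, ‖ψ ξ‖ ≤ M)
    (hs : -(d : ℝ) < σ + β 0 + β 1 ∨ ∀ ξ, ‖ξ‖ < 1 → ψ ξ = 0) (h2 : ∀ ξ, 2 ≤ ‖ξ‖ → ψ ξ = 0)
    (m : ℕ) : OscBound B β ψ Ψ m 0 := by
  obtain ⟨g, hg, hψg⟩ := exists_dominating hM le_rfl (m := m) (N := 0) hs
    ⟨0, fun ξ hξ => by simp [h2 ξ hξ]⟩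
  exact .of_dominated hB h hψ le_rfl hg hψg

/-- Convergence up to `a = b = 0` because the total order is below `-(d + 1)`, even after `m`
derivatives in `w`. -/
theorem HomSymbol.oscBound_of_le (hB : IsOpen B) (h : HomSymbol B β σ Ψ)
    (hψ : ContDiff ℝ ∞ ψ) (hM : ∀ ξ, ‖ψ ξ‖ ≤ M) (h1 : ∀ ξ, ‖ξ‖ < 1 → ψ ξ = 0) {m : ℕ}
    (hs : σ + β 0 + β 1 + m ≤ -((d : ℝ) + 1)) : OscBound B β ψ Ψ m 0 := by
  obtain ⟨A, hA⟩ := exists_rpow_mul_pow_le hs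
  obtain ⟨g, hg, hψg⟩ := exists_dominating hM le_rfl (m := m) (N := 0) (.inr h1)
    ⟨M * A, fun ξ hξ => by
      have h1 := hA ‖ξ‖ (by linarith)
      have h2 := hM ξ
      have h4 := (norm_nonneg _).trans h2
      have h3 : 0 ≤ A * (1 + ‖ξ‖) ^ (-((d : ℝ) + 1)) := le_trans (by positivity) h1
      rw [mul_assoc, mul_assoc, pow_zero, div_one]
      gcongr⟩
  exact .of_dominated hB h hψ le_rfl hg hψg

end OscBounds

end

/-! ### Bounds of finite order and integration by parts -/

section

section FinBound

variable {E : Type*} [NormedAddCommGroup E] [NormedSpace ℝ E] {l : Filter E} {μ ν : E → ℝ}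
  {U V : E → ℂ} {m : ℕ}

/-- `U` is `m` times differentiable with derivatives `O (exp μ)` along the filter `l`. -/
def FinBound (m : ℕ) (l : Filter E) (μ : E → ℝ) (U : E → ℂ) : Prop :=
  (∀ᶠ q in l, ContDiffAt ℝ m U q) ∧
    ∃ C : ℝ, ∀ᶠ q in l, ∀ j ≤ m, ‖iteratedFDeriv ℝ j U q‖ ≤ C * Real.exp (μ q)

theorem FinBound.add (hU : FinBound m l μ U) (hV : FinBound m l μ V) :
    FinBound m l μ (fun q => U q + V q) := by
  obtain ⟨hU1, C, hC⟩ := hU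
  obtain ⟨hV1, C', hC'⟩ := hV
  refine ⟨by filter_upwards [hU1, hV1] with q h1 h2 using h1.add h2, C + C', ?_⟩
  filter_upwards [hU1, hV1, hC, hC'] with q h1 h2 h3 h4 j hj
  have hle : (j : ℕ∞ω) ≤ m := by exact_mod_cast hj
  change ‖iteratedFDeriv ℝ j (U + V) q‖ ≤ _
  rw [iteratedFDeriv_add_apply (h1.of_le hle) (h2.of_le hle), add_mul]
  exact (norm_add_le _ _).trans (add_le_add (h3 j hj) (h4 j hj))

theorem FinBound.congr (hl : IsOpenFilter l) (hU : FinBound m l μ U) (h : ∀ᶠ q in l, U q = V q) :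
    FinBound m l μ V := by
  obtain ⟨hU1, C, hC⟩ := hU
  have h' := hl _ h
  refine ⟨?_, C, ?_⟩
  · filter_upwards [hU1, h'] with q h1 h2
    exact h1.congr_of_eventuallyEq (h2.mono fun _ h => h.symm)
  · filter_upwards [hC, h'] with q h1 h2 j hj
    rw [← iteratedFDeriv_congr_of_eventuallyEq h2]
    exact h1 j hj

theorem SymbolBound.finBound_mul (hU : SymbolBound l ν U) (hV : FinBound m l μ V) :
    FinBound m l (fun q => ν q + μ q) (fun q => U q * V q) := by
  obtain ⟨hV1, C', hC'⟩ := hV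
  choose C hC0 hC using hU.exists_pos_bound
  refine ⟨?_, ∑ j ∈ Finset.range (m + 1), ∑ i ∈ Finset.range (j + 1), (j.choose i : ℝ) * C i * |C'|,
    ?_⟩
  · filter_upwards [hU.smooth, hV1] with q h1 h2 using (h1.of_le (natCast_le_infty m)).mul h2
  have hall : ∀ᶠ q in l, ∀ i ∈ Finset.range (m + 1), ‖iteratedFDeriv ℝ i U q‖ ≤
    C i * Real.exp (ν q) := (Finset.eventually_all _).2 fun i _ => hC i
  filter_upwards [hU.smooth, hV1, hall, hC'] with q h1 h2 h3 h4 j hj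
  have hle : (j : ℕ∞ω) ≤ m := by exact_mod_cast hj
  refine (norm_iteratedFDeriv_mul_le_of_contDiffAt (h1.of_le (natCast_le_infty j))
    (h2.of_le hle)).trans ?_
  calc _ ≤ ∑ i ∈ Finset.range (j + 1), (j.choose i : ℝ) * C i * |C'| * Real.exp (ν q + μ q) := by
        refine Finset.sum_le_sum fun i hi => ?_
        have hi' := Finset.mem_range.1 hi
        have h5 := h3 i (Finset.mem_range.2 (by omega))
        have h6 := (h4 (j - i) (by omega)).trans
          (mul_le_mul_of_nonneg_right (le_abs_self C') (Real.exp_pos _).le)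
        have := (hC0 i).le
        calc _ ≤ (j.choose i : ℝ) * (C i * Real.exp (ν q)) * (|C'| * Real.exp (μ q)) := by gcongr
          _ = _ := by rw [Real.exp_add]; ring
    _ = (∑ i ∈ Finset.range (j + 1), (j.choose i : ℝ) * C i * |C'|) * Real.exp (ν q + μ q) := by
        rw [Finset.sum_mul]
    _ ≤ _ := by
        gcongr
        refine Finset.single_le_sum (f := fun j => ∑ i ∈ Finset.range (j + 1),
          (j.choose i : ℝ) * C i * |C'|) (fun j _ => Finset.sum_nonneg fun i _ => ?_)
          (Finset.mem_range.2 (by omega))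
        have := (hC0 i).le
        positivity

/-- The number of integrations by parts depends on the number of derivatives, so bounds are proved
for each finite order separately. Smoothness is supplied independently, at points with `a + b > 0`.
-/
theorem SymbolBound.of_finBound (h : ∀ m, FinBound m l μ U)
    (hs : ∀ᶠ q in l, ContDiffAt ℝ ∞ U q) : SymbolBound l μ U :=
  ⟨hs, fun m => by
    obtain ⟨-, C, hC⟩ := h m
    exact ⟨C, hC.mono fun q hq => hq m le_rfl⟩⟩

end FinBound

section Oscillatory

variable {d : ℕ} [Nontrivial (Tan d)] {B : Set (Tan d)} {β : Fin 2 → ℝ} {σ : ℝ}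
  {Ψ : ((Fin 2 → ℝ) × Tan d) × Tan d → ℂ} {ψ : Tan d → ℂ} {M : ℝ}

theorem OscBound.integrable {m : ℕ} {δ : ℝ} (h : OscBound B β ψ Ψ m δ)
    {q : (Fin 2 → ℝ) × (Tan d × Tan d)} (hq : q.2.2 ∈ B)
    (hδ : δ < Real.exp (q.1 0) + Real.exp (q.1 1)) :
    Integrable (fun ξ => oscIntegrand ψ Ψ q ξ) := by
  obtain ⟨C, hC⟩ := h
  have h1 := ((hC q hq hδ).2 0 (Nat.zero_le m)).1
  exact (ContinuousMultilinearMap.apply ℝ (fun _ : Fin 0 => (Fin 2 → ℝ) × (Tan d × Tan d)) ℂ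
    (fun _ => 0)).integrable_comp h1

theorem OscBound.finBound {m : ℕ} {δ : ℝ} (h : OscBound B β ψ Ψ m δ)
    {l : Filter ((Fin 2 → ℝ) × (Tan d × Tan d))} (hB : ∀ᶠ q in l, q.2.2 ∈ B)
    (hδ : ∀ᶠ q in l, δ < Real.exp (q.1 0) + Real.exp (q.1 1)) :
    FinBound m l (weight β) (oscIntegral ψ Ψ) := by
  obtain ⟨C, hC⟩ := h
  refine ⟨?_, C, ?_⟩
  · filter_upwards [hB, hδ] with q h1 h2 using (hC q h1 h2).1
  · filter_upwards [hB, hδ] with q h1 h2 j hj using ((hC q h1 h2).2 j hj).2.2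

/-- In logarithmic coordinates `a + b` is positive at every point, so `oscBound_of_pos` applies
there with half this value as `δ`, for every order. -/
theorem HomSymbol.contDiffAt_oscIntegral (hB : IsOpen B) (h : HomSymbol B β σ Ψ)
    (hψ : ContDiff ℝ ∞ ψ) (hM : ∀ ξ, ‖ψ ξ‖ ≤ M)
    (hs : -(d : ℝ) < σ + β 0 + β 1 ∨ ∀ ξ, ‖ξ‖ < 1 → ψ ξ = 0)
    {q : (Fin 2 → ℝ) × (Tan d × Tan d)} (hq : q.2.2 ∈ B) :
    ContDiffAt ℝ ∞ (oscIntegral ψ Ψ) q := by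
  have hδ : 0 < (Real.exp (q.1 0) + Real.exp (q.1 1)) / 2 := by positivity
  rw [contDiffAt_infty]
  intro m
  obtain ⟨C, hC⟩ := h.oscBound_of_pos hB hψ hM hs m hδ
  exact (hC q hq (half_lt_self (by positivity))).1

theorem HomSymbol.integrable_oscIntegrand (hB : IsOpen B) (h : HomSymbol B β σ Ψ)
    (hψ : ContDiff ℝ ∞ ψ) (hM : ∀ ξ, ‖ψ ξ‖ ≤ M)
    (hs : -(d : ℝ) < σ + β 0 + β 1 ∨ ∀ ξ, ‖ξ‖ < 1 → ψ ξ = 0)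
    {q : (Fin 2 → ℝ) × (Tan d × Tan d)} (hq : q.2.2 ∈ B) :
    Integrable (fun ξ => oscIntegrand ψ Ψ q ξ) := by
  have hδ : 0 < (Real.exp (q.1 0) + Real.exp (q.1 1)) / 2 := by positivity
  exact (h.oscBound_of_pos hB hψ hM hs 0 hδ).integrable hq (half_lt_self (by positivity))

/-- Integration by parts in the covariable. -/
theorem HomSymbol.inner_mul_oscIntegral (hB : IsOpen B) (h : HomSymbol B β σ Ψ)
    (hψ : ContDiff ℝ ∞ ψ) (hM : ∀ ξ, ‖ψ ξ‖ ≤ M) (h1 : ∀ ξ, ‖ξ‖ < 1 → ψ ξ = 0) (v : Tan d) {M' : ℝ}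
    (hM' : ∀ ξ, ‖fderiv ℝ ψ ξ v‖ ≤ M') {q : (Fin 2 → ℝ) × (Tan d × Tan d)} (hq : q.2.2 ∈ B) :
    Complex.I * (inner ℝ q.2.1 v : ℝ) * oscIntegral ψ Ψ q =
      -(oscIntegral (fun ξ => fderiv ℝ ψ ξ v) Ψ q +
        oscIntegral ψ (fun a => lineDeriv ℝ Ψ a (0, v)) q) := by
  have hψ' : ContDiff ℝ ∞ (fun ξ => fderiv ℝ ψ ξ v) :=
    (hψ.fderiv_right (m := ∞) (by simp)).clm_apply contDiff_const
  -- As `ψ` vanishes near the origin, the product `ψ Ψ` is differentiable everywhere and there is no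
  -- boundary term at the singular point `ξ = 0`.
  have hzero : ∀ ξ : Tan d, ‖ξ‖ < 1 → ψ =ᶠ[𝓝 ξ] fun _ => 0 := fun ξ hξ =>
    ((continuous_norm.continuousAt.eventually (gt_mem_nhds hξ))).mono fun ξ' h => h1 ξ' h
  have h1' : ∀ ξ : Tan d, ‖ξ‖ < 1 → fderiv ℝ ψ ξ v = 0 := fun ξ hξ => by
    rw [(hzero ξ hξ).fderiv_eq]; simp
  let f : Tan d → ℂ := fun ξ => Complex.exp (Complex.I * (inner ℝ q.2.1 ξ : ℝ))
  let g : Tan d → ℂ := fun ξ => ψ ξ * Ψ ((q.1, q.2.2), ξ)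
  have hf : ∀ ξ, HasFDerivAt f ((Complex.I * f ξ) •
      (Complex.ofRealCLM.comp (innerSL ℝ q.2.1))) ξ := by
    intro ξ
    have h2 : HasFDerivAt (fun ξ : Tan d => ((inner ℝ q.2.1 ξ : ℝ) : ℂ))
      (Complex.ofRealCLM.comp (innerSL ℝ q.2.1)) ξ :=
      (Complex.ofRealCLM.comp (innerSL ℝ q.2.1)).hasFDerivAt
    have h3 := (h2.const_mul Complex.I).cexp
    have h4 : (Complex.I * f ξ) • (Complex.ofRealCLM.comp (innerSL ℝ q.2.1)) =
        f ξ • Complex.I • (Complex.ofRealCLM.comp (innerSL ℝ q.2.1)) := by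
      rw [smul_smul, mul_comm]
    rw [h4]
    exact h3
  have hsl : ∀ ξ : Tan d, ξ ≠ 0 → HasFDerivAt (fun ξ => Ψ ((q.1, q.2.2), ξ))
      ((fderiv ℝ Ψ ((q.1, q.2.2), ξ)).comp (ContinuousLinearMap.inr ℝ _ _)) ξ := fun ξ hξ =>
    (((h.smooth (q.1, q.2.2) ξ hq hξ).differentiableAt (by simp)).hasFDerivAt).comp ξ
      (hasFDerivAt_prodMk_right _ ξ)
  have hg : ∀ ξ, DifferentiableAt ℝ g ξ ∧ fderiv ℝ g ξ v =
      fderiv ℝ ψ ξ v * Ψ ((q.1, q.2.2), ξ) +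
        ψ ξ * lineDeriv ℝ Ψ ((q.1, q.2.2), ξ) (0, v) := by
    intro ξ
    by_cases hξ : ‖ξ‖ < 1
    · have h2 : g =ᶠ[𝓝 ξ] fun _ => 0 := (hzero ξ hξ).mono fun ξ' h => by simp [g, h]
      refine ⟨h2.differentiableAt_iff.2 (differentiableAt_const _), ?_⟩
      rw [h2.fderiv_eq, h1' ξ hξ, h1 ξ hξ]
      simp
    · have hξ0 : ξ ≠ 0 := by
        rintro rfl
        simp at hξ
      have h2 := ((hψ.differentiable (by simp)) ξ).hasFDerivAt.mul (hsl ξ hξ0)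
      refine ⟨h2.differentiableAt, ?_⟩
      have h3 := h2.fderiv
      change fderiv ℝ g ξ = _ at h3
      rw [h3, DifferentiableAt.lineDeriv_eq_fderiv
        ((h.smooth (q.1, q.2.2) ξ hq hξ0).differentiableAt (by simp))]
      simp [mul_comm, add_comm]
  have hi1 : Integrable (oscIntegrand ψ Ψ q) :=
    h.integrable_oscIntegrand hB hψ hM (.inr h1) hq
  have hi2 : Integrable (oscIntegrand (fun ξ => fderiv ℝ ψ ξ v) Ψ q) :=
    h.integrable_oscIntegrand hB hψ' hM' (.inr h1') hq
  have hi3 : Integrable (oscIntegrand ψ (fun a => lineDeriv ℝ Ψ a (0, v)) q) :=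
    (h.fderiv_snd hB v).integrable_oscIntegrand hB hψ hM (.inr h1) hq
  have e1 : (fun ξ => f ξ * fderiv ℝ g ξ v) = fun ξ => oscIntegrand (fun ξ => fderiv ℝ ψ ξ v) Ψ q ξ +
      oscIntegrand ψ (fun a => lineDeriv ℝ Ψ a (0, v)) q ξ := by
    ext ξ
    rw [(hg ξ).2]
    simp only [oscIntegrand, f]
    ring
  have e2 : (fun ξ => fderiv ℝ f ξ v * g ξ) = fun ξ =>
      Complex.I * (inner ℝ q.2.1 v : ℝ) * oscIntegrand ψ Ψ q ξ := by
    ext ξ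
    rw [(hf ξ).fderiv]
    simp only [oscIntegrand, f, g, ContinuousLinearMap.smul_apply, ContinuousLinearMap.comp_apply,
      innerSL_apply_apply, Complex.ofRealCLM_apply, smul_eq_mul]
    ring
  have key := integral_mul_fderiv_eq_neg_fderiv_mul_of_integrable (μ := (volume : Measure (Tan d)))
    (f := f) (g := g) (v := v) (by rw [e2]; exact hi1.const_mul _) (by rw [e1]; exact hi2.add hi3)
    hi1 (fun ξ _ => (hf ξ).differentiableAt) (fun ξ _ => (hg ξ).1)
  rw [e1, e2, integral_add hi2 hi3, integral_const_mul] at key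
  rw [oscIntegral, oscIntegral, oscIntegral, key, neg_neg]

end Oscillatory

end

/-! ### Conormality of the oscillatory integrals on the blow-up -/

section

section Oscillatory

variable {d : ℕ} [Nontrivial (Tan d)] {B : Set (Tan d)} {β : Fin 2 → ℝ} {σ : ℝ}
  {Ψ : ((Fin 2 → ℝ) × Tan d) × Tan d → ℂ} {ψ : Tan d → ℂ} {M : ℝ}

theorem eventually_snd_snd_mem {k : ℕ} {F G : Type*} [NormedAddCommGroup F] [NormedSpace ℝ F]
    [NormedAddCommGroup G] [NormedSpace ℝ G] {B : Set G} (hB : IsOpen B) (x₀ : Fin k → ℝ)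
    {w₀ : F} {y₀ : G} (hy₀ : y₀ ∈ B) : ∀ᶠ q in logNhds univ x₀ (w₀, y₀), q.2.2 ∈ B := by
  have : ∀ᶠ q : (Fin k → ℝ) × (F × G) in 𝓝 (x₀, (w₀, y₀)), q.2.2 ∈ B :=
    (hB.preimage (f := fun q : (Fin k → ℝ) × (F × G) => q.2.2) (by fun_prop)).mem_nhds hy₀
  exact (eventually_logNhds_of_nhds this).mono fun _ h => h

/-- Induction on the number `r` of integrations by parts in the direction `w₀`. A derivative falling
on the cutoff gives bounded support, one falling on the symbol lowers `σ` by one; after `r` steps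
the order is low enough for `oscBound_of_le`. -/
theorem HomSymbol.finBound_of_ne_zero (hB : IsOpen B) (hψ : ContDiff ℝ ∞ ψ)
    (hM : ∀ ξ, ‖ψ ξ‖ ≤ M) (h1 : ∀ ξ, ‖ξ‖ < 1 → ψ ξ = 0) (h2 : ∀ ξ v, 2 ≤ ‖ξ‖ → fderiv ℝ ψ ξ v = 0)
    (hM' : ∀ v, ∃ M', ∀ ξ, ‖fderiv ℝ ψ ξ v‖ ≤ M')
    (a : Fin 2 → ℝ) {w₀ y₀ : Tan d} (hw₀ : w₀ ≠ 0) (hy₀ : y₀ ∈ B) (m r : ℕ) :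
    ∀ {σ : ℝ} {Ψ : ((Fin 2 → ℝ) × Tan d) × Tan d → ℂ}, HomSymbol B β σ Ψ →
      σ + β 0 + β 1 + m - r ≤ -((d : ℝ) + 1) →
      FinBound m (logNhds univ a (w₀, y₀)) (weight β) (oscIntegral ψ Ψ) := by
  have hB' := eventually_snd_snd_mem hB a (w₀ := w₀) hy₀
  have hδ : ∀ᶠ q in logNhds univ a (w₀, y₀), 0 < Real.exp (q.1 0) + Real.exp (q.1 1) :=
    Eventually.of_forall fun q => by positivity
  induction r with
  | zero =>
    intro σ Ψ h hs
    rw [Nat.cast_zero, sub_zero] at hs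
    exact (h.oscBound_of_le hB hψ hM h1 hs).finBound hB' hδ
  | succ r ih =>
    intro σ Ψ h hs
    have hψ' : ContDiff ℝ ∞ (fun ξ => fderiv ℝ ψ ξ w₀) :=
      (hψ.fderiv_right (m := ∞) (by simp)).clm_apply contDiff_const
    have h1' : ∀ ξ : Tan d, ‖ξ‖ < 1 → fderiv ℝ ψ ξ w₀ = 0 := fun ξ hξ => by
      have : ψ =ᶠ[𝓝 ξ] fun _ => 0 :=
        ((continuous_norm.continuousAt.eventually (gt_mem_nhds hξ))).mono fun ξ' h => h1 ξ' h
      rw [this.fderiv_eq]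
      simp
    obtain ⟨M', hM'⟩ := hM' w₀
    have hI1 : FinBound m (logNhds univ a (w₀, y₀)) (weight β)
        (oscIntegral (fun ξ => fderiv ℝ ψ ξ w₀) Ψ) :=
      (h.oscBound_of_support hB hψ' hM' (.inr h1') (fun ξ hξ => h2 ξ w₀ hξ) m).finBound hB' hδ
    have hI2 : FinBound m (logNhds univ a (w₀, y₀)) (weight β)
        (oscIntegral ψ (fun a => lineDeriv ℝ Ψ a (0, w₀))) :=
      ih (h.fderiv_snd hB w₀) (by push_cast at hs; linarith)
    -- The inverse of the factor `i ⟨w, w₀⟩` produced by the integration by parts; it is smooth near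
    -- `w = w₀ ≠ 0`.
    let G : (Fin 2 → ℝ) × (Tan d × Tan d) → ℂ :=
      fun q => -(Complex.I * (inner ℝ q.2.1 w₀ : ℝ))⁻¹
    have hne : ∀ᶠ q : (Fin 2 → ℝ) × (Tan d × Tan d) in 𝓝 (a, (w₀, y₀)),
        (inner ℝ q.2.1 w₀ : ℝ) ≠ 0 := by
      have hc : Continuous fun q : (Fin 2 → ℝ) × (Tan d × Tan d) => (inner ℝ q.2.1 w₀ : ℝ) := by
        fun_prop
      exact hc.continuousAt.eventually_ne (by simpa using hw₀)
    have hG : SymbolBound (logNhds univ a (w₀, y₀)) (fun _ => 0) (fun p => G (expMap p)) := by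
      refine SymbolBound.of_contDiffAt (hne.mono fun q hq => ?_)
      refine ContDiffAt.neg (ContDiffAt.inv ?_ ?_)
      · exact contDiffAt_const.mul (Complex.ofRealCLM.contDiff.contDiffAt.comp _
          (ContDiffAt.inner ℝ contDiffAt_snd.fst contDiffAt_const))
      · simpa using hq
    have key := hG.finBound_mul (hI1.add hI2)
    simp only [zero_add] at key
    refine key.congr (isOpenFilter_logNhds isOpen_univ _ _) ?_
    filter_upwards [eventually_logNhds_of_nhds hne, hB'] with q hq hqB
    have h3 := h.inner_mul_oscIntegral hB hψ hM h1 w₀ hM' hqB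
    have h4 : Complex.I * ((inner ℝ q.2.1 w₀ : ℝ) : ℂ) ≠ 0 := by
      have : (inner ℝ q.2.1 w₀ : ℝ) ≠ 0 := hq
      simpa using this
    change -(Complex.I * ((inner ℝ q.2.1 w₀ : ℝ) : ℂ))⁻¹ * _ = _
    rw [neg_mul, ← mul_neg, ← h3, ← mul_assoc, inv_mul_cancel₀ h4, one_mul]

theorem exists_cutoff (d : ℕ) : ∃ χ : Tan d → ℂ, ContDiff ℝ ∞ χ ∧ HasCompactSupport χ ∧
    (∀ ξ, ‖χ ξ‖ ≤ 1) ∧ (∀ ξ, ‖1 - χ ξ‖ ≤ 1) ∧ (∀ ξ, ‖ξ‖ < 1 → χ ξ = 1) ∧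
    ∀ ξ, 3 / 2 ≤ ‖ξ‖ → χ ξ = 0 := by
  let b : ContDiffBump (0 : Tan d) := ⟨1, 3 / 2, one_pos, by norm_num⟩
  have h0 : ∀ ξ, 0 ≤ b ξ := fun ξ => b.nonneg
  have h1 : ∀ ξ, b ξ ≤ 1 := fun ξ => b.le_one
  refine ⟨fun ξ => (b ξ : ℂ), Complex.ofRealCLM.contDiff.comp b.contDiff,
    b.hasCompactSupport.comp_left Complex.ofReal_zero, fun ξ => ?_, fun ξ => ?_, fun ξ hξ => ?_,
    fun ξ hξ => ?_⟩
  · rw [Complex.norm_real, Real.norm_of_nonneg (h0 ξ)]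
    exact h1 ξ
  · rw [← Complex.ofReal_one, ← Complex.ofReal_sub, Complex.norm_real,
      Real.norm_of_nonneg (sub_nonneg.2 (h1 ξ))]
    linarith [h0 ξ]
  · change ((b ξ : ℝ) : ℂ) = 1
    rw [b.one_of_mem_closedBall (by simpa using hξ.le), Complex.ofReal_one]
  · change ((b ξ : ℝ) : ℂ) = 0
    rw [b.zero_of_le_dist (by simpa using hξ), Complex.ofReal_zero]

/-- If `a ≠ 0`, decay of the symbol suffices. If `a = 0`, then `w₀ ≠ 0`: small `ξ` are split off by
a cutoff, where `σ + β₀ + β₁ > -d` gives convergence, and the rest is integrated by parts. -/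
theorem HomSymbol.symbolBound_oscIntegral (hB : IsOpen B) (h : HomSymbol B β σ Ψ)
    (hs : -(d : ℝ) < σ + β 0 + β 1) {a : Fin 2 → ℝ} (ha : ∀ i, 0 ≤ a i) {w₀ y₀ : Tan d}
    (hy₀ : y₀ ∈ B) (hne : a ≠ 0 ∨ w₀ ≠ 0) :
    SymbolBound (logNhds univ a (w₀, y₀)) (weight β) (oscIntegral (fun _ => 1) Ψ) := by
  have hB' := eventually_snd_snd_mem hB a (w₀ := w₀) hy₀
  have hδ0 : ∀ᶠ q in logNhds univ a (w₀, y₀), 0 < Real.exp (q.1 0) + Real.exp (q.1 1) :=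
    Eventually.of_forall fun q => by positivity
  refine .of_finBound (fun m => ?_) (hB'.mono fun q hq => h.contDiffAt_oscIntegral hB
    contDiff_const (M := 1) (by simp) (.inl hs) hq)
  by_cases ha0 : a = 0
  · have hw₀ : w₀ ≠ 0 := hne.resolve_left (not_not.2 ha0)
    obtain ⟨χ, hχ, hχc, hχ1, hχ1', hχ2, hχ3⟩ := exists_cutoff d
    have hχ' : ContDiff ℝ ∞ (fun ξ => 1 - χ ξ) := contDiff_const.sub hχ
    have hI1 : FinBound m (logNhds univ a (w₀, y₀)) (weight β) (oscIntegral χ Ψ) :=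
      (h.oscBound_of_support hB hχ hχ1 (.inl hs) (fun ξ hξ => hχ3 ξ (by linarith)) m).finBound
        hB' hδ0
    have hfd : ∀ ξ v, fderiv ℝ (fun ξ => 1 - χ ξ) ξ v = -fderiv ℝ χ ξ v := fun ξ v => by
      rw [fderiv_const_sub]; rfl
    -- Enough integrations by parts to bring the order, including the `m` derivatives, below `-(d +
    -- 1)`.
    obtain ⟨r, hr⟩ := exists_nat_ge (σ + β 0 + β 1 + m + ((d : ℝ) + 1))
    have hI2 : FinBound m (logNhds univ a (w₀, y₀)) (weight β)
        (oscIntegral (fun ξ => 1 - χ ξ) Ψ) := by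
      refine HomSymbol.finBound_of_ne_zero hB hχ' hχ1' (fun ξ hξ => by rw [hχ2 ξ hξ, sub_self])
        (fun ξ v hξ => ?_) (fun v => ?_) a hw₀ hy₀ m r h (by linarith)
      · have : χ =ᶠ[𝓝 ξ] fun _ => 0 :=
          (continuous_norm.continuousAt.eventually
            (lt_mem_nhds (show (3 / 2 : ℝ) < ‖ξ‖ by linarith))).mono fun ξ' h => hχ3 ξ' h.le
        rw [hfd, this.fderiv_eq]
        simp
      · obtain ⟨C, hC⟩ := (hχc.fderiv_apply (𝕜 := ℝ) v).exists_bound_of_continuous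
          ((hχ.fderiv_right (m := ∞) (by simp)).clm_apply contDiff_const).continuous
        exact ⟨C, fun ξ => by rw [hfd, norm_neg]; exact hC ξ⟩
    refine (hI1.add hI2).congr (isOpenFilter_logNhds isOpen_univ _ _) ?_
    filter_upwards [hB'] with q hq
    have i1 : Integrable (oscIntegrand χ Ψ q) :=
      h.integrable_oscIntegrand hB hχ hχ1 (.inl hs) hq
    have i2 : Integrable (oscIntegrand (fun ξ => 1 - χ ξ) Ψ q) :=
      h.integrable_oscIntegrand hB hχ' hχ1' (.inl hs) hq
    rw [oscIntegral, oscIntegral, ← integral_add i1 i2, oscIntegral]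
    congr 1
    ext ξ
    simp only [oscIntegrand]
    ring
  · obtain ⟨i, hi⟩ : ∃ i, a i ≠ 0 := Function.ne_iff.1 ha0
    have hi' : 0 < a i := lt_of_le_of_ne (ha i) hi.symm
    refine (h.oscBound_of_pos hB contDiff_const (M := 1) (by simp) (.inl hs) m
      (half_pos hi')).finBound hB' ?_
    have hev : ∀ᶠ q : (Fin 2 → ℝ) × (Tan d × Tan d) in 𝓝 (a, (w₀, y₀)), a i / 2 < q.1 i := by
      have hc : Continuous fun q : (Fin 2 → ℝ) × (Tan d × Tan d) => q.1 i := by fun_prop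
      exact hc.continuousAt.eventually (lt_mem_nhds (half_lt_self hi'))
    refine (eventually_logNhds_of_nhds hev).mono fun q hq => ?_
    have hq' : a i / 2 < Real.exp (q.1 i) := hq
    have h0 := Real.exp_pos (q.1 0)
    have h1 := Real.exp_pos (q.1 1)
    revert hq'
    fin_cases i
    · intro hq'
      change a 0 / 2 < Real.exp (q.1 0) at hq'
      change a 0 / 2 < _
      linarith
    · intro hq'
      change a 1 / 2 < Real.exp (q.1 1) at hq'
      change a 1 / 2 < _
      linarith

end Oscillatory

end

section

/-! ### Symbols of families of fully residual operators -/

variable {d : ℕ}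

/-- The lift to logarithmic homogeneous coordinates of a family of kernels on the quarter disc:
invariant under translation of the logarithmic coordinates and scaling of the covector, of order
`β` at `t = 0` and `t' = 0`, and of any order at infinity. -/
structure FamilySymbol (W : Set (Tan d)) (β : Fin 2 → ℝ)
    (V : (Fin 3 → ℝ) × (Tan d × Tan d) → ℂ) : Prop where
  bound : ∀ y ∈ W, ∀ η : Tan d, η ≠ 0 → ∀ x : Fin 3 → ℝ, (∀ i, 0 ≤ x i) → x ≠ 0 → ∀ N : ℝ,
    SymbolBound (logNhds univ x (y, η)) (weight ![N, β 0, β 1]) V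
  translate : ∀ (r : ℝ) (p : Fin 3 → ℝ) (g : Tan d × Tan d), V (fun i => p i + r, g) = V (p, g)
  scale : ∀ r : ℝ, 0 < r → ∀ (p : Fin 3 → ℝ) (y η : Tan d), V (p, (y, r • η)) = V (p, (y, η))

/-- The integrand of the kernel of a family: `Ψ (p₀, p₁, y, ξ) = V (-log |ξ|, p₀, p₁, y, ξ)`. -/
def symbolOf (V : (Fin 3 → ℝ) × (Tan d × Tan d) → ℂ) : ((Fin 2 → ℝ) × Tan d) × Tan d → ℂ :=
  fun a => V (![-Real.log ‖a.2‖, a.1.1 0, a.1.1 1], (a.1.2, a.2))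

theorem weight_fin_three {F : Type*} (β : Fin 3 → ℝ) (q : (Fin 3 → ℝ) × F) :
    weight β q = β 0 * q.1 0 + β 1 * q.1 1 + β 2 * q.1 2 := by
  simp [weight, Fin.sum_univ_three]

namespace FamilySymbol

variable {W : Set (Tan d)} {β : Fin 2 → ℝ} {V : (Fin 3 → ℝ) × (Tan d × Tan d) → ℂ}

theorem iteratedFDeriv_translate (h : FamilySymbol W β V) (m : ℕ) (r : ℝ) (p : Fin 3 → ℝ)
    (g : Tan d × Tan d) :
    iteratedFDeriv ℝ m V (fun i => p i + r, g) = iteratedFDeriv ℝ m V (p, g) := by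
  have h1 := iteratedFDeriv_comp_add_right (𝕜 := ℝ) (f := V) m ((fun _ => r, 0) :
    (Fin 3 → ℝ) × (Tan d × Tan d)) (p, g)
  have h2 : (fun z : (Fin 3 → ℝ) × (Tan d × Tan d) => V (z + (fun _ => r, 0))) = V := by
    ext ⟨z, g⟩
    rw [← h.translate r z g]
    congr 1
    exact Prod.ext rfl (by simp)
  rw [h2] at h1
  rw [h1]
  congr 1
  exact Prod.ext rfl (by simp)

theorem smooth (h : FamilySymbol W β V) {y : Tan d} (hy : y ∈ W) {η : Tan d} (hη : η ≠ 0)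
    (p : Fin 3 → ℝ) : ContDiffAt ℝ ∞ V (p, (y, η)) := by
  have h1 := (h.bound y hy η hη (fun i => Real.exp (p i)) (fun i => (Real.exp_pos _).le)
    (fun h0 => (Real.exp_pos (p 0)).ne' (congrFun h0 0)) 0).smooth
  obtain ⟨t, ht, htP⟩ := exists_nhds_of_eventually_logNhds h1
  exact htP (p, (y, η)) (mem_of_mem_nhds ht)

/-- Uniform bounds over compact sets of parameters. -/
theorem exists_bound (h : FamilySymbol W β V) {K : Set (Tan d)} (hK : IsCompact K) (hKW : K ⊆ W)
    (m : ℕ) (N : ℝ) : ∃ C > 0, ∀ (p : Fin 2 → ℝ) (y η : Tan d), y ∈ K → ‖η‖ = 1 →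
      ‖iteratedFDeriv ℝ m V (![0, p 0, p 1], (y, η))‖ ≤
        C * Real.exp (β 0 * p 0 + β 1 * p 1) *
          (1 + (Real.exp (p 0) + Real.exp (p 1))) ^ (-N) := by
  -- A compact cross-section `T + a + b = 1` of the homogeneous coordinates on the quarter disc,
  -- times compact sets of parameters.
  let S : Set ((Fin 3 → ℝ) × (Tan d × Tan d)) :=
    (Icc (0 : Fin 3 → ℝ) 1 ∩ {x | ∑ i, x i = 1}) ×ˢ (K ×ˢ Metric.sphere 0 1)
  have hS : IsCompact S := by
    refine IsCompact.prod (isCompact_Icc.inter_right ?_) (hK.prod (isCompact_sphere 0 1))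
    exact isClosed_eq (by fun_prop) continuous_const
  -- Order at infinity `N - (β₀ + β₁)`: rescaling to the cross-section divides all three coordinates
  -- by `s`, and the total power of `s` becomes `-N`.
  let μ : (Fin 3 → ℝ) × (Tan d × Tan d) → ℝ := weight ![N - (β 0 + β 1), β 0, β 1]
  obtain ⟨C, hC⟩ : ∃ C : ℝ, ∀ q, expMap q ∈ S → ‖iteratedFDeriv ℝ m V q‖ ≤ C * Real.exp (μ q) := by
    refine hS.induction_on (p := fun S => ∃ C : ℝ, ∀ q, expMap q ∈ S →
      ‖iteratedFDeriv ℝ m V q‖ ≤ C * Real.exp (μ q)) ⟨0, fun q hq => absurd hq (notMem_empty _)⟩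
      (fun s t hst ⟨C, hC⟩ => ⟨C, fun q hq => hC q (hst hq)⟩)
      (fun s t ⟨C, hC⟩ ⟨D, hD⟩ => ⟨max C D, fun q hq => ?_⟩) (fun q hq => ?_)
    · rcases hq with hq | hq
      · exact (hC q hq).trans (by gcongr; exact le_max_left _ _)
      · exact (hD q hq).trans (by gcongr; exact le_max_right _ _)
    · obtain ⟨x, y, η⟩ := q
      obtain ⟨⟨⟨hx0, hx1⟩, hx⟩, hy, hη⟩ := hq
      have hη0 : η ≠ 0 := by
        rintro rfl
        simp at hη
      have hxne : x ≠ 0 := by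
        rintro rfl
        simp at hx
      obtain ⟨C, hC⟩ := (h.bound y (hKW hy) η hη0 x hx0 hxne (N - (β 0 + β 1))).bound m
      obtain ⟨t, ht, htP⟩ := exists_nhds_of_eventually_logNhds hC
      exact ⟨t, mem_nhdsWithin_of_mem_nhds ht, C, fun q hq => htP q hq⟩
  refine ⟨max C 1, by positivity, fun p y η hy hη => ?_⟩
  set s := 1 + (Real.exp (p 0) + Real.exp (p 1)) with hs
  have hs0 : 0 < s := by positivity
  -- Translation by `-log s` moves the point with `T = 1` onto the cross-section without changing
  -- derivatives.
  have h1 := h.iteratedFDeriv_translate m (-Real.log s) ![0, p 0, p 1] (y, η)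
  rw [← h1]
  have hexp : ∀ x : ℝ, Real.exp (x + -Real.log s) = Real.exp x / s := fun x => by
    rw [Real.exp_add, Real.exp_neg, Real.exp_log hs0]; rfl
  have hmem : expMap ((fun i => (![0, p 0, p 1] : Fin 3 → ℝ) i + -Real.log s, (y, η)) :
      (Fin 3 → ℝ) × (Tan d × Tan d)) ∈ S := by
    refine ⟨⟨⟨fun i => (Real.exp_pos _).le, fun i => ?_⟩, ?_⟩, hy, mem_sphere_zero_iff_norm.2 hη⟩
    · change Real.exp _ ≤ 1
      rw [hexp, div_le_one hs0]
      have e0 := Real.exp_pos (p 0)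
      have e1 := Real.exp_pos (p 1)
      fin_cases i
      · simp [hs]; positivity
      · simp [hs]; linarith
      · simp [hs]; linarith
    · change ∑ i, Real.exp _ = 1
      simp only [hexp, Fin.sum_univ_three]
      simp only [Matrix.cons_val_zero, Matrix.cons_val_one, Matrix.cons_val, Real.exp_zero]
      field_simp
      rw [hs]
      ring
  refine (hC _ hmem).trans ?_
  have hμ : Real.exp (μ ((fun i => (![0, p 0, p 1] : Fin 3 → ℝ) i + -Real.log s, (y, η)) :
      (Fin 3 → ℝ) × (Tan d × Tan d))) = Real.exp (β 0 * p 0 + β 1 * p 1) * s ^ (-N) := by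
    rw [Real.rpow_def_of_pos hs0, ← Real.exp_add]
    congr 1
    simp only [μ, weight_fin_three, Matrix.cons_val_zero, Matrix.cons_val_one, Matrix.cons_val]
    ring
  rw [hμ, mul_assoc]
  gcongr
  exact le_max_left _ _

end FamilySymbol

/-- The map `(p, y, ξ) ↦ (-log |ξ|, p, y, ξ)`. -/
def symbolMap (a : ((Fin 2 → ℝ) × Tan d) × Tan d) : (Fin 3 → ℝ) × (Tan d × Tan d) :=
  (![-Real.log ‖a.2‖, a.1.1 0, a.1.1 1], (a.1.2, a.2))

/-- The linear part of `symbolMap`. -/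
def symbolLin (d : ℕ) :
    ((Fin 2 → ℝ) × Tan d) × Tan d →L[ℝ] (Fin 3 → ℝ) × (Tan d × Tan d) :=
  (ContinuousLinearMap.pi ![0,
    (ContinuousLinearMap.proj 0).comp ((ContinuousLinearMap.fst ℝ _ _).comp
      (ContinuousLinearMap.fst ℝ _ _)),
    (ContinuousLinearMap.proj 1).comp ((ContinuousLinearMap.fst ℝ _ _).comp
      (ContinuousLinearMap.fst ℝ _ _))]).prod
  (((ContinuousLinearMap.snd ℝ _ _).comp (ContinuousLinearMap.fst ℝ _ _)).prod
    (ContinuousLinearMap.snd ℝ _ _))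

theorem symbolMap_eq : (symbolMap : ((Fin 2 → ℝ) × Tan d) × Tan d → _) =
    (fun a => symbolLin d a) + fun a => (-Real.log ‖a.2‖) •
      ((unitVec 0 : (Fin 3 → ℝ) × (Tan d × Tan d))) := by
  ext1 a
  refine Prod.ext ?_ ?_
  · ext i
    fin_cases i <;> simp [symbolMap, symbolLin, unitVec]
  · simp [symbolMap, symbolLin, unitVec]

theorem contDiffAt_log_norm {ξ : Tan d} (hξ : ξ ≠ 0) {n : ℕ∞ω} :
    ContDiffAt ℝ n (fun ξ : Tan d => Real.log ‖ξ‖) ξ :=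
  (contDiffAt_norm ℝ hξ).log (norm_ne_zero_iff.2 hξ)

theorem contDiffAt_symbolMap {τ : (Fin 2 → ℝ) × Tan d} {ξ : Tan d} (hξ : ξ ≠ 0) {n : ℕ∞ω} :
    ContDiffAt ℝ n symbolMap (τ, ξ) := by
  rw [symbolMap_eq]
  exact (symbolLin d).contDiff.contDiffAt.add
    ((((contDiffAt_log_norm hξ).comp (τ, ξ) contDiffAt_snd).neg).smul contDiffAt_const)

/-- A shift of `τ` changes `symbolMap` by a constant, so its derivatives depend on `ξ` only and are
bounded on the compact unit sphere. The form `D ^ i` is the one required by the Faà di Bruno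
estimate. -/
theorem exists_norm_iteratedFDeriv_symbolMap_le (d m : ℕ) :
    ∃ D : ℝ, ∀ (τ : (Fin 2 → ℝ) × Tan d) (ξ : Tan d), ‖ξ‖ = 1 → ∀ i, 1 ≤ i → i ≤ m →
      ‖iteratedFDeriv ℝ i symbolMap (τ, ξ)‖ ≤ D ^ i := by
  have hne : ∀ ξ : Tan d, ‖ξ‖ = 1 → ξ ≠ 0 := fun ξ hξ => by rw [← norm_pos_iff, hξ]; exact one_pos
  have hτ : ∀ i, 1 ≤ i → ∀ (τ : (Fin 2 → ℝ) × Tan d) (ξ : Tan d), ξ ≠ 0 →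
      iteratedFDeriv ℝ i symbolMap (τ, ξ) = iteratedFDeriv ℝ i symbolMap (0, ξ) := by
    intro i hi τ ξ hξ
    have h2 := iteratedFDeriv_comp_add_right (𝕜 := ℝ)
      (f := (symbolMap : ((Fin 2 → ℝ) × Tan d) × Tan d → _)) i (τ, 0) (0, ξ)
    have h3 : (fun z : ((Fin 2 → ℝ) × Tan d) × Tan d => symbolMap (z + (τ, 0))) =
        symbolMap + fun _ => symbolLin d (τ, 0) := by
      ext1 z
      rw [symbolMap_eq]
      simp only [Pi.add_apply, map_add, Prod.snd_add, add_zero]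
      abel
    rw [h3, iteratedFDeriv_add_apply (contDiffAt_symbolMap hξ) contDiffAt_const,
      iteratedFDeriv_const_of_ne (by omega)] at h2
    simpa using h2.symm
  have h1 : ∀ i, ∃ C : ℝ, ∀ ξ : Tan d, ‖ξ‖ = 1 → ‖iteratedFDeriv ℝ i symbolMap
      (((0 : (Fin 2 → ℝ) × Tan d), ξ))‖ ≤ C := by
    intro i
    have hc : ContinuousOn (fun ξ : Tan d => iteratedFDeriv ℝ i symbolMap
        (((0 : (Fin 2 → ℝ) × Tan d), ξ))) (Metric.sphere 0 1) := fun ξ hξ =>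
      (((contDiffAt_symbolMap (n := i) (hne ξ (by simpa using hξ))).continuousAt_iteratedFDeriv
        le_rfl).comp (f := fun ξ : Tan d => ((0 : (Fin 2 → ℝ) × Tan d), ξ))
        (by fun_prop)).continuousWithinAt
    obtain ⟨C, hC⟩ := (isCompact_sphere (0 : Tan d) 1).exists_bound_of_continuousOn hc
    exact ⟨C, fun ξ hξ => hC ξ (by simpa using hξ)⟩
  choose C hC using h1
  refine ⟨1 + ∑ i ∈ Finset.range (m + 1), |C i|, fun τ ξ hξ i hi him => ?_⟩
  rw [hτ i hi τ ξ (hne ξ hξ)]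
  have h4 : |C i| ≤ ∑ i ∈ Finset.range (m + 1), |C i| :=
    Finset.single_le_sum (f := fun i => |C i|) (fun _ _ => abs_nonneg _)
      (Finset.mem_range.2 (by omega))
  refine (((hC i ξ hξ).trans (le_abs_self _)).trans (h4.trans ?_)).trans
    (le_self_pow₀ (le_add_of_nonneg_right (by positivity)) (by omega))
  linarith

/-- The degree is `0`: replacing `ξ` by `r ξ` moves `-log |ξ|` by `-log r`, and translation
invariance converts this into a shift of the other two coordinates by `log r`. Compactness of `K`
makes the bounds uniform in the parameter. -/
theorem FamilySymbol.homSymbol {W B : Set (Tan d)} {β : Fin 2 → ℝ}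
    {V : (Fin 3 → ℝ) × (Tan d × Tan d) → ℂ} (h : FamilySymbol W β V) {K : Set (Tan d)}
    (hK : IsCompact K) (hKW : K ⊆ W) (hBK : B ⊆ K) : HomSymbol B β 0 (symbolOf V) := by
  refine ⟨fun τ ξ hτ hξ => ?_, fun r hr τ ξ hξ => ?_, fun m N => ?_⟩
  · exact ContDiffAt.comp (g := V) (τ, ξ) (h.smooth (hKW (hBK hτ)) hξ _)
      (contDiffAt_symbolMap (n := ∞) hξ)
  · rw [Real.rpow_zero, Complex.ofReal_one, one_mul, symbolOf, symbolOf]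
    simp only
    rw [h.scale r hr, ← h.translate (Real.log r)]
    congr 2
    ext i
    fin_cases i
    · simp [norm_smul, abs_of_pos hr, Real.log_mul hr.ne' (norm_ne_zero_iff.2 hξ)]
    · simp
    · simp
  · choose C hC0 hC using fun j => h.exists_bound hK hKW j N
    obtain ⟨D, hD⟩ := exists_norm_iteratedFDeriv_symbolMap_le d m
    have hle : ∀ j ≤ m, C j ≤ ∑ j ∈ Finset.range (m + 1), C j := fun j hj =>
      Finset.single_le_sum (f := C) (fun j _ => (hC0 j).le) (Finset.mem_range.2 (by omega))
    have hsum : 0 < ∑ j ∈ Finset.range (m + 1), C j := (hC0 0).trans_le (hle 0 (by omega))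
    refine ⟨m.factorial * (∑ j ∈ Finset.range (m + 1), C j) * (|D| + 1) ^ m, by positivity,
      fun τ ξ hτ hξ => ?_⟩
    have hξ0 : ξ ≠ 0 := by rw [← norm_pos_iff, hξ]; exact one_pos
    have hsm : ContDiffAt ℝ m V (symbolMap (τ, ξ)) :=
      (h.smooth (hKW (hBK hτ)) hξ0 (symbolMap (τ, ξ)).1).of_le (natCast_le_infty m)
    obtain ⟨s, hs, hps, hVs⟩ := exists_isOpen_contDiffOn hsm
    obtain ⟨t, ht, hpt, hft⟩ := exists_isOpen_contDiffOn
      (contDiffAt_symbolMap (τ := τ) (n := m) hξ0)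
    obtain ⟨o, hot, ho, hpo⟩ : ∃ o ⊆ t ∩ symbolMap ⁻¹' s, IsOpen o ∧ (τ, ξ) ∈ o :=
      mem_nhds_iff.1 (inter_mem (ht.mem_nhds hpt) ((contDiffAt_symbolMap (τ := τ) (n := m)
        hξ0).continuousAt.preimage_mem_nhds (hs.mem_nhds hps)))
    set E := Real.exp (weight β τ) / (1 + (Real.exp (τ.1 0) + Real.exp (τ.1 1))) ^ N with hE
    have hE0 : 0 ≤ E := by positivity
    -- Composition estimate for `V ∘ symbolMap` at `|ξ| = 1`, where `-log |ξ| = 0`, so that the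
    -- bounds of `exists_bound` apply.
    have key := norm_iteratedFDerivWithin_comp_le (𝕜 := ℝ) (g := V) (f := symbolMap) (n := m)
      (s := o) (t := s) (x := (τ, ξ)) hVs (hft.mono (hot.trans inter_subset_left)) le_rfl
      hs.uniqueDiffOn ho.uniqueDiffOn (fun z hz => (hot hz).2) hpo
      (C := (∑ j ∈ Finset.range (m + 1), C j) * E) (D := |D| + 1)
      (fun i hi => by
        rw [iteratedFDerivWithin_of_isOpen _ hs hps]
        have h1 := hC i τ.1 τ.2 ξ (hBK hτ) hξ
        have h2 : symbolMap (τ, ξ) = (![0, τ.1 0, τ.1 1], (τ.2, ξ)) := by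
          simp [symbolMap, hξ]
        rw [h2]
        refine h1.trans ?_
        rw [Real.rpow_neg (by positivity), Real.rpow_natCast, mul_assoc]
        rw [hE, weight_fin_two, div_eq_mul_inv]
        have := hle i hi
        gcongr)
      (fun i hi him => by
        rw [iteratedFDerivWithin_of_isOpen _ ho hpo]
        refine (hD τ ξ hξ i hi him).trans ((le_abs_self _).trans ?_)
        rw [abs_pow]
        gcongr
        linarith)
    rw [iteratedFDerivWithin_of_isOpen _ ho hpo] at key
    refine key.trans_eq ?_
    rw [hE]
    ring

/-- The kernel of a family of fully residual operators, in logarithmic homogeneous coordinates. -/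
def kernelOf (V : (Fin 3 → ℝ) × (Tan d × Tan d) → ℂ) : (Fin 2 → ℝ) × (Tan d × Tan d) → ℂ :=
  oscIntegral (fun _ => 1) (symbolOf V)

theorem FamilySymbol.symbolBound_kernelOf [Nontrivial (Tan d)] {W : Set (Tan d)} (hW : IsOpen W)
    {β : Fin 2 → ℝ} {V : (Fin 3 → ℝ) × (Tan d × Tan d) → ℂ} (h : FamilySymbol W β V)
    (hβ : -(d : ℝ) < β 0 + β 1) {a : Fin 2 → ℝ} (ha : ∀ i, 0 ≤ a i) {w₀ y₀ : Tan d}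
    (hy₀ : y₀ ∈ W) (hne : a ≠ 0 ∨ w₀ ≠ 0) :
    SymbolBound (logNhds univ a (w₀, y₀)) (weight β) (kernelOf V) := by
  obtain ⟨ε, hε, hεW⟩ := Metric.nhds_basis_closedBall.mem_iff.1 (hW.mem_nhds hy₀)
  exact (h.homSymbol (isCompact_closedBall y₀ ε) hεW
    Metric.ball_subset_closedBall).symbolBound_oscIntegral Metric.isOpen_ball (by linarith) ha
    (Metric.mem_ball_self hε) hne

end

/-! ### Commutation of the radial operators with quantization -/

section

section Commutation

variable {d : ℕ} {W : Set (Tan d)} {β : Fin 2 → ℝ} {V : (Fin 3 → ℝ) × (Tan d × Tan d) → ℂ}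

theorem shiftDerivs_translate (h : ∀ (r : ℝ) (p : Fin 3 → ℝ) (g : Tan d × Tan d),
    V (fun i => p i + r, g) = V (p, g)) (i : Fin 3) (L : List ℂ) (r : ℝ) (p : Fin 3 → ℝ)
    (g : Tan d × Tan d) :
    shiftDerivs (unitVec i) L V (fun i => p i + r, g) = shiftDerivs (unitVec i) L V (p, g) := by
  have h1 := shiftDerivs_comp_affine (ContinuousLinearMap.id ℝ ((Fin 3 → ℝ) × (Tan d × Tan d)))
    (fun _ => r, 0) (unitVec i) L V
  have h2 : (fun q : (Fin 3 → ℝ) × (Tan d × Tan d) =>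
      V (ContinuousLinearMap.id ℝ ((Fin 3 → ℝ) × (Tan d × Tan d)) q + (fun _ => r, 0))) = V := by
    ext ⟨p, g⟩
    rw [← h r p g]
    congr 1
    exact Prod.ext rfl (by simp)
  rw [h2] at h1
  have h3 := congrFun h1 (p, g)
  rw [h3]
  congr 1
  exact Prod.ext rfl (by simp)

theorem shiftDerivs_scale (h : ∀ r : ℝ, 0 < r → ∀ (p : Fin 3 → ℝ) (y η : Tan d),
    V (p, (y, r • η)) = V (p, (y, η))) (i : Fin 3) (L : List ℂ) {r : ℝ} (hr : 0 < r)
    (p : Fin 3 → ℝ) (y η : Tan d) :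
    shiftDerivs (unitVec i) L V (p, (y, r • η)) = shiftDerivs (unitVec i) L V (p, (y, η)) := by
  let A : (Fin 3 → ℝ) × (Tan d × Tan d) →L[ℝ] (Fin 3 → ℝ) × (Tan d × Tan d) :=
    (ContinuousLinearMap.fst ℝ _ _).prod (((ContinuousLinearMap.fst ℝ _ _).comp
      (ContinuousLinearMap.snd ℝ _ _)).prod
        (r • (ContinuousLinearMap.snd ℝ _ _).comp (ContinuousLinearMap.snd ℝ _ _)))
  have h1 := shiftDerivs_comp_linear A (unitVec i) L V
  have h2 : (fun q => V (A q)) = V := by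
    ext ⟨p, y, η⟩
    exact h r hr p y η
  have h3 : A (unitVec i) = unitVec i := by
    refine Prod.ext rfl (Prod.ext rfl ?_)
    simp [A, unitVec_snd]
  rw [h2, h3] at h1
  exact (congrFun h1 (p, (y, η))).symm

theorem FamilySymbol.shiftDerivs (h : FamilySymbol W β V) (i : Fin 3) (L : List ℂ) :
    FamilySymbol W β (shiftDerivs (unitVec i) L V) :=
  ⟨fun y hy η hη x hx hx0 N => (h.bound y hy η hη x hx hx0 N).shiftDerivs _ _,
    shiftDerivs_translate h.translate i L, fun _ hr => shiftDerivs_scale h.scale i L hr⟩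

/-- The phase does not involve the normal coordinates, so differentiation under the integral acts on
`V` alone. The index is `j.succ` because coordinate `0` of `V` is the one at infinity. Both
integrability statements are recorded so that `∂ - z` can be applied termwise. -/
theorem lineDeriv_kernelOf [Nontrivial (Tan d)] (hW : IsOpen W) (h : FamilySymbol W β V)
    (hβ : -(d : ℝ) < β 0 + β 1) {q : (Fin 2 → ℝ) × (Tan d × Tan d)} (hq : q.2.2 ∈ W) (j : Fin 2) :
    Integrable (oscIntegrand (fun _ => 1) (symbolOf V) q) ∧
    Integrable (oscIntegrand (fun _ => 1) (symbolOf fun q => lineDeriv ℝ V q (unitVec j.succ)) q) ∧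
    lineDeriv ℝ (kernelOf V) q (unitVec j) =
      kernelOf (fun q => lineDeriv ℝ V q (unitVec j.succ)) q := by
  obtain ⟨ε, hε, hεW⟩ := Metric.nhds_basis_closedBall.mem_iff.1 (hW.mem_nhds hq)
  have hS := h.homSymbol (isCompact_closedBall q.2.2 ε) hεW Metric.ball_subset_closedBall
  have hqB : q.2.2 ∈ Metric.ball q.2.2 ε := Metric.mem_ball_self hε
  have hδ : 0 < (Real.exp (q.1 0) + Real.exp (q.1 1)) / 2 := by positivity
  have hO := hS.oscBound_of_pos (ψ := fun _ => 1) Metric.isOpen_ball contDiff_const (M := 1)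
    (by simp) (.inl (by linarith)) 1 hδ
  have hi := hO.integrable hqB (half_lt_self (by positivity))
  obtain ⟨C, hC⟩ := hO
  obtain ⟨h1, h2⟩ := hC q hqB (half_lt_self (by positivity))
  obtain ⟨hi1, hd1, -⟩ := h2 1 le_rfl
  have e1 : ∀ {f : (Fin 2 → ℝ) × (Tan d × Tan d) → ℂ}, DifferentiableAt ℝ f q →
      iteratedFDeriv ℝ 1 f q (fun _ => unitVec j) = lineDeriv ℝ f q (unitVec j) := fun hf => by
    rw [iteratedFDeriv_one_apply, hf.lineDeriv_eq_fderiv]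
  let ev := ContinuousMultilinearMap.apply ℝ (fun _ : Fin 1 => (Fin 2 → ℝ) × (Tan d × Tan d)) ℂ
    (fun _ => unitVec j)
  have e2 : ∀ ξ : Tan d, ξ ≠ 0 →
      iteratedFDeriv ℝ 1 (fun q => oscIntegrand (fun _ => 1) (symbolOf V) q ξ) q
        (fun _ => unitVec j) =
      oscIntegrand (fun _ => 1) (symbolOf fun q => lineDeriv ℝ V q (unitVec j.succ)) q ξ := by
    intro ξ hξ
    have hsm : ContDiffAt ℝ ∞ (fun q => oscIntegrand (fun _ => 1) (symbolOf V) q ξ) q :=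
      (contDiffAt_oscIntegrand (ψ := fun _ => 1) hS contDiff_const hqB hξ).comp q
        (f := fun q => (q, ξ)) (contDiffAt_id.prodMk contDiffAt_const)
    rw [e1 (hsm.differentiableAt (by simp)), lineDeriv]
    have e3 : (fun t : ℝ => oscIntegrand (fun _ => 1) (symbolOf V) (q + t • unitVec j) ξ) =
        fun t : ℝ => Complex.exp (Complex.I * (inner ℝ q.2.1 ξ : ℝ)) *
          V ((![-Real.log ‖ξ‖, q.1 0, q.1 1], (q.2.2, ξ)) + t • unitVec j.succ) := by
      ext t
      simp only [oscIntegrand, symbolOf, one_mul, Prod.snd_add, Prod.smul_snd, unitVec_snd,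
        smul_zero, add_zero]
      congr 2
      refine Prod.ext ?_ ?_
      · have hu : ∀ {k : ℕ} (i j : Fin k), (unitVec j : (Fin k → ℝ) × (Tan d × Tan d)).1 i =
            if i = j then 1 else 0 := fun i j => by
          split_ifs with hij
          · rw [hij, unitVec_fst_self]
          · exact unitVec_fst_of_ne hij
        ext i
        simp only [Prod.fst_add, Prod.smul_fst, Pi.add_apply, Pi.smul_apply, hu]
        fin_cases j <;> fin_cases i <;> simp
      · simp [unitVec_snd]
    rw [e3, deriv_const_mul_field]
    simp only [oscIntegrand, one_mul, symbolOf, lineDeriv]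
  have hev : Integrable (fun ξ => ev (iteratedFDeriv ℝ 1
      (fun q => oscIntegrand (fun _ => 1) (symbolOf V) q ξ) q)) := ev.integrable_comp hi1
  refine ⟨hi, hev.congr (ae_ne_zero.mono fun ξ hξ => e2 ξ hξ), ?_⟩
  rw [kernelOf, ← e1 (h1.differentiableAt (by simp)), hd1]
  change ev _ = _
  rw [← ev.integral_comp_comm hi1]
  exact integral_congr_ae (ae_ne_zero.mono fun ξ hξ => e2 ξ hξ)

theorem shiftDerivs_kernelOf [Nontrivial (Tan d)] (hW : IsOpen W) (h : FamilySymbol W β V)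
    (hβ : -(d : ℝ) < β 0 + β 1) (j : Fin 2) (L : List ℂ) :
    ∀ q : (Fin 2 → ℝ) × (Tan d × Tan d), q.2.2 ∈ W → shiftDerivs (unitVec j) L (kernelOf V) q =
      kernelOf (shiftDerivs (unitVec j.succ) L V) q := by
  induction L with
  | nil => exact fun q _ => rfl
  | cons z L ih =>
    intro q hq
    have hV := h.shiftDerivs j.succ L
    obtain ⟨hi1, hi2, he⟩ := lineDeriv_kernelOf hW hV hβ hq j
    have h1 : lineDeriv ℝ (ZeroCalculus.shiftDerivs (unitVec j) L (kernelOf V)) q (unitVec j) =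
        lineDeriv ℝ (kernelOf (ZeroCalculus.shiftDerivs (unitVec j.succ) L V)) q (unitVec j) := by
      simp only [lineDeriv]
      congr 1
      ext t
      exact ih _ (by simpa [unitVec_snd] using hq)
    simp only [ZeroCalculus.shiftDerivs, shiftDeriv]
    rw [h1, ih q hq, he]
    simp only [kernelOf, oscIntegral]
    rw [← integral_const_mul, ← integral_sub hi2 (hi1.const_mul z)]
    congr 1
    ext ξ
    simp only [oscIntegrand, symbolOf, ZeroCalculus.shiftDerivs, shiftDeriv]
    ring

end Commutation

/-! ### Order of the given families before and after applying the radial operators -/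

section Families

variable {d : ℕ}

/-- The family in logarithmic homogeneous coordinates. -/
def familyLog (n : Tan d → Tan d → ℝ → ℝ → ℂ) : (Fin 3 → ℝ) × (Tan d × Tan d) → ℂ :=
  logPullback (homogPullback fun g : Tan d × Tan d => sphereExtend (n g.1) g.2)

theorem familyLog_apply (n : Tan d → Tan d → ℝ → ℝ → ℂ) (p : Fin 3 → ℝ) (y η : Tan d) :
    familyLog n (p, (y, η)) =
      n y (‖η‖⁻¹ • η) (Real.exp (p 1) / Real.exp (p 0)) (Real.exp (p 2) / Real.exp (p 0)) := rfl

theorem familyLog_translate (n : Tan d → Tan d → ℝ → ℝ → ℂ) (r : ℝ) (p : Fin 3 → ℝ)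
    (g : Tan d × Tan d) : familyLog n (fun i => p i + r, g) = familyLog n (p, g) := by
  obtain ⟨y, η⟩ := g
  simp only [familyLog_apply, Real.exp_add]
  rw [mul_div_mul_right _ _ (Real.exp_ne_zero r), mul_div_mul_right _ _ (Real.exp_ne_zero r)]

theorem familyLog_scale (n : Tan d → Tan d → ℝ → ℝ → ℂ) {r : ℝ} (hr : 0 < r) (p : Fin 3 → ℝ)
    (y η : Tan d) : familyLog n (p, (y, r • η)) = familyLog n (p, (y, η)) := by
  simp only [familyLog_apply]
  congr 1
  rw [norm_smul, Real.norm_of_nonneg hr.le, mul_inv, smul_smul, mul_right_comm,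
    inv_mul_cancel₀ hr.ne', one_mul]

theorem IsConormalSphereFamilyOn.familySymbol {α₀ α₁ : WithTop ℝ} {W : Set (Tan d)}
    {n : Tan d → Tan d → ℝ → ℝ → ℂ} (h : IsConormalSphereFamilyOn α₀ α₁ W n) {β : Fin 2 → ℝ}
    (h0 : (β 0 : WithTop ℝ) ≤ α₀) (h1 : (β 1 : WithTop ℝ) ≤ α₁) :
    FamilySymbol W β (familyLog n) := by
  refine ⟨fun y hy η hη x hx hx0 N => ?_, familyLog_translate n,
    fun r hr => familyLog_scale n hr⟩
  refine isConormalAt_iff.1 (h y hy η hη x hx hx0) _ fun i => ?_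
  fin_cases i
  · exact le_top
  · exact h0
  · exact h1

theorem IsPhgSphereFamilyOn.familySymbol {E₀ E₁ : IndexSet} {W : Set (Tan d)}
    {n : Tan d → Tan d → ℝ → ℝ → ℂ} (h : IsPhgSphereFamilyOn E₀ E₁ W n) {β : Fin 2 → ℝ}
    (h0 : ∀ p ∈ E₀.carrier, β 0 < p.1.re) (h1 : ∀ p ∈ E₁.carrier, β 1 < p.1.re) :
    FamilySymbol W β (familyLog n) := by
  refine ⟨fun y hy η hη x hx hx0 N => ?_, familyLog_translate n,
    fun r hr => familyLog_scale n hr⟩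
  refine (h y hy η hη x hx hx0).symbolBound hx fun i => ?_
  fin_cases i
  · exact fun p hp => absurd hp (notMem_empty p)
  · exact h0
  · exact h1

/-- Once the exponents up to `β 0` are removed, the order `β 0` at `t = 0` is attained, with no
restriction on `β 0`. -/
theorem IsPhgSphereFamilyOn.familySymbol_left {E₀ E₁ : IndexSet} {W : Set (Tan d)}
    {n : Tan d → Tan d → ℝ → ℝ → ℂ} (h : IsPhgSphereFamilyOn E₀ E₁ W n) {β : Fin 2 → ℝ}
    (h1 : ∀ p ∈ E₁.carrier, β 1 < p.1.re) :
    FamilySymbol W β (shiftDerivs (unitVec 1) (E₀.exponents (β 0)) (familyLog n)) := by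
  obtain ⟨b, hb⟩ := E₀.exists_lt
  have hF : FamilySymbol W ![b, β 1] (familyLog n) := h.familySymbol hb h1
  refine ⟨fun y hy η hη x hx hx0 N => ?_, (hF.shiftDerivs _ _).translate, (hF.shiftDerivs _ _).scale⟩
  by_cases hx1 : x 1 = 0
  · refine (h y hy η hη x hx hx0).symbolBound_shiftDerivs (α := ![N, β 0, β 1]) hx hx1
      fun j hj => ?_
    fin_cases j
    · exact fun p hp => absurd hp (notMem_empty p)
    · exact absurd rfl hj
    · exact h1
  -- Away from `t = 0` the weight there is irrelevant, and the bound with some admissible weight `b`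
  -- suffices.
  · refine ((hF.shiftDerivs 1 (E₀.exponents (β 0))).bound y hy η hη x hx hx0 N).mono_weight hx
      fun i hi => ?_
    fin_cases i
    · exact le_rfl
    · exact absurd hi hx1
    · exact le_rfl

theorem IsPhgSphereFamilyOn.familySymbol_right {E₀ E₁ : IndexSet} {W : Set (Tan d)}
    {n : Tan d → Tan d → ℝ → ℝ → ℂ} (h : IsPhgSphereFamilyOn E₀ E₁ W n) {β : Fin 2 → ℝ}
    (h0 : ∀ p ∈ E₀.carrier, β 0 < p.1.re) :
    FamilySymbol W β (shiftDerivs (unitVec 2) (E₁.exponents (β 1)) (familyLog n)) := by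
  obtain ⟨b, hb⟩ := E₁.exists_lt
  have hF : FamilySymbol W ![β 0, b] (familyLog n) := h.familySymbol h0 hb
  refine ⟨fun y hy η hη x hx hx0 N => ?_, (hF.shiftDerivs _ _).translate, (hF.shiftDerivs _ _).scale⟩
  by_cases hx2 : x 2 = 0
  · refine (h y hy η hη x hx hx0).symbolBound_shiftDerivs (α := ![N, β 0, β 1]) hx hx2
      fun j hj => ?_
    fin_cases j
    · exact fun p hp => absurd hp (notMem_empty p)
    · exact h0
    · exact absurd rfl hj
  · refine ((hF.shiftDerivs 2 (E₁.exponents (β 1))).bound y hy η hη x hx hx0 N).mono_weight hx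
      fun i hi => ?_
    fin_cases i
    · exact le_rfl
    · exact le_rfl
    · exact absurd hi hx2

/-- Weights below the index sets may be increased to satisfy the integrability condition. -/
theorem IndexSet.exists_weights {E₀ E₁ : IndexSet} {c : ℝ} (h : ∀ p ∈ E₀.sum E₁, c < p.1.re)
    {β : Fin 2 → ℝ} (h0 : ∀ p ∈ E₀.carrier, β 0 < p.1.re) (h1 : ∀ p ∈ E₁.carrier, β 1 < p.1.re) :
    ∃ γ : Fin 2 → ℝ, (∀ i, β i ≤ γ i) ∧ (∀ p ∈ E₀.carrier, γ 0 < p.1.re) ∧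
      (∀ p ∈ E₁.carrier, γ 1 < p.1.re) ∧ c < γ 0 + γ 1 := by
  have hmin : ∀ E : IndexSet, E.carrier.Nonempty → ∃ e ∈ E.carrier, ∀ p ∈ E.carrier, e.1.re ≤ p.1.re := by
    rintro E ⟨p, hp⟩
    obtain ⟨e, ⟨he, he'⟩, hmin⟩ := (E.finite_lt (p.1.re + 1)).exists_minimalFor
      (fun p : ℂ × ℕ => p.1.re) _ ⟨p, hp, by linarith⟩
    refine ⟨e, he, fun q hq => ?_⟩
    rcases lt_or_ge q.1.re (p.1.re + 1) with h | h
    · rcases le_total e.1.re q.1.re with h2 | h2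
      · exact h2
      · exact hmin ⟨hq, h⟩ h2
    · exact le_of_lt (lt_of_lt_of_le he' h)
  rcases E₀.carrier.eq_empty_or_nonempty with h2 | h2
  · refine ⟨![max (β 0) (c - β 1 + 1), β 1], ?_, by simp [h2], h1, ?_⟩
    · intro i
      fin_cases i
      · exact le_max_left _ _
      · exact le_rfl
    · change c < max (β 0) (c - β 1 + 1) + β 1
      linarith [le_max_right (β 0) (c - β 1 + 1)]
  rcases E₁.carrier.eq_empty_or_nonempty with h3 | h3
  · refine ⟨![β 0, max (β 1) (c - β 0 + 1)], ?_, h0, by simp [h3], ?_⟩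
    · intro i
      fin_cases i
      · exact le_rfl
      · exact le_max_left _ _
    · change c < β 0 + max (β 1) (c - β 0 + 1)
      linarith [le_max_right (β 1) (c - β 0 + 1)]
  obtain ⟨e, he, hemin⟩ := hmin E₀ h2
  obtain ⟨f, hf, hfmin⟩ := hmin E₁ h3
  have hs : c < e.1.re + f.1.re := by
    simpa using h (e.1 + f.1, e.2 + f.2) ⟨e, he, f, hf, rfl⟩
  -- A third of the slack: giving up `ε` at each of the two smallest real parts keeps the sum of the
  -- weights above `c`.
  set ε := (e.1.re + f.1.re - c) / 3 with hε
  refine ⟨![max (β 0) (e.1.re - ε), max (β 1) (f.1.re - ε)], ?_, fun p hp => ?_, fun p hp => ?_, ?_⟩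
  · intro i
    fin_cases i
    · exact le_max_left _ _
    · exact le_max_left _ _
  · exact max_lt (h0 p hp) (by linarith [hemin p hp])
  · exact max_lt (h1 p hp) (by linarith [hfmin p hp])
  · change c < max (β 0) (e.1.re - ε) + max (β 1) (f.1.re - ε)
    linarith [le_max_right (β 0) (e.1.re - ε), le_max_right (β 1) (f.1.re - ε)]

end Families

end

/-! ### The kernel relative to 0-half-densities, and its behaviour at the boundary hypersurfaces -/

section

theorem tendsto_logNhds_of_comp {k k' : ℕ} {F F' : Type*} [NormedAddCommGroup F] [NormedSpace ℝ F]
    [NormedAddCommGroup F'] [NormedSpace ℝ F'] {D : Set F'} {x₀ : Fin k → ℝ} {y₀ : F}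
    {x₁ : Fin k' → ℝ} {y₁ : F'} {A B : (Fin k' → ℝ) × F' → (Fin k → ℝ) × F}
    (hAB : ∀ p, expMap (A p) = B (expMap p)) (hB : Continuous B) (hB0 : B (x₁, y₁) = (x₀, y₀)) :
    Tendsto A (logNhds D x₁ y₁) (logNhds univ x₀ y₀) := by
  intro P hP
  obtain ⟨t, ht, htP⟩ := exists_nhds_of_eventually_logNhds hP
  have h1 : ∀ᶠ q in 𝓝 (x₁, y₁), B q ∈ t := hB.continuousAt.eventually_mem (by rwa [hB0])
  exact (eventually_logNhds_of_nhds h1).mono fun p hp => htP (A p) (by rwa [hAB])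

section Weighted

variable {d : ℕ} {W : Set (Tan d)} {β : Fin 2 → ℝ} {V : (Fin 3 → ℝ) × (Tan d × Tan d) → ℂ}

/-- The kernel of a family, as a coefficient relative to 0-half-densities. -/
def zeroKernel (V : (Fin 3 → ℝ) × (Tan d × Tan d) → ℂ) : (Fin 2 → ℝ) × (Tan d × Tan d) → ℂ :=
  fun q => Complex.exp ((d : ℂ) * (q.1 1 : ℝ)) * kernelOf V q

theorem shiftDerivs_mul_of_const {E : Type*} [NormedAddCommGroup E] [NormedSpace ℝ E] {v : E}
    {c : E → ℂ} (hc : ∀ q (t : ℝ), c (q + t • v) = c q) (L : List ℂ) (U : E → ℂ) :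
    shiftDerivs v L (fun q => c q * U q) = fun q => c q * shiftDerivs v L U q := by
  induction L with
  | nil => rfl
  | cons z L ih =>
    simp only [shiftDerivs, ih]
    ext q
    simp only [shiftDeriv, lineDeriv, hc, deriv_const_mul_field]
    ring

theorem FamilySymbol.contDiffAt_kernelOf [Nontrivial (Tan d)] (hW : IsOpen W)
    (h : FamilySymbol W β V) (hβ : -(d : ℝ) < β 0 + β 1) {q : (Fin 2 → ℝ) × (Tan d × Tan d)}
    (hq : q.2.2 ∈ W) : ContDiffAt ℝ ∞ (kernelOf V) q := by
  have h1 := (h.symbolBound_kernelOf hW hβ (a := fun i => Real.exp (q.1 i)) (w₀ := q.2.1)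
    (fun i => (Real.exp_pos _).le) hq (.inl fun h0 => (Real.exp_pos (q.1 0)).ne' (congrFun h0 0))).smooth
  obtain ⟨t, ht, htP⟩ := exists_nhds_of_eventually_logNhds h1
  exact htP q (mem_of_mem_nhds ht)

theorem FamilySymbol.symbolBound_zeroKernel [Nontrivial (Tan d)] (hW : IsOpen W)
    (h : FamilySymbol W β V) (hβ : -(d : ℝ) < β 0 + β 1) {a : Fin 2 → ℝ} (ha : ∀ i, 0 ≤ a i)
    {w₀ y₀ : Tan d} (hy₀ : y₀ ∈ W) (hne : a ≠ 0 ∨ w₀ ≠ 0) :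
    SymbolBound (logNhds univ a (w₀, y₀)) (weight ![β 0, β 1 + d]) (zeroKernel V) := by
  refine ((SymbolBound.cexp _ (d : ℂ) (coordL 1 : (Fin 2 → ℝ) × (Tan d × Tan d) →L[ℝ] ℝ)).mul
    (h.symbolBound_kernelOf hW hβ ha hy₀ hne)).mono 0 (Eventually.of_forall fun q => le_of_eq ?_)
  simp only [weight_fin_two, coordL_apply, Complex.natCast_re, Matrix.cons_val_zero,
    Matrix.cons_val_one]
  ring

theorem shiftDerivs_zeroKernel_left [Nontrivial (Tan d)] (hW : IsOpen W) (h : FamilySymbol W β V)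
    (hβ : -(d : ℝ) < β 0 + β 1) (L : List ℂ) {q : (Fin 2 → ℝ) × (Tan d × Tan d)} (hq : q.2.2 ∈ W) :
    shiftDerivs (unitVec 0) L (zeroKernel V) q = zeroKernel (shiftDerivs (unitVec 1) L V) q := by
  have h1 := shiftDerivs_mul_of_const (v := (unitVec 0 : (Fin 2 → ℝ) × (Tan d × Tan d)))
    (c := fun q => Complex.exp ((d : ℂ) * (q.1 1 : ℝ)))
    (fun q t => by simp [unitVec_fst_of_ne (show (1 : Fin 2) ≠ 0 by decide)]) L (kernelOf V)
  have h2 := congrFun h1 q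
  refine h2.trans ?_
  rw [shiftDerivs_kernelOf hW h hβ 0 L q hq]
  rfl

/-- Conjugation by the factor `b ^ d` of the kernel shifts all exponents by `d`. -/
theorem shiftDerivs_zeroKernel_right [Nontrivial (Tan d)] (hW : IsOpen W) (h : FamilySymbol W β V)
    (hβ : -(d : ℝ) < β 0 + β 1) (L : List ℂ) {q : (Fin 2 → ℝ) × (Tan d × Tan d)} (hq : q.2.2 ∈ W) :
    shiftDerivs (unitVec 1) (L.map (· + (d : ℂ))) (zeroKernel V) q =
      zeroKernel (shiftDerivs (unitVec 2) L V) q := by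
  have h1 := shiftDerivs_expPoly_mul (1 : Fin 2) (d : ℂ) (fun _ => 1) L
    (h.contDiffAt_kernelOf hW hβ hq)
  have h2 : (fun p => expPoly (1 : Fin 2) (d : ℂ) (Polynomial.X ^ 0) (fun _ => 1) p *
      kernelOf V p) = zeroKernel V := by
    ext p
    simp [expPoly, zeroKernel]
  rw [h2] at h1
  rw [h1.eq_of_nhds, shiftDerivs_kernelOf hW h hβ 1 L q hq]
  simp [expPoly, zeroKernel]

end Weighted

section Polyhomogeneous

variable {d : ℕ} [Nontrivial (Tan d)] {W : Set (Tan d)} {E₀ E₁ : IndexSet}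
  {n : Tan d → Tan d → ℝ → ℝ → ℂ}

theorem symbolBound_dropL {F : Type*} [NormedAddCommGroup F] [NormedSpace ℝ F]
    {q : (Fin 3 → ℝ) × F} (hq : ∀ i, 0 ≤ q.1 i) {γ : Fin 2 → ℝ} {α : Fin 3 → ℝ} (h0 : α 0 ≤ 0)
    (h1 : α 1 ≤ γ 0) (h2 : α 2 ≤ γ 1) {U : (Fin 2 → ℝ) × F → ℂ}
    (hU : SymbolBound (logNhds univ (dropL 0 q).1 q.2) (weight γ) U) :
    SymbolBound (logNhds univ q.1 q.2) (weight α) (fun p => U (dropL 0 p)) := by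
  have h3 : Tendsto (dropL 0 : (Fin 3 → ℝ) × F →L[ℝ] _) (logNhds univ q.1 q.2)
      (logNhds univ (dropL 0 q).1 q.2) :=
    tendsto_logNhds_of_comp (B := dropL 0) (fun p => rfl) (dropL 0).continuous rfl
  have h4 := (hU.comp_linear (dropL 0) h3).mono (ν := weight ![0, γ 0, γ 1]) 0
    (Eventually.of_forall fun p => le_of_eq ?_)
  · refine h4.mono_weight hq fun i _ => ?_
    fin_cases i
    · exact h0
    · exact h1
    · exact h2
  · rw [weight_fin_two, weight_fin_three]
    change γ 0 * p.1 1 + γ 1 * p.1 2 = 0 * p.1 0 + γ 0 * p.1 1 + γ 1 * p.1 2 + 0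
    ring

/-- At the front face nothing depends on `R`. At `a = 0` and `b = 0` the operators pass to the
family, where they raise the order. The condition on the box says that it stays in the blow-up,
where `(a, b, w) ≠ 0`, and over `W`. -/
theorem IsPhgSphereFamilyOn.testPhg (hW : IsOpen W) (h : IsPhgSphereFamilyOn E₀ E₁ W n)
    (hE : ∀ p ∈ E₀.sum E₁, -(d : ℝ) < p.1.re) {x₀ : Fin 3 → ℝ} {g₀ : Tan d × Tan d} {ε : ℝ}
    (hbox : ∀ q ∈ closedBox x₀ g₀ ε, q.2.2 ∈ W ∧ ((dropL 0 q).1 ≠ 0 ∨ q.2.1 ≠ 0)) :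
    TestPhg ![IndexSet.nat, E₀, E₁.shift d] x₀ g₀ ε
      (fun p => zeroKernel (familyLog n) (dropL 0 p)) := by
  have hnat : ∀ {a : ℝ}, (∀ p ∈ IndexSet.nat.carrier, a < p.1.re) → a ≤ 0 := fun ha => by
    simpa using (ha (((0 : ℕ) : ℂ), 0) ⟨0, rfl⟩).le
  have hshift : ∀ {a : ℝ}, (∀ p ∈ (E₁.shift d).carrier, a < p.1.re) →
      ∀ p ∈ E₁.carrier, a - d < p.1.re := fun ha p hp => by
    have h1 := ha (p.1 + d, p.2) (by simpa [IndexSet.shift] using hp)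
    simp only [Complex.add_re, Complex.natCast_re] at h1
    linarith
  have hpos : ∀ {q : (Fin 3 → ℝ) × (Tan d × Tan d)}, q ∈ closedBox x₀ g₀ ε →
      ∀ i, 0 ≤ (dropL 0 q).1 i := fun hq i => (hq.1 _).1
  have hmem : ∀ {p : (Fin 3 → ℝ) × (Tan d × Tan d)}, p ∈ logBox x₀ g₀ ε → (dropL 0 p).2.2 ∈ W :=
    fun hp => (hbox _ (expMap_mem_closedBox hp)).1
  constructor
  · intro α hα
    obtain ⟨γ, hγ, hγ0, hγ1, hγs⟩ := IndexSet.exists_weights hE (β := ![α 1, α 2 - d]) (hα 1)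
      (hshift (hα 2))
    refine .logBox_of_forall fun q hq => ?_
    refine symbolBound_dropL (fun i => (hq.1 i).1) (hnat (hα 0)) ?_ ?_
      ((h.familySymbol hγ0 hγ1).symbolBound_zeroKernel hW hγs (hpos hq) (hbox q hq).1 (hbox q hq).2)
    · exact hγ 0
    · have h1 : α 2 - d ≤ γ 1 := hγ 1
      change α 2 ≤ γ 1 + d
      linarith
  · intro i hi α hα
    obtain ⟨b₀, hb₀⟩ := E₀.exists_lt
    obtain ⟨b₁, hb₁⟩ := E₁.exists_lt
    obtain ⟨γ', -, hγ0', hγ1', hγs'⟩ := IndexSet.exists_weights hE (β := ![b₀, b₁]) hb₀ hb₁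
    have hV := h.familySymbol hγ0' hγ1'
    fin_cases i
    -- The single operator `R ∂_R` annihilates the kernel.
    · refine ⟨[0], fun z l hl => ?_, ?_⟩
      · have h1 : z = 0 := by
          by_contra hz
          simp [List.count_singleton, Ne.symm hz] at hl
        subst h1
        have h2 : l = 0 := by simpa using hl
        subst h2
        exact ⟨0, by simp⟩
      · have h1 : shiftDerivs (unitVec (0 : Fin 3)) [0]
            (fun p => zeroKernel (familyLog n) (dropL 0 p)) = fun _ => 0 := by
          ext p
          simp [shiftDerivs, shiftDeriv, lineDeriv, dropL_unitVec]
        have h2 := SymbolBound.zero (l := 𝓟 (logBox x₀ g₀ ε)) (μ := weight α)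
        rw [← h1] at h2
        exact h2
    -- The order at `a = 0` may be raised at will after the operators are applied; it is taken so
    -- large that the integral of the new family converges.
    · set β : Fin 2 → ℝ := ![max (α 1) (-d - (α 2 - d) + 1), α 2 - d] with hβ
      have hβs : -(d : ℝ) < β 0 + β 1 := by
        simp only [hβ, Matrix.cons_val_zero, Matrix.cons_val_one]
        linarith [le_max_right (α 1) (-d - (α 2 - d) + 1)]
      have h2 := hα 2 (by decide)
      have hF := h.familySymbol_left (β := β) (hshift h2)
      refine ⟨E₀.exponents (β 0), E₀.admissible_exponents _, ?_⟩
      have hb : SymbolBound (𝓟 (logBox x₀ g₀ ε)) (weight α) (fun p =>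
          zeroKernel (shiftDerivs (unitVec 1) (E₀.exponents (β 0)) (familyLog n)) (dropL 0 p)) := by
        refine .logBox_of_forall fun q hq => ?_
        refine symbolBound_dropL (fun i => (hq.1 i).1) (hnat (hα 0 (by decide))) ?_ ?_
          (hF.symbolBound_zeroKernel hW hβs (hpos hq) (hbox q hq).1 (hbox q hq).2)
        · exact le_max_left _ _
        · simp [hβ]
      refine hb.congr isOpenFilter_logBox (eventually_principal.2 fun p hp => ?_)
      change _ = shiftDerivs (unitVec (1 : Fin 3)) _ _ p
      rw [shiftDerivs_comp_linear, show (unitVec (1 : Fin 3) : (Fin 3 → ℝ) × (Tan d × Tan d)) =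
        unitVec ((0 : Fin 3).succAbove 0) from rfl, dropL_unitVec_succAbove]
      exact (shiftDerivs_zeroKernel_left hW hV hγs' _ (hmem hp)).symm
    · set β : Fin 2 → ℝ := ![α 1, max (α 2 - d) (-d - α 1 + 1)] with hβ
      have hβs : -(d : ℝ) < β 0 + β 1 := by
        simp only [hβ, Matrix.cons_val_zero, Matrix.cons_val_one]
        linarith [le_max_right (α 2 - d) (-d - α 1 + 1)]
      have h1 := hα 1 (by decide)
      have hF := h.familySymbol_right (β := β) h1
      refine ⟨(E₁.exponents (β 1)).map (· + (d : ℂ)), fun z l hl => ?_, ?_⟩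
      · have h3 : ((E₁.exponents (β 1)).map (· + (d : ℂ))).count z =
            (E₁.exponents (β 1)).count (z - d) := by
          have := List.count_map_of_injective (E₁.exponents (β 1)) (· + (d : ℂ))
            (add_left_injective (d : ℂ)) (z - d)
          simpa using this
        rw [h3] at hl
        exact E₁.admissible_exponents _ _ _ hl
      have hb : SymbolBound (𝓟 (logBox x₀ g₀ ε)) (weight α) (fun p =>
          zeroKernel (shiftDerivs (unitVec 2) (E₁.exponents (β 1)) (familyLog n)) (dropL 0 p)) := by
        refine .logBox_of_forall fun q hq => ?_
        refine symbolBound_dropL (fun i => (hq.1 i).1) (hnat (hα 0 (by decide))) ?_ ?_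
          (hF.symbolBound_zeroKernel hW hβs (hpos hq) (hbox q hq).1 (hbox q hq).2)
        · simp [hβ]
        · have := le_max_left (α 2 - d) (-d - α 1 + 1)
          change α 2 ≤ max (α 2 - d) (-d - α 1 + 1) + d
          linarith
      refine hb.congr isOpenFilter_logBox (eventually_principal.2 fun p hp => ?_)
      change _ = shiftDerivs (unitVec (2 : Fin 3)) _ _ p
      rw [shiftDerivs_comp_linear, show (unitVec (2 : Fin 3) : (Fin 3 → ℝ) × (Tan d × Tan d)) =
        unitVec ((0 : Fin 3).succAbove 1) from rfl, dropL_unitVec_succAbove]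
      exact (shiftDerivs_zeroKernel_right hW hV hγs' _ (hmem hp)).symm

end Polyhomogeneous

section Conormal

variable {d : ℕ} [Nontrivial (Tan d)] {W : Set (Tan d)} {α₀ α₁ : WithTop ℝ}
  {n : Tan d → Tan d → ℝ → ℝ → ℂ}

/-- Weights may be increased to satisfy the integrability condition. -/
theorem exists_weights_of_lt {c : ℝ} (h : (c : WithTop ℝ) < α₀ + α₁) {β : Fin 2 → ℝ}
    (h0 : (β 0 : WithTop ℝ) ≤ α₀) (h1 : (β 1 : WithTop ℝ) ≤ α₁) :
    ∃ γ : Fin 2 → ℝ, (∀ i, β i ≤ γ i) ∧ (γ 0 : WithTop ℝ) ≤ α₀ ∧ (γ 1 : WithTop ℝ) ≤ α₁ ∧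
      c < γ 0 + γ 1 := by
  induction α₀ using WithTop.recTopCoe with
  | top =>
    refine ⟨![max (β 0) (c - β 1 + 1), β 1], fun i => ?_, le_top, h1, ?_⟩
    · fin_cases i
      · exact le_max_left _ _
      · exact le_rfl
    · change c < max (β 0) (c - β 1 + 1) + β 1
      linarith [le_max_right (β 0) (c - β 1 + 1)]
  | coe a =>
    induction α₁ using WithTop.recTopCoe with
    | top =>
      refine ⟨![β 0, max (β 1) (c - β 0 + 1)], fun i => ?_, h0, le_top, ?_⟩
      · fin_cases i
        · exact le_rfl
        · exact le_max_left _ _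
      · change c < β 0 + max (β 1) (c - β 0 + 1)
        linarith [le_max_right (β 1) (c - β 0 + 1)]
    | coe b =>
      refine ⟨![a, b], fun i => ?_, le_rfl, le_rfl, by exact_mod_cast h⟩
      fin_cases i
      · exact_mod_cast h0
      · exact_mod_cast h1

/-- The weights asked for may be too low for convergence of the integral; they are first raised
within the given bounds and lowered again in the result. The linear map `A` is there to add the
parameter `R`, on which the kernel does not depend. -/
theorem IsConormalSphereFamilyOn.symbolBound (hW : IsOpen W)
    (h : IsConormalSphereFamilyOn α₀ α₁ W n) (hα : ((-(d : ℝ) : ℝ) : WithTop ℝ) < α₀ + α₁)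
    {F : Type*} [NormedAddCommGroup F] [NormedSpace ℝ F] (A : F →L[ℝ] Tan d × Tan d) (D : Set F)
    {a : Fin 2 → ℝ} (ha : ∀ i, 0 ≤ a i) {f₀ : F} (hy₀ : (A f₀).2 ∈ W) (hne : a ≠ 0 ∨ (A f₀).1 ≠ 0)
    {β : Fin 2 → ℝ} (hβ : ∀ i, (β i : WithTop ℝ) ≤ ![α₀, α₁ + ((d : ℝ) : WithTop ℝ)] i) :
    SymbolBound (logNhds D a f₀) (weight β)
      (fun p : (Fin 2 → ℝ) × F => zeroKernel (familyLog n) (p.1, A p.2)) := by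
  have hβ1 : ((β 1 - d : ℝ) : WithTop ℝ) ≤ α₁ := by
    have h1 : (β 1 : WithTop ℝ) ≤ α₁ + ((d : ℝ) : WithTop ℝ) := hβ 1
    induction α₁ using WithTop.recTopCoe with
    | top => exact le_top
    | coe b =>
      have h2 : β 1 ≤ b + d := by exact_mod_cast h1
      exact_mod_cast (show β 1 - d ≤ b by linarith)
  obtain ⟨γ, hγ, hγ0, hγ1, hγs⟩ := exists_weights_of_lt hα (β := ![β 0, β 1 - d]) (hβ 0) hβ1
  let T : (Fin 2 → ℝ) × F →L[ℝ] (Fin 2 → ℝ) × (Tan d × Tan d) :=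
    (ContinuousLinearMap.fst ℝ _ _).prod (A.comp (ContinuousLinearMap.snd ℝ _ _))
  have h1 := (h.familySymbol hγ0 hγ1).symbolBound_zeroKernel hW hγs ha hy₀ hne
  have h2 : Tendsto T (logNhds D a f₀) (logNhds univ a ((A f₀).1, (A f₀).2)) :=
    tendsto_logNhds_of_comp (B := T) (fun p => rfl) T.continuous rfl
  have h3 : SymbolBound (logNhds D a f₀) (weight ![γ 0, γ 1 + d])
      (fun p => zeroKernel (familyLog n) (T p)) :=
    (h1.comp_linear T h2).mono 0 (Eventually.of_forall fun p => by
      simp [weight_fin_two, T])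
  refine h3.mono_weight ha fun i _ => ?_
  fin_cases i
  · exact hγ 0
  · have h4 : β 1 - d ≤ γ 1 := hγ 1
    change β 1 ≤ γ 1 + d
    linarith

end Conormal

end

/-! ### Fourier inversion and the reduced normal operator -/

section

open scoped FourierTransform

section Fourier

variable {d : ℕ}

/-- Adapts the phase `exp (i Y·ξ)` to the normalization `exp (2π i w·ξ)` of `𝓕⁻` by rescaling; this
is the source of the factor `(2π) ^ d`. -/
theorem integral_cexp_inner_eq_fourierInv (φ : Tan d → ℂ) (Y : Tan d) :
    ∫ ξ, Complex.exp (Complex.I * (inner ℝ Y ξ : ℝ)) * φ ξ = 𝓕⁻ φ ((2 * Real.pi)⁻¹ • Y) := by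
  rw [Real.fourierInv_eq']
  congr 1
  ext ξ
  rw [inner_smul_right, ← mul_assoc, mul_inv_cancel₀ (by positivity), one_mul, real_inner_comm,
    mul_comm Complex.I, smul_eq_mul]

theorem integral_cexp_neg_inner_eq_fourier (φ : Tan d → ℂ) (Y : Tan d) :
    ∫ ξ, Complex.exp (-(Complex.I * (inner ℝ Y ξ : ℝ))) * φ ξ = 𝓕 φ ((2 * Real.pi)⁻¹ • Y) := by
  rw [Real.fourier_eq']
  congr 1
  ext ξ
  rw [inner_smul_right, neg_mul, neg_mul, ← mul_assoc, mul_inv_cancel₀ (by positivity), one_mul,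
    real_inner_comm, mul_comm Complex.I, smul_eq_mul, Complex.ofReal_neg, neg_mul]

/-- Fourier inversion in the distributional sense. -/
theorem hasFourierTransformOffZero_of_integrable {φ : Tan d → ℂ} (hφ : Integrable φ) :
    HasFourierTransformOffZero (fun Y => ((2 * Real.pi : ℝ) ^ d : ℂ)⁻¹ *
      ∫ ξ, Complex.exp (Complex.I * (inner ℝ Y ξ : ℝ)) * φ ξ) φ := by
  intro χ hχ hχc _
  have hc : (0 : ℝ) < 2 * Real.pi := by positivity
  have hfd : Module.finrank ℝ (Tan d) = d := by simp
  set S : SchwartzMap (Tan d) ℂ := hχc.toSchwartzMap hχ with hS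
  have hSχ : (S : Tan d → ℂ) = χ := rfl
  have hFχ : Integrable (𝓕 χ) := by
    have := (𝓕 S).integrable (μ := volume)
    rwa [SchwartzMap.fourier_coe, hSχ] at this
  have hχi : Integrable χ := hSχ ▸ S.integrable
  have hcont : ∀ {f : Tan d → ℂ}, Integrable f → Continuous (𝓕 f) := fun hf =>
    VectorFourier.fourierIntegral_continuous Real.continuous_fourierChar
      (innerSL ℝ).continuous₂ hf
  have hinv : 𝓕⁻ φ = fun w => 𝓕 φ (-w) := by
    ext w
    exact Real.fourierInv_eq_fourier_neg φ w
  -- The inverse transform of `φ` is bounded and the transform of the test function is Schwartz.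
  have hprod : Integrable (fun w => 𝓕⁻ φ w * 𝓕 χ w) := by
    refine hFχ.bdd_mul (c := ∫ ξ, ‖φ ξ‖) ?_ (ae_of_all _ fun w => ?_)
    · rw [hinv]
      exact ((hcont hφ).comp continuous_neg).aestronglyMeasurable
    · rw [hinv]
      exact VectorFourier.norm_fourierIntegral_le_integral_norm _ _ _ _ _
  have hfun : (fun Y => ((2 * Real.pi : ℝ) ^ d : ℂ)⁻¹ *
      (∫ ξ, Complex.exp (Complex.I * (inner ℝ Y ξ : ℝ)) * φ ξ) *
      ∫ η, Complex.exp (-(Complex.I * (inner ℝ Y η : ℝ))) * χ η) =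
      fun Y => ((2 * Real.pi : ℝ) ^ d : ℂ)⁻¹ *
        (fun w => 𝓕⁻ φ w * 𝓕 χ w) ((2 * Real.pi)⁻¹ • Y) := by
    ext Y
    rw [integral_cexp_inner_eq_fourierInv, integral_cexp_neg_inner_eq_fourier, mul_assoc]
  refine ⟨?_, ?_, ?_⟩
  · rw [hfun]
    exact (hprod.comp_smul (inv_ne_zero hc.ne')).const_mul _
  · obtain ⟨C, hC⟩ := hχc.exists_bound_of_continuous hχ.continuous
    exact hφ.mul_bdd (c := C) hχ.continuous.aestronglyMeasurable (ae_of_all _ hC)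
  · have hsub := Measure.integral_comp_smul (volume : Measure (Tan d))
      (fun w => 𝓕⁻ φ w * 𝓕 χ w) (2 * Real.pi)⁻¹
    rw [hfd] at hsub
    rw [hfun, integral_const_mul, hsub]
    have h1 : |(((2 * Real.pi)⁻¹ : ℝ) ^ d)⁻¹| = (2 * Real.pi) ^ d := by
      rw [inv_pow, inv_inv, abs_of_pos (by positivity)]
    rw [h1, Complex.real_smul, ← mul_assoc, Complex.ofReal_pow, inv_mul_cancel₀
      (by exact_mod_cast (pow_pos hc d).ne'), one_mul]
    -- The transform is moved from `φ` to the test function, for which pointwise inversion then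
    -- holds; `φ` is merely integrable.
    have h2 : ∫ w, 𝓕⁻ φ w * 𝓕 χ w = ∫ w, φ (-w) * 𝓕 (𝓕 χ) w := by
      have := VectorFourier.integral_fourierIntegral_smul_eq_flip (μ := (volume : Measure (Tan d)))
        (ν := (volume : Measure (Tan d))) (L := innerₗ (Tan d)) (f := fun ξ => φ (-ξ)) (g := 𝓕 χ)
        Real.continuous_fourierChar (innerSL ℝ).continuous₂ hφ.comp_neg hFχ
      rw [Real.fourierInv_eq_fourier_comp_neg]
      simp only [smul_eq_mul, flip_innerₗ] at this
      exact this
    rw [h2, ← integral_neg_eq_self]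
    congr 1
    ext w
    rw [neg_neg, ← Real.fourierInv_eq_fourier_neg, hχ.continuous.fourierInv_fourier_eq hχi hFχ]

theorem HasFourierTransformOffZero.congr_ae {f g g' : Tan d → ℂ} (h : HasFourierTransformOffZero f g)
    (hg : g =ᵐ[volume] g') : HasFourierTransformOffZero f g' := by
  intro χ hχ hχc h0
  obtain ⟨h1, h2, h3⟩ := h χ hχ hχc h0
  have h4 : (fun η => g η * χ η) =ᵐ[volume] fun η => g' η * χ η :=
    hg.mono fun η hη => by simp only [hη]
  exact ⟨h1, h2.congr h4, h3.trans (integral_congr_ae h4)⟩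

/-- At `a = s`, `b = 1` the integrand of the kernel is `n(s|ξ|, |ξ|)` for `ξ ≠ 0`. It is integrable
because `β₀ + β₁ > -d`, so the inversion theorem applies to it directly. -/
theorem FamilySymbol.hasFourierTransformOffZero [Nontrivial (Tan d)] {W : Set (Tan d)}
    (hW : IsOpen W) {β : Fin 2 → ℝ} {n : Tan d → Tan d → ℝ → ℝ → ℂ}
    (h : FamilySymbol W β (familyLog n)) (hβ : -(d : ℝ) < β 0 + β 1) {y : Tan d} (hy : y ∈ W)
    {s : ℝ} (hs : 0 < s) :
    HasFourierTransformOffZero (fun Υ => ((2 * Real.pi : ℝ) ^ d : ℂ)⁻¹ *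
      kernelOf (familyLog n) (![Real.log s, 0], (Υ, y)))
      (fun η => n y (‖η‖⁻¹ • η) (s * ‖η‖) ‖η‖) := by
  have hi := (lineDeriv_kernelOf hW h hβ (q := (![Real.log s, 0], ((0 : Tan d), y))) hy 0).1
  have hae : symbolOf (familyLog n) ∘ (fun ξ => ((![Real.log s, 0], y), ξ)) =ᵐ[volume]
      fun η => n y (‖η‖⁻¹ • η) (s * ‖η‖) ‖η‖ := by
    filter_upwards [ae_ne_zero] with ξ hξ
    have hξ' : 0 < ‖ξ‖ := norm_pos_iff.2 hξ
    simp only [Function.comp_apply, symbolOf, familyLog_apply]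
    congr 1
    · simp [Real.exp_neg, Real.exp_log hξ', Real.exp_log hs]
    · simp [Real.exp_neg, Real.exp_log hξ']
  have hφ : Integrable (symbolOf (familyLog n) ∘ (fun ξ => ((![Real.log s, 0], y), ξ))) := by
    refine hi.congr (ae_of_all _ fun ξ => ?_)
    simp [oscIntegrand]
  have key := (hasFourierTransformOffZero_of_integrable hφ).congr_ae hae
  refine (congrArg (fun f => HasFourierTransformOffZero f _) ?_).mp key
  ext Y
  congr 2
  ext ξ
  simp [oscIntegrand]

end Fourier

end

/-! ### Homogeneity of the kernel on the double space -/

section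

section Homogeneity

variable {d : ℕ} [Nontrivial (Tan d)]

/-- The kernel of a family is homogeneous of degree `0` on the double space. -/
theorem zeroKernel_dilation (n : Tan d → Tan d → ℝ → ℝ → ℂ) (r : ℝ) (p : Fin 2 → ℝ)
    (w y : Tan d) : zeroKernel (familyLog n) (fun i => p i + r, (Real.exp r • w, y)) =
      zeroKernel (familyLog n) (p, (w, y)) := by
  -- The dilation is absorbed by the substitution `ξ ↦ exp r • ξ`; its Jacobian `exp (-(d r))`
  -- cancels against the factor `b ^ d`.
  have h1 : ∀ᵐ ξ : Tan d, oscIntegrand (fun _ => 1) (symbolOf (familyLog n))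
      (fun i => p i + r, (Real.exp r • w, y)) ξ =
      oscIntegrand (fun _ => 1) (symbolOf (familyLog n)) (p, (w, y)) (Real.exp r • ξ) := by
    filter_upwards [ae_ne_zero] with ξ hξ
    simp only [oscIntegrand, symbolOf, one_mul]
    congr 1
    · rw [inner_smul_left, inner_smul_right]
      simp
    · rw [familyLog_scale n (Real.exp_pos r), ← familyLog_translate n r
        ![-Real.log ‖Real.exp r • ξ‖, p 0, p 1] (y, ξ)]
      congr 2
      ext i
      fin_cases i
      · simp [norm_smul, Real.log_mul (Real.exp_ne_zero r) (norm_ne_zero_iff.2 hξ)]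
      · simp
      · simp
  have h2 : kernelOf (familyLog n) (fun i => p i + r, (Real.exp r • w, y)) =
      (Real.exp (-(d * r)) : ℂ) * kernelOf (familyLog n) (p, (w, y)) := by
    have h3 := Measure.integral_comp_smul (volume : Measure (Tan d))
      (oscIntegrand (fun _ => 1) (symbolOf (familyLog n)) (p, (w, y))) (Real.exp r)
    change ∫ ξ, oscIntegrand (fun _ => 1) (symbolOf (familyLog n))
      (fun i => p i + r, (Real.exp r • w, y)) ξ = _ * ∫ ξ, oscIntegrand (fun _ => 1)
        (symbolOf (familyLog n)) (p, (w, y)) ξ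
    rw [integral_congr_ae h1, h3, Complex.real_smul, finrank_euclideanSpace_fin, ← Real.exp_nat_mul, ← Real.exp_neg, abs_of_pos (Real.exp_pos _)]
  simp only [zeroKernel, h2]
  rw [← mul_assoc, Complex.ofReal_exp, ← Complex.exp_add]
  congr 2
  push_cast
  ring

end Homogeneity

/-! ### Locality of the classes, and families pulled back in the parameters -/

section Local

variable {F : Type*} [NormedAddCommGroup F] [NormedSpace ℝ F] {k : ℕ} {E : Fin k → IndexSet}
  {x₀ : Fin k → ℝ} {y₀ : F} {ε : ℝ}

theorem TestPhg.congr {U V : (Fin k → ℝ) × F → ℂ} (h : TestPhg E x₀ y₀ ε U)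
    (hUV : ∀ p ∈ logBox x₀ y₀ ε, U p = V p) : TestPhg E x₀ y₀ ε V := by
  have hev : ∀ᶠ p in 𝓟 (logBox x₀ y₀ ε), U p = V p := eventually_principal.2 hUV
  refine ⟨fun α hα => (h.conormal α hα).congr isOpenFilter_logBox hev, fun i hi α hα => ?_⟩
  obtain ⟨L, hL, hb⟩ := h.tests i hi α hα
  exact ⟨L, hL, hb.congr isOpenFilter_logBox
    (eventually_shiftDerivs_congr isOpenFilter_logBox _ L hev)⟩

theorem TestPhg.zero : TestPhg E x₀ y₀ ε (fun _ => 0) := by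
  refine ⟨fun α _ => SymbolBound.zero, fun i _ α _ => ⟨[], IndexSet.Admissible.nil _, ?_⟩⟩
  rw [shiftDerivs_zero]
  exact SymbolBound.zero

theorem isPhgAt_of_eventually_eq_zero (hx₀ : ∀ i, 0 ≤ x₀ i) {u : (Fin k → ℝ) → F → ℂ}
    (h : ∀ᶠ p in logNhds univ x₀ y₀, logPullback u p = 0) : IsPhgAt k E u x₀ y₀ := by
  obtain ⟨ε, hε, hb⟩ := eventually_logNhds_univ_iff.1 h
  exact (TestPhg.zero.congr fun p hp => (hb p hp.1 hp.2).symm).isPhgAt hε hx₀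

theorem isConormalAt_of_eventually_eq_zero {α : Fin k → WithTop ℝ} {D : Set F} (hD : IsOpen D)
    {u : (Fin k → ℝ) → F → ℂ} (h : ∀ᶠ p in logNhds D x₀ y₀, logPullback u p = 0) :
    IsConormalAt α D u x₀ y₀ :=
  isConormalAt_iff.2 fun _ _ => SymbolBound.zero.congr (isOpenFilter_logNhds hD x₀ y₀)
    (h.mono fun _ h => h.symm)

theorem exists_closedBox_subset {O : Set ((Fin k → ℝ) × F)} (hO : O ∈ 𝓝 (x₀, y₀)) :
    ∃ ε > 0, closedBox x₀ y₀ ε ⊆ O := by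
  obtain ⟨ε, hε, hb⟩ := Metric.nhds_basis_closedBall.mem_iff.1 hO
  refine ⟨ε, hε, fun q hq => hb ?_⟩
  rw [Metric.mem_closedBall, dist_eq_norm, Prod.norm_def]
  refine max_le ?_ hq.2
  rw [pi_norm_le_iff_of_nonneg hε.le]
  exact fun i => (hq.1 i).2

variable {F' : Type*} [NormedAddCommGroup F'] [NormedSpace ℝ F']

/-- Families may be pulled back along linear maps of the parameter spaces. -/
theorem IsConormalAt.comp_param {α : Fin k → WithTop ℝ} {u : (Fin k → ℝ) → F → ℂ}
    (A : F' →L[ℝ] F) {f₀ : F'} (hf₀ : A f₀ = y₀) (h : IsConormalAt α univ u x₀ y₀) :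
    IsConormalAt α univ (fun x f => u x (A f)) x₀ f₀ := by
  rw [isConormalAt_iff] at h ⊢
  intro β hβ
  let T : (Fin k → ℝ) × F' →L[ℝ] (Fin k → ℝ) × F :=
    (ContinuousLinearMap.fst ℝ _ _).prod (A.comp (ContinuousLinearMap.snd ℝ _ _))
  have hT : Tendsto T (logNhds univ x₀ f₀) (logNhds univ x₀ y₀) :=
    tendsto_logNhds_of_comp (B := T) (fun p => rfl) T.continuous (Prod.ext rfl hf₀)
  exact (h β hβ).comp_linear T hT

theorem IsPhgAt.comp_param (A : F' →L[ℝ] F) {f₀ : F'} (hf₀ : A f₀ = y₀) :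
    ∀ {k : ℕ} {E : Fin k → IndexSet} {x₀ : Fin k → ℝ} {u : (Fin k → ℝ) → F → ℂ},
      IsPhgAt k E u x₀ y₀ → IsPhgAt k E (fun x f => u x (A f)) x₀ f₀
  | 0, _, _, _, h => IsConormalAt.comp_param A hf₀ h
  | _ + 1, _, _, _, h => ⟨fun α hα => (h.1 α hα).comp_param A hf₀, fun i hi => by
      obtain ⟨a, ha, hb⟩ := h.2 i hi
      exact ⟨fun z l x f => a z l x (A f), fun z l hz => IsPhgAt.comp_param A hf₀ (ha z l hz),
        fun N α hα hα' => (hb N α hα hα').comp_param A hf₀⟩⟩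

end Local

section Constant

variable {d : ℕ} {E₀ E₁ : IndexSet} {α₀ α₁ : WithTop ℝ} {n : Tan d → ℝ → ℝ → ℂ}

theorem IsPhgSphereFamily.const (h : IsPhgSphereFamily E₀ E₁ n) (W : Set (Tan d)) :
    IsPhgSphereFamilyOn E₀ E₁ W (fun _ => n) := fun _ _ η hη x hx hx0 =>
  IsPhgAt.comp_param (u := homogPullback (sphereExtend n))
    (ContinuousLinearMap.snd ℝ (Tan d) (Tan d)) rfl (h η hη x hx hx0)

theorem IsConormalSphereFamily.const (h : IsConormalSphereFamily α₀ α₁ n) (W : Set (Tan d)) :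
    IsConormalSphereFamilyOn α₀ α₁ W (fun _ => n) := fun _ _ η hη x hx hx0 =>
  IsConormalAt.comp_param (u := homogPullback (sphereExtend n))
    (ContinuousLinearMap.snd ℝ (Tan d) (Tan d)) rfl (h η hη x hx hx0)

end Constant

end

/-! ### Boundary charts and half-density factors -/

section

section Charts

variable {d : ℕ} {X : Type*} [TopologicalSpace X] [ChartedSpace (EuclideanHalfSpace (d + 1)) X]
  (φ : OpenPartialHomeomorph X (EuclideanHalfSpace (d + 1)))

/-- The tangential coordinates of a point of `ℝ^{d+1}`. -/
def tanPart (z : EuclideanSpace ℝ (Fin (d + 1))) : Tan d := WithLp.toLp 2 fun i => z i.succ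

@[simp] theorem hpoint_zero (x : ℝ) (y : Tan d) : hpoint x y 0 = x := rfl

@[simp] theorem tanPart_hpoint (x : ℝ) (y : Tan d) : tanPart (hpoint x y) = y := rfl

theorem contDiff_hpoint {n : ℕ∞ω} : ContDiff ℝ n (fun p : ℝ × Tan d => hpoint p.1 p.2) := by
  rw [contDiff_euclidean]
  intro i
  refine Fin.cases ?_ (fun j => ?_) i
  · exact contDiff_fst
  · exact (contDiff_euclidean.1 contDiff_snd) j

theorem continuous_tanPart : Continuous (tanPart : EuclideanSpace ℝ (Fin (d + 1)) → Tan d) := by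
  unfold tanPart
  fun_prop

/-- An open set whose intersection with the half space is the coordinate range of `φ`. -/
def chartDomain : Set (EuclideanSpace ℝ (Fin (d + 1))) := (𝓡∂ (d + 1)).symm ⁻¹' φ.target

theorem isOpen_chartDomain : IsOpen (chartDomain φ) :=
  φ.open_target.preimage (𝓡∂ (d + 1)).continuous_symm

theorem inRange_iff {x : ℝ} {y : Tan d} : InRange φ x y ↔ hpoint x y ∈ chartDomain φ ∧ 0 ≤ x := by
  rw [InRange, OpenPartialHomeomorph.extend_target, range_modelWithCornersEuclideanHalfSpace]
  rfl

theorem isOpen_boundaryRange : IsOpen (boundaryRange φ) := by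
  have h : boundaryRange φ = (fun y : Tan d => hpoint 0 y) ⁻¹' chartDomain φ := by
    ext y
    change InRange φ 0 y ↔ _
    rw [inRange_iff]
    simp
  rw [h]
  exact (isOpen_chartDomain φ).preimage
    ((contDiff_hpoint (n := 0)).continuous.comp (by fun_prop : Continuous fun y : Tan d => ((0 : ℝ), y)))

/-- For `x > 0` the coordinate range is a neighbourhood, and the chain rule for the chart composed
with its inverse shows that the Jacobian determinant does not vanish. Hence the kernel may be
divided by this factor. -/
theorem zeroFactor_pos [IsManifold (𝓡∂ (d + 1)) ∞ X]
    (hφ : φ ∈ IsManifold.maximalAtlas (𝓡∂ (d + 1)) ∞ X) {x : ℝ} {y : Tan d} (h : InRange φ x y)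
    (hx : 0 < x) : 0 < zeroFactor φ x y := by
  have hnhds : (φ.extend (𝓡∂ (d + 1))).target ∈ 𝓝 (hpoint x y) := by
    have hpos : IsOpen {z : EuclideanSpace ℝ (Fin (d + 1)) | 0 < z 0} :=
      isOpen_lt continuous_const (by fun_prop)
    refine mem_of_superset (((isOpen_chartDomain φ).inter hpos).mem_nhds
      ⟨((inRange_iff φ).1 h).1, hx⟩) fun z hz => ?_
    rw [OpenPartialHomeomorph.extend_target, range_modelWithCornersEuclideanHalfSpace]
    exact ⟨hz.1, (show 0 < z 0 from hz.2).le⟩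
  have hsource : (φ.extend (𝓡∂ (d + 1))).symm (hpoint x y) ∈ φ.source := by
    rw [← φ.extend_source (I := 𝓡∂ (d + 1))]
    exact (φ.extend (𝓡∂ (d + 1))).map_target h
  have hsymm : MDifferentiableAt 𝓘(ℝ, EuclideanSpace ℝ (Fin (d + 1))) (𝓡∂ (d + 1))
      (φ.extend (𝓡∂ (d + 1))).symm (hpoint x y) := by
    have h1 := (contMDiffOn_extend_symm hφ).mdifferentiableOn (by simp)
    rw [← OpenPartialHomeomorph.extend_target'] at h1
    exact (h1 _ h).mdifferentiableAt hnhds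
  have hext : MDifferentiableAt (𝓡∂ (d + 1)) 𝓘(ℝ, EuclideanSpace ℝ (Fin (d + 1)))
      (φ.extend (𝓡∂ (d + 1))) ((φ.extend (𝓡∂ (d + 1))).symm (hpoint x y)) :=
    (φ.contMDiffAt_extend (n := ∞) hφ hsource).mdifferentiableAt (by simp)
  have hcomp := mfderiv_comp (hpoint x y) hext hsymm
  have hid : (φ.extend (𝓡∂ (d + 1))) ∘ (φ.extend (𝓡∂ (d + 1))).symm =ᶠ[𝓝 (hpoint x y)] id := by
    filter_upwards [hnhds] with z hz
    exact (φ.extend (𝓡∂ (d + 1))).right_inv hz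
  rw [hid.mfderiv_eq, mfderiv_id] at hcomp
  let E := EuclideanSpace ℝ (Fin (d + 1))
  have hdet : ∀ A J : E →L[ℝ] E, ContinuousLinearMap.id ℝ E = A.comp J → J.det ≠ 0 := by
    intro A J hAJ
    have h1 : LinearMap.det (A : E →ₗ[ℝ] E) * LinearMap.det (J : E →ₗ[ℝ] E) = 1 := by
      have h2 : (A : E →ₗ[ℝ] E) ∘ₗ (J : E →ₗ[ℝ] E) = LinearMap.id := by
        ext1 v
        exact (DFunLike.congr_fun hAJ v).symm
      rw [← LinearMap.det_comp, h2, LinearMap.det_id]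
    exact right_ne_zero_of_mul_eq_one h1
  exact Real.sqrt_pos.2 (mul_pos (abs_pos.2 (hdet _ _ hcomp)) (pow_pos hx _))

end Charts

end

/-! ### Cutoff functions near boundary sets -/

section

section Cutoff

variable {d : ℕ} {X : Type*} [TopologicalSpace X] [ChartedSpace (EuclideanHalfSpace (d + 1)) X]
  (φ : OpenPartialHomeomorph X (EuclideanHalfSpace (d + 1)))

theorem symm_mem_source {z : EuclideanSpace ℝ (Fin (d + 1))} (hz : z ∈ chartDomain φ) :
    (φ.extend (𝓡∂ (d + 1))).symm z ∈ φ.source :=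
  φ.map_target hz

theorem continuousAt_symm {z : EuclideanSpace ℝ (Fin (d + 1))} (hz : z ∈ chartDomain φ) :
    ContinuousAt (φ.extend (𝓡∂ (d + 1))).symm z :=
  ContinuousAt.comp (g := φ.symm) (φ.symm.continuousAt hz)
    (𝓡∂ (d + 1)).continuous_symm.continuousAt

/-- A closed boundary set in the domain of a chart has a cutoff function in the coordinates of this
chart whose support lies in a set `A` which is closed in the manifold and lies over the boundary
part of the chart. -/
theorem exists_boundary_cutoff [T2Space X] [SecondCountableTopology X] {K : Set (Tan d)}
    (hK : K ⊆ boundaryRange φ) (hcl : IsClosed (boundaryPoints φ K)) :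
    ∃ (A : Set X) (g : EuclideanSpace ℝ (Fin (d + 1)) → ℝ), IsClosed A ∧ A ⊆ φ.source ∧
      (∀ p ∈ A, tanPart (φ.extend (𝓡∂ (d + 1)) p) ∈ boundaryRange φ) ∧
      ContDiffOn ℝ ∞ g (chartDomain φ) ∧
      (∀ p ∈ φ.source, g (φ.extend (𝓡∂ (d + 1)) p) ≠ 0 → p ∈ A) ∧
      ∀ y ∈ K, g (hpoint 0 y) = 1 := by
  have : LocallyCompactSpace X := Manifold.locallyCompact_of_finiteDimensional (𝓡∂ (d + 1))
  have : NormalSpace X := NormalSpace.of_regularSpace_lindelofSpace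
  -- The condition on the tangential coordinate is imposed because the family is given only over
  -- `W`, while the kernel evaluates it at `y'` also for `x' > 0`.
  set O : Set X := φ.source ∩
    (fun p => tanPart (φ.extend (𝓡∂ (d + 1)) p)) ⁻¹' boundaryRange φ with hOdef
  have hO : IsOpen O := by
    refine ContinuousOn.isOpen_inter_preimage ?_ φ.open_source (isOpen_boundaryRange φ)
    have h := φ.continuousOn_extend (I := 𝓡∂ (d + 1))
    rw [φ.extend_source] at h
    exact continuous_tanPart.comp_continuousOn h
  have hmem : ∀ y ∈ K, hpoint 0 y ∈ chartDomain φ := fun y hy => ((inRange_iff φ).1 (hK hy)).1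
  have hKO : boundaryPoints φ K ⊆ O := by
    rintro _ ⟨y, hy, rfl⟩
    refine ⟨symm_mem_source φ (hmem y hy), ?_⟩
    have h1 : φ.extend (𝓡∂ (d + 1)) ((φ.extend (𝓡∂ (d + 1))).symm (hpoint 0 y)) = hpoint 0 y :=
      (φ.extend (𝓡∂ (d + 1))).right_inv (hK hy)
    rw [mem_preimage, h1, tanPart_hpoint]
    exact hK hy
  obtain ⟨u, hu, hKu, huO⟩ := normal_exists_closure_subset hcl hO hKO
  have hopen : ∀ s : Set X, IsOpen s → IsOpen ((𝓡∂ (d + 1)).symm ⁻¹' (φ.target ∩ φ.symm ⁻¹' s)) :=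
    fun s hs => (φ.isOpen_inter_preimage_symm hs).preimage (𝓡∂ (d + 1)).continuous_symm
  -- The cutoff is `h₁ / (h₁ + h₂)` with `h₁` positive exactly over `u` and `h₂` positive exactly
  -- off the boundary set. The denominator has no zeros in the chart as `u` contains that set, where
  -- the quotient is `1`.
  obtain ⟨h₁, hs₁, hc₁, hr₁⟩ := IsOpen.exists_contDiff_support_eq (n := ⊤) (hopen u hu)
  obtain ⟨h₂, hs₂, hc₂, hr₂⟩ :=
    IsOpen.exists_contDiff_support_eq (n := ⊤) (hopen (boundaryPoints φ K)ᶜ hcl.isOpen_compl)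
  have hpos : ∀ z ∈ chartDomain φ, h₁ z + h₂ z ≠ 0 := by
    intro z hz h0
    have n1 : 0 ≤ h₁ z := (hr₁ (mem_range_self z)).1
    have n2 : 0 ≤ h₂ z := (hr₂ (mem_range_self z)).1
    have z1 : h₁ z = 0 := by linarith
    have z2 : h₂ z = 0 := by linarith
    rw [← Function.notMem_support, hs₁] at z1
    rw [← Function.notMem_support, hs₂] at z2
    refine z2 ⟨hz, fun hb => z1 ⟨hz, hKu hb⟩⟩
  refine ⟨closure u, fun z => h₁ z / (h₁ z + h₂ z), isClosed_closure, fun p hp => (huO hp).1,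
    fun p hp => (huO hp).2, ?_, ?_, ?_⟩
  · exact hc₁.contDiffOn.div (hc₁.contDiffOn.add hc₂.contDiffOn) hpos
  · intro p hp hne
    have h1 : h₁ (φ.extend (𝓡∂ (d + 1)) p) ≠ 0 := fun h => hne (by change _ / _ = _; rw [h, zero_div])
    rw [← Function.mem_support, hs₁] at h1
    have h2 : (φ.extend (𝓡∂ (d + 1))).symm (φ.extend (𝓡∂ (d + 1)) p) ∈ u := h1.2
    rw [φ.extend_left_inv hp] at h2
    exact subset_closure h2
  · intro y hy
    have h2 : h₂ (hpoint 0 y) = 0 := by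
      rw [← Function.notMem_support, hs₂]
      exact fun h => h.2 ⟨y, hy, rfl⟩
    have h1 := hpos _ (hmem y hy)
    simp only [h2, add_zero] at h1 ⊢
    exact div_self h1

end Cutoff

end

/-! ### Kernels supported in a chart -/

section

section ChartKernel

variable {d : ℕ} {X : Type*} [TopologicalSpace X] [ChartedSpace (EuclideanHalfSpace (d + 1)) X]

/-- The set `A` and the function `g` in the coordinates of `φ` localize kernels to a neighbourhood
of a part of the boundary in the domain of `φ`. -/
structure IsBoundaryCutoff (φ : OpenPartialHomeomorph X (EuclideanHalfSpace (d + 1))) (A : Set X)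
    (g : EuclideanSpace ℝ (Fin (d + 1)) → ℝ) : Prop where
  isClosed : IsClosed A
  subset_source : A ⊆ φ.source
  tanPart_mem : ∀ p ∈ A, tanPart (φ.extend (𝓡∂ (d + 1)) p) ∈ boundaryRange φ
  smooth : ContDiffOn ℝ ∞ g (chartDomain φ)
  mem_of_ne_zero : ∀ p ∈ φ.source, g (φ.extend (𝓡∂ (d + 1)) p) ≠ 0 → p ∈ A

open Classical in
/-- The kernel on the manifold which is given in the chart `φ` by the function `k` of
`((log x, log x'), (y - y', y'))`, cut off by `g`. -/
def chartKernel (φ : OpenPartialHomeomorph X (EuclideanHalfSpace (d + 1)))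
    (g : EuclideanSpace ℝ (Fin (d + 1)) → ℝ) (k : (Fin 2 → ℝ) × (Tan d × Tan d) → ℂ) :
    X → X → ℂ := fun p q =>
  let z := φ.extend (𝓡∂ (d + 1)) p
  let z' := φ.extend (𝓡∂ (d + 1)) q
  if p ∈ φ.source ∧ q ∈ φ.source then
    g z * g z' * k (![Real.log (z 0), Real.log (z' 0)], (tanPart z - tanPart z', tanPart z')) /
      (zeroFactor φ (z 0) (tanPart z) * zeroFactor φ (z' 0) (tanPart z'))
  else 0

variable {φ : OpenPartialHomeomorph X (EuclideanHalfSpace (d + 1))} {A : Set X}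
  {g : EuclideanSpace ℝ (Fin (d + 1)) → ℝ} {k : (Fin 2 → ℝ) × (Tan d × Tan d) → ℂ}

theorem IsBoundaryCutoff.chartKernel_eq_zero (hg : IsBoundaryCutoff φ A g) {p q : X}
    (h : p ∉ A ∨ q ∉ A) : chartKernel φ g k p q = 0 := by
  rw [chartKernel]
  split_ifs with hpq
  · rcases h with h | h
    · have h1 : g (φ.extend (𝓡∂ (d + 1)) p) = 0 := by
        by_contra h0
        exact h (hg.mem_of_ne_zero p hpq.1 h0)
      rw [h1]
      simp
    · have h1 : g (φ.extend (𝓡∂ (d + 1)) q) = 0 := by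
        by_contra h0
        exact h (hg.mem_of_ne_zero q hpq.2 h0)
      rw [h1]
      simp
  · rfl

theorem kernelCoeff_chartKernel [IsManifold (𝓡∂ (d + 1)) ∞ X]
    (hφ : φ ∈ IsManifold.maximalAtlas (𝓡∂ (d + 1)) ∞ X) {x x' : ℝ} {y y' : Tan d}
    (h : InRange φ x y) (h' : InRange φ x' y') (hx : 0 < x) (hx' : 0 < x') :
    kernelCoeff φ φ (chartKernel φ g k) x y x' y' =
      g (hpoint x y) * g (hpoint x' y') * k (![Real.log x, Real.log x'], (y - y', y')) := by
  have hz : φ.extend (𝓡∂ (d + 1)) ((φ.extend (𝓡∂ (d + 1))).symm (hpoint x y)) = hpoint x y :=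
    (φ.extend (𝓡∂ (d + 1))).right_inv h
  have hz' : φ.extend (𝓡∂ (d + 1)) ((φ.extend (𝓡∂ (d + 1))).symm (hpoint x' y')) = hpoint x' y' :=
    (φ.extend (𝓡∂ (d + 1))).right_inv h'
  have h1 : (zeroFactor φ x y : ℂ) ≠ 0 := by exact_mod_cast (zeroFactor_pos φ hφ h hx).ne'
  have h2 : (zeroFactor φ x' y' : ℂ) ≠ 0 := by exact_mod_cast (zeroFactor_pos φ hφ h' hx').ne'
  simp only [kernelCoeff, chartKernel, hz, hz', hpoint_zero, tanPart_hpoint]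
  rw [if_pos ⟨symm_mem_source φ ((inRange_iff φ).1 h).1,
    symm_mem_source φ ((inRange_iff φ).1 h').1⟩]
  field_simp

/-- If the closed set `A` lies in the domain of `φ`, the double space is covered by the blow-up of
`φ` and by blow-ups and products of charts which avoid `A`. -/
theorem locallyOnDoubleSpace_of_isClosed [T2Space X] [IsManifold (𝓡∂ (d + 1)) ∞ X]
    {P : OpenPartialHomeomorph X (EuclideanHalfSpace (d + 1)) → Prop}
    {Q : OpenPartialHomeomorph X (EuclideanHalfSpace (d + 1)) →
      OpenPartialHomeomorph X (EuclideanHalfSpace (d + 1)) → Prop}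
    (hφ : φ ∈ IsManifold.maximalAtlas (𝓡∂ (d + 1)) ∞ X) (hA : IsClosed A) (hAφ : A ⊆ φ.source)
    (h1 : P φ) (h2 : ∀ ψ ∈ IsManifold.maximalAtlas (𝓡∂ (d + 1)) ∞ X, ψ.source ⊆ Aᶜ → P ψ)
    (h3 : ∀ ψ ∈ IsManifold.maximalAtlas (𝓡∂ (d + 1)) ∞ X,
      ∀ χ ∈ IsManifold.maximalAtlas (𝓡∂ (d + 1)) ∞ X,
      ψ.source ⊆ Aᶜ ∨ χ.source ⊆ Aᶜ → Q ψ χ) :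
    LocallyOnDoubleSpace (d := d) (X := X) P Q := by
  have hchart : ∀ (p : X) (s : Set X), IsOpen s → p ∈ s →
      ∃ ψ ∈ IsManifold.maximalAtlas (𝓡∂ (d + 1)) ∞ X, p ∈ ψ.source ∧ ψ.source ⊆ s := by
    intro p s hs hp
    refine ⟨(chartAt (EuclideanHalfSpace (d + 1)) p).restr s,
      restr_mem_maximalAtlas (contDiffGroupoid ∞ (𝓡∂ (d + 1)))
        (IsManifold.chart_mem_maximalAtlas p) hs, ?_, ?_⟩
    · rw [OpenPartialHomeomorph.restr_source, hs.interior_eq]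
      exact ⟨mem_chart_source _ p, hp⟩
    · rw [OpenPartialHomeomorph.restr_source, hs.interior_eq]
      exact inter_subset_right
  intro p q
  -- Pairs inside the chart use its blow-up. Otherwise one of the points is outside `A`: on the
  -- diagonal a small chart avoiding `A` contains it, and off the diagonal the points are separated
  -- by disjoint charts, one of which avoids `A`.
  by_cases hpq : p ∈ φ.source ∧ q ∈ φ.source
  · exact Or.inl ⟨φ, hφ, hpq.1, hpq.2, h1⟩
  by_cases he : p = q
  · subst he
    obtain ⟨ψ, hψ, hp, hs⟩ := hchart p Aᶜ hA.isOpen_compl fun h => hpq ⟨hAφ h, hAφ h⟩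
    exact Or.inl ⟨ψ, hψ, hp, hp, h2 ψ hψ hs⟩
  · obtain ⟨u, v, hu, hv, hpu, hqv, huv⟩ := t2_separation he
    rcases not_and_or.1 hpq with h | h
    · obtain ⟨ψ, hψ, hp, hs⟩ := hchart p (u ∩ Aᶜ) (hu.inter hA.isOpen_compl)
        ⟨hpu, fun hm => h (hAφ hm)⟩
      obtain ⟨χ, hχ, hq, ht⟩ := hchart q v hv hqv
      exact Or.inr ⟨ψ, hψ, χ, hχ, hp, hq, huv.mono (hs.trans inter_subset_left) ht,
        h3 ψ hψ χ hχ (Or.inl (hs.trans inter_subset_right))⟩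
    · obtain ⟨ψ, hψ, hp, hs⟩ := hchart p u hu hpu
      obtain ⟨χ, hχ, hq, ht⟩ := hchart q (v ∩ Aᶜ) (hv.inter hA.isOpen_compl)
        ⟨hqv, fun hm => h (hAφ hm)⟩
      exact Or.inr ⟨ψ, hψ, χ, hχ, hp, hq, huv.mono hs (ht.trans inter_subset_left),
        h3 ψ hψ χ hχ (Or.inr (ht.trans inter_subset_right))⟩

theorem eventually_symm_notMem (hA : IsClosed A) {E : Type*} [TopologicalSpace E] {x : E → ℝ}
    {y : E → Tan d} (hx : Continuous x) (hy : Continuous y) {e : E} (h : InRange φ (x e) (y e))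
    (he : (φ.extend (𝓡∂ (d + 1))).symm (hpoint (x e) (y e)) ∉ A) :
    ∀ᶠ e' in 𝓝 e, (φ.extend (𝓡∂ (d + 1))).symm (hpoint (x e') (y e')) ∉ A := by
  have h1 : ContinuousAt (fun e' => (φ.extend (𝓡∂ (d + 1))).symm (hpoint (x e') (y e'))) e :=
    ContinuousAt.comp (g := (φ.extend (𝓡∂ (d + 1))).symm) (f := fun e' => hpoint (x e') (y e'))
      (continuousAt_symm φ ((inRange_iff φ).1 h).1)
      ((contDiff_hpoint (n := 0)).continuous.comp (hx.prodMk hy)).continuousAt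
  exact h1.eventually_mem (hA.isOpen_compl.mem_nhds he)

variable {F : Type*} [NormedAddCommGroup F] [NormedSpace ℝ F] {m : ℕ} {D : Set F}
  {ψ χ : OpenPartialHomeomorph X (EuclideanHalfSpace (d + 1))} {κ : X → X → ℂ}
  {x x' : (Fin m → ℝ) × F → ℝ} {y y' : (Fin m → ℝ) × F → Tan d} {x₀ : Fin m → ℝ} {y₀ : F}

theorem eventually_kernelCoeff_eq_zero (hA : IsClosed A)
    (hκ : ∀ p q, p ∉ A ∨ q ∉ A → κ p q = 0) (hx : Continuous x) (hx' : Continuous x')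
    (hy : Continuous y) (hy' : Continuous y') (h : InRange ψ (x (x₀, y₀)) (y (x₀, y₀)))
    (h' : InRange χ (x' (x₀, y₀)) (y' (x₀, y₀)))
    (h0 : (ψ.extend (𝓡∂ (d + 1))).symm (hpoint (x (x₀, y₀)) (y (x₀, y₀))) ∉ A ∨
      (χ.extend (𝓡∂ (d + 1))).symm (hpoint (x' (x₀, y₀)) (y' (x₀, y₀))) ∉ A) :
    ∀ᶠ p in logNhds D x₀ y₀, kernelCoeff ψ χ κ (x (expMap p)) (y (expMap p)) (x' (expMap p))
      (y' (expMap p)) = 0 := by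
  refine eventually_logNhds_of_nhds
    (P := fun q => kernelCoeff ψ χ κ (x q) (y q) (x' q) (y' q) = 0) ?_
  rcases h0 with h0 | h0
  · filter_upwards [eventually_symm_notMem hA hx hy h h0] with q hq
    rw [kernelCoeff, hκ _ _ (Or.inl hq), zero_mul, zero_mul]
  · filter_upwards [eventually_symm_notMem hA hx' hy' h' h0] with q hq
    rw [kernelCoeff, hκ _ _ (Or.inr hq), zero_mul, zero_mul]

end ChartKernel

end

/-! ### Membership in the residual classes for kernels supported in a chart -/

section

section Residual

variable {d : ℕ} {X : Type*} [TopologicalSpace X] [ChartedSpace (EuclideanHalfSpace (d + 1)) X]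
  {φ : OpenPartialHomeomorph X (EuclideanHalfSpace (d + 1))} {A : Set X}
  {g : EuclideanSpace ℝ (Fin (d + 1)) → ℝ} {k : (Fin 2 → ℝ) × (Tan d × Tan d) → ℂ}

/-- Over points outside the closed set the kernel vanishes identically nearby. Only points whose
right factor lies in `A` remain, and there `y'` is a parameter for which the family is defined. -/
theorem isResidualPhg_of_support [T2Space X] [IsManifold (𝓡∂ (d + 1)) ∞ X] {κ : X → X → ℂ}
    {Elb Eff Erb : IndexSet} (hφ : φ ∈ IsManifold.maximalAtlas (𝓡∂ (d + 1)) ∞ X)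
    (hA : IsClosed A) (hAφ : A ⊆ φ.source) (hκ : ∀ p q, p ∉ A ∨ q ∉ A → κ p q = 0)
    (h : ∀ (R a b : ℝ) (w y' : Tan d), IsBlowupPoint φ R a b w y' →
      (φ.extend (𝓡∂ (d + 1))).symm (hpoint (R * b) y') ∈ A →
      IsPhgAt 3 ![Eff, Elb, Erb]
        (fun x (g : Tan d × Tan d) =>
          kernelCoeff φ φ κ (x 0 * x 1) (g.2 + x 0 • g.1) (x 0 * x 2) g.2)
        ![R, a, b] (w, y')) :
    IsResidualPhg (d := d) Elb Eff Erb κ := by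
  have hpos : ∀ {R a b : ℝ}, 0 ≤ R → 0 ≤ a → 0 ≤ b → ∀ i, 0 ≤ ![R, a, b] i := by
    intro R a b hR ha hb i
    fin_cases i <;> assumption
  have hmain : ∀ (ψ : OpenPartialHomeomorph X (EuclideanHalfSpace (d + 1))) (R a b : ℝ)
      (w y' : Tan d), IsBlowupPoint ψ R a b w y' →
      (ψ.extend (𝓡∂ (d + 1))).symm (hpoint (R * b) y') ∉ A →
      IsPhgAt 3 ![Eff, Elb, Erb]
        (fun x (g : Tan d × Tan d) =>
          kernelCoeff ψ ψ κ (x 0 * x 1) (g.2 + x 0 • g.1) (x 0 * x 2) g.2)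
        ![R, a, b] (w, y') := by
    rintro ψ R a b w y' ⟨hR, ha, hb, -, hr, hr'⟩ hn
    exact isPhgAt_of_eventually_eq_zero (hpos hR ha hb)
      (eventually_kernelCoeff_eq_zero (F := Tan d × Tan d) (m := 3)
        (x := fun q => q.1 0 * q.1 1) (y := fun q => q.2.2 + q.1 0 • q.2.1)
        (x' := fun q => q.1 0 * q.1 2) (y' := fun q => q.2.2) hA hκ (by fun_prop) (by fun_prop)
        (by fun_prop) (by fun_prop) hr hr' (Or.inr hn))
  refine locallyOnDoubleSpace_of_isClosed hφ hA hAφ ?_ ?_ ?_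
  · intro R a b w y' hB
    by_cases hm : (φ.extend (𝓡∂ (d + 1))).symm (hpoint (R * b) y') ∈ A
    · exact h R a b w y' hB hm
    · exact hmain φ R a b w y' hB hm
  · intro ψ _ hs R a b w y' hB
    exact hmain ψ R a b w y' hB (hs (symm_mem_source ψ ((inRange_iff ψ).1 hB.2.2.2.2.2).1))
  · intro ψ _ χ _ hs x y x' y' hr hr'
    refine isPhgAt_of_eventually_eq_zero (fun i => ?_)
      (eventually_kernelCoeff_eq_zero (F := Tan d × Tan d) (m := 2)
        (x := fun q => q.1 0) (y := fun q => q.2.1)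
        (x' := fun q => q.1 1) (y' := fun q => q.2.2) hA hκ (by fun_prop) (by fun_prop)
        (by fun_prop) (by fun_prop) hr hr' (hs.imp
          (fun h => h (symm_mem_source ψ ((inRange_iff ψ).1 hr).1))
          (fun h => h (symm_mem_source χ ((inRange_iff χ).1 hr').1))))
    fin_cases i
    · exact ((inRange_iff ψ).1 hr).2
    · exact ((inRange_iff χ).1 hr').2

theorem isResidualConormal_of_support [T2Space X] [IsManifold (𝓡∂ (d + 1)) ∞ X] {κ : X → X → ℂ}
    {αlb αrb : WithTop ℝ} (hφ : φ ∈ IsManifold.maximalAtlas (𝓡∂ (d + 1)) ∞ X)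
    (hA : IsClosed A) (hAφ : A ⊆ φ.source) (hκ : ∀ p q, p ∉ A ∨ q ∉ A → κ p q = 0)
    (h : ∀ (R a b : ℝ) (w y' : Tan d), IsBlowupPoint φ R a b w y' →
      (φ.extend (𝓡∂ (d + 1))).symm (hpoint (R * b) y') ∈ A →
      IsConormalAt ![αlb, αrb] {g : ℝ × Tan d × Tan d | 0 < g.1}
        (fun x (g : ℝ × Tan d × Tan d) =>
          kernelCoeff φ φ κ (g.1 * x 0) (g.2.2 + g.1 • g.2.1) (g.1 * x 1) g.2.2)
        ![a, b] (R, w, y')) :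
    IsResidualConormal (d := d) αlb αrb κ := by
  have hD : IsOpen {g : ℝ × Tan d × Tan d | 0 < g.1} := isOpen_lt continuous_const continuous_fst
  have hmain : ∀ (ψ : OpenPartialHomeomorph X (EuclideanHalfSpace (d + 1))) (R a b : ℝ)
      (w y' : Tan d), IsBlowupPoint ψ R a b w y' →
      (ψ.extend (𝓡∂ (d + 1))).symm (hpoint (R * b) y') ∉ A →
      IsConormalAt ![αlb, αrb] {g : ℝ × Tan d × Tan d | 0 < g.1}
        (fun x (g : ℝ × Tan d × Tan d) =>
          kernelCoeff ψ ψ κ (g.1 * x 0) (g.2.2 + g.1 • g.2.1) (g.1 * x 1) g.2.2)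
        ![a, b] (R, w, y') := by
    rintro ψ R a b w y' ⟨hR, ha, hb, -, hr, hr'⟩ hn
    exact isConormalAt_of_eventually_eq_zero hD
      (eventually_kernelCoeff_eq_zero (F := ℝ × Tan d × Tan d) (m := 2)
        (x := fun q => q.2.1 * q.1 0) (y := fun q => q.2.2.2 + q.2.1 • q.2.2.1)
        (x' := fun q => q.2.1 * q.1 1) (y' := fun q => q.2.2.2) hA hκ (by fun_prop) (by fun_prop)
        (by fun_prop) (by fun_prop) hr hr' (Or.inr hn))
  refine locallyOnDoubleSpace_of_isClosed hφ hA hAφ ?_ ?_ ?_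
  · intro R a b w y' hB
    by_cases hm : (φ.extend (𝓡∂ (d + 1))).symm (hpoint (R * b) y') ∈ A
    · exact h R a b w y' hB hm
    · exact hmain φ R a b w y' hB hm
  · intro ψ _ hs R a b w y' hB
    exact hmain ψ R a b w y' hB (hs (symm_mem_source ψ ((inRange_iff ψ).1 hB.2.2.2.2.2).1))
  · intro ψ _ χ _ hs x y x' y' hr hr'
    exact isConormalAt_of_eventually_eq_zero isOpen_univ
      (eventually_kernelCoeff_eq_zero (F := Tan d × Tan d) (m := 2)
        (x := fun q => q.1 0) (y := fun q => q.2.1)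
        (x' := fun q => q.1 1) (y' := fun q => q.2.2) hA hκ (by fun_prop) (by fun_prop)
        (by fun_prop) (by fun_prop) hr hr' (hs.imp
          (fun h => h (symm_mem_source ψ ((inRange_iff ψ).1 hr).1))
          (fun h => h (symm_mem_source χ ((inRange_iff χ).1 hr').1))))

/-- The coefficient of `chartKernel` in homogeneous coordinates on the blow-up. -/
theorem kernelCoeff_chartKernel_blowup [IsManifold (𝓡∂ (d + 1)) ∞ X]
    (hφ : φ ∈ IsManifold.maximalAtlas (𝓡∂ (d + 1)) ∞ X)
    (hk : ∀ (r : ℝ) (p : Fin 2 → ℝ) (w y : Tan d),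
      k (fun i => p i + r, (Real.exp r • w, y)) = k (p, (w, y)))
    {R a b : ℝ} {w y' : Tan d} (hR : 0 < R) (ha : 0 < a) (hb : 0 < b)
    (h : hpoint (R * a) (y' + R • w) ∈ chartDomain φ) (h' : hpoint (R * b) y' ∈ chartDomain φ) :
    kernelCoeff φ φ (chartKernel φ g k) (R * a) (y' + R • w) (R * b) y' =
      g (hpoint (R * a) (y' + R • w)) * g (hpoint (R * b) y') *
        k (![Real.log a, Real.log b], (w, y')) := by
  rw [kernelCoeff_chartKernel hφ ((inRange_iff φ).2 ⟨h, by positivity⟩)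
    ((inRange_iff φ).2 ⟨h', by positivity⟩) (by positivity) (by positivity),
    ← hk (Real.log R) ![Real.log a, Real.log b] w y', Real.exp_log hR, add_sub_cancel_left]
  congr 3
  ext i
  fin_cases i
  · simp [Real.log_mul hR.ne' ha.ne', add_comm]
  · simp [Real.log_mul hR.ne' hb.ne', add_comm]

end Residual

end

/-! ### The quantization in a chart -/

section

section Realization

variable {d : ℕ} {X : Type*} [TopologicalSpace X] [ChartedSpace (EuclideanHalfSpace (d + 1)) X]
  {φ : OpenPartialHomeomorph X (EuclideanHalfSpace (d + 1))} {A : Set X}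
  {g : EuclideanSpace ℝ (Fin (d + 1)) → ℝ} {n : Tan d → Tan d → ℝ → ℝ → ℂ}
  {E₀ E₁ : IndexSet} {α₀ α₁ : WithTop ℝ} {β : Fin 2 → ℝ}

/-- The function of `((log x, log x'), (y - y', y'))` which quantizes the family `n`. -/
def realization (n : Tan d → Tan d → ℝ → ℝ → ℂ) (q : (Fin 2 → ℝ) × (Tan d × Tan d)) : ℂ :=
  ((2 * Real.pi : ℝ) ^ d : ℂ)⁻¹ * zeroKernel (familyLog n) q

theorem realization_dilation [Nontrivial (Tan d)] (n : Tan d → Tan d → ℝ → ℝ → ℂ) (r : ℝ) (p : Fin 2 → ℝ)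
    (w y : Tan d) :
    realization n (fun i => p i + r, (Real.exp r • w, y)) = realization n (p, (w, y)) := by
  rw [realization, realization, zeroKernel_dilation]

theorem IsBoundaryCutoff.contDiffOn_comp (hg : IsBoundaryCutoff φ A g) {E : Type*}
    [NormedAddCommGroup E] [NormedSpace ℝ E] {x : E → ℝ} {y : E → Tan d}
    (hx : ContDiff ℝ ∞ x) (hy : ContDiff ℝ ∞ y) :
    ContDiffOn ℝ ∞ (fun e => (g (hpoint (x e) (y e)) : ℂ))
      {e | hpoint (x e) (y e) ∈ chartDomain φ} := by
  have h1 : ContDiff ℝ ∞ (fun e => hpoint (x e) (y e)) := contDiff_hpoint.comp (hx.prodMk hy)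
  exact Complex.ofRealCLM.contDiff.comp_contDiffOn (hg.smooth.comp h1.contDiffOn fun _ he => he)

theorem isOpen_preimage_chartDomain {E : Type*} [TopologicalSpace E] {x : E → ℝ} {y : E → Tan d}
    (hx : Continuous x) (hy : Continuous y) :
    IsOpen {e | hpoint (x e) (y e) ∈ chartDomain φ} :=
  (isOpen_chartDomain φ).preimage ((contDiff_hpoint (n := 0)).continuous.comp (hx.prodMk hy))

theorem IsBoundaryCutoff.mem_boundaryRange (hg : IsBoundaryCutoff φ A g) {x : ℝ} {y : Tan d}
    (h : InRange φ x y) (hA : (φ.extend (𝓡∂ (d + 1))).symm (hpoint x y) ∈ A) :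
    y ∈ boundaryRange φ := by
  have h1 := hg.tanPart_mem _ hA
  rwa [(φ.extend (𝓡∂ (d + 1))).right_inv h, tanPart_hpoint] at h1

/-- By dilation invariance the coefficient in the coordinates `(R, a, b, w, y')` is a smooth cutoff
times a function independent of `R`. The latter passes the tests by `testPhg`, the product by
`smooth_mul`. -/
theorem IsBoundaryCutoff.isResidualPhg [Nontrivial (Tan d)] [T2Space X]
    [IsManifold (𝓡∂ (d + 1)) ∞ X] (hg : IsBoundaryCutoff φ A g)
    (hφ : φ ∈ IsManifold.maximalAtlas (𝓡∂ (d + 1)) ∞ X)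
    (hE : ∀ p ∈ E₀.sum E₁, -(d : ℝ) < p.1.re)
    (h : IsPhgSphereFamilyOn E₀ E₁ (boundaryRange φ) n) :
    IsResidualPhg (d := d) E₀ IndexSet.nat (E₁.shift d) (chartKernel φ g (realization n)) := by
  refine isResidualPhg_of_support hφ hg.isClosed hg.subset_source
    (fun p q hpq => hg.chartKernel_eq_zero hpq) ?_
  rintro R a b w y' ⟨hR, ha, hb, hne, hr, hr'⟩ hmem
  have hpos : ∀ i, 0 ≤ ![R, a, b] i := by
    intro i
    fin_cases i <;> assumption
  have hy' := hg.mem_boundaryRange hr' hmem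
  set O₁ : Set ((Fin 3 → ℝ) × (Tan d × Tan d)) :=
    {q | hpoint (q.1 0 * q.1 1) (q.2.2 + q.1 0 • q.2.1) ∈ chartDomain φ}
  set O₂ : Set ((Fin 3 → ℝ) × (Tan d × Tan d)) :=
    {q | hpoint (q.1 0 * q.1 2) q.2.2 ∈ chartDomain φ}
  have hO₁ : IsOpen O₁ := isOpen_preimage_chartDomain (by fun_prop) (by fun_prop)
  have hO₂ : IsOpen O₂ := isOpen_preimage_chartDomain (by fun_prop) (by fun_prop)
  have hG : ContDiffOn ℝ ∞ (fun q : (Fin 3 → ℝ) × (Tan d × Tan d) =>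
      ((2 * Real.pi : ℝ) ^ d : ℂ)⁻¹ * ((g (hpoint (q.1 0 * q.1 1) (q.2.2 + q.1 0 • q.2.1)) : ℂ) *
        (g (hpoint (q.1 0 * q.1 2) q.2.2) : ℂ))) (O₁ ∩ O₂) :=
    contDiffOn_const.mul (((hg.contDiffOn_comp (by fun_prop) (by fun_prop)).mono
      inter_subset_left).mul ((hg.contDiffOn_comp (by fun_prop) (by fun_prop)).mono
      inter_subset_right))
  -- Open condition on the whole box, needed for the bounds of the kernel: `y'` in `W` and `(a, b,
  -- w) ≠ 0`.
  set S : Set ((Fin 3 → ℝ) × (Tan d × Tan d)) :=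
    {q | q.2.2 ∈ boundaryRange φ ∧ ((dropL 0 q).1 ≠ 0 ∨ q.2.1 ≠ 0)}
  have hS : IsOpen S := by
    refine ((isOpen_boundaryRange φ).preimage (by fun_prop)).inter
      (IsOpen.union ?_ ?_)
    · exact isOpen_compl_singleton.preimage (by fun_prop)
    · exact isOpen_compl_singleton.preimage (by fun_prop)
  have hbase : ((![R, a, b], (w, y')) : (Fin 3 → ℝ) × (Tan d × Tan d)) ∈ (O₁ ∩ O₂) ∩ S := by
    refine ⟨⟨((inRange_iff φ).1 hr).1, ((inRange_iff φ).1 hr').1⟩, hy', ?_⟩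
    by_contra! h0
    refine hne ⟨congrFun h0.1 0, congrFun h0.1 1, h0.2⟩
  obtain ⟨ε, hε, hbox⟩ := exists_closedBox_subset (((hO₁.inter hO₂).inter hS).mem_nhds hbase)
  refine TestPhg.isPhgAt (TestPhg.congr ((h.testPhg (isOpen_boundaryRange φ) hE
    fun q hq => (hbox hq).2).smooth_mul hε (hO₁.inter hO₂) (hbox.trans inter_subset_left) hG)
    fun p hp => ?_) hε hpos
  have hpO := (hbox (expMap_mem_closedBox hp)).1
  have h1 := kernelCoeff_chartKernel_blowup (g := g) (k := realization n) hφ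
    (realization_dilation n) (Real.exp_pos (p.1 0)) (Real.exp_pos (p.1 1)) (Real.exp_pos (p.1 2))
    (w := p.2.1) (y' := p.2.2) hpO.1 hpO.2
  have h2 : ((![p.1 1, p.1 2], (p.2.1, p.2.2)) : (Fin 2 → ℝ) × (Tan d × Tan d)) = dropL 0 p := by
    refine Prod.ext (funext fun i => ?_) rfl
    fin_cases i <;> rfl
  rw [Real.log_exp, Real.log_exp, h2, realization] at h1
  refine Eq.trans ?_ h1.symm
  simp only [expMap]
  ring

/-- Here `R` is one of the parameters. The kernel does not depend on it and the cutoff is smooth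
across `R = 0`, so derivatives along `∂_R` remain bounded up to `R = 0`. -/
theorem IsBoundaryCutoff.isResidualConormal [Nontrivial (Tan d)] [T2Space X]
    [IsManifold (𝓡∂ (d + 1)) ∞ X] (hg : IsBoundaryCutoff φ A g)
    (hφ : φ ∈ IsManifold.maximalAtlas (𝓡∂ (d + 1)) ∞ X)
    (hα : ((-(d : ℝ) : ℝ) : WithTop ℝ) < α₀ + α₁)
    (h : IsConormalSphereFamilyOn α₀ α₁ (boundaryRange φ) n) :
    IsResidualConormal (d := d) α₀ (α₁ + ((d : ℝ) : WithTop ℝ))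
      (chartKernel φ g (realization n)) := by
  refine isResidualConormal_of_support hφ hg.isClosed hg.subset_source
    (fun p q hpq => hg.chartKernel_eq_zero hpq) ?_
  rintro R a b w y' ⟨hR, ha, hb, hne, hr, hr'⟩ hmem
  have hpos : ∀ i, 0 ≤ ![a, b] i := by
    intro i
    fin_cases i <;> assumption
  have hy' := hg.mem_boundaryRange hr' hmem
  have hD : IsOpen {g : ℝ × Tan d × Tan d | 0 < g.1} := isOpen_lt continuous_const continuous_fst
  set O₁ : Set ((Fin 2 → ℝ) × (ℝ × Tan d × Tan d)) :=
    {q | hpoint (q.2.1 * q.1 0) (q.2.2.2 + q.2.1 • q.2.2.1) ∈ chartDomain φ}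
  set O₂ : Set ((Fin 2 → ℝ) × (ℝ × Tan d × Tan d)) :=
    {q | hpoint (q.2.1 * q.1 1) q.2.2.2 ∈ chartDomain φ}
  have hO₁ : IsOpen O₁ := isOpen_preimage_chartDomain (by fun_prop) (by fun_prop)
  have hO₂ : IsOpen O₂ := isOpen_preimage_chartDomain (by fun_prop) (by fun_prop)
  have hbase : ((![a, b], (R, w, y')) : (Fin 2 → ℝ) × (ℝ × Tan d × Tan d)) ∈ O₁ ∩ O₂ :=
    ⟨((inRange_iff φ).1 hr).1, ((inRange_iff φ).1 hr').1⟩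
  set G : (Fin 2 → ℝ) × (ℝ × Tan d × Tan d) → ℂ := fun q =>
    ((2 * Real.pi : ℝ) ^ d : ℂ)⁻¹ * ((g (hpoint (q.2.1 * q.1 0) (q.2.2.2 + q.2.1 • q.2.2.1)) : ℂ) *
        (g (hpoint (q.2.1 * q.1 1) q.2.2.2) : ℂ)) with hGdef
  have hG : ContDiffOn ℝ ∞ G (O₁ ∩ O₂) :=
    contDiffOn_const.mul (((hg.contDiffOn_comp (by fun_prop) (by fun_prop)).mono
      inter_subset_left).mul ((hg.contDiffOn_comp (by fun_prop) (by fun_prop)).mono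
      inter_subset_right))
  have hOn : ∀ᶠ q in 𝓝 ((![a, b], (R, w, y')) : (Fin 2 → ℝ) × (ℝ × Tan d × Tan d)), q ∈ O₁ ∩ O₂ :=
    (hO₁.inter hO₂).mem_nhds hbase
  refine isConormalAt_iff.2 fun β hβ => ?_
  have hK := h.symbolBound (isOpen_boundaryRange φ) hα
    (ContinuousLinearMap.snd ℝ ℝ (Tan d × Tan d)) {g : ℝ × Tan d × Tan d | 0 < g.1} hpos
    (f₀ := (R, w, y')) hy' (by
      by_contra! h0
      exact hne ⟨congrFun h0.1 0, congrFun h0.1 1, h0.2⟩) hβ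
  have hGs := SymbolBound.of_contDiffAt (D := {g : ℝ × Tan d × Tan d | 0 < g.1})
    (hOn.mono fun q hq => hG.contDiffAt ((hO₁.inter hO₂).mem_nhds hq))
  have hinner : ∀ᶠ p in logNhds {g : ℝ × Tan d × Tan d | 0 < g.1} ![a, b] (R, w, y'),
      0 < (expMap p).2.1 :=
    eventually_interiorNhds_iff.1 (eventually_nhdsWithin_of_forall fun q hq => hq.2)
  refine ((hGs.mul hK).mono 0 (Eventually.of_forall fun p => by simp)).congr
    (isOpenFilter_logNhds hD _ _) ?_
  filter_upwards [hinner, eventually_logNhds_of_nhds hOn] with p hp hpO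
  have h1 := kernelCoeff_chartKernel_blowup (g := g) (k := realization n) hφ
    (realization_dilation n) hp (Real.exp_pos (p.1 0)) (Real.exp_pos (p.1 1))
    (w := p.2.2.1) (y' := p.2.2.2) hpO.1 hpO.2
  have h2 : (![p.1 0, p.1 1] : Fin 2 → ℝ) = p.1 := by
    ext i
    fin_cases i <;> rfl
  rw [Real.log_exp, Real.log_exp, h2, realization] at h1
  refine Eq.trans ?_ h1.symm
  simp only [hGdef, expMap]
  change _ * zeroKernel (familyLog n) (p.1, (p.2.2.1, p.2.2.2)) = _
  ring

/-- With `R = x'`, `a = s`, `b = 1`, `w = Υ` the coefficient is the fixed function of `(s, Υ, y)`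
times values of the cutoff which tend to `1` as `x' → 0`. -/
theorem IsBoundaryCutoff.hasReducedNormalOperator [IsManifold (𝓡∂ (d + 1)) ∞ X]
    [Nontrivial (Tan d)] (hg : IsBoundaryCutoff φ A g)
    (hφ : φ ∈ IsManifold.maximalAtlas (𝓡∂ (d + 1)) ∞ X)
    (h : FamilySymbol (boundaryRange φ) β (familyLog n)) (hβ : -(d : ℝ) < β 0 + β 1) {y : Tan d}
    (hy : y ∈ boundaryRange φ) (hgy : g (hpoint 0 y) = 1) :
    HasReducedNormalOperator φ (chartKernel φ g (realization n)) y (n y) := by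
  refine ⟨fun s Υ => ((2 * Real.pi : ℝ) ^ d : ℂ)⁻¹ *
    kernelOf (familyLog n) (![Real.log s, 0], (Υ, y)), fun s hs Υ => ?_,
    fun s hs => h.hasFourierTransformOffZero (isOpen_boundaryRange φ) hβ hy hs⟩
  have hy0 : hpoint 0 y ∈ chartDomain φ := ((inRange_iff φ).1 hy).1
  have hreal : realization n (![Real.log s, Real.log 1], (Υ, y)) = ((2 * Real.pi : ℝ) ^ d : ℂ)⁻¹ *
      kernelOf (familyLog n) (![Real.log s, 0], (Υ, y)) := by
    rw [Real.log_one, realization, zeroKernel]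
    simp
  have hcont : ∀ (x : ℝ → ℝ) (v : ℝ → Tan d), Continuous x → Continuous v → x 0 = 0 → v 0 = y →
      Tendsto (fun r => g (hpoint (x r) (v r))) (𝓝[>] 0) (𝓝 1) ∧
        ∀ᶠ r in 𝓝[>] (0 : ℝ), hpoint (x r) (v r) ∈ chartDomain φ := by
    intro x v hx hv hx0 hv0
    have h1 : Tendsto (fun r => hpoint (x r) (v r)) (𝓝[>] 0) (𝓝 (hpoint 0 y)) := by
      have h2 := ((contDiff_hpoint (n := 0) (d := d)).continuous.comp (hx.prodMk hv)).tendsto 0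
      simp only [Function.comp_apply, hx0, hv0] at h2
      exact h2.mono_left nhdsWithin_le_nhds
    have h3 : ContinuousAt g (hpoint 0 y) :=
      hg.smooth.continuousOn.continuousAt ((isOpen_chartDomain φ).mem_nhds hy0)
    refine ⟨?_, h1.eventually ((isOpen_chartDomain φ).mem_nhds hy0)⟩
    rw [← hgy]
    exact h3.tendsto.comp h1
  obtain ⟨t1, e1⟩ := hcont (fun r => r * s) (fun r => y + r • Υ) (by fun_prop) (by fun_prop)
    (by simp) (by simp)
  obtain ⟨t2, e2⟩ := hcont (fun r => r * 1) (fun _ => y) (by fun_prop) (by fun_prop)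
    (by simp) rfl
  have hlim : Tendsto (fun r : ℝ => ((g (hpoint (r * s) (y + r • Υ)) * g (hpoint (r * 1) y) : ℝ) : ℂ) *
      realization n (![Real.log s, Real.log 1], (Υ, y))) (𝓝[>] 0)
      (𝓝 (((1 * 1 : ℝ) : ℂ) * realization n (![Real.log s, Real.log 1], (Υ, y)))) :=
    (((Complex.continuous_ofReal.tendsto _).comp (t1.mul t2))).mul_const _
  rw [mul_one, Complex.ofReal_one, one_mul, hreal] at hlim
  refine hlim.congr' ?_
  filter_upwards [e1, e2, self_mem_nhdsWithin] with r h1 h2 hr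
  have h3 := kernelCoeff_chartKernel_blowup (g := g) (k := realization n) hφ
    (realization_dilation n) hr hs one_pos h1 h2
  rw [hreal, mul_one] at h3
  rw [mul_comm s r, h3, mul_one]
  push_cast
  ring

end Realization

end

/-! ### Existence of operators with given reduced normal operators -/

section

section Existence

variable {d : ℕ} {X : Type*} [TopologicalSpace X] [ChartedSpace (EuclideanHalfSpace (d + 1)) X]
  {φ : OpenPartialHomeomorph X (EuclideanHalfSpace (d + 1))}
  {n : Tan d → Tan d → ℝ → ℝ → ℂ} {E₀ E₁ : IndexSet} {α₀ α₁ : WithTop ℝ} {K : Set (Tan d)}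

/-- In dimension `n = 1` there are no test functions supported off the origin except zero, so the
condition is empty. -/
theorem hasReducedNormalOperator_zero [Subsingleton (Tan d)]
    (φ : OpenPartialHomeomorph X (EuclideanHalfSpace (d + 1))) (y : Tan d)
    (n : Tan d → ℝ → ℝ → ℂ) : HasReducedNormalOperator φ (fun _ _ => 0) y n := by
  refine ⟨fun _ _ => 0, fun s _ Υ => by simp [kernelCoeff],
    fun s _ χ _ _ h0 => ?_⟩
  have hχ : χ = 0 := by
    ext η
    by_contra hη
    exact h0 (Subsingleton.elim η 0 ▸ subset_tsupport χ hη)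
  subst hχ
  simp

variable [T2Space X] [SecondCountableTopology X] [IsManifold (𝓡∂ (d + 1)) ∞ X]

theorem exists_isBoundaryCutoff (hK : K ⊆ boundaryRange φ) (hcl : IsClosed (boundaryPoints φ K)) :
    ∃ A g, IsBoundaryCutoff φ A g ∧ ∀ y ∈ K, g (hpoint 0 y) = 1 := by
  obtain ⟨A, g, h1, h2, h3, h4, h5, h6⟩ := exists_boundary_cutoff φ hK hcl
  exact ⟨A, g, ⟨h1, h2, h3, h4, h5⟩, h6⟩

theorem IsPhgSphereFamilyOn.exists_realization (hφ : φ ∈ IsManifold.maximalAtlas (𝓡∂ (d + 1)) ∞ X)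
    (hE : ∀ p ∈ E₀.sum E₁, -(d : ℝ) < p.1.re)
    (h : IsPhgSphereFamilyOn E₀ E₁ (boundaryRange φ) n) (hK : K ⊆ boundaryRange φ)
    (hcl : IsClosed (boundaryPoints φ K)) :
    ∃ κ : X → X → ℂ, IsResidualPhg (d := d) E₀ IndexSet.nat (E₁.shift d) κ ∧
      ∀ y ∈ K, HasReducedNormalOperator φ κ y (n y) := by
  rcases subsingleton_or_nontrivial (Tan d) with _ | _
  -- The zero kernel, supported in `A = ∅`.
  · exact ⟨fun _ _ => 0, isResidualPhg_of_support hφ isClosed_empty (empty_subset _)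
      (fun _ _ _ => rfl) fun _ _ _ _ _ _ hm => absurd hm (notMem_empty _),
      fun y _ => hasReducedNormalOperator_zero φ y (n y)⟩
  · obtain ⟨A, g, hg, hg1⟩ := exists_isBoundaryCutoff hK hcl
    obtain ⟨b₀, hb₀⟩ := E₀.exists_lt
    obtain ⟨b₁, hb₁⟩ := E₁.exists_lt
    obtain ⟨γ, -, hγ0, hγ1, hγ⟩ := IndexSet.exists_weights hE (β := ![b₀, b₁]) hb₀ hb₁
    exact ⟨chartKernel φ g (realization n), hg.isResidualPhg hφ hE h, fun y hy =>
      hg.hasReducedNormalOperator hφ (h.familySymbol hγ0 hγ1) hγ (hK hy) (hg1 y hy)⟩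

theorem exists_real_le (α : WithTop ℝ) : ∃ b : ℝ, (b : WithTop ℝ) ≤ α := by
  induction α using WithTop.recTopCoe with
  | top => exact ⟨0, le_top⟩
  | coe a => exact ⟨a, le_rfl⟩

theorem IsConormalSphereFamilyOn.exists_realization
    (hφ : φ ∈ IsManifold.maximalAtlas (𝓡∂ (d + 1)) ∞ X)
    (hα : ((-(d : ℝ) : ℝ) : WithTop ℝ) < α₀ + α₁)
    (h : IsConormalSphereFamilyOn α₀ α₁ (boundaryRange φ) n) (hK : K ⊆ boundaryRange φ)
    (hcl : IsClosed (boundaryPoints φ K)) :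
    ∃ κ : X → X → ℂ, IsResidualConormal (d := d) α₀ (α₁ + ((d : ℝ) : WithTop ℝ)) κ ∧
      ∀ y ∈ K, HasReducedNormalOperator φ κ y (n y) := by
  rcases subsingleton_or_nontrivial (Tan d) with _ | _
  · exact ⟨fun _ _ => 0, isResidualConormal_of_support hφ isClosed_empty (empty_subset _)
      (fun _ _ _ => rfl) fun _ _ _ _ _ _ hm => absurd hm (notMem_empty _),
      fun y _ => hasReducedNormalOperator_zero φ y (n y)⟩
  · obtain ⟨A, g, hg, hg1⟩ := exists_isBoundaryCutoff hK hcl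
    obtain ⟨b₀, hb₀⟩ := exists_real_le α₀
    obtain ⟨b₁, hb₁⟩ := exists_real_le α₁
    obtain ⟨γ, -, hγ0, hγ1, hγ⟩ := exists_weights_of_lt hα (β := ![b₀, b₁]) hb₀ hb₁
    exact ⟨chartKernel φ g (realization n), hg.isResidualConormal hφ hα h, fun y hy =>
      hg.hasReducedNormalOperator hφ (h.familySymbol hγ0 hγ1) hγ (hK hy) (hg1 y hy)⟩

end Existence

end

end ZeroCalculus

end

theorem proposition2p13 {d : ℕ} {X : Type*} [TopologicalSpace X] [T2Space X]
    [SecondCountableTopology X] [ChartedSpace (EuclideanHalfSpace (d + 1)) X]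
    [IsManifold (𝓡∂ (d + 1)) ∞ X]
    (φ : OpenPartialHomeomorph X (EuclideanHalfSpace (d + 1)))
    (hφ : φ ∈ IsManifold.maximalAtlas (𝓡∂ (d + 1)) ∞ X) :
    (∀ E₀ E₁ : ZeroCalculus.IndexSet,
      (∀ p ∈ E₀.sum E₁, -(d : ℝ) < p.1.re) →
      (∀ n : ZeroCalculus.Tan d → ℝ → ℝ → ℂ,
        ZeroCalculus.IsPhgSphereFamily E₀ E₁ n →
        ∀ y₀ ∈ ZeroCalculus.boundaryRange φ,
          ∃ κ : X → X → ℂ,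
            ZeroCalculus.IsResidualPhg (d := d) E₀ ZeroCalculus.IndexSet.nat (E₁.shift d) κ ∧
            ZeroCalculus.HasReducedNormalOperator φ κ y₀ n) ∧
      (∀ n : ZeroCalculus.Tan d → ZeroCalculus.Tan d → ℝ → ℝ → ℂ,
        ZeroCalculus.IsPhgSphereFamilyOn E₀ E₁ (ZeroCalculus.boundaryRange φ) n →
        ∀ K ⊆ ZeroCalculus.boundaryRange φ, IsClosed (ZeroCalculus.boundaryPoints φ K) →
          ∃ κ : X → X → ℂ,
            ZeroCalculus.IsResidualPhg (d := d) E₀ ZeroCalculus.IndexSet.nat (E₁.shift d) κ ∧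
            ∀ y ∈ K, ZeroCalculus.HasReducedNormalOperator φ κ y (n y))) ∧
    (∀ α₀ α₁ : WithTop ℝ,
      ((-(d : ℝ) : ℝ) : WithTop ℝ) < α₀ + α₁ →
      (∀ n : ZeroCalculus.Tan d → ℝ → ℝ → ℂ,
        ZeroCalculus.IsConormalSphereFamily α₀ α₁ n →
        ∀ y₀ ∈ ZeroCalculus.boundaryRange φ,
          ∃ κ : X → X → ℂ,
            ZeroCalculus.IsResidualConormal (d := d) α₀ (α₁ + ((d : ℝ) : WithTop ℝ)) κ ∧
            ZeroCalculus.HasReducedNormalOperator φ κ y₀ n) ∧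
      (∀ n : ZeroCalculus.Tan d → ZeroCalculus.Tan d → ℝ → ℝ → ℂ,
        ZeroCalculus.IsConormalSphereFamilyOn α₀ α₁ (ZeroCalculus.boundaryRange φ) n →
        ∀ K ⊆ ZeroCalculus.boundaryRange φ, IsClosed (ZeroCalculus.boundaryPoints φ K) →
          ∃ κ : X → X → ℂ,
            ZeroCalculus.IsResidualConormal (d := d) α₀ (α₁ + ((d : ℝ) : WithTop ℝ)) κ ∧
            ∀ y ∈ K, ZeroCalculus.HasReducedNormalOperator φ κ y (n y))) := by
  -- A single boundary point is closed, so the statement at one point follows from the one over `K =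
  -- {y₀}`, applied to the family which is constant in `y`.
  have hclosed : ∀ y₀, IsClosed (ZeroCalculus.boundaryPoints φ {y₀}) := fun y₀ => by
    rw [ZeroCalculus.boundaryPoints, Set.image_singleton]
    exact isClosed_singleton
  refine ⟨fun E₀ E₁ hE => ⟨fun n hn y₀ hy₀ => ?_, fun n hn K hK hcl =>
      hn.exists_realization hφ hE hK hcl⟩,
    fun α₀ α₁ hα => ⟨fun n hn y₀ hy₀ => ?_, fun n hn K hK hcl =>
      hn.exists_realization hφ hα hK hcl⟩⟩
  · obtain ⟨κ, h1, h2⟩ := (hn.const (ZeroCalculus.boundaryRange φ)).exists_realization hφ hE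
      (Set.singleton_subset_iff.2 hy₀) (hclosed y₀)
    exact ⟨κ, h1, h2 y₀ rfl⟩
  · obtain ⟨κ, h1, h2⟩ := (hn.const (ZeroCalculus.boundaryRange φ)).exists_realization hφ hα
      (Set.singleton_subset_iff.2 hy₀) (hclosed y₀)
    exact ⟨κ, h1, h2 y₀ rfl⟩
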